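/- **Target.** Let $M$ be a Liouville domain: a compact manifold with boundary and a one-form $\theta$ such that $\omega=d\theta$ is symplectic and the Liouville field $Z$ ($i_Z\omega=\theta$) points strictly outwards along $\partial M$. Let $\hat M=M\cup([1,\infty)\times\partial M)$ be its completion, and let $\psi^\rho$ be the flow of $Z$ for time $\log\rho$ (on $\hat M$). Let $M^{in}\subset M\setminus\partial M$ be a Liouville subdomain ($Z$ points outwards along $\partial M^{in}$), $M^{out}=(M\setminus M^{in})\cup\partial M^{in}$, and $\kappa^{in}(r,y)=\psi^r(y)$ for $y\in\partial M^{in}$. Let $L\subset M$ be a Lagrangian submanifold transverse to $\partial M$ and $\partial M^{in}$, with $L^{in}=L\cap M^{in}$, $L^{out}=L\cap M^{out}$, such that $\theta|L^{out}$ vanishes near $\partial L\cup\partial L^{in}$, and $\theta|L=dh$ with $h=0$ on $\partial L\cup\partial L^{in}$. Assume that neither $\partial L\subset\partial M$ nor $\partial L^{in}\subset\partial M^{in}$ has Reeb chords of positive integer length. Let $H>0$ be a smooth function on $M$ which extends smoothly to $\hat M$ by $H(r,y)=r$ on the cone, such that $H(\kappa^{in}(r,y))-r$ vanishes to infinite order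 along $r=1$ and $H-dH(Z)>0$ on $M^{out}\setminus\partial M^{out}$. Let $X$ be its Hamiltonian field, $i_X\omega=-dH$. An integer chord of length $w\in\{1,2,\dots\}$ is a trajectory $x:[0,1]\to M$ of $wX$ with $x(0),x(1)\in L$; assume that all of these are nondegenerate. Let $\mathcal X_w$ be the set of chords of length $w$, and $\mathcal X_w^{in},\mathcal X_w^{out}$ the subsets of those lying in $M^{in}\setminus\partial M^{in}$, respectively $M^{out}\setminus\partial M^{out}$. The action of $x\in\mathcal X_w$ is $A_{wH}(x)=\int_0^1(-x^*\theta+wH(x(t))\,dt)+h(x(1))-h(x(0))$. **Rescaling.** For $\rho\in(0,1]$ put $M^{in,\rho}=\psi^\rho(M^{in})$. Let $L^\rho$ equal $\psi^\rho(L^{in})$ in $M^{in,\rho}$, the cone $\kappa^{in}((\rho,1)\times\partial L^{in})$ on $\kappa^{in}((\rho,1)\times\partial M^{in})$, and $L$ on $M^{out}$. Let $H^\rho$ equal $\rho\cdot(H\circ\psi^{1/\rho})$ on $M^{in,\rho}$, $r$ at $\kappa^{in}(r,y)$ with $\rho<r<1$, and $H$ on $M^{out}$; let $X^\rho$ be its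 Hamiltonian field. For a chord $x$ put $x^\rho=\psi^\rho\circ x$ if $x$ lies inside $M^{in}$, and $x^\rho=x$ if it lies in $M^{out}$. **Source.** Let $S$ be a closed disc minus $d+1$ boundary points $\zeta^0,\dots,\zeta^d$ (in the order given by the boundary orientation), with strip-like ends $\epsilon^0:(-\infty,0]\times[0,1]\to S$ and $\epsilon^k:[0,\infty)\times[0,1]\to S$ ($k>0$) around these points, weights $w^0,\dots,w^d\in\{1,2,\dots\}$, and a one-form $\gamma$ with $\gamma|\partial S=0$, $d\gamma\le 0$, $d\gamma=0$ near $\partial S$, and $(\epsilon^k)^*\gamma=w^k\,dt$ for $|s|\gg0$. **Almost complex structures.** $\mathcal J(M)$ is the space of $\omega$-compatible almost complex structures of contact type at the boundary, i.e. restrictions of smooth $\hat\omega$-compatible structures on $\hat M$ which on the cone are $Z$-invariant, map $r\partial_r$ to the Reeb field, and preserve the contact planes. $\mathcal J(M^{in})$ is defined in the same way. For each $\rho\in(0,1]$ take a smooth family $J^\rho_z\in\mathcal J(M)$, and also take a smooth family $J^{in}_z\in\mathcal J(M^{in})$, where $z\in S$. Each of these families converges, faster than exponentially in any $C^m$ topology,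 over each strip-like end to a family depending only on $t$. Suppose that they interpolate: there is $\delta>0$ such that for $\rho\le\delta$ and all $z$, $J^\rho_z|M^{in,\rho}=\psi^\rho_*J^{in}_z$, and $J^\rho_z$ is of contact type on a neighbourhood, independent of $z$, of $\{\rho\}\times\partial M^{in}$ in $\kappa^{in}([\rho,1]\times\partial M^{in})$. **Equations.** Given $x^k\in\mathcal X_{w^k}$, consider smooth maps $$u:S\to M,\qquad u(\partial S)\subset L^\rho,\qquad \lim_{s\to\pm\infty}u(\epsilon^k(s,\cdot))=x^{k,\rho},\qquad (du-X^\rho\otimes\gamma)\circ j=J^\rho_z\circ(du-X^\rho\otimes\gamma),\tag{1}$$ where the limits (with $s\to-\infty$ for $k=0$ and $s\to+\infty$ for $k>0$) are uniform in $t\in[0,1]$. The corresponding equation on $M^{in}$, for $x^k\in\mathcal X_{w^k}^{in}$, is the one for smooth maps $u^{in}:S\to M^{in}$ with boundary values in $L^{in}$ and limits $x^k$, using $X$ and $J^{in}_z$. **Lemma.** There is a positive-action threshold, namely a $\nu\in\mathbb N$ such that $A_{wH}(x)>0$ for all $w\ge\nu$ and $x\in\mathcal X_w^{out}$. Let $\nu$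 be any such number, and fix $d\ge0$ and weights $w^0,\dots,w^d\ge\nu$. Then there is $\delta_0>0$, depending only on the target data $(M,\theta,M^{in},L,h,H)$, on $d$ and on the weights, such that for all $S$, strip-like ends, $\gamma$ and interpolating families as above, all $\rho\in(0,1]$ with $\rho\le\min(\delta_0,\delta)$, and all chords $x^k\in\mathcal X_{w^k}$ with $x^0\in\mathcal X_{w^0}^{in}$, every solution $u$ of (1) is of the form $u=\psi^\rho\circ u^{in}$, where $u^{in}$ is a solution of the corresponding equation on $M^{in}$. In particular, $x^k\in\mathcal X_{w^k}^{in}$ for all $k$, and $u(S)\subset M^{in,\rho}$. -/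

import Mathlib

open Set Filter Topology
open scoped Manifold ContDiff

noncomputable section

namespace Viterbo

section Calculus

variable (E : Type*) [NormedAddCommGroup E] [NormedSpace ℝ E]
variable (W : Type*) [TopologicalSpace W] [ChartedSpace E W]

/-- Differential one-forms (without smoothness condition) on a manifold `W` modelled on `E`. -/
abbrev OneForm : Type _ := ∀ x : W, TangentSpace 𝓘(ℝ, E) x →L[ℝ] ℝ

/-- Vector fields (without smoothness condition). -/
abbrev VField : Type _ := ∀ x : W, TangentSpace 𝓘(ℝ, E) x

/-- Fields of endomorphisms of the tangent spaces (without further conditions). -/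
abbrev EndField : Type _ :=
  ∀ x : W, TangentSpace 𝓘(ℝ, E) x →L[ℝ] TangentSpace 𝓘(ℝ, E) x

variable {E W}

/-- The expression of a one-form in the preferred chart at `x₀`: its pullback under the inverse of
that chart. -/
def coordForm (θ : OneForm E W) (x₀ : W) (y : E) : E →L[ℝ] ℝ :=
  (θ ((extChartAt 𝓘(ℝ, E) x₀).symm y)).comp
    (mfderiv 𝓘(ℝ, E) 𝓘(ℝ, E) ((extChartAt 𝓘(ℝ, E) x₀).symm : E → W) y)

/-- The expression of a field of endomorphisms in the preferred chart at `x₀`. -/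
def coordEnd (J : EndField E W) (x₀ : W) (y : E) : E →L[ℝ] E :=
  (mfderiv 𝓘(ℝ, E) 𝓘(ℝ, E) (extChartAt 𝓘(ℝ, E) x₀ : W → E)
      ((extChartAt 𝓘(ℝ, E) x₀).symm y)).comp
    ((J ((extChartAt 𝓘(ℝ, E) x₀).symm y)).comp
      (mfderiv 𝓘(ℝ, E) 𝓘(ℝ, E) ((extChartAt 𝓘(ℝ, E) x₀).symm : E → W) y))

/-- A one-form is smooth if all its chart expressions are. -/
def SmoothForm (θ : OneForm E W) : Prop :=
  ∀ x₀ : W, ContDiffOn ℝ ∞ (coordForm θ x₀) (extChartAt 𝓘(ℝ, E) x₀).target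

/-- The exterior derivative `dθ` of a one-form, computed at `x` in the preferred chart at `x` (which
is the chart that identifies `TangentSpace 𝓘(ℝ, E) x` with `E`). -/
def dForm (θ : OneForm E W) (x : W) (u v : TangentSpace 𝓘(ℝ, E) x) : ℝ :=
  fderiv ℝ (coordForm θ x) (extChartAt 𝓘(ℝ, E) x x) (u : E) (v : E) -
    fderiv ℝ (coordForm θ x) (extChartAt 𝓘(ℝ, E) x x) (v : E) (u : E)

/-- The differential of a real-valued function, as a one-form. -/
def dFun (F : W → ℝ) : OneForm E W := fun x => mfderiv 𝓘(ℝ, E) 𝓘(ℝ, ℝ) F x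

/-- The vector `v` with `dθ(v, ·) = α`, which exists and is unique when `dθ` is symplectic. -/
def dualVector (θ : OneForm E W) (x : W) (α : TangentSpace 𝓘(ℝ, E) x →L[ℝ] ℝ) :
    TangentSpace 𝓘(ℝ, E) x :=
  open Classical in
  if h : ∃ v : TangentSpace 𝓘(ℝ, E) x, ∀ u, dForm θ x v u = α u then h.choose else 0

/-- The vector field `Z` with `i_Z dθ = θ`. -/
def liouvilleField (θ : OneForm E W) : VField E W := fun x => dualVector θ x (θ x)

/-- The Hamiltonian vector field `X` of `F`, with the sign convention `i_X dθ = -dF`. -/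
def hamField (θ : OneForm E W) (F : W → ℝ) : VField E W :=
  fun x => dualVector θ x (-(dFun F x))

/-- `Φ` is the (complete, smooth) flow of the vector field `V`; the first variable is time. -/
structure IsFlow (V : VField E W) (Φ : ℝ → W → W) : Prop where
  smooth : ContMDiff (𝓘(ℝ, ℝ).prod 𝓘(ℝ, E)) 𝓘(ℝ, E) ∞ (fun p : ℝ × W => Φ p.1 p.2)
  zero : ∀ x, Φ 0 x = x
  deriv : ∀ x, IsMIntegralCurve (I := 𝓘(ℝ, E)) (fun t => Φ t x) V

/-- The vectors tangent at `x` to the subset `A`: velocities at `x` of smooth curves inside `A`.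
For a submanifold this is its tangent space. -/
def tangentTo (A : Set W) (x : W) : Set (TangentSpace 𝓘(ℝ, E) x) :=
  {v | ∃ c : ℝ → W, ContMDiff 𝓘(ℝ, ℝ) 𝓘(ℝ, E) ∞ c ∧ (∀ t, c t ∈ A) ∧ c 0 = x ∧
    (mfderiv 𝓘(ℝ, ℝ) 𝓘(ℝ, E) c 0 : ℝ →L[ℝ] E) 1 = (v : E)}

/-- `A` is a closed (as a subset) embedded submanifold without boundary: it is closed, and locally
a linear subspace in suitable smooth charts. -/
def IsClosedSubmanifold (A : Set W) : Prop :=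
  IsClosed A ∧ ∀ x ∈ A, ∃ φ ∈ IsManifold.maximalAtlas 𝓘(ℝ, E) ∞ W, x ∈ φ.source ∧
    ∃ V : Submodule ℝ E, ∀ y ∈ φ.source, y ∈ A ↔ φ y ∈ V

/-- `A` is a closed Lagrangian submanifold for `dθ`: its tangent spaces are equal to their
symplectic orthogonal complements. -/
def IsLagrangian (θ : OneForm E W) (A : Set W) : Prop :=
  IsClosedSubmanifold (E := E) A ∧ ∀ x ∈ A, ∀ v : TangentSpace 𝓘(ℝ, E) x,
    v ∈ tangentTo A x ↔ ∀ u ∈ tangentTo (E := E) A x, dForm θ x v u = 0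

end Calculus

section Target

variable (E : Type*) [NormedAddCommGroup E] [NormedSpace ℝ E]
variable (W : Type*) [TopologicalSpace W] [ChartedSpace E W]

/-- An exact symplectic structure `dθ` on `W`, together with the flow of its Liouville field
`Z` (so that `Z` is complete). -/
structure LiouvilleManifold where
  θ : OneForm E W
  smooth_θ : SmoothForm θ
  nondeg : ∀ (x : W) (v : TangentSpace 𝓘(ℝ, E) x), (∀ u, dForm θ x v u = 0) → v = 0
  flow : ℝ → W → W
  isFlow : IsFlow (liouvilleField θ) flow

variable {E W}

namespace LiouvilleManifold

variable (Y : LiouvilleManifold E W)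

/-- The symplectic form. -/
def symp (x : W) (u v : TangentSpace 𝓘(ℝ, E) x) : ℝ := dForm Y.θ x u v

/-- The Liouville vector field. -/
def Z : VField E W := liouvilleField Y.θ

/-- Hamiltonian vector fields. -/
def X (F : W → ℝ) : VField E W := hamField Y.θ F

/-- The flow of `Z` at time `log r`, for `r > 0`. For a domain `K` with `Z` pointing outwards along
its boundary, the collar map is `κ(r, y) = ψ r y`, where `y` is a boundary point of `K`. -/
def ψ (r : ℝ) (x : W) : W := Y.flow (Real.log r) x

/-- The derivative of `ψ r`. -/
def dψ (r : ℝ) (x : W) : TangentSpace 𝓘(ℝ, E) x →L[ℝ] TangentSpace 𝓘(ℝ, E) (Y.ψ r x) :=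
  mfderiv 𝓘(ℝ, E) 𝓘(ℝ, E) (Y.ψ r) x

/-- `K` is a Liouville domain in `W`: it is compact with smooth boundary, and `Z` points
strictly outwards along the boundary. The boundary of `K` is then `frontier K`. -/
def IsDomain (K : Set W) : Prop :=
  IsCompact K ∧ ∃ f : W → ℝ, ContMDiff 𝓘(ℝ, E) 𝓘(ℝ, ℝ) ∞ f ∧ K = {x | f x ≤ 0} ∧
    ∀ x, f x = 0 → 0 < dFun f x (Y.Z x)

/-- The completion of a Liouville domain `K`, realized inside `W`: the union of `K` and of the
infinite cone `κ([1,∞) × ∂K)`. -/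
def completion (K : Set W) : Set W := {x | ∃ r : ℝ, 1 ≤ r ∧ ∃ y ∈ K, Y.ψ r y = x}

/-- `R` is the value at `y ∈ ∂K` of the Reeb vector field of the contact form `θ|∂K`. -/
def IsReeb (K : Set W) (y : W) (R : TangentSpace 𝓘(ℝ, E) y) : Prop :=
  R ∈ tangentTo (frontier K) y ∧ Y.θ y R = 1 ∧
    ∀ v ∈ tangentTo (E := E) (frontier K) y, Y.symp y R v = 0

/-- The contact hyperplane `ξ` at `y ∈ ∂K`. -/
def contactPlane (K : Set W) (y : W) : Set (TangentSpace 𝓘(ℝ, E) y) :=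
  {v | v ∈ tangentTo (frontier K) y ∧ Y.θ y v = 0}

/-- The almost complex structure `I` is of contact type on the part `κ(A × ∂K)` of the
symplectization of `∂K`: there it is the `ψ`-invariant extension of some `I₀` which is given at
points of `∂K`, takes `Z` to the Reeb vector, and preserves `ξ`. -/
def ContactTypeOn (K : Set W) (A : Set ℝ) (I : EndField E W) : Prop :=
  ∃ I₀ : EndField E W, ∀ r ∈ A, 0 < r → ∀ y ∈ frontier K,
    Y.IsReeb K y (I₀ y (Y.Z y)) ∧
    (∀ v ∈ Y.contactPlane K y, I₀ y v ∈ Y.contactPlane K y) ∧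
    ∀ v, I (Y.ψ r y) (Y.dψ r y v) = Y.dψ r y (I₀ y v)

/-- Joint smoothness, on `A × (completion of K)`, of a family of fields of endomorphisms with
parameter in the subset `A` of a normed space. -/
def SmoothFamily {P : Type*} [NormedAddCommGroup P] [NormedSpace ℝ P] (K : Set W) (A : Set P)
    (J : P → EndField E W) : Prop :=
  ∀ x₀ : W, ContDiffOn ℝ ∞ (fun p : P × E => coordEnd (J p.1) x₀ p.2)
    (A ×ˢ ((extChartAt 𝓘(ℝ, E) x₀).target ∩
      (extChartAt 𝓘(ℝ, E) x₀).symm ⁻¹' Y.completion K))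

/-- The space of almost complex structures on the Liouville domain `K` which are `dθ`-compatible and
of contact type at the boundary. As usual such a structure is identified with its unique extension
to the completion which is of contact type on the infinite cone; that extension is required to
be smooth. (Values outside the completion of `K` are irrelevant.) -/
structure IsACS (K : Set W) (I : EndField E W) : Prop where
  smooth : Y.SmoothFamily K (univ : Set ℝ) (fun _ => I)
  sq : ∀ x ∈ Y.completion K, ∀ v, I x (I x v) = -v
  invariant : ∀ x ∈ Y.completion K, ∀ u v, Y.symp x (I x u) (I x v) = Y.symp x u v
  tame : ∀ x ∈ Y.completion K, ∀ v, v ≠ 0 → 0 < Y.symp x v (I x v)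
  contact : Y.ContactTypeOn K (Ici 1) I

end LiouvilleManifold

/-- The geometric data on the target: a Liouville domain `M` whose completion is `W`, a Liouville
subdomain `Min`, a Lagrangian submanifold `L` (including its conical extension to the infinite
cone), the primitive `h` of `θ|L`, and the Hamiltonian `H` (including its extension to the infinite
cone). -/
structure TargetData (Y : LiouvilleManifold E W) where
  M : Set W
  Min : Set W
  L : Set W
  h : W → ℝ
  H : W → ℝ
  domain_M : Y.IsDomain M
  completion_M : Y.completion M = univ
  domain_Min : Y.IsDomain Min
  Min_subset : Min ⊆ interior M
  lagrangian : IsLagrangian Y.θ L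
  /-- On the infinite cone, `L` is the cone over `∂L`. -/
  L_cone : ∀ y ∈ frontier M, ∀ r : ℝ, 1 ≤ r → (Y.ψ r y ∈ L ↔ y ∈ L)
  transverse : ∀ K ∈ ({M, Min} : Set (Set W)), ∀ y ∈ L ∩ frontier K,
    ∃ v ∈ tangentTo (E := E) L y, v ∉ tangentTo (E := E) (frontier K) y
  /-- `θ|Lout` vanishes on a neighbourhood of the boundary of `Lout`. -/
  θ_vanishes : ∃ U : Set W, IsOpen U ∧ frontier M ∪ frontier Min ⊆ U ∧
    ∀ x ∈ L ∩ U, x ∈ M → x ∉ interior Min → ∀ v ∈ tangentTo (E := E) L x, Y.θ x v = 0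
  smooth_h : ContMDiff 𝓘(ℝ, E) 𝓘(ℝ, ℝ) ∞ h
  dh : ∀ x ∈ L, ∀ v ∈ tangentTo (E := E) L x,
    dFun h x v = Y.θ x v
  h_boundary : ∀ x ∈ L, x ∈ frontier M ∪ frontier Min → h x = 0
  /-- There are no integer Reeb chords, for both `∂L ⊂ ∂M` and `∂Lin ⊂ ∂Min`. -/
  no_reeb_chords : ∀ K ∈ ({M, Min} : Set (Set W)), ¬ ∃ (w : ℕ) (x : ℝ → W), 0 < w ∧
    x 0 ∈ L ∧ x 1 ∈ L ∧ ∀ t ∈ Icc (0 : ℝ) 1, x t ∈ frontier K ∧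
      ∃ R : TangentSpace 𝓘(ℝ, E) (x t), Y.IsReeb K (x t) R ∧
        HasMFDerivWithinAt 𝓘(ℝ, ℝ) 𝓘(ℝ, E) x (Icc 0 1) t
          ((1 : ℝ →L[ℝ] ℝ).smulRight ((w : ℝ) • R))
  smooth_H : ContMDiff 𝓘(ℝ, E) 𝓘(ℝ, ℝ) ∞ H
  H_pos : ∀ x ∈ M, 0 < H x
  H_cone : ∀ y ∈ frontier M, ∀ r : ℝ, 1 ≤ r → H (Y.ψ r y) = r
  /-- `H(κin(r,y)) - r` vanishes to infinite order along `r = 1`. -/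
  H_dividing : ∀ y ∈ frontier Min, ∀ m : ℕ,
    iteratedDeriv m (fun r : ℝ => H (Y.ψ r y) - r) 1 = 0
  /-- `H - dH(Z)` is positive on the part of `M` outside `Min`, away from the boundary. -/
  H_out : ∀ x ∈ interior M, x ∉ Min →
    0 < H x - dFun H x (Y.Z x)
  /-- All integer chords of the Hamiltonian vector field in `M` are nondegenerate: for a chord
  of length `w`, the time `w` map `Φ w` of the Hamiltonian flow satisfies
  `D(Φ w)(T L) ∩ T L = 0` at the end point. -/
  nondegenerate : ∃ Φ : ℝ → W → W, IsFlow (Y.X H) Φ ∧ ∀ (w : ℕ) (p : W), 0 < w → p ∈ L →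
    Φ w p ∈ L → (∀ t ∈ Icc (0 : ℝ) w, Φ t p ∈ M) →
    ∀ v ∈ tangentTo (E := E) L p,
      (mfderiv 𝓘(ℝ, E) 𝓘(ℝ, E) (Φ w) p : E →L[ℝ] E) (v : E) ∈
        (tangentTo (E := E) L (Φ w p) : Set E) → v = 0

namespace TargetData

variable {Y : LiouvilleManifold E W} (V : TargetData Y)

/-- `x` (restricted to `[0,1]`) is an integer chord of length `w` in `M`. -/
structure IsChord (w : ℕ) (x : ℝ → W) : Prop where
  pos : 0 < w
  start_mem : x 0 ∈ V.L
  end_mem : x 1 ∈ V.L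
  mem : ∀ t ∈ Icc (0 : ℝ) 1, x t ∈ V.M
  curve : IsMIntegralCurveOn (I := 𝓘(ℝ, E)) x (fun p => (w : ℝ) • Y.X V.H p) (Icc 0 1)

/-- Integer chords lying in the interior of `Min`. -/
def IsChordIn (w : ℕ) (x : ℝ → W) : Prop :=
  V.IsChord w x ∧ ∀ t ∈ Icc (0 : ℝ) 1, x t ∈ interior V.Min

/-- Integer chords lying in `Mout` minus its boundary. -/
def IsChordOut (w : ℕ) (x : ℝ → W) : Prop :=
  V.IsChord w x ∧ ∀ t ∈ Icc (0 : ℝ) 1, x t ∈ interior V.M \ V.Min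

/-- The action of a chord of length `w`. -/
def action (w : ℕ) (x : ℝ → W) : ℝ :=
  (∫ t in (0 : ℝ)..1,
    (-(Y.θ (x t) (mfderivWithin 𝓘(ℝ, ℝ) 𝓘(ℝ, E) x (Icc 0 1) t (1 : ℝ))) + w * V.H (x t))) +
  V.h (x 1) - V.h (x 0)

/-- The threshold property of `ν`: chords of length at least `ν` outside `Min` have positive
action. -/
def PositiveAction (ν : ℕ) : Prop :=
  ∀ w : ℕ, ν ≤ w → ∀ x : ℝ → W, V.IsChordOut w x → 0 < V.action w x

/-- The shrunk subdomain. -/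
def MinR (ρ : ℝ) : Set W := Y.ψ ρ '' V.Min

/-- The part `Lin` of `L`. -/
def Lin : Set W := V.L ∩ V.Min

/-- The rescaled Lagrangian submanifold (again with its conical extension): `ψ^ρ(Lin)`, followed by
the cone over `∂Lin` for radii in `(ρ,1)`, followed by the part of `L` outside `Min`. -/
def LR (ρ : ℝ) : Set W :=
  Y.ψ ρ '' V.Lin ∪ {x | ∃ r ∈ Ioo ρ 1, ∃ y ∈ V.L ∩ frontier V.Min, Y.ψ r y = x} ∪
    V.L \ interior V.Min

/-- The radial coordinate `r` of a point `κin(r,y)` of the collar of `∂Min` (it is unique). -/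
def radius (x : W) : ℝ :=
  open Classical in
  if h : ∃ r : ℝ, 0 < r ∧ ∃ y ∈ frontier V.Min, Y.ψ r y = x then h.choose else 0

/-- The rescaled Hamiltonian. -/
def HR (ρ : ℝ) (x : W) : ℝ :=
  open Classical in
  if x ∈ V.MinR ρ then ρ * V.H (Y.ψ ρ⁻¹ x) else if x ∈ V.Min then V.radius x else V.H x

/-- The chord `x^ρ` corresponding to `x`: this is `ψ^ρ ∘ x` for chords inside `Min`, and `x` itself
otherwise. -/
def chordR (ρ : ℝ) (x : ℝ → W) : ℝ → W :=
  open Classical in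
  if ∀ t ∈ Icc (0 : ℝ) 1, x t ∈ interior V.Min then fun t => Y.ψ ρ (x t) else x

end TargetData

end Target

section Source

/-- The domain of `ε^k`: the negative half-strip for `k = 0`, the positive one for `k > 0`. -/
def halfStrip {d : ℕ} (k : Fin (d + 1)) : Set ℂ :=
  {z | (if k = 0 then z.re ≤ 0 else 0 ≤ z.re) ∧ z.im ∈ Icc (0 : ℝ) 1}

/-- The filter for the variable `s` which expresses going to infinity along the `k`-th end. -/
def endDir {d : ℕ} (k : Fin (d + 1)) : Filter ℝ := if k = 0 then atBot else atTop

/-- A disc with `d + 1` ends: the closed unit disc minus the boundary points `ζ^k = exp(i a_k)`, with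
`ζ^0, ..., ζ^d` in anticlockwise order. It is equipped with strip-like ends and a one-form
`γ` which is adapted to the weights `w`. -/
structure WeightedDisc (d : ℕ) (w : Fin (d + 1) → ℕ) where
  angle : Fin (d + 1) → ℝ
  angle_mono : StrictMono angle
  angle_lt : ∀ k, angle k < angle 0 + 2 * Real.pi
  ends : Fin (d + 1) → ℂ → ℂ
  γ : ℂ → ℂ →L[ℝ] ℝ

namespace WeightedDisc

variable {d : ℕ} {w : Fin (d + 1) → ℕ} (D : WeightedDisc d w)

/-- The points at infinity. -/
def point (k : Fin (d + 1)) : ℂ := Complex.exp (D.angle k * Complex.I)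

/-- The Riemann surface `S`. -/
def S : Set ℂ := Metric.closedBall 0 1 \ range D.point

/-- The boundary of `S`. -/
def bdry : Set ℂ := Metric.sphere 0 1 \ range D.point

/-- The value of `dγ` at `z` on the positively oriented basis `1, i`. -/
def dγ (z : ℂ) : ℝ :=
  fderivWithin ℝ D.γ D.S z 1 Complex.I - fderivWithin ℝ D.γ D.S z Complex.I 1

/-- Each `ε^k` is a strip-like end around `ζ^k`: a holomorphic embedding of the half-strip (smooth up
to the boundary and corners), compatible with the boundaries and converging to `ζ^k`; and `γ`
vanishes along the boundary, has `dγ ≤ 0` everywhere and `dγ = 0` near the boundary, and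
pulls back to `w^k dt` far along the ends. -/
structure IsAdmissible : Prop where
  ends_smooth : ∀ k, ContDiffOn ℝ ∞ (D.ends k) (halfStrip k)
  ends_holo : ∀ k, DifferentiableOn ℂ (D.ends k) (halfStrip k)
  ends_inj : ∀ k, InjOn (D.ends k) (halfStrip k)
  ends_deriv : ∀ k, ∀ z ∈ halfStrip k, derivWithin (D.ends k) (halfStrip k) z ≠ 0
  ends_mem : ∀ k, MapsTo (D.ends k) (halfStrip k) D.S
  ends_bdry : ∀ k, ∀ z ∈ halfStrip k, D.ends k z ∈ D.bdry ↔ z.im = 0 ∨ z.im = 1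
  ends_lim : ∀ k, Tendsto (fun p : ℝ × ℝ => D.ends k ⟨p.1, p.2⟩)
    (endDir k ×ˢ 𝓟 (Icc 0 1)) (𝓝 (D.point k))
  γ_smooth : ContDiffOn ℝ ∞ D.γ D.S
  γ_bdry : ∀ z ∈ D.bdry, D.γ z (Complex.I * z) = 0
  dγ_nonpos : ∀ z ∈ D.S, D.dγ z ≤ 0
  dγ_bdry : ∃ U : Set ℂ, IsOpen U ∧ D.bdry ⊆ U ∧ ∀ z ∈ D.S ∩ U, D.dγ z = 0
  γ_ends : ∀ k, ∃ T : ℝ, ∀ z ∈ halfStrip k, T ≤ |z.re| → ∀ v : ℂ,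
    D.γ (D.ends k z) (derivWithin (D.ends k) (halfStrip k) z * v) = w k * v.im

variable {E : Type*} [NormedAddCommGroup E] [NormedSpace ℝ E]
variable {W : Type*} [TopologicalSpace W] [ChartedSpace E W]

/-- A smooth family of almost complex structures on the Liouville domain `K` parametrized by `S`.
Over each strip-like end it converges to a family which depends only on `t`, and the convergence
is faster than exponential in any `C^m` topology. -/
structure IsACSFamily (Y : LiouvilleManifold E W) (K : Set W) (J : ℂ → EndField E W) : Prop where
  mem : ∀ z ∈ D.S, Y.IsACS K (J z)
  smooth : Y.SmoothFamily K D.S J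
  asymptotic : ∀ k, ∃ Jlim : ℝ → EndField E W,
    (∀ t ∈ Icc (0 : ℝ) 1, Y.IsACS K (Jlim t)) ∧ Y.SmoothFamily K (Icc (0 : ℝ) 1) Jlim ∧
    ∀ x₀ ∈ Y.completion K, ∃ U : Set E, IsOpen U ∧ extChartAt 𝓘(ℝ, E) x₀ x₀ ∈ U ∧
      ∀ (m : ℕ) (C : ℝ), ∃ B : ℝ, ∀ q ∈ halfStrip k ×ˢ U,
        ‖iteratedFDerivWithin ℝ m
          (fun q : ℂ × E => coordEnd (J (D.ends k q.1)) x₀ q.2 - coordEnd (Jlim q.1.im) x₀ q.2)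
          (halfStrip k ×ˢ U) q‖ ≤ B * Real.exp (-(C * |q.1.re|))

/-- Solutions `u : S → K` of the inhomogeneous Cauchy-Riemann equation
`(du - X ⊗ γ)^{0,1} = 0`, that is `(du - X ⊗ γ) ∘ j = J ∘ (du - X ⊗ γ)`, with boundary values in `Λ`.
The convergence of the paths `u(ε^k(s,·))` to `x^k` is uniform in `t ∈ [0,1]`, expressed as
continuous convergence. -/
structure IsSolution (K Λ : Set W) (X : VField E W) (J : ℂ → EndField E W)
    (x : Fin (d + 1) → ℝ → W) (u : ℂ → W) : Prop where
  smooth : ContMDiffOn 𝓘(ℝ, ℂ) 𝓘(ℝ, E) ∞ u D.S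
  mem : MapsTo u D.S K
  bdry : MapsTo u D.bdry Λ
  lim : ∀ k, ∀ t ∈ Icc (0 : ℝ) 1, Tendsto (fun p : ℝ × ℝ => u (D.ends k ⟨p.1, p.2⟩))
    (endDir k ×ˢ 𝓝[Icc 0 1] t) (𝓝 (x k t))
  eqn : ∀ z ∈ D.S, ∀ v : ℂ,
    (mfderivWithin 𝓘(ℝ, ℂ) 𝓘(ℝ, E) u D.S z : ℂ →L[ℝ] TangentSpace 𝓘(ℝ, E) (u z))
        (Complex.I * v) - D.γ z (Complex.I * v) • X (u z) =
      J z (u z) ((mfderivWithin 𝓘(ℝ, ℂ) 𝓘(ℝ, E) u D.S z :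
        ℂ →L[ℝ] TangentSpace 𝓘(ℝ, E) (u z)) v - D.γ z v • X (u z))

end WeightedDisc

variable {E : Type*} [NormedAddCommGroup E] [NormedSpace ℝ E]
variable {W : Type*} [TopologicalSpace W] [ChartedSpace E W]

/-- An interpolating family `J^ρ` of almost complex structures on `M`, for `ρ ∈ (0,1]`, parametrized
by `S`. It starts at the given family `J = J^1` on `M`, and for `ρ ≤ δ` it is related to a
family `Jin` on `Min`: it equals the pushforward of `Jin` on the shrunk subdomain, and it is of
contact type on a collar `κin([ρ,ρ+η) × ∂Min)`, where `δ` and `η` are independent of `z ∈ S`. -/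
structure InterpolatingFamily {Y : LiouvilleManifold E W} (V : TargetData Y) {d : ℕ}
    {w : Fin (d + 1) → ℕ} (D : WeightedDisc d w) where
  J : ℝ → ℂ → EndField E W
  Jin : ℂ → EndField E W
  δ : ℝ
  δ_pos : 0 < δ
  family : ∀ ρ ∈ Ioc (0 : ℝ) 1, D.IsACSFamily Y V.M (J ρ)
  family_in : D.IsACSFamily Y V.Min Jin
  inner : ∀ ρ ∈ Ioc (0 : ℝ) 1, ρ ≤ δ → ∀ z ∈ D.S, ∀ x ∈ V.Min,
    ∀ v : TangentSpace 𝓘(ℝ, E) x,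
      J ρ z (Y.ψ ρ x) (Y.dψ ρ x v) = Y.dψ ρ x (Jin z x v)
  collar : ∀ ρ ∈ Ioc (0 : ℝ) 1, ρ ≤ δ → ∃ η : ℝ, 0 < η ∧ ∀ z ∈ D.S,
    Y.ContactTypeOn V.Min (Ico ρ (ρ + η) ∩ Iic 1) (J ρ z)

end Source

end Viterbo

end

/-!
The confinement of solutions to the shrunk subdomain is an energy argument. Fix a solution `u` for
`ρ < 1`. Let `χ` be a radial cutoff function which vanishes on a neighbourhood of `MinR ρ` and is equal
to `1` outside `Min`, and let `hcut` be the primitive `h`, cut off so that it vanishes on `Min`. Consider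
the truncated action form (`cutForm`)

  `β = χ(u) (u^*θ - HR ρ (u) γ) - d(hcut ∘ u)`

on the punctured disc. Four properties are used.

* `β` vanishes along the boundary (`cutForm_bdry`, `cut_mul_fm_vel`). Outside `Min` the Lagrangian
  satisfies `θ = dh`. Between `MinR ρ` and the boundary of `Min` it is a cone over a Legendrian, on which
  `θ = 0`. The two descriptions match because `h` vanishes on `L` near the boundary of `Min`: near its
  boundary `L` is transverse to `{r = 1}`, `h` is locally constant there since `θ` vanishes, and it is zero
  on the boundary itself (`exists_h_eq_zero`).
* `dβ` is at least `χ(u)` times the energy density of `u` (`le_curl_cutForm`). The terms with `dχ` are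
  nonnegative by the contact type condition `θ ∘ J = dr`, and because the Hamiltonian is the radial
  coordinate where `dχ ≠ 0`; the remaining term is `-χ H dγ`, with `dγ ≤ 0` and `H > 0`.
* Along an end that converges to a chord inside `Min`, `β` eventually vanishes (`cutForm_end_in`).
* Along an end that converges to a chord outside `Min`, the integral `a(s)` of `β` over the segments of
  the end is eventually negative (`cutForm_end_out`, `integral_end_neg`). Here `β` is the untruncated
  action form, and `a` is nondecreasing, its derivative being the energy of the segment. Completing the
  square gives `(a + A)² ≤ B a'` as long as `a ≥ 0`, where `A` is half of the action of the limit, which is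
  positive by the choice of `ν`, and `B` bounds `θ(JZ)` along the end. If `a` were ever nonnegative it would
  therefore blow up in finite time (`neg_of_riccati`). Only uniform convergence of `u` and boundedness of
  `J` enter, and no decay estimates for the derivatives of `u`.

Since `x⁰` lies inside `Min`, all chords outside `Min` are limits at positive ends, where the boundary
term has the sign just described. Stokes' theorem on the disc with strip-like ends
(`curl_eq_zero_of_ends`) then says that a nonnegative quantity equals a sum of nonpositive ones, with a
negative one for each chord outside. So there are no such chords, and `dβ = 0`. Where `χ(u) > 0` this gives
`du = X ⊗ γ`, and `X` preserves the levels of `χ`; hence `χ(u)` is constant, and zero because it is zero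
along the end `k = 0` (`flow_mem_of_isSolution`). Letting the support of `χ` increase to the complement of
`MinR ρ` gives `u(S) ⊆ MinR ρ` (`mem_MinR_of_isSolution`), and the backward Liouville flow then takes `u`
to a solution in `Min` (`isSolution_rescale`). The argument works for every `ρ < 1`, so that `δ₀ = 1 / 2`
is admissible for all weights.

It uses that each chord lies either in the interior of `Min` or outside `Min` (`IsChord.in_or_out`). As
`H` and `r` agree to first order along the boundaries, a chord that touches a boundary would stay on it,
and be a Reeb chord of positive integer length.

For the existence of the threshold (`exists_positiveAction`), the action of a chord outside `Min` is the
integral of `w (H - dH(Z))` plus `h(x(1)) - h(x(0))`. On a chord that stays away from the boundaries the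
integrand is at least `w` times a positive constant, while `h` is bounded; a chord that comes close to a
boundary remains close to it, because `H` is constant on the chord, so that its endpoints lie where
`h = 0`, and its action is positive for every `w`.
-/

set_option linter.unusedSectionVars false

noncomputable section

namespace Viterbo

/-! ### Pulling back one-forms -/

lemma two_le_infty : (2 : ℕ∞ω) ≤ ∞ := by
  change ((2 : ℕ∞) : WithTop ℕ∞) ≤ ((⊤ : ℕ∞) : WithTop ℕ∞)
  exact WithTop.coe_le_coe.2 le_top

section Pullback

variable {E : Type*} [NormedAddCommGroup E] [NormedSpace ℝ E]
variable {W : Type*} [TopologicalSpace W] [ChartedSpace E W]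
variable {F : Type*} [NormedAddCommGroup F] [NormedSpace ℝ F]
variable {G : Type*} [NormedAddCommGroup G] [NormedSpace ℝ G]

/-- The value of a one-form, as a functional on the model space. -/
def fm (θ : OneForm E W) (x : W) : E →L[ℝ] ℝ := θ x

/-- The two-form `dθ`, evaluated on vectors of the model space. -/
def om (θ : OneForm E W) (x : W) (u v : E) : ℝ :=
  fderiv ℝ (coordForm θ x) (extChartAt 𝓘(ℝ, E) x x) u v -
    fderiv ℝ (coordForm θ x) (extChartAt 𝓘(ℝ, E) x x) v u

/-- The value of a vector field, as a vector of the model space. -/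
def vv (V : VField E W) (x : W) : E := V x

/-- The value of a field of endomorphisms, acting on the model space. -/
def en (J : EndField E W) (x : W) : E →L[ℝ] E := J x

/-- The derivative of a map between manifolds, acting on the model space. -/
def dd (Ψ : W → W) (x : W) : E →L[ℝ] E := mfderiv 𝓘(ℝ, E) 𝓘(ℝ, E) Ψ x

/-- The differential of a function, as a functional on the model space. -/
def df (f : W → ℝ) (x : W) : E →L[ℝ] ℝ := mfderiv 𝓘(ℝ, E) 𝓘(ℝ, ℝ) f x

/-- The derivative within `s` of a map from a normed space to a manifold, as a map to the model
space `E` of the tangent spaces. -/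
def vel (u : F → W) (s : Set F) (z : F) : F →L[ℝ] E :=
  mfderivWithin 𝓘(ℝ, F) 𝓘(ℝ, E) u s z

lemma vel_univ (u : F → W) (z : F) :
    vel (E := E) u univ z = (mfderiv 𝓘(ℝ, F) 𝓘(ℝ, E) u z : F →L[ℝ] E) := by
  unfold vel
  exact congrFun (mfderivWithin_univ (f := u)) z

lemma vel_congr {u v : F → W} {s : Set F} {z : F} (h : u =ᶠ[𝓝[s] z] v) (hz : u z = v z) :
    vel (E := E) u s z = vel v s z := by
  unfold vel
  exact Filter.EventuallyEq.mfderivWithin_eq (I := 𝓘(ℝ, F)) (I' := 𝓘(ℝ, E)) h hz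

/-- The pullback of a one-form under a map from a normed space. -/
def pullForm (θ : OneForm E W) (u : F → W) (s : Set F) (z : F) : F →L[ℝ] ℝ :=
  (fm θ (u z)).comp (vel u s z)

lemma pullForm_apply (θ : OneForm E W) (u : F → W) (s : Set F) (z : F) (v : F) :
    pullForm θ u s z v = fm θ (u z) (vel (E := E) u s z v) := rfl

variable [IsManifold 𝓘(ℝ, E) ∞ W]

instance isManifold_one : IsManifold 𝓘(ℝ, E) 1 W := IsManifold.of_le (n := ∞) (by simp)

variable (E) in
/-- The expression of a map in the preferred chart at `x₀`. -/
def inChart (x₀ : W) (u : F → W) (z : F) : E := extChartAt 𝓘(ℝ, E) x₀ (u z)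

lemma eventually_mem_source {u : F → W} {s : Set F} {z : F} (x₀ : W)
    (hu : ContinuousWithinAt u s z) (h : u z ∈ (extChartAt 𝓘(ℝ, E) x₀).source) :
    ∀ᶠ y in 𝓝[s] z, u y ∈ (extChartAt 𝓘(ℝ, E) x₀).source :=
  hu.eventually ((isOpen_extChartAt_source x₀).mem_nhds h)

lemma contDiffWithinAt_inChart {n : ℕ∞ω} {u : F → W} {s : Set F} {z : F} (hn : n ≤ ∞) (x₀ : W)
    (hu : ContMDiffWithinAt 𝓘(ℝ, F) 𝓘(ℝ, E) n u s z)
    (h : u z ∈ (extChartAt 𝓘(ℝ, E) x₀).source) :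
    ContDiffWithinAt ℝ n (inChart E x₀ u) s z := by
  rw [← contMDiffWithinAt_iff_contDiffWithinAt]
  have h' : ContMDiffAt 𝓘(ℝ, E) 𝓘(ℝ, E) ∞ (extChartAt 𝓘(ℝ, E) x₀) (u z) :=
    contMDiffAt_extChartAt' (by simpa using h)
  exact (h'.of_le hn).comp_contMDiffWithinAt z hu

lemma vel_eq {u : F → W} {s : Set F} {z : F} (hs : UniqueDiffWithinAt ℝ s z) (x₀ : W)
    (hu : ContMDiffWithinAt 𝓘(ℝ, F) 𝓘(ℝ, E) 1 u s z)
    (h : u z ∈ (extChartAt 𝓘(ℝ, E) x₀).source) :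
    vel u s z = (vel (E := E) ((extChartAt 𝓘(ℝ, E) x₀).symm : E → W) univ (inChart E x₀ u z)).comp
        (fderivWithin ℝ (inChart E x₀ u) s z) := by
  have h1 : MDifferentiableAt 𝓘(ℝ, E) 𝓘(ℝ, E) ((extChartAt 𝓘(ℝ, E) x₀).symm : E → W)
      (inChart E x₀ u z) := by
    have := mdifferentiableWithinAt_extChartAt_symm (I := 𝓘(ℝ, E))
      ((extChartAt 𝓘(ℝ, E) x₀).map_source h)
    rw [modelWithCornersSelf_coe, range_id] at this
    exact mdifferentiableWithinAt_univ.1 this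
  have h2 := (contDiffWithinAt_inChart (by simp) x₀ hu h).differentiableWithinAt one_ne_zero
  have h3 := mfderiv_comp_mfderivWithin (I := 𝓘(ℝ, F)) z h1 h2.mdifferentiableWithinAt
    hs.uniqueMDiffWithinAt
  rw [mfderivWithin_eq_fderivWithin] at h3
  have h4 : vel (E := E) u s z = vel (((extChartAt 𝓘(ℝ, E) x₀).symm : E → W) ∘ inChart E x₀ u) s z := by
    refine vel_congr ?_ ?_
    · filter_upwards [eventually_mem_source x₀ hu.continuousWithinAt h] with y hy
      exact ((extChartAt 𝓘(ℝ, E) x₀).left_inv hy).symm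
    · exact ((extChartAt 𝓘(ℝ, E) x₀).left_inv h).symm
  rw [h4, vel_univ]
  exact h3

/-- In the preferred chart at the image point the velocity is the usual derivative. -/
lemma vel_eq_self {u : F → W} {s : Set F} {z : F}
    (hu : ContMDiffWithinAt 𝓘(ℝ, F) 𝓘(ℝ, E) 1 u s z) :
    vel u s z = fderivWithin ℝ (inChart E (u z) u) s z := by
  have := hu.mdifferentiableWithinAt one_ne_zero
  have h2 : vel u s z = fderivWithin ℝ (writtenInExtChartAt 𝓘(ℝ, F) 𝓘(ℝ, E) z u)
      ((extChartAt 𝓘(ℝ, F) z).symm ⁻¹' s ∩ range 𝓘(ℝ, F)) (extChartAt 𝓘(ℝ, F) z z) := by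
    unfold vel mfderivWithin
    exact if_pos this
  rw [h2]
  simp only [mfld_simps, writtenInExtChartAt, Function.comp_def]
  rfl

lemma pullForm_eq (θ : OneForm E W) {u : F → W} {s : Set F} {z : F}
    (hs : UniqueDiffWithinAt ℝ s z) (x₀ : W)
    (hu : ContMDiffWithinAt 𝓘(ℝ, F) 𝓘(ℝ, E) 1 u s z)
    (h : u z ∈ (extChartAt 𝓘(ℝ, E) x₀).source) :
    pullForm θ u s z = (coordForm θ x₀ (inChart E x₀ u z)).comp
      (fderivWithin ℝ (inChart E x₀ u) s z) := by
  rw [pullForm, vel_eq hs x₀ hu h]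
  ext v
  have : (extChartAt 𝓘(ℝ, E) x₀).symm (inChart E x₀ u z) = u z :=
    (extChartAt 𝓘(ℝ, E) x₀).left_inv h
  have h2 : ∀ w : E, fm θ (u z) w = fm θ ((extChartAt 𝓘(ℝ, E) x₀).symm (inChart E x₀ u z)) w := by
    intro w; rw [this]
  rw [vel_univ]
  exact h2 _

lemma pullForm_eventuallyEq (θ : OneForm E W) {u : F → W} {s : Set F} {z : F}
    (hs : UniqueDiffOn ℝ s) (x₀ : W) (hz : z ∈ s)
    (hu : ContMDiffOn 𝓘(ℝ, F) 𝓘(ℝ, E) 1 u s)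
    (h : u z ∈ (extChartAt 𝓘(ℝ, E) x₀).source) :
    ∀ᶠ y in 𝓝[s] z, pullForm θ u s y = (coordForm θ x₀ (inChart E x₀ u y)).comp
      (fderivWithin ℝ (inChart E x₀ u) s y) := by
  filter_upwards [eventually_mem_source x₀ (hu z hz).continuousWithinAt h,
    self_mem_nhdsWithin] with y hy hys
  exact pullForm_eq θ (hs y hys) x₀ (hu y hys) hy

lemma contDiffWithinAt_fderivWithin_inChart {u : F → W} {s : Set F} {z : F}
    (hs : UniqueDiffOn ℝ s) (x₀ : W) (hz : z ∈ s)
    (hu : ContMDiffOn 𝓘(ℝ, F) 𝓘(ℝ, E) ∞ u s)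
    (h : u z ∈ (extChartAt 𝓘(ℝ, E) x₀).source) :
    ContDiffWithinAt ℝ ∞ (fderivWithin ℝ (inChart E x₀ u) s) s z :=
  (contDiffWithinAt_inChart le_rfl x₀ (hu z hz) h).fderivWithin_right hs (by simp) hz

lemma contDiffWithinAt_coordForm {θ : OneForm E W} (hθ : SmoothForm θ) {u : F → W} {s : Set F}
    {z : F} (x₀ : W) (hu : ContMDiffWithinAt 𝓘(ℝ, F) 𝓘(ℝ, E) ∞ u s z)
    (h : u z ∈ (extChartAt 𝓘(ℝ, E) x₀).source) :
    ContDiffWithinAt ℝ ∞ (fun y => coordForm θ x₀ (inChart E x₀ u y)) s z := by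
  have h1 : ContDiffAt ℝ ∞ (coordForm θ x₀) (inChart E x₀ u z) :=
    (hθ x₀).contDiffAt (extChartAt_target_mem_nhds' ((extChartAt 𝓘(ℝ, E) x₀).map_source h))
  exact h1.comp_contDiffWithinAt z (contDiffWithinAt_inChart le_rfl x₀ hu h)

lemma contDiffOn_pullForm {θ : OneForm E W} (hθ : SmoothForm θ) {u : F → W} {s : Set F}
    (hs : UniqueDiffOn ℝ s) (hu : ContMDiffOn 𝓘(ℝ, F) 𝓘(ℝ, E) ∞ u s) :
    ContDiffOn ℝ ∞ (pullForm θ u s) s := by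
  intro z hz
  have h : u z ∈ (extChartAt 𝓘(ℝ, E) (u z)).source := mem_extChartAt_source (I := 𝓘(ℝ, E)) (u z)
  have := (contDiffWithinAt_coordForm hθ (u z) (hu z hz) h).clm_comp
    (contDiffWithinAt_fderivWithin_inChart hs (u z) hz hu h)
  exact this.congr_of_eventuallyEq
    (pullForm_eventuallyEq θ hs (u z) hz (hu.of_le (by simp)) h)
    (pullForm_eq θ (hs z hz) (u z) ((hu z hz).of_le (by simp)) h)

/-- The exterior derivative commutes with pullback: the antisymmetrized derivative of the pullback
of `θ` is the pullback of `dθ`. -/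
lemma curl_pullForm {θ : OneForm E W} (hθ : SmoothForm θ) {u : F → W} {s : Set F}
    (hs : UniqueDiffOn ℝ s) (hu : ContMDiffOn 𝓘(ℝ, F) 𝓘(ℝ, E) ∞ u s) {z : F} (hz : z ∈ s)
    (hz' : z ∈ closure (interior s)) (a b : F) :
    fderivWithin ℝ (pullForm θ u s) s z a b - fderivWithin ℝ (pullForm θ u s) s z b a =
      om θ (u z) (vel u s z a) (vel u s z b) := by
  have h : u z ∈ (extChartAt 𝓘(ℝ, E) (u z)).source := mem_extChartAt_source (I := 𝓘(ℝ, E)) (u z)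
  have hc := contDiffWithinAt_inChart le_rfl (u z) (hu z hz) h
  have hcd := (hc.differentiableWithinAt (by simp)).hasFDerivWithinAt
  have h1 : HasFDerivAt (coordForm θ (u z)) (fderiv ℝ (coordForm θ (u z)) (inChart E (u z) u z))
      (inChart E (u z) u z) := by
    refine DifferentiableAt.hasFDerivAt (ContDiffAt.differentiableAt (n := ∞) ?_ (by simp))
    exact (hθ (u z)).contDiffAt (extChartAt_target_mem_nhds (u z))
  have h2 := h1.comp_hasFDerivWithinAt z hcd
  have h3 := ((contDiffWithinAt_fderivWithin_inChart hs (u z) hz hu h).differentiableWithinAt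
    (by simp)).hasFDerivWithinAt
  have h4 := (h2.clm_comp h3).congr_of_eventuallyEq
    (pullForm_eventuallyEq θ hs (u z) hz (hu.of_le (by simp)) h)
    (pullForm_eq θ (hs z hz) (u z) ((hu z hz).of_le (by simp)) h)
  rw [h4.fderivWithin (hs z hz)]
  have hsymm := (hc.isSymmSndFDerivWithinAt
    (by rw [minSmoothness_of_isRCLikeNormedField]; exact two_le_infty) hs hz' hz).eq a b
  have hv := vel_eq_self ((hu z hz).of_le (n := ∞) (m := 1) (by simp))
  simp only [om, hv]
  simp only [add_apply, ContinuousLinearMap.comp_apply,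
    ContinuousLinearMap.compL_apply, ContinuousLinearMap.flip_apply, Function.comp_apply, hsymm]
  simp only [inChart]
  ring

lemma contDiffOn_comp {n : ℕ∞ω} {f : W → G} (hf : ContMDiff 𝓘(ℝ, E) 𝓘(ℝ, G) n f) {u : F → W}
    {s : Set F} (hu : ContMDiffOn 𝓘(ℝ, F) 𝓘(ℝ, E) n u s) :
    ContDiffOn ℝ n (fun z => f (u z)) s := by
  rw [← contMDiffOn_iff_contDiffOn]
  exact hf.comp_contMDiffOn hu

lemma fderivWithin_comp_vel {f : W → ℝ} {u : F → W} {s : Set F} {z : F}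
    (hf : MDifferentiableAt 𝓘(ℝ, E) 𝓘(ℝ, ℝ) f (u z))
    (hs : UniqueDiffWithinAt ℝ s z) (hu : MDifferentiableWithinAt 𝓘(ℝ, F) 𝓘(ℝ, E) u s z) (a : F) :
    fderivWithin ℝ (fun z => f (u z)) s z a = df f (u z) (vel (E := E) u s z a) := by
  have h3 := mfderiv_comp_mfderivWithin (I := 𝓘(ℝ, F)) z hf hu hs.uniqueMDiffWithinAt
  rw [mfderivWithin_eq_fderivWithin] at h3
  exact congrArg (fun L : F →L[ℝ] ℝ => L a) h3

/-- Chain rule for velocities. -/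
lemma vel_comp {u : F → W} {g : G → F} {s : Set F} {t : Set G} {q : G}
    (hu : MDifferentiableWithinAt 𝓘(ℝ, F) 𝓘(ℝ, E) u s (g q)) (hg : DifferentiableWithinAt ℝ g t q)
    (hm : MapsTo g t s) (ht : UniqueDiffWithinAt ℝ t q) (a : G) :
    (vel (fun q => u (g q)) t q : G →L[ℝ] E) a = vel u s (g q) (fderivWithin ℝ g t q a) := by
  have h3 := mfderivWithin_comp (I := 𝓘(ℝ, G)) q hu hg.mdifferentiableWithinAt hm
    ht.uniqueMDiffWithinAt
  rw [mfderivWithin_eq_fderivWithin] at h3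
  exact congrArg (fun L : G →L[ℝ] E => L a) h3

/-- Chain rule for a map between manifolds. -/
lemma vel_map {u : F → W} {s : Set F} {z : F} {Ψ : W → W}
    (hΨ : MDifferentiableAt 𝓘(ℝ, E) 𝓘(ℝ, E) Ψ (u z)) (hs : UniqueDiffWithinAt ℝ s z)
    (hu : MDifferentiableWithinAt 𝓘(ℝ, F) 𝓘(ℝ, E) u s z) (a : F) :
    (vel (fun z => Ψ (u z)) s z : F →L[ℝ] E) a =
      dd Ψ (u z) (vel u s z a) := by
  have h3 := mfderiv_comp_mfderivWithin (I := 𝓘(ℝ, F)) z hΨ hu hs.uniqueMDiffWithinAt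
  exact congrArg (fun L : F →L[ℝ] E => L a) h3

end Pullback

/-! ### Symplectic linear algebra -/

section Linear

variable {E : Type*} [NormedAddCommGroup E] [NormedSpace ℝ E]
variable {W : Type*} [TopologicalSpace W] [ChartedSpace E W]
variable (θ : OneForm E W) (x : W)

variable (c : ℝ) (u u' v : E)

lemma om_swap : om θ x u v = -om θ x v u := by
  simp only [om]; ring

lemma om_add_left : om θ x (u + u') v = om θ x u v + om θ x u' v := by
  simp only [om, map_add, add_apply]; ring

lemma om_smul_left : om θ x (c • u) v = c * om θ x u v := by
  simp only [om, map_smul, smul_apply, smul_eq_mul]; ring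

lemma om_add_right : om θ x v (u + u') = om θ x v u + om θ x v u' := by
  simp only [om, map_add, add_apply]; ring

lemma om_smul_right : om θ x v (c • u) = c * om θ x v u := by
  simp only [om, map_smul, smul_apply, smul_eq_mul]; ring

lemma om_sub_left : om θ x (u - u') v = om θ x u v - om θ x u' v := by
  simp only [om, map_sub, sub_apply]; ring

lemma om_sub_right : om θ x v (u - u') = om θ x v u - om θ x v u' := by
  simp only [om, map_sub, sub_apply]; ring

lemma om_neg_right : om θ x v (-u) = -om θ x v u := by
  simp only [om, map_neg, neg_apply]; ring

lemma om_self : om θ x u u = 0 := by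
  simp [om]

/-- `dθ` as a bilinear map on the model space. -/
def omL : E →ₗ[ℝ] E →ₗ[ℝ] ℝ :=
  LinearMap.mk₂ ℝ (om θ x) (om_add_left θ x) (om_smul_left θ x)
    (fun v u u' => om_add_right θ x u u' v) (fun c u v => om_smul_right θ x c v u)

variable [FiniteDimensional ℝ E]

lemma om_dualVector (hnd : ∀ v : E, (∀ u : E, om θ x v u = 0) → v = 0)
    (α : TangentSpace 𝓘(ℝ, E) x →L[ℝ] ℝ) (u : E) :
    om θ x (dualVector θ x α) u = (show E →L[ℝ] ℝ from α) u := by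
  have h : ∃ v : TangentSpace 𝓘(ℝ, E) x, ∀ u, dForm θ x v u = α u := by
    have hinj : Function.Injective (omL θ x) := by
      rw [injective_iff_map_eq_zero]
      intro v hv
      exact hnd v fun u => congrArg (fun L : E →ₗ[ℝ] ℝ => L u) hv
    have hsurj : Function.Surjective (omL θ x) :=
      (LinearMap.injective_iff_surjective_of_finrank_eq_finrank
        (by rw [Module.finrank_linearMap_self])).1 hinj
    obtain ⟨v, hv⟩ := hsurj ((show E →L[ℝ] ℝ from α) : E →ₗ[ℝ] ℝ)
    exact ⟨v, fun u => congrArg (fun L : E →ₗ[ℝ] ℝ => L u) hv⟩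
  simp only [dualVector, dif_pos h]
  exact h.choose_spec u

end Linear

/-! ### Curves with prescribed velocity -/

section Curves

variable {E : Type*} [NormedAddCommGroup E] [NormedSpace ℝ E]
variable {W : Type*} [TopologicalSpace W] [ChartedSpace E W] [IsManifold 𝓘(ℝ, E) ∞ W]
variable {F : Type*} [NormedAddCommGroup F] [NormedSpace ℝ F]

lemma hasDerivAt_sin_scale {δ : ℝ} (hδ : 0 < δ) :
    HasDerivAt (fun t : ℝ => δ * Real.sin (t / δ)) 1 0 := by
  have h := (((hasDerivAt_id (0 : ℝ)).div_const δ).sin).const_mul δ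
  simpa [hδ.ne'] using h

lemma contDiff_sin_scale (δ : ℝ) : ContDiff ℝ ∞ (fun t : ℝ => δ * Real.sin (t / δ)) :=
  contDiff_const.mul (Real.contDiff_sin.comp (contDiff_id.div_const δ))

lemma abs_sin_scale_le {δ : ℝ} (hδ : 0 < δ) (t : ℝ) : |δ * Real.sin (t / δ)| ≤ δ := by
  rw [abs_mul, abs_of_pos hδ]
  exact mul_le_of_le_one_right hδ.le (Real.abs_sin_le_one _)

/-- The velocity of a curve that is only defined on a short interval is a tangent vector: the curve
can be reparametrized over the real line without changing its velocity at `0`. -/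
lemma vel_mem_tangentTo {A : Set W} {c : ℝ → W} {ε : ℝ} (hε : 0 < ε)
    (hc : ContMDiffOn 𝓘(ℝ, ℝ) 𝓘(ℝ, E) ∞ c (Ioo (-ε) ε)) (hA : ∀ t ∈ Ioo (-ε) ε, c t ∈ A)
    {x : W} (hx : c 0 = x) {v : E} (hv : vel c univ 0 1 = v) :
    v ∈ tangentTo (E := E) A x := by
  have hm : ∀ t : ℝ, ε / 2 * Real.sin (t / (ε / 2)) ∈ Ioo (-ε) ε := by
    intro t
    have := abs_le.1 (abs_sin_scale_le (half_pos hε) t)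
    constructor <;> linarith
  refine ⟨fun t => c (ε / 2 * Real.sin (t / (ε / 2))), ?_, fun t => hA _ (hm t), by simp [hx], ?_⟩
  · rw [← contMDiffOn_univ]
    exact hc.comp ((contDiff_sin_scale _).contMDiff.contMDiffOn) fun t _ => hm t
  · have h0 : (0 : ℝ) ∈ Ioo (-ε) ε := ⟨by linarith, hε⟩
    have hd : MDifferentiableAt 𝓘(ℝ, ℝ) 𝓘(ℝ, E) c (ε / 2 * Real.sin (0 / (ε / 2))) := by
      have := (hc.contMDiffAt (x := (0 : ℝ)) (Ioo_mem_nhds h0.1 h0.2)).mdifferentiableAt (by simp)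
      simpa using this
    have h1 := vel_comp (g := fun t : ℝ => ε / 2 * Real.sin (t / (ε / 2))) (t := univ) (q := 0)
      (s := univ) hd.mdifferentiableWithinAt
      (hasDerivAt_sin_scale (half_pos hε)).differentiableAt.differentiableWithinAt
      (mapsTo_univ _ _) uniqueDiffWithinAt_univ 1
    rw [fderivWithin_univ, fderiv_apply_one_eq_deriv, (hasDerivAt_sin_scale (half_pos hε)).deriv] at h1
    rw [vel_univ] at h1
    have h2 : vel (E := E) c univ (ε / 2 * Real.sin (0 / (ε / 2))) 1 = v := by simpa using hv
    exact h1.trans h2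

lemma tangentTo_iff {A : Set W} {x : W} {v : E} : v ∈ tangentTo (E := E) A x ↔
    ∃ c : ℝ → W, ContMDiff 𝓘(ℝ, ℝ) 𝓘(ℝ, E) ∞ c ∧ (∀ t, c t ∈ A) ∧ c 0 = x ∧
      vel c univ 0 1 = v := by
  simp only [vel_univ]
  exact Iff.rfl

/-- The derivative of a chart. -/
def cv (x₀ : W) (x : W) : E →L[ℝ] E := mfderiv 𝓘(ℝ, E) 𝓘(ℝ, E) (extChartAt 𝓘(ℝ, E) x₀ : W → E) x

lemma fderivWithin_inChart {u : F → W} {s : Set F} {z : F} (x₀ : W)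
    (h : u z ∈ (extChartAt 𝓘(ℝ, E) x₀).source)
    (hs : UniqueDiffWithinAt ℝ s z) (hu : MDifferentiableWithinAt 𝓘(ℝ, F) 𝓘(ℝ, E) u s z) :
    fderivWithin ℝ (inChart E x₀ u) s z = (cv x₀ (u z)).comp (vel u s z) := by
  have h' : MDifferentiableAt 𝓘(ℝ, E) 𝓘(ℝ, E) (extChartAt 𝓘(ℝ, E) x₀) (u z) :=
    mdifferentiableAt_extChartAt (by simpa using h)
  have h3 := mfderiv_comp_mfderivWithin (I := 𝓘(ℝ, F)) z h' hu hs.uniqueMDiffWithinAt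
  rw [mfderivWithin_eq_fderivWithin] at h3
  exact h3

/-- Any linear map from the plane is the derivative of a smooth map into the manifold. -/
lemma exists_surface (x : W) (L : ℝ × ℝ →L[ℝ] E) : ∃ c : ℝ × ℝ → W,
    ContMDiff 𝓘(ℝ, ℝ × ℝ) 𝓘(ℝ, E) ∞ c ∧ c 0 = x ∧ vel c univ 0 = L := by
  obtain ⟨r, hr, hB⟩ := Metric.mem_nhds_iff.1 (extChartAt_target_mem_nhds (I := 𝓘(ℝ, E)) x)
  -- The map is affine in the chart at `x`, up to replacing each coordinate `t` by `δ sin (t / δ)`, which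
  -- has derivative `1` at `0` and keeps the image inside the chart.
  set δ : ℝ := r / (2 * (‖L‖ + 1)) with hδ'
  have hL : 0 < ‖L‖ + 1 := by positivity
  have hδ : 0 < δ := by positivity
  set g : ℝ × ℝ → E := fun p => extChartAt 𝓘(ℝ, E) x x +
    L (δ * Real.sin (p.1 / δ), δ * Real.sin (p.2 / δ)) with hg
  have hgs : ContDiff ℝ ∞ g := contDiff_const.add (L.contDiff.comp
    (((contDiff_sin_scale δ).comp contDiff_fst).prodMk ((contDiff_sin_scale δ).comp contDiff_snd)))
  have hgt : ∀ p, g p ∈ (extChartAt 𝓘(ℝ, E) x).target := by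
    intro p
    apply hB
    rw [mem_ball_iff_norm]
    simp only [hg, add_sub_cancel_left]
    calc _ ≤ ‖L‖ * ‖(δ * Real.sin (p.1 / δ), δ * Real.sin (p.2 / δ))‖ := L.le_opNorm _
      _ ≤ ‖L‖ * δ := by
        gcongr
        exact max_le (abs_sin_scale_le hδ _) (abs_sin_scale_le hδ _)
      _ ≤ (‖L‖ + 1) * δ := by gcongr; linarith
      _ = r / 2 := by rw [hδ']; field_simp
      _ < r := by linarith
  have hg0 : g 0 = extChartAt 𝓘(ℝ, E) x x := by
    have : L (0, 0) = 0 := L.map_zero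
    simp [hg, this]
  have hc0 : (extChartAt 𝓘(ℝ, E) x).symm (g 0) = x := by rw [hg0]; simp
  have hcs : ContMDiff 𝓘(ℝ, ℝ × ℝ) 𝓘(ℝ, E) ∞ (fun p => (extChartAt 𝓘(ℝ, E) x).symm (g p)) := by
    rw [← contMDiffOn_univ]
    exact (contMDiffOn_extChartAt_symm x).comp hgs.contMDiff.contMDiffOn fun p _ => hgt p
  refine ⟨_, hcs, hc0, ?_⟩
  have h := vel_eq_self (E := E) (u := fun p => (extChartAt 𝓘(ℝ, E) x).symm (g p)) (s := univ)
    (z := 0) ((hcs.contMDiffAt).of_le (by simp)).contMDiffWithinAt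
  rw [h, hc0]
  have : inChart E x (fun p => (extChartAt 𝓘(ℝ, E) x).symm (g p)) = g := by
    funext p; exact (extChartAt 𝓘(ℝ, E) x).right_inv (hgt p)
  rw [this, fderivWithin_univ]
  refine HasFDerivAt.fderiv ?_
  have hs1 : HasFDerivAt (fun p : ℝ × ℝ => (δ * Real.sin (p.1 / δ), δ * Real.sin (p.2 / δ)))
      (ContinuousLinearMap.id ℝ (ℝ × ℝ)) 0 := by
    have h1 := (hasDerivAt_sin_scale hδ).comp_hasFDerivAt (0 : ℝ × ℝ)
      (hasFDerivAt_fst (𝕜 := ℝ) (E := ℝ) (F := ℝ) (p := 0))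
    have h2 := (hasDerivAt_sin_scale hδ).comp_hasFDerivAt (0 : ℝ × ℝ)
      (hasFDerivAt_snd (𝕜 := ℝ) (E := ℝ) (F := ℝ) (p := 0))
    have h3 := h1.prodMk h2
    have h4 : (((1 : ℝ) • ContinuousLinearMap.fst ℝ ℝ ℝ).prod ((1 : ℝ) • ContinuousLinearMap.snd ℝ ℝ ℝ))
      = ContinuousLinearMap.id ℝ (ℝ × ℝ) := by ext <;> simp
    rw [h4] at h3
    exact h3
  have := (L.hasFDerivAt.comp (0 : ℝ × ℝ) hs1).const_add (extChartAt 𝓘(ℝ, E) x x)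
  rw [ContinuousLinearMap.comp_id] at this
  exact this

lemma exists_curve (x : W) (v : E) : ∃ c : ℝ → W,
    ContMDiff 𝓘(ℝ, ℝ) 𝓘(ℝ, E) ∞ c ∧ c 0 = x ∧ vel c univ 0 1 = v := by
  obtain ⟨c, hc, h0, hv⟩ := exists_surface x
    ((ContinuousLinearMap.fst ℝ ℝ ℝ).smulRight v)
  have hi : ContDiff ℝ ∞ (fun t : ℝ => (t, (0 : ℝ))) := contDiff_id.prodMk contDiff_const
  refine ⟨fun t => c (t, 0), hc.comp hi.contMDiff, h0, ?_⟩
  have h := vel_comp (u := c) (g := fun t : ℝ => (t, (0 : ℝ))) (s := univ) (t := univ) (q := 0)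
    ((hc.contMDiffAt).mdifferentiableAt (by simp)).mdifferentiableWithinAt
    (hi.differentiable (by simp)).differentiableAt.differentiableWithinAt (mapsTo_univ _ _)
    uniqueDiffWithinAt_univ 1
  rw [h]
  have h2 : fderivWithin ℝ (fun t : ℝ => (t, (0 : ℝ))) univ 0 1 = (1, 0) := by
    rw [fderivWithin_univ]
    have := ((hasDerivAt_id (0 : ℝ)).prodMk (hasDerivAt_const (0 : ℝ) (0 : ℝ))).deriv
    rw [fderiv_apply_one_eq_deriv]; exact this
  rw [h2]
  have h3 : ((0 : ℝ), (0 : ℝ)) = 0 := rfl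
  rw [h3, hv]
  simp

end Curves

/-! ### Flows -/

section Flows

variable {E : Type*} [NormedAddCommGroup E] [NormedSpace ℝ E]
variable {W : Type*} [TopologicalSpace W] [ChartedSpace E W] [IsManifold 𝓘(ℝ, E) ∞ W]
variable {V : VField E W} {Φ : ℝ → W → W}

lemma contMDiff_prodSpace (h : IsFlow V Φ) {F : Type*} [NormedAddCommGroup F] [NormedSpace ℝ F]
    {s : Set F} {τ : F → ℝ} {c : F → W} (hτ : ContDiffOn ℝ ∞ τ s)
    (hc : ContMDiffOn 𝓘(ℝ, F) 𝓘(ℝ, E) ∞ c s) :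
    ContMDiffOn 𝓘(ℝ, F) 𝓘(ℝ, E) ∞ (fun z => Φ (τ z) (c z)) s :=
  h.smooth.comp_contMDiffOn (hτ.contMDiffOn.prodMk hc)

lemma IsFlow.contMDiff (h : IsFlow V Φ) (t : ℝ) : ContMDiff 𝓘(ℝ, E) 𝓘(ℝ, E) ∞ (Φ t) :=
  h.smooth.comp (contMDiff_const.prodMk contMDiff_id)

lemma IsFlow.contMDiff_time (h : IsFlow V Φ) (x : W) :
    ContMDiff 𝓘(ℝ, ℝ) 𝓘(ℝ, E) ∞ (fun t => Φ t x) :=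
  h.smooth.comp (contMDiff_id.prodMk contMDiff_const)

lemma IsFlow.continuous (h : IsFlow V Φ) : Continuous (fun p : ℝ × W => Φ p.1 p.2) :=
  h.smooth.continuous

lemma IsFlow.vel_time (h : IsFlow V Φ) (x : W) (t : ℝ) :
    vel (fun t => Φ t x) univ t 1 = vv V (Φ t x) := by
  rw [vel_univ]
  have := (h.deriv x t).mfderiv
  refine (congrArg (fun L : ℝ →L[ℝ] E => L 1) this).trans ?_
  exact one_smul ℝ (vv V (Φ t x))

/-- The derivative of a function along a flow line. -/
lemma IsFlow.hasDerivAt_comp (h : IsFlow V Φ) {f : W → ℝ} {x : W} {t : ℝ}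
    (hf : MDifferentiableAt 𝓘(ℝ, E) 𝓘(ℝ, ℝ) f (Φ t x)) :
    HasDerivAt (fun t => f (Φ t x)) (df f (Φ t x) (vv V (Φ t x))) t := by
  have hm : MDifferentiableAt 𝓘(ℝ, ℝ) 𝓘(ℝ, E) (fun t => Φ t x) t :=
    (h.contMDiff_time x).contMDiffAt.mdifferentiableAt (by simp)
  have hd : DifferentiableAt ℝ (fun t => f (Φ t x)) t :=
    (hf.comp t hm).differentiableAt
  have h1 := fderivWithin_comp_vel (u := fun t => Φ t x) (s := univ) (z := t) hf
    uniqueDiffWithinAt_univ hm.mdifferentiableWithinAt 1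
  rw [fderivWithin_univ, h.vel_time, fderiv_apply_one_eq_deriv] at h1
  rw [← h1]
  exact hd.hasDerivAt

/-- The function of time and a point in a chart which describes a flow near time `0`. -/
lemma IsFlow.contDiffAt_inChart (h : IsFlow V Φ) (x₀ x : W)
    (hx : x ∈ (extChartAt 𝓘(ℝ, E) x₀).source) :
    ContDiffAt ℝ ∞ (fun p : ℝ × E => extChartAt 𝓘(ℝ, E) x₀ (Φ p.1 ((extChartAt 𝓘(ℝ, E) x₀).symm p.2)))
      (0, extChartAt 𝓘(ℝ, E) x₀ x) := by
  have ht := extChartAt_target_mem_nhds' (I := 𝓘(ℝ, E)) ((extChartAt 𝓘(ℝ, E) x₀).map_source hx)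
  have hs : ContMDiffAt 𝓘(ℝ, E) 𝓘(ℝ, E) ∞ ((extChartAt 𝓘(ℝ, E) x₀).symm : E → W)
      (extChartAt 𝓘(ℝ, E) x₀ x) := (contMDiffOn_extChartAt_symm x₀).contMDiffAt ht
  have h1 : ContMDiffAt 𝓘(ℝ, ℝ × E) 𝓘(ℝ, E) ∞
      (fun p : ℝ × E => Φ p.1 ((extChartAt 𝓘(ℝ, E) x₀).symm p.2)) (0, extChartAt 𝓘(ℝ, E) x₀ x) := by
    refine h.smooth.contMDiffAt.comp (0, extChartAt 𝓘(ℝ, E) x₀ x) (ContMDiffAt.prodMk ?_ ?_)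
    · exact contDiff_fst.contMDiff.contMDiffAt
    · refine ContMDiffAt.comp (0, extChartAt 𝓘(ℝ, E) x₀ x) hs ?_
      exact contDiff_snd.contMDiff.contMDiffAt
  have h2 := contDiffWithinAt_inChart (E := E) (s := univ) le_rfl x₀ h1.contMDiffWithinAt
    (by rw [h.zero, (extChartAt 𝓘(ℝ, E) x₀).left_inv hx]; exact hx)
  exact h2.contDiffAt univ_mem

/-- The expression of the generating vector field of a flow in a chart is smooth. -/
lemma IsFlow.contMDiffAt_cv (h : IsFlow V Φ) (x₀ x : W)
    (hx : x ∈ (extChartAt 𝓘(ℝ, E) x₀).source) :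
    ContMDiffAt 𝓘(ℝ, E) 𝓘(ℝ, E) ∞ (fun y => cv x₀ y (vv V y)) x := by
  have h1 := h.contDiffAt_inChart x₀ x hx
  set g : ℝ × E → E :=
    fun p => extChartAt 𝓘(ℝ, E) x₀ (Φ p.1 ((extChartAt 𝓘(ℝ, E) x₀).symm p.2)) with hg
  have h2 : ContDiffAt ℝ ∞ (fun y : E => fderiv ℝ g (0, y) (1, 0)) (extChartAt 𝓘(ℝ, E) x₀ x) :=
    ((h1.fderiv_right (m := ∞) (by simp)).clm_apply contDiffAt_const).comp
      (extChartAt 𝓘(ℝ, E) x₀ x) (contDiffAt_const.prodMk contDiffAt_id)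
  have h3 : ContMDiffAt 𝓘(ℝ, E) 𝓘(ℝ, E) ∞ (extChartAt 𝓘(ℝ, E) x₀) x :=
    contMDiffAt_extChartAt' (by simpa using hx)
  refine (ContMDiffAt.comp x h2.contMDiffAt h3).congr_of_eventuallyEq ?_
  filter_upwards [(isOpen_extChartAt_source (I := 𝓘(ℝ, E)) x₀).mem_nhds hx] with y hy
  have hd := ((h.contDiffAt_inChart x₀ y hy).differentiableAt (by simp)).hasFDerivAt
  have hc := hd.comp_hasDerivAt (0 : ℝ) (((hasDerivAt_id (0 : ℝ)).prodMk
    (hasDerivAt_const (0 : ℝ) (extChartAt 𝓘(ℝ, E) x₀ y))))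
  have h5 : (g ∘ fun t : ℝ => (id t, extChartAt 𝓘(ℝ, E) x₀ y)) = inChart E x₀ (fun t => Φ t y) := by
    funext t
    simp only [hg, Function.comp, inChart, id, (extChartAt 𝓘(ℝ, E) x₀).left_inv hy]
  rw [h5] at hc
  have h6 := fderivWithin_inChart (E := E) (u := fun t => Φ t y) (s := univ) (z := 0) x₀
    (by simpa [h.zero] using hy) uniqueDiffWithinAt_univ
    ((h.contMDiff_time y).contMDiffAt.mdifferentiableAt (by simp)).mdifferentiableWithinAt
  have h7 := congrArg (fun L : ℝ →L[ℝ] E => L 1) h6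
  simp only [fderivWithin_univ, fderiv_apply_one_eq_deriv, ContinuousLinearMap.comp_apply,
    h.vel_time, hc.deriv, h.zero] at h7
  exact h7.symm

lemma IsFlow.contMDiff_section (h : IsFlow V Φ) :
    ContMDiff 𝓘(ℝ, E) 𝓘(ℝ, E).tangent 1 (fun x => (⟨x, V x⟩ : TangentBundle 𝓘(ℝ, E) W)) := by
  intro x
  rw [Bundle.contMDiffAt_section]
  have h1 := (h.contMDiffAt_cv x x (mem_extChartAt_source (I := 𝓘(ℝ, E)) x)).of_le
    (m := 1) (by simp)
  refine h1.congr_of_eventuallyEq ?_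
  filter_upwards [(isOpen_extChartAt_source (I := 𝓘(ℝ, E)) x).mem_nhds
    (mem_extChartAt_source (I := 𝓘(ℝ, E)) x)] with y hy
  have hy' : y ∈ (chartAt E x).source := by simpa using hy
  have := mfderiv_chartAt_eq_tangentCoordChange (I := 𝓘(ℝ, E)) hy'
  exact (congrArg (fun L : E →L[ℝ] E => L (vv V y)) this).symm

variable [T2Space W] [CompleteSpace E]

lemma IsFlow.eq_of_integralCurve (h : IsFlow V Φ) {c : ℝ → W}
    (hc : IsMIntegralCurve (I := 𝓘(ℝ, E)) c V) (t : ℝ) : c t = Φ t (c 0) := by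
  have := isMIntegralCurve_Ioo_eq_of_contMDiff_boundaryless (t₀ := 0) h.contMDiff_section hc
    (h.deriv (c 0)) (by rw [h.zero])
  exact congrFun this t

lemma IsFlow.add (h : IsFlow V Φ) (s t : ℝ) (x : W) : Φ (s + t) x = Φ s (Φ t x) := by
  have hc : IsMIntegralCurve (I := 𝓘(ℝ, E)) (fun s => Φ (s + t) x) V :=
    (h.deriv x).comp_add t
  have := h.eq_of_integralCurve hc s
  simpa using this

lemma IsFlow.neg_cancel (h : IsFlow V Φ) (t : ℝ) (x : W) : Φ (-t) (Φ t x) = x := by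
  rw [← h.add]; simp [h.zero]

lemma IsFlow.cancel_neg (h : IsFlow V Φ) (t : ℝ) (x : W) : Φ t (Φ (-t) x) = x := by
  rw [← h.add]; simp [h.zero]

end Flows

/-! ### The Liouville flow -/

section Liouville

variable {E : Type*} [NormedAddCommGroup E] [NormedSpace ℝ E]
variable {W : Type*} [TopologicalSpace W] [ChartedSpace E W] [IsManifold 𝓘(ℝ, E) ∞ W]

lemma dd_comp {Ψ Ψ' : W → W} {x : W} (h : MDifferentiableAt 𝓘(ℝ, E) 𝓘(ℝ, E) Ψ x)
    (h' : MDifferentiableAt 𝓘(ℝ, E) 𝓘(ℝ, E) Ψ' (Ψ x)) (v : E) :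
    dd Ψ' (Ψ x) (dd Ψ x v) = dd (fun x => Ψ' (Ψ x)) x v := by
  have := mfderiv_comp (I := 𝓘(ℝ, E)) x h' h
  exact (congrArg (fun L : E →L[ℝ] E => L v) this).symm

lemma dd_id (x : W) (v : E) : dd (fun x : W => x) x v = v := by
  have := mfderiv_id (I := 𝓘(ℝ, E)) (x := x)
  exact congrArg (fun L : E →L[ℝ] E => L v) this

lemma df_comp {Ψ : W → W} {f : W → ℝ} {x : W} (h : MDifferentiableAt 𝓘(ℝ, E) 𝓘(ℝ, E) Ψ x)
    (h' : MDifferentiableAt 𝓘(ℝ, E) 𝓘(ℝ, ℝ) f (Ψ x)) (v : E) :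
    df (fun x => f (Ψ x)) x v = df f (Ψ x) (dd Ψ x v) := by
  have := mfderiv_comp (I := 𝓘(ℝ, E)) x h' h
  exact congrArg (fun L : E →L[ℝ] ℝ => L v) this

lemma df_congr {f g : W → ℝ} {x : W} (h : f =ᶠ[𝓝 x] g) : df (E := E) f x = df g x := by
  unfold df
  exact Filter.EventuallyEq.mfderiv_eq (I := 𝓘(ℝ, E)) (I' := 𝓘(ℝ, ℝ)) h

lemma vel_global_mdiff {F : Type*} [NormedAddCommGroup F] [NormedSpace ℝ F] {u : F → W}
    (hu : ContMDiff 𝓘(ℝ, F) 𝓘(ℝ, E) ∞ u) (z : F) :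
    MDifferentiableWithinAt 𝓘(ℝ, F) 𝓘(ℝ, E) u univ z :=
  (hu.contMDiffAt.mdifferentiableAt (by simp)).mdifferentiableWithinAt

instance completeSpace_of_finiteDimensional [FiniteDimensional ℝ E] : CompleteSpace E :=
  FiniteDimensional.complete ℝ E

variable [T2Space W] [FiniteDimensional ℝ E]

namespace LiouvilleManifold

variable (Y : LiouvilleManifold E W)

lemma om_Z (x : W) (u : E) : om Y.θ x (vv Y.Z x) u = fm Y.θ x u :=
  om_dualVector Y.θ x (Y.nondeg x) (Y.θ x) u

lemma om_X (F : W → ℝ) (x : W) (u : E) : om Y.θ x (vv (Y.X F) x) u = -df F x u :=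
  om_dualVector Y.θ x (Y.nondeg x) (-(dFun F x)) u

lemma eq_of_om {x : W} {v v' : E} (h : ∀ u : E, om Y.θ x v u = om Y.θ x v' u) : v = v' := by
  rw [← sub_eq_zero]
  exact Y.nondeg x (v - v') fun u => by
    have := om_sub_left Y.θ x v v' u
    rw [h u, sub_self] at this
    exact this

lemma fm_Z (x : W) : fm Y.θ x (vv Y.Z x) = 0 := by
  rw [← om_Z, om_self]

/-- `θ(X) = dF(Z)` for the Hamiltonian field `X` of `F`. -/
lemma fm_X (F : W → ℝ) (x : W) : fm Y.θ x (vv (Y.X F) x) = df F x (vv Y.Z x) := by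
  rw [← om_Z, om_swap, om_X, neg_neg]

lemma df_X (F : W → ℝ) (x : W) : df F x (vv (Y.X F) x) = 0 := by
  have := Y.om_X F x (vv (Y.X F) x)
  rw [om_self] at this; linarith

lemma vel_prod {u : ℝ × ℝ → W} (hu : ContMDiff 𝓘(ℝ, ℝ × ℝ) 𝓘(ℝ, E) ∞ u) (p : ℝ × ℝ) (s : ℝ) :
    vel u univ p (s, 0) = s • vel (E := E) (fun t => u (t, p.2)) univ p.1 1 := by
  have hi : HasDerivAt (fun t : ℝ => (t, p.2)) ((1 : ℝ), (0 : ℝ)) p.1 :=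
    (hasDerivAt_id p.1).prodMk (hasDerivAt_const p.1 p.2)
  have h := vel_comp (u := u) (g := fun t : ℝ => (t, p.2)) (s := univ) (t := univ) (q := p.1)
    (vel_global_mdiff hu _) hi.differentiableAt.differentiableWithinAt (mapsTo_univ _ _)
    uniqueDiffWithinAt_univ 1
  rw [fderivWithin_univ, fderiv_apply_one_eq_deriv, hi.deriv] at h
  rw [h, ← map_smul]; simp

/-- The Liouville flow rescales `θ`. For `u(t, s) = flow t (c s)`, where `c` is a curve with velocity `v`,
the formula for `d(u^*θ)` and `i_Z dθ = θ` give the linear differential equation satisfied by the left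
hand side as a function of `t`. -/
lemma fm_flow (t : ℝ) (x : W) (v : E) :
    fm Y.θ (Y.flow t x) (dd (Y.flow t) x v) = Real.exp t * fm Y.θ x v := by
  obtain ⟨c, hc, hc0, hcv⟩ := exists_curve x v
  set u : ℝ × ℝ → W := fun p => Y.flow p.1 (c p.2) with hu
  have hus : ContMDiff 𝓘(ℝ, ℝ × ℝ) 𝓘(ℝ, E) ∞ u :=
    Y.isFlow.smooth.comp (contDiff_fst.contMDiff.prodMk (hc.comp contDiff_snd.contMDiff))
  have hu1 : ∀ p, vel u univ p (1, 0) = vv Y.Z (u p) := by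
    intro p
    rw [vel_prod hus p 1, one_smul]
    exact Y.isFlow.vel_time (c p.2) p.1
  have hu2 : ∀ t, vel u univ (t, 0) (0, 1) = dd (Y.flow t) x v := by
    intro t
    have hi : HasDerivAt (fun s : ℝ => (t, s)) ((0 : ℝ), (1 : ℝ)) 0 :=
      (hasDerivAt_const (0 : ℝ) t).prodMk (hasDerivAt_id (0 : ℝ))
    have h := vel_comp (u := u) (g := fun s : ℝ => (t, s)) (s := univ) (t := univ) (q := 0)
      (vel_global_mdiff hus _) hi.differentiableAt.differentiableWithinAt (mapsTo_univ _ _)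
      uniqueDiffWithinAt_univ 1
    rw [fderivWithin_univ, fderiv_apply_one_eq_deriv, hi.deriv] at h
    rw [← h]
    have h2 := vel_map (E := E) (u := c) (s := univ) (z := 0) (Ψ := Y.flow t)
      ((Y.isFlow.contMDiff t).contMDiffAt.mdifferentiableAt (by simp)) uniqueDiffWithinAt_univ
      (vel_global_mdiff hc _) 1
    rw [hcv, hc0] at h2
    exact h2
  have hp : ContDiff ℝ ∞ (pullForm Y.θ u univ) := by
    rw [← contDiffOn_univ]
    exact contDiffOn_pullForm Y.smooth_θ uniqueDiffOn_univ hus.contMDiffOn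
  have hp1 : ∀ p, pullForm Y.θ u univ p (1, 0) = 0 := by
    intro p; rw [pullForm_apply, hu1, fm_Z]
  -- `u^*θ` vanishes on the first coordinate vector, so only one term of its exterior derivative remains.
  have hcurl : ∀ t, fderiv ℝ (pullForm Y.θ u univ) (t, 0) (1, 0) (0, 1) =
      pullForm Y.θ u univ (t, 0) (0, 1) := by
    intro t
    have h := curl_pullForm Y.smooth_θ uniqueDiffOn_univ hus.contMDiffOn (mem_univ (t, (0 : ℝ)))
      (by simp) (1, 0) (0, 1)
    rw [fderivWithin_univ, hu1, om_Z] at h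
    have h0 : fderiv ℝ (pullForm Y.θ u univ) (t, 0) (0, 1) (1, 0) = 0 := by
      have h1 := ((hp.differentiable (by simp)).differentiableAt (x := (t, (0 : ℝ)))).hasFDerivAt.clm_apply
        (hasFDerivAt_const ((1 : ℝ), (0 : ℝ)) (t, (0 : ℝ)))
      have h2 : (fun y => pullForm Y.θ u univ y (1, 0)) = fun _ => 0 := funext hp1
      rw [h2] at h1
      have h3 := h1.unique (hasFDerivAt_const (0 : ℝ) (t, (0 : ℝ)))
      simpa using congrArg (fun L : ℝ × ℝ →L[ℝ] ℝ => L (0, 1)) h3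
    rw [h0, sub_zero] at h
    exact h
  have hder : ∀ t, HasDerivAt (fun t : ℝ => pullForm Y.θ u univ (t, 0) (0, 1))
      (pullForm Y.θ u univ (t, 0) (0, 1)) t := by
    intro t
    have hi : HasDerivAt (fun s : ℝ => (s, (0 : ℝ))) ((1 : ℝ), (0 : ℝ)) t :=
      (hasDerivAt_id t).prodMk (hasDerivAt_const t (0 : ℝ))
    have h1 := ((hp.differentiable (by simp)).differentiableAt
      (x := (t, (0 : ℝ)))).hasFDerivAt.comp_hasDerivAt t hi
    have h2 := h1.clm_apply (hasDerivAt_const t ((0 : ℝ), (1 : ℝ)))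
    simpa [hcurl] using h2
  have hconst : ∀ t, pullForm Y.θ u univ (t, 0) (0, 1) * Real.exp (-t) =
      pullForm Y.θ u univ (0, 0) (0, 1) * Real.exp (-0) := by
    intro t
    refine is_const_of_deriv_eq_zero (f := fun t => pullForm Y.θ u univ (t, 0) (0, 1) * Real.exp (-t))
      (fun t => ((hder t).mul ((hasDerivAt_neg t).exp)).differentiableAt) ?_ t 0
    intro t
    exact ((hder t).mul ((hasDerivAt_neg t).exp)).deriv.trans (by ring)
  have h := hconst t
  have e1 : pullForm Y.θ u univ (t, 0) (0, 1) = fm Y.θ (Y.flow t x) (dd (Y.flow t) x v) := by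
    rw [pullForm_apply, hu2]; simp [hu, hc0]
  have e2 : pullForm Y.θ u univ (0, 0) (0, 1) = fm Y.θ x v := by
    rw [pullForm_apply, hu2]
    have : Y.flow 0 = fun x => x := funext Y.isFlow.zero
    rw [this, dd_id]; simp [hu, hc0, Y.isFlow.zero]
  rw [e1, e2, neg_zero, Real.exp_zero, mul_one] at h
  rw [← h, mul_comm, mul_assoc, ← Real.exp_add]; simp

/-- The Liouville flow rescales `dθ`. -/
lemma om_flow (t : ℝ) (x : W) (v w : E) :
    om Y.θ (Y.flow t x) (dd (Y.flow t) x v) (dd (Y.flow t) x w) = Real.exp t * om Y.θ x v w := by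
  obtain ⟨c, hc, hc0, hcv⟩ := exists_surface x
    ((ContinuousLinearMap.fst ℝ ℝ ℝ).smulRight v + (ContinuousLinearMap.snd ℝ ℝ ℝ).smulRight w)
  have hus : ContMDiff 𝓘(ℝ, ℝ × ℝ) 𝓘(ℝ, E) ∞ (fun p => Y.flow t (c p)) :=
    (Y.isFlow.contMDiff t).comp hc
  have hv : ∀ p a, vel (fun p => Y.flow t (c p)) univ p a = dd (Y.flow t) (c p) (vel c univ p a) :=
    fun p a => vel_map (E := E) (u := c) (s := univ) (z := p) (Ψ := Y.flow t)
      ((Y.isFlow.contMDiff t).contMDiffAt.mdifferentiableAt (by simp)) uniqueDiffWithinAt_univ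
      (vel_global_mdiff hc _) a
  have hp : pullForm Y.θ (fun p => Y.flow t (c p)) univ = Real.exp t • pullForm Y.θ c univ := by
    ext1 p
    refine ContinuousLinearMap.ext fun a => ?_
    rw [pullForm_apply, hv, fm_flow]; rfl
  have hd : DifferentiableAt ℝ (pullForm Y.θ c univ) 0 := by
    have := contDiffOn_pullForm Y.smooth_θ uniqueDiffOn_univ hc.contMDiffOn
    rw [contDiffOn_univ] at this
    exact (this.differentiable (by simp)).differentiableAt
  have h1 := curl_pullForm Y.smooth_θ uniqueDiffOn_univ hus.contMDiffOn (mem_univ 0)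
      (by simp) (1, 0) (0, 1)
  have h2 := curl_pullForm Y.smooth_θ uniqueDiffOn_univ hc.contMDiffOn (mem_univ 0)
      (by simp) (1, 0) (0, 1)
  rw [hp, fderivWithin_univ, fderiv_const_smul hd, hv, hv, hcv, hc0] at h1
  rw [fderivWithin_univ, hcv, hc0] at h2
  simp at h1 h2
  rw [← h1, ← h2]; ring

lemma mdiff_flow (t : ℝ) (x : W) : MDifferentiableAt 𝓘(ℝ, E) 𝓘(ℝ, E) (Y.flow t) x :=
  (Y.isFlow.contMDiff t).contMDiffAt.mdifferentiableAt (by simp)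

lemma dd_neg_cancel (t : ℝ) (x : W) (v : E) :
    dd (Y.flow (-t)) (Y.flow t x) (dd (Y.flow t) x v) = v := by
  rw [dd_comp (Y.mdiff_flow t x) (Y.mdiff_flow (-t) _)]
  have : (fun x => Y.flow (-t) (Y.flow t x)) = fun x => x := funext (Y.isFlow.neg_cancel t)
  rw [this, dd_id]

lemma dd_cancel_neg (t : ℝ) (x : W) (v : E) :
    dd (Y.flow t) x (dd (Y.flow (-t)) (Y.flow t x) v) = v := by
  have h := Y.dd_neg_cancel (-t) (Y.flow t x) v
  simpa [Y.isFlow.neg_cancel] using h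

end LiouvilleManifold

end Liouville

/-! ### Collars of Liouville domains -/

lemma nonneg_of_deriv_pos_at_zeros {g g' : ℝ → ℝ} (hg : ∀ t, HasDerivAt g (g' t) t)
    (h0 : g 0 = 0) (hpos : ∀ t, g t = 0 → 0 < g' t) {t : ℝ} (ht : 0 ≤ t) : 0 ≤ g t := by
  refine image_le_of_deriv_right_lt_deriv_boundary (f := fun _ => 0) (f' := fun _ => 0)
    (a := 0) (b := t) (B := g) (B' := g') continuousOn_const
    (fun x _ => hasDerivWithinAt_const _ _ _) (by rw [h0]) (fun x => hg x)
    (fun x _ hx => hpos x hx.symm) ⟨ht, le_rfl⟩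

lemma pos_of_deriv_pos_at_zeros {g g' : ℝ → ℝ} (hg : ∀ t, HasDerivAt g (g' t) t)
    (h0 : g 0 = 0) (hpos : ∀ t, g t = 0 → 0 < g' t) {t : ℝ} (ht : 0 < t) : 0 < g t := by
  refine lt_of_le_of_ne (nonneg_of_deriv_pos_at_zeros hg h0 hpos ht.le) fun h => ?_
  have h1 : IsLocalMin g t := by
    filter_upwards [Ioi_mem_nhds ht] with s hs
    rw [← h]
    exact nonneg_of_deriv_pos_at_zeros hg h0 hpos (le_of_lt hs)
  exact (hpos t h.symm).ne' (h1.hasDerivAt_eq_zero (hg t))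

lemma neg_of_deriv_pos_at_zeros {g g' : ℝ → ℝ} (hg : ∀ t, HasDerivAt g (g' t) t)
    (h0 : g 0 = 0) (hpos : ∀ t, g t = 0 → 0 < g' t) {t : ℝ} (ht : t < 0) : g t < 0 := by
  have h := pos_of_deriv_pos_at_zeros (g := fun s => -g (-s)) (g' := fun s => g' (-s))
    (fun s => (((hg (-s)).comp s (hasDerivAt_neg s)).neg).congr_deriv (by ring))
    (by simp [h0]) (fun s hs => hpos _ (by simpa using hs)) (t := -t) (by linarith)
  simpa using h

section Collar

variable {E : Type*} [NormedAddCommGroup E] [NormedSpace ℝ E] [FiniteDimensional ℝ E]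
variable {W : Type*} [TopologicalSpace W] [T2Space W] [ChartedSpace E W]
  [IsManifold 𝓘(ℝ, E) ∞ W]

namespace LiouvilleManifold

variable (Y : LiouvilleManifold E W) {K : Set W}

/-- The union of all orbits of the Liouville flow which meet the boundary of `K`. -/
def collar (K : Set W) : Set W := {x | ∃ t : ℝ, Y.flow t x ∈ frontier K}

/-- The time that the Liouville flow takes to get from the boundary of `K` to `x`, which is the
logarithm of the radial coordinate; it is `0` if `x` does not lie on the collar. -/
def logr (K : Set W) (x : W) : ℝ :=
  open Classical in if h : ∃ t : ℝ, Y.flow t x ∈ frontier K then -h.choose else 0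

/-- A defining function for the domain `K`. -/
structure IsDefining (K : Set W) (f : W → ℝ) : Prop where
  smooth : ContMDiff 𝓘(ℝ, E) 𝓘(ℝ, ℝ) ∞ f
  eq : K = {x | f x ≤ 0}
  pos : ∀ x, f x = 0 → 0 < df f x (vv Y.Z x)

variable {Y}

lemma IsDomain.exists_defining (h : Y.IsDomain K) : ∃ f, Y.IsDefining K f := by
  obtain ⟨_, f, h1, h2, h3⟩ := h
  exact ⟨f, h1, h2, h3⟩

lemma hasDerivAt_flow {f : W → ℝ} (hf : ContMDiff 𝓘(ℝ, E) 𝓘(ℝ, ℝ) ∞ f) (x : W) (t : ℝ) :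
    HasDerivAt (fun t => f (Y.flow t x)) (df f (Y.flow t x) (vv Y.Z (Y.flow t x))) t :=
  Y.isFlow.hasDerivAt_comp (hf.contMDiffAt.mdifferentiableAt (by simp))

namespace IsDefining

variable {f : W → ℝ} (hf : Y.IsDefining K f)
include hf

lemma pos_flow {y : W} (hy : f y = 0) {t : ℝ} (ht : 0 < t) : 0 < f (Y.flow t y) :=
  pos_of_deriv_pos_at_zeros (hasDerivAt_flow hf.smooth y) (by rw [Y.isFlow.zero, hy])
    (fun _ h => hf.pos _ h) ht

lemma neg_flow {y : W} (hy : f y = 0) {t : ℝ} (ht : t < 0) : f (Y.flow t y) < 0 :=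
  neg_of_deriv_pos_at_zeros (hasDerivAt_flow hf.smooth y) (by rw [Y.isFlow.zero, hy])
    (fun _ h => hf.pos _ h) ht

lemma interior_eq : interior K = {x | f x < 0} := by
  apply Subset.antisymm
  · intro x hx
    have hxK : f x ≤ 0 := by have := interior_subset hx; rwa [hf.eq] at this
    refine lt_of_le_of_ne hxK fun h0 => ?_
    have hc : ContinuousAt (fun t => Y.flow t x) 0 := (Y.isFlow.contMDiff_time x).continuous.continuousAt
    have h1 : ∀ᶠ t in 𝓝 (0 : ℝ), Y.flow t x ∈ interior K :=
      hc.eventually (isOpen_interior.mem_nhds (by simpa [Y.isFlow.zero] using hx))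
    obtain ⟨ε, hε, hB⟩ := Metric.eventually_nhds_iff.1 h1
    have h2 := hB (y := ε / 2) (by rw [Real.dist_eq, sub_zero, abs_of_pos (half_pos hε)]; linarith)
    have h3 := interior_subset h2
    rw [hf.eq] at h3
    exact absurd (hf.pos_flow h0 (half_pos hε)) (not_lt.2 h3)
  · refine interior_maximal ?_ (isOpen_lt hf.smooth.continuous continuous_const)
    rw [hf.eq]
    intro x hx
    simp only [mem_ofPred_eq] at hx ⊢
    exact hx.le

lemma frontier_eq : frontier K = {x | f x = 0} := by
  have hcl : IsClosed K := by
    rw [hf.eq]; exact isClosed_le hf.smooth.continuous continuous_const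
  rw [hcl.frontier_eq, hf.interior_eq]
  ext x
  rw [hf.eq]
  simp only [Set.mem_sdiff, mem_ofPred_eq, not_lt]
  constructor
  · rintro ⟨h1, h2⟩; exact le_antisymm h1 h2
  · intro h; simp [h]

lemma time_unique {x : W} {s t : ℝ} (hs : Y.flow s x ∈ frontier K) (ht : Y.flow t x ∈ frontier K) :
    s = t := by
  rw [hf.frontier_eq] at hs ht
  by_contra hne
  wlog h : s < t generalizing s t
  · exact this ht hs (Ne.symm hne) (lt_of_le_of_ne (not_lt.1 h) (Ne.symm hne))
  have h1 := hf.pos_flow hs (sub_pos.2 h)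
  rw [← Y.isFlow.add, sub_add_cancel] at h1
  exact h1.ne' ht

lemma logr_eq {x : W} {t : ℝ} (h : Y.flow (-t) x ∈ frontier K) : Y.logr K x = t := by
  have hex : ∃ t : ℝ, Y.flow t x ∈ frontier K := ⟨-t, h⟩
  simp only [logr, dif_pos hex]
  have := hf.time_unique hex.choose_spec h
  linarith

lemma logr_flow {y : W} (hy : y ∈ frontier K) (t : ℝ) : Y.logr K (Y.flow t y) = t :=
  hf.logr_eq (by rwa [Y.isFlow.neg_cancel])

lemma flow_neg_logr {x : W} (hx : x ∈ Y.collar K) : Y.flow (-Y.logr K x) x ∈ frontier K := by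
  obtain ⟨t, ht⟩ := hx
  have := hf.logr_eq (x := x) (t := -t) (by simpa using ht)
  rw [this, neg_neg]; exact ht

lemma logr_flow_collar {x : W} (hx : x ∈ Y.collar K) (s : ℝ) :
    Y.logr K (Y.flow s x) = Y.logr K x + s := by
  apply hf.logr_eq
  rw [← Y.isFlow.add]
  simpa using hf.flow_neg_logr hx

lemma f_neg_iff {x : W} (hx : x ∈ Y.collar K) : f x < 0 ↔ Y.logr K x < 0 := by
  have h := hf.flow_neg_logr hx
  rw [hf.frontier_eq] at h
  have hx' : Y.flow (Y.logr K x) (Y.flow (-Y.logr K x) x) = x := Y.isFlow.cancel_neg _ _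
  constructor
  · intro h1
    by_contra h2
    rcases (not_lt.1 h2).eq_or_lt with h3 | h3
    · rw [← h3] at h; simp [Y.isFlow.zero] at h; exact h1.ne h
    · have := hf.pos_flow h h3
      rw [hx'] at this; exact lt_asymm h1 this
  · intro h1
    have := hf.neg_flow h h1
    rwa [hx'] at this

lemma f_pos_iff {x : W} (hx : x ∈ Y.collar K) : 0 < f x ↔ 0 < Y.logr K x := by
  have h := hf.flow_neg_logr hx
  rw [hf.frontier_eq] at h
  have hx' : Y.flow (Y.logr K x) (Y.flow (-Y.logr K x) x) = x := Y.isFlow.cancel_neg _ _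
  constructor
  · intro h1
    by_contra h2
    rcases (not_lt.1 h2).eq_or_lt with h3 | h3
    · rw [h3] at h; simp [Y.isFlow.zero] at h; exact h1.ne' h
    · have := hf.neg_flow h h3
      rw [hx'] at this; exact lt_asymm h1 this
  · intro h1
    have := hf.pos_flow h h1
    rwa [hx'] at this

/-- The crossing time with the boundary is a smooth function: this is the implicit function theorem
for `f(flow (-t) x) = 0`. -/
lemma exists_local_time {x : W} {t : ℝ} (h : f (Y.flow (-t) x) = 0) :
    ∃ τ : W → ℝ, ContMDiffAt 𝓘(ℝ, E) 𝓘(ℝ, ℝ) ∞ τ x ∧ ∀ᶠ y in 𝓝 x, f (Y.flow (-τ y) y) = 0 := by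
  set φ := extChartAt 𝓘(ℝ, E) x
  set F : E × ℝ → ℝ := fun p => f (Y.flow (-p.2) (φ.symm p.1)) with hF
  have hx : x ∈ φ.source := mem_extChartAt_source (I := 𝓘(ℝ, E)) x
  have hs : ContMDiffAt 𝓘(ℝ, E) 𝓘(ℝ, E) ∞ (φ.symm : E → W) (φ x) :=
    (contMDiffOn_extChartAt_symm x).contMDiffAt (extChartAt_target_mem_nhds x)
  have hFs : ContDiffAt ℝ ∞ F (φ x, t) := by
    rw [← contMDiffAt_iff_contDiffAt]
    refine hf.smooth.contMDiffAt.comp (φ x, t)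
      (Y.isFlow.smooth.contMDiffAt.comp (φ x, t) (ContMDiffAt.prodMk ?_ ?_))
    · exact contDiff_snd.neg.contMDiff.contMDiffAt
    · exact ContMDiffAt.comp (φ x, t) hs contDiff_fst.contMDiff.contMDiffAt
  -- the Liouville field is transverse to `{f = 0}`, so the implicit function theorem applies
  have hd : HasDerivAt (fun s => F (φ x, s)) (-df f (Y.flow (-t) x) (vv Y.Z (Y.flow (-t) x))) t := by
    have h1 := (hasDerivAt_flow (Y := Y) hf.smooth x (-t)).comp t (hasDerivAt_neg t)
    simp only [hF, φ.left_inv hx]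
    simpa [Function.comp_def] using h1
  have hinv : (fderiv ℝ F (φ x, t) ∘L ContinuousLinearMap.inr ℝ E ℝ).IsInvertible := by
    have h1 := (hFs.differentiableAt (by simp)).hasFDerivAt.comp_hasDerivAt t
      ((hasDerivAt_const t (φ x)).prodMk (hasDerivAt_id t))
    have h2 : fderiv ℝ F (φ x, t) (0, 1) = -df f (Y.flow (-t) x) (vv Y.Z (Y.flow (-t) x)) :=
      h1.unique hd
    have hne : fderiv ℝ F (φ x, t) (0, 1) ≠ 0 := by
      rw [h2]; exact neg_ne_zero.2 (hf.pos _ h).ne'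
    refine ⟨ContinuousLinearEquiv.unitsEquivAut ℝ (Units.mk0 _ hne), ?_⟩
    ext
    simp
  refine ⟨fun y => hFs.implicitFunction (by simp) hinv (φ y), ?_, ?_⟩
  · exact ContMDiffAt.comp x (hFs.contDiffAt_implicitFunction (by simp) hinv).contMDiffAt
      (contMDiffAt_extChartAt)
  · have h1 := hFs.eventually_apply_implicitFunction (by simp) hinv
    have h2 := (continuousAt_extChartAt (I := 𝓘(ℝ, E)) x).eventually h1
    filter_upwards [h2, (isOpen_extChartAt_source (I := 𝓘(ℝ, E)) x).mem_nhds hx] with y hy hys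
    simp only [hF] at hy
    rw [φ.left_inv hys, φ.left_inv hx, h] at hy
    exact hy

lemma isOpen_collar : IsOpen (Y.collar K) := by
  rw [isOpen_iff_mem_nhds]
  rintro x ⟨t, ht⟩
  rw [hf.frontier_eq] at ht
  obtain ⟨τ, -, h⟩ := hf.exists_local_time (x := x) (t := -t) (by simpa using ht)
  filter_upwards [h] with y hy
  exact ⟨-τ y, by rw [hf.frontier_eq]; exact hy⟩

lemma contMDiffAt_logr {x : W} (hx : x ∈ Y.collar K) :
    ContMDiffAt 𝓘(ℝ, E) 𝓘(ℝ, ℝ) ∞ (Y.logr K) x := by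
  obtain ⟨t, ht⟩ := hx
  rw [hf.frontier_eq] at ht
  obtain ⟨τ, hτ, h⟩ := hf.exists_local_time (x := x) (t := -t) (by simpa using ht)
  refine hτ.congr_of_eventuallyEq ?_
  filter_upwards [h] with y hy
  exact hf.logr_eq (by rw [hf.frontier_eq]; exact hy)

lemma mdiff_logr {x : W} (hx : x ∈ Y.collar K) :
    MDifferentiableAt 𝓘(ℝ, E) 𝓘(ℝ, ℝ) (Y.logr K) x :=
  (hf.contMDiffAt_logr hx).mdifferentiableAt (by simp)

lemma frontier_subset_collar : frontier K ⊆ Y.collar K := fun x hx => ⟨0, by rwa [Y.isFlow.zero]⟩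

lemma logr_frontier {y : W} (hy : y ∈ frontier K) : Y.logr K y = 0 :=
  hf.logr_eq (by rwa [neg_zero, Y.isFlow.zero])

lemma mem_frontier_iff {x : W} (hx : x ∈ Y.collar K) : x ∈ frontier K ↔ Y.logr K x = 0 := by
  refine ⟨hf.logr_frontier, fun h => ?_⟩
  have := hf.flow_neg_logr hx
  rwa [h, neg_zero, Y.isFlow.zero] at this

lemma flow_mem_collar {x : W} (hx : x ∈ Y.collar K) (s : ℝ) : Y.flow s x ∈ Y.collar K := by
  obtain ⟨t, ht⟩ := hx
  exact ⟨t - s, by rwa [← Y.isFlow.add, sub_add_cancel]⟩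

lemma df_logr_Z {x : W} (hx : x ∈ Y.collar K) : df (Y.logr K) x (vv Y.Z x) = 1 := by
  have h1 := Y.isFlow.hasDerivAt_comp (f := Y.logr K) (x := x) (t := 0)
    (by rw [Y.isFlow.zero]; exact hf.mdiff_logr hx)
  rw [Y.isFlow.zero] at h1
  have h2 : (fun t => Y.logr K (Y.flow t x)) = fun t => Y.logr K x + t :=
    funext fun t => hf.logr_flow_collar hx t
  rw [h2] at h1
  exact h1.unique ((hasDerivAt_id (0 : ℝ)).const_add _)

lemma df_logr_flow {x : W} (hx : x ∈ Y.collar K) (s : ℝ) (v : E) :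
    df (Y.logr K) (Y.flow s x) (dd (Y.flow s) x v) = df (Y.logr K) x v := by
  rw [← df_comp (Y.mdiff_flow s x) (hf.mdiff_logr (hf.flow_mem_collar hx s))]
  have h : (fun x => Y.logr K (Y.flow s x)) =ᶠ[𝓝 x] fun x => Y.logr K x + s := by
    filter_upwards [hf.isOpen_collar.mem_nhds hx] with y hy
    exact hf.logr_flow_collar hy s
  rw [df_congr h]
  have := mfderiv_add (hf.mdiff_logr hx) (mdifferentiableAt_const (c := s) (x := x) (I := 𝓘(ℝ, E)))
  have h3 : df (E := E) (fun x => Y.logr K x + s) x = df (Y.logr K) x + (0 : E →L[ℝ] ℝ) := by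
    refine this.trans ?_
    exact congrArg (fun L : E →L[ℝ] ℝ => df (Y.logr K) x + L)
      (mfderiv_const (c := s) (x := x) (I := 𝓘(ℝ, E)) (I' := 𝓘(ℝ, ℝ)))
  rw [h3, add_zero]

/-- Tangent vectors to the boundary are those which are annihilated by the differential of the
radial coordinate. -/
lemma mem_tangentTo_frontier_iff {y : W} (hy : y ∈ frontier K) (v : E) :
    v ∈ tangentTo (E := E) (frontier K) y ↔ df (Y.logr K) y v = 0 := by
  have hyc := hf.frontier_subset_collar hy
  constructor
  · rw [tangentTo_iff]
    rintro ⟨c, hc, hA, h0, hv⟩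
    have h1 := fderivWithin_comp_vel (E := E) (f := Y.logr K) (u := c) (s := univ) (z := 0)
      (by rw [h0]; exact hf.mdiff_logr hyc) uniqueDiffWithinAt_univ (vel_global_mdiff hc 0) 1
    have h2 : (fun t => Y.logr K (c t)) = fun _ => 0 := funext fun t => hf.logr_frontier (hA t)
    rw [h2, hv, h0] at h1
    simpa using h1.symm
  · intro hv
    obtain ⟨c, hc, h0, hcv⟩ := exists_curve y v
    have hcont : ∀ᶠ t in 𝓝 (0 : ℝ), c t ∈ Y.collar K :=
      hc.continuous.continuousAt.eventually (hf.isOpen_collar.mem_nhds (by rwa [h0]))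
    obtain ⟨ε, hε, hB⟩ := Metric.eventually_nhds_iff.1 hcont
    have hB' : ∀ t ∈ Ioo (-ε) ε, c t ∈ Y.collar K := fun t ht => hB (by
      rw [Real.dist_eq, sub_zero]; exact abs_lt.2 ht)
    have hτ : ContDiffOn ℝ ∞ (fun t => -Y.logr K (c t)) (Ioo (-ε) ε) := by
      intro t ht
      refine ContDiffAt.contDiffWithinAt (ContDiffAt.neg ?_)
      rw [← contMDiffAt_iff_contDiffAt]
      exact (hf.contMDiffAt_logr (hB' t ht)).comp t hc.contMDiffAt
    have h0m : (0 : ℝ) ∈ Ioo (-ε) ε := ⟨by linarith, hε⟩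
    refine vel_mem_tangentTo hε (c := fun t => Y.flow (-Y.logr K (c t)) (c t))
      (contMDiff_prodSpace Y.isFlow hτ hc.contMDiffOn)
      (fun t ht => hf.flow_neg_logr (hB' t ht))
      (by simp [h0, hf.logr_frontier hy, Y.isFlow.zero]) ?_
    -- the velocity is computed from the map `(s, t) ↦ flow s (c t)` along the graph of `-logr`
    set u : ℝ × ℝ → W := fun p => Y.flow p.1 (c p.2) with hu
    have hus : ContMDiff 𝓘(ℝ, ℝ × ℝ) 𝓘(ℝ, E) ∞ u :=
      Y.isFlow.smooth.comp (contDiff_fst.contMDiff.prodMk (hc.comp contDiff_snd.contMDiff))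
    have hτd : HasDerivAt (fun t => -Y.logr K (c t)) 0 0 := by
      have h1 := fderivWithin_comp_vel (E := E) (f := Y.logr K) (u := c) (s := univ) (z := 0)
        (by rw [h0]; exact hf.mdiff_logr hyc) uniqueDiffWithinAt_univ (vel_global_mdiff hc 0) 1
      rw [hcv, h0, hv, fderivWithin_univ, fderiv_apply_one_eq_deriv] at h1
      have h2 : DifferentiableAt ℝ (fun t => -Y.logr K (c t)) 0 :=
        (hτ.contDiffAt (Ioo_mem_nhds h0m.1 h0m.2)).differentiableAt (by simp)
      have h3 := h2.hasDerivAt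
      rw [deriv.fun_neg, h1, neg_zero] at h3
      exact h3
    have hg := hτd.prodMk (hasDerivAt_id (0 : ℝ))
    have h := vel_comp (u := u) (g := fun t : ℝ => (-Y.logr K (c t), id t)) (s := univ) (t := univ)
      (q := 0) (vel_global_mdiff hus _) hg.differentiableAt.differentiableWithinAt (mapsTo_univ _ _)
      uniqueDiffWithinAt_univ 1
    rw [fderivWithin_univ, fderiv_apply_one_eq_deriv, hg.deriv] at h
    refine h.trans ?_
    have hi : HasDerivAt (fun s : ℝ => ((0 : ℝ), s)) ((0 : ℝ), (1 : ℝ)) 0 :=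
      (hasDerivAt_const (0 : ℝ) (0 : ℝ)).prodMk (hasDerivAt_id (0 : ℝ))
    have h2 := vel_comp (u := u) (g := fun s : ℝ => ((0 : ℝ), s)) (s := univ) (t := univ) (q := 0)
      (vel_global_mdiff hus _) hi.differentiableAt.differentiableWithinAt (mapsTo_univ _ _)
      uniqueDiffWithinAt_univ 1
    rw [fderivWithin_univ, fderiv_apply_one_eq_deriv, hi.deriv] at h2
    have h3 : (fun q : ℝ => u (0, q)) = c := by funext q; simp [hu, Y.isFlow.zero]
    rw [h3, hcv] at h2
    rw [h2]
    simp [h0, hf.logr_frontier hy]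

lemma isClosed : IsClosed K := by
  rw [hf.eq]; exact isClosed_le hf.smooth.continuous continuous_const

lemma flow_mem_interior {y : W} (hy : y ∈ frontier K) {t : ℝ} (ht : t < 0) :
    Y.flow t y ∈ interior K := by
  rw [hf.interior_eq]; rw [hf.frontier_eq] at hy
  exact hf.neg_flow hy ht

/-- Backward flow lines of the Liouville field do not leave a Liouville domain. -/
lemma flow_mem_of_nonpos {x : W} (hx : x ∈ K) {t : ℝ} (ht : t ≤ 0) : Y.flow t x ∈ K := by
  by_contra h
  have h1 : 0 < f (Y.flow t x) := by rw [hf.eq] at h; exact not_le.1 h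
  have h2 : f x ≤ 0 := by rw [hf.eq] at hx; exact hx
  have hc : Continuous fun s => f (Y.flow s x) :=
    hf.smooth.continuous.comp (Y.isFlow.contMDiff_time x).continuous
  obtain ⟨s, hs, hs0⟩ := intermediate_value_Icc' ht hc.continuousOn
    (show (0 : ℝ) ∈ Icc _ _ from ⟨by simpa [Y.isFlow.zero] using h2, h1.le⟩)
  rcases hs.1.eq_or_lt with h3 | h3
  · rw [← h3] at hs0; exact h1.ne' hs0
  · have h4 := hf.neg_flow hs0 (sub_neg.2 h3)
    rw [← Y.isFlow.add, sub_add_cancel] at h4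
    exact lt_asymm h1 h4

end IsDefining

end LiouvilleManifold

end Collar

/-! ### Chords and the boundaries of the domains -/

lemma exists_mem_frontier {X : Type*} [TopologicalSpace X] {P s : Set X} (hP : IsPreconnected P)
    (h1 : (P ∩ s).Nonempty) (h2 : (P ∩ sᶜ).Nonempty) : (P ∩ frontier s).Nonempty := by
  -- Rolle's theorem along that segment contradicts `dH(Z) > 0`.
  by_contra hne
  have hcov : P ⊆ interior s ∪ interior sᶜ := by
    intro p hp
    by_contra h
    refine hne ⟨p, hp, ?_⟩
    rw [frontier_eq_closure_inter_closure, closure_eq_compl_interior_compl,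
      closure_eq_compl_interior_compl, compl_compl]
    exact ⟨fun h' => h (Or.inr h'), fun h' => h (Or.inl h')⟩
  obtain ⟨p, hp, hps⟩ := h1
  obtain ⟨q, hq, hqs⟩ := h2
  obtain ⟨r, -, hr1, hr2⟩ := hP _ _ isOpen_interior isOpen_interior hcov
    ⟨p, hp, (hcov hp).resolve_right fun h => interior_subset h hps⟩
    ⟨q, hq, (hcov hq).resolve_left fun h => hqs (interior_subset h)⟩
  exact interior_subset hr2 (interior_subset hr1)

section Chords

variable {E : Type*} [NormedAddCommGroup E] [NormedSpace ℝ E]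
variable {W : Type*} [TopologicalSpace W] [ChartedSpace E W] [IsManifold 𝓘(ℝ, E) ∞ W]

lemma df_eq_fderiv_chart {f : W → ℝ} {x₀ x : W} (hx : x ∈ (extChartAt 𝓘(ℝ, E) x₀).source)
    (hf : MDifferentiableAt 𝓘(ℝ, E) 𝓘(ℝ, ℝ) f x) (v : E) :
    df f x v = fderiv ℝ (fun p => f ((extChartAt 𝓘(ℝ, E) x₀).symm p))
      (extChartAt 𝓘(ℝ, E) x₀ x) (cv x₀ x v) := by
  set φ := extChartAt 𝓘(ℝ, E) x₀
  have h1 : MDifferentiableAt 𝓘(ℝ, E) 𝓘(ℝ, E) (φ.symm : E → W) (φ x) :=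
    ((contMDiffOn_extChartAt_symm (n := ∞) x₀).contMDiffAt
      (extChartAt_target_mem_nhds' (φ.map_source hx))).mdifferentiableAt (by simp)
  have h2 : MDifferentiableAt 𝓘(ℝ, E) 𝓘(ℝ, ℝ) (fun p => f (φ.symm p)) (φ x) := by
    refine MDifferentiableAt.comp (φ x) ?_ h1
    rwa [φ.left_inv hx]
  have h3 : MDifferentiableAt 𝓘(ℝ, E) 𝓘(ℝ, E) φ x := mdifferentiableAt_extChartAt (by simpa [φ] using hx)
  have h4 := mfderiv_comp x h2 h3
  have h5 : ((fun p => f (φ.symm p)) ∘ φ) =ᶠ[𝓝 x] f := by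
    filter_upwards [(isOpen_extChartAt_source (I := 𝓘(ℝ, E)) x₀).mem_nhds hx] with y hy
    exact congrArg f (φ.left_inv hy)
  have h6 : df (E := E) ((fun p => f (φ.symm p)) ∘ φ) x = df f x := df_congr h5
  rw [← h6]
  rw [mfderiv_eq_fderiv] at h4
  exact congrArg (fun L : E →L[ℝ] ℝ => L v) h4

/-- The derivative of a smooth function in the direction of the generator of a flow is smooth. -/
lemma IsFlow.contMDiff_df {V : VField E W} {Φ : ℝ → W → W} (h : IsFlow V Φ) {f : W → ℝ}
    (hf : ContMDiff 𝓘(ℝ, E) 𝓘(ℝ, ℝ) ∞ f) :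
    ContMDiff 𝓘(ℝ, E) 𝓘(ℝ, ℝ) ∞ (fun x => df f x (vv V x)) := by
  intro x
  set φ := extChartAt 𝓘(ℝ, E) x
  have hx : x ∈ φ.source := mem_extChartAt_source (I := 𝓘(ℝ, E)) x
  have h1 : ContMDiffAt 𝓘(ℝ, E) 𝓘(ℝ, E) ∞ (φ.symm : E → W) (φ x) :=
    (contMDiffOn_extChartAt_symm (n := ∞) x).contMDiffAt (extChartAt_target_mem_nhds x)
  have h2 : ContDiffAt ℝ ∞ (fun p => f (φ.symm p)) (φ x) := by
    rw [← contMDiffAt_iff_contDiffAt]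
    exact hf.contMDiffAt.comp (φ x) h1
  have h3 : ContMDiffAt 𝓘(ℝ, E) 𝓘(ℝ, E →L[ℝ] ℝ) ∞
      (fun y => fderiv ℝ (fun p => f (φ.symm p)) (φ y)) x :=
    ContMDiffAt.comp x (h2.fderiv_right (m := ∞) (by simp)).contMDiffAt contMDiffAt_extChartAt
  have h4 := h3.clm_apply (h.contMDiffAt_cv x x hx)
  refine h4.congr_of_eventuallyEq ?_
  filter_upwards [(isOpen_extChartAt_source (I := 𝓘(ℝ, E)) x).mem_nhds hx] with y hy
  exact df_eq_fderiv_chart hy (hf.contMDiffAt.mdifferentiableAt (by simp)) _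

variable [FiniteDimensional ℝ E] [T2Space W]

namespace LiouvilleManifold

variable {Y : LiouvilleManifold E W} {K : Set W} {f : W → ℝ}

/-- `H` is normalized along the boundary of `K`: to first order it agrees there with the radial
coordinate. -/
def Normalized (Y : LiouvilleManifold E W) (K : Set W) (H : W → ℝ) : Prop :=
  ∀ y ∈ frontier K, H y = 1 ∧ df H y (vv Y.Z y) = 1

variable {H : W → ℝ}

/-- Along the boundary, `dH` agrees with the differential of the radial coordinate: both vanish on the
tangent space of the boundary and take the value `1` on `Z`. -/
lemma Normalized.df_eq (hf : Y.IsDefining K f) (hH : ContMDiff 𝓘(ℝ, E) 𝓘(ℝ, ℝ) ∞ H)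
    (hn : Y.Normalized K H) {y : W} (hy : y ∈ frontier K) (v : E) :
    df H y v = df (Y.logr K) y v := by
  have hyc := hf.frontier_subset_collar hy
  have h0 : ∀ v : E, v ∈ tangentTo (E := E) (frontier K) y → df H y v = 0 := by
    intro v hv
    obtain ⟨c, hc, hA, h0, hv⟩ := (tangentTo_iff (E := E)).1 hv
    have h1 := fderivWithin_comp_vel (E := E) (f := H) (u := c) (s := univ) (z := 0)
      (hH.contMDiffAt.mdifferentiableAt (by simp)) uniqueDiffWithinAt_univ (vel_global_mdiff hc 0) 1
    have h2 : (fun t => H (c t)) = fun _ => 1 := funext fun t => (hn _ (hA t)).1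
    rw [h2, hv, h0] at h1
    simpa using h1.symm
  have h1 := h0 (v - df (Y.logr K) y v • vv Y.Z y) ((hf.mem_tangentTo_frontier_iff hy _).2 (by
    rw [map_sub, map_smul, hf.df_logr_Z hyc]; simp))
  rw [map_sub, map_smul, (hn y hy).2] at h1
  simpa [sub_eq_zero] using h1

/-- Near the boundary the level set `H = 1` consists of boundary points only, since `H` increases
along the Liouville flow. -/
lemma Normalized.eventually_mem_frontier (hf : Y.IsDefining K f)
    (hH : ContMDiff 𝓘(ℝ, E) 𝓘(ℝ, ℝ) ∞ H) (hn : Y.Normalized K H) {y : W} (hy : y ∈ frontier K) :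
    ∀ᶠ x in 𝓝 y, H x = 1 → x ∈ frontier K := by
  have hyc := hf.frontier_subset_collar hy
  have hO : IsOpen {x | 0 < df H x (vv Y.Z x)} :=
    isOpen_lt continuous_const (Y.isFlow.contMDiff_df hH).continuous
  have h1 : ∀ τ ∈ Icc (0 : ℝ) 1, ∀ᶠ p : W × ℝ in 𝓝 (y, τ),
      Y.flow (-(p.2 * Y.logr K p.1)) p.1 ∈ {x | 0 < df H x (vv Y.Z x)} := by
    intro τ _
    have hc : ContinuousAt (fun p : W × ℝ => Y.flow (-(p.2 * Y.logr K p.1)) p.1) (y, τ) := by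
      have hl : ContinuousAt (Y.logr K) y := (hf.contMDiffAt_logr hyc).continuousAt
      have hl' : ContinuousAt (fun p : W × ℝ => Y.logr K p.1) (y, τ) :=
        ContinuousAt.comp (f := Prod.fst) (x := (y, τ)) hl continuousAt_fst
      exact Y.isFlow.continuous.continuousAt.comp
        (f := fun p : W × ℝ => (-(p.2 * Y.logr K p.1), p.1))
        ((continuousAt_snd.mul hl').neg.prodMk continuousAt_fst)
    refine hc.eventually (hO.mem_nhds ?_)
    simp [hf.logr_frontier hy, Y.isFlow.zero, (hn y hy).2]
  -- The whole flow segment between `x` and its projection to the boundary lies where `dH(Z) > 0`.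
  have h2 := isCompact_Icc.eventually_forall_of_forall_eventually
    (P := fun x τ => Y.flow (-(τ * Y.logr K x)) x ∈ {x | 0 < df H x (vv Y.Z x)}) h1
  filter_upwards [h2, hf.isOpen_collar.mem_nhds hyc] with x hx hxc hHx
  rw [hf.mem_frontier_iff hxc]
  by_contra hne
  have hd : ∀ τ : ℝ, HasDerivAt (fun τ => H (Y.flow (-(τ * Y.logr K x)) x))
      (df H (Y.flow (-(τ * Y.logr K x)) x) (vv Y.Z (Y.flow (-(τ * Y.logr K x)) x)) *
        -(Y.logr K x)) τ := by
    intro τ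
    have h3 := (hasDerivAt_flow (Y := Y) hH x (-(τ * Y.logr K x))).comp τ
      (((hasDerivAt_id τ).mul_const (Y.logr K x)).neg)
    simpa [Function.comp_def] using h3
  obtain ⟨τ, hτ, h0⟩ := exists_hasDerivAt_eq_zero (a := 0) (b := 1) one_pos
    (fun τ _ => (hd τ).continuousAt.continuousWithinAt)
    (by simpa [Y.isFlow.zero, hHx] using (hn _ (hf.flow_neg_logr hxc)).1.symm) (fun τ _ => hd τ)
  have := hx τ ⟨hτ.1.le, hτ.2.le⟩
  rcases mul_eq_zero.1 h0 with h | h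
  · exact this.ne' h
  · exact hne (neg_eq_zero.1 h)

/-- A connected subset of a level set of `H` which comes sufficiently close to the boundary has to
stay close to it. -/
lemma Normalized.exists_trap (hf : Y.IsDefining K f)
    (hH : ContMDiff 𝓘(ℝ, E) 𝓘(ℝ, ℝ) ∞ H) (hn : Y.Normalized K H) (hK : IsCompact K)
    {N : Set W} (hN : IsOpen N) (hKN : frontier K ⊆ N) :
    ∃ N' : Set W, IsOpen N' ∧ frontier K ⊆ N' ∧ ∀ P : Set W, IsPreconnected P →
      (∀ p ∈ P, ∀ q ∈ P, H p = H q) → (P ∩ N').Nonempty → P ⊆ N := by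
  have : LocallyCompactSpace W := Manifold.locallyCompact_of_finiteDimensional 𝓘(ℝ, E)
  set N₀ := interior {x | H x = 1 → x ∈ frontier K}
  have hKN₀ : frontier K ⊆ N₀ := fun y hy =>
    mem_interior_iff_mem_nhds.2 (hn.eventually_mem_frontier hf hH hy)
  have hKc : IsCompact (frontier K) := hK.of_isClosed_subset isClosed_frontier
    hK.isClosed.frontier_subset
  -- On the boundary of a small neighbourhood `N₁` of `∂K`, `H ≠ 1`, so `|H - 1|` has a positive lower
  -- bound `m`. A level set with `|H - 1| < m` cannot cross that boundary.
  obtain ⟨N₁, hN₁, hKN₁, hN₁s, hN₁c⟩ := exists_open_between_and_isCompact_closure hKc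
    (hN.inter isOpen_interior) (subset_inter hKN hKN₀)
  have hfc : IsCompact (frontier N₁) := hN₁c.of_isClosed_subset isClosed_frontier
    frontier_subset_closure
  have hpos : ∀ x ∈ frontier N₁, 0 < |H x - 1| := by
    intro x hx
    rw [abs_pos, sub_ne_zero]
    intro h1
    have h2 := hN₁s (frontier_subset_closure hx)
    have h3 := interior_subset h2.2
    simp only [mem_ofPred_eq] at h3
    have h4 := hKN₁ (h3 h1)
    rw [hN₁.frontier_eq] at hx
    exact hx.2 h4
  obtain ⟨m, hm, hmin⟩ : ∃ m > 0, ∀ x ∈ frontier N₁, m ≤ |H x - 1| := by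
    rcases (frontier N₁).eq_empty_or_nonempty with h | h
    · exact ⟨1, one_pos, by simp [h]⟩
    · obtain ⟨x, hx, hxm⟩ := hfc.exists_isMinOn h
        ((hH.continuous.sub continuous_const).abs.continuousOn)
      exact ⟨_, hpos x hx, fun z hz => hxm hz⟩
  refine ⟨N₁ ∩ {x | |H x - 1| < m}, hN₁.inter
    (isOpen_lt (hH.continuous.sub continuous_const).abs continuous_const), ?_, ?_⟩
  · intro y hy
    refine ⟨hKN₁ hy, ?_⟩
    simp [(hn y hy).1, hm]
  · rintro P hP hconst ⟨p, hpP, hpN, hpm⟩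
    have hPN : P ⊆ N₁ := by
      by_contra hnot
      obtain ⟨q, hqP, hqN⟩ := not_subset.1 hnot
      obtain ⟨r, hrP, hr⟩ := exists_mem_frontier hP ⟨p, hpP, hpN⟩ ⟨q, hqP, hqN⟩
      have h1 := hmin r hr
      rw [hconst r hrP p hpP] at h1
      exact absurd h1 (not_le.2 hpm)
    exact fun q hq => (hN₁s (subset_closure (hPN hq))).1

/-- Along the boundary of `K` the Hamiltonian field is the Reeb field. -/
lemma Normalized.isReeb (hf : Y.IsDefining K f) (hH : ContMDiff 𝓘(ℝ, E) 𝓘(ℝ, ℝ) ∞ H)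
    (hn : Y.Normalized K H) {y : W} (hy : y ∈ frontier K) : Y.IsReeb K y (Y.X H y) := by
  refine ⟨?_, ?_, ?_⟩
  · refine (hf.mem_tangentTo_frontier_iff hy (vv (Y.X H) y)).2 ?_
    rw [← hn.df_eq hf hH hy, df_X]
  · exact (Y.fm_X H y).trans (hn y hy).2
  · intro v hv
    have h1 := (hf.mem_tangentTo_frontier_iff hy v).1 hv
    refine (Y.om_X H y v).trans ?_
    have h2 := hn.df_eq hf hH hy v
    exact neg_eq_zero.2 (h2.trans h1)

end LiouvilleManifold

namespace TargetData

open LiouvilleManifold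

variable {Y : LiouvilleManifold E W} (V : TargetData Y)

lemma hasDerivAt_ψ {f : W → ℝ} (hf : ContMDiff 𝓘(ℝ, E) 𝓘(ℝ, ℝ) ∞ f) (y : W) :
    HasDerivAt (fun r => f (Y.ψ r y)) (df f y (vv Y.Z y)) 1 := by
  have h1 := (hasDerivAt_flow (Y := Y) hf y (Real.log 1)).comp 1 (Real.hasDerivAt_log one_ne_zero)
  simpa [Y.isFlow.zero, Function.comp_def, ψ] using h1

lemma ψ_one (y : W) : Y.ψ 1 y = y := by simp [ψ, Y.isFlow.zero]

lemma normalized_Min : Y.Normalized V.Min V.H := by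
  intro y hy
  have h0 := V.H_dividing y hy 0
  have h1 := V.H_dividing y hy 1
  rw [iteratedDeriv_zero, ψ_one] at h0
  have hd := (hasDerivAt_ψ (Y := Y) V.smooth_H y).sub (hasDerivAt_id (1 : ℝ))
  rw [iteratedDeriv_one] at h1
  have h2 := hd.deriv.symm.trans h1
  exact ⟨by linarith, by linarith⟩

lemma normalized_M : Y.Normalized V.M V.H := by
  intro y hy
  have h0 := V.H_cone y hy 1 le_rfl
  rw [ψ_one] at h0
  have hd := ((hasDerivAt_ψ (Y := Y) V.smooth_H y).hasDerivWithinAt (s := Ici 1)).congr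
    (f₁ := fun r => r) (fun r hr => (V.H_cone y hy r hr).symm) (by rw [ψ_one, h0])
  exact ⟨h0, (uniqueDiffWithinAt_Ici (1 : ℝ)).eq_deriv _ hd (hasDerivWithinAt_id _ _)⟩

lemma normalized {K : Set W} (hK : K ∈ ({V.M, V.Min} : Set (Set W))) : Y.Normalized K V.H := by
  rcases hK with rfl | rfl
  · exact V.normalized_M
  · exact V.normalized_Min

lemma isDomain {K : Set W} (hK : K ∈ ({V.M, V.Min} : Set (Set W))) : Y.IsDomain K := by
  rcases hK with rfl | rfl
  · exact V.domain_M
  · exact V.domain_Min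

variable {V} {w : ℕ} {x : ℝ → W}

lemma IsChord.continuousOn (hx : V.IsChord w x) : ContinuousOn x (Icc 0 1) :=
  hx.curve.continuousOn

lemma IsChord.vel (hx : V.IsChord w x) {t : ℝ} (ht : t ∈ Icc (0 : ℝ) 1) :
    Viterbo.vel x (Icc 0 1) t 1 = (w : ℝ) • vv (Y.X V.H) (x t) := by
  have h1 := (hx.curve t ht).mfderivWithin ((uniqueDiffOn_Icc zero_lt_one t ht).uniqueMDiffWithinAt)
  refine (congrArg (fun L : ℝ →L[ℝ] E => L 1) h1).trans ?_
  exact one_smul ℝ _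

lemma IsChord.H_const (hx : V.IsChord w x) {t : ℝ} (ht : t ∈ Icc (0 : ℝ) 1) :
    V.H (x t) = V.H (x 0) := by
  have hm : ∀ t ∈ Icc (0 : ℝ) 1, MDifferentiableAt 𝓘(ℝ, E) 𝓘(ℝ, ℝ) V.H (x t) := fun t _ =>
    V.smooth_H.contMDiffAt.mdifferentiableAt (by simp)
  have hd : ∀ t ∈ Icc (0 : ℝ) 1, DifferentiableWithinAt ℝ (fun t => V.H (x t)) (Icc 0 1) t :=
    fun t ht => (((hm t ht).comp_mdifferentiableWithinAt t
      (hx.curve t ht).mdifferentiableWithinAt)).differentiableWithinAt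
  refine constant_of_derivWithin_zero (f := fun t => V.H (x t)) hd (fun t ht => ?_) t ht
  have ht' : t ∈ Icc (0 : ℝ) 1 := Ico_subset_Icc_self ht
  have h1 := fderivWithin_comp_vel (E := E) (f := V.H) (u := x) (hm t ht')
    (uniqueDiffOn_Icc zero_lt_one t ht') (hx.curve t ht').mdifferentiableWithinAt 1
  rw [hx.vel ht', map_smul, df_X, smul_zero] at h1
  exact h1

lemma IsChord.isPreconnected_image (hx : V.IsChord w x) : IsPreconnected (x '' Icc 0 1) :=
  isPreconnected_Icc.image x hx.continuousOn

lemma IsChord.image_H_const (hx : V.IsChord w x) :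
    ∀ p ∈ x '' Icc 0 1, ∀ q ∈ x '' Icc 0 1, V.H p = V.H q := by
  rintro _ ⟨s, hs, rfl⟩ _ ⟨t, ht, rfl⟩
  rw [hx.H_const hs, hx.H_const ht]

/-- A chord which touches the boundary of `M` or `Min` would be an integer Reeb chord. -/
lemma IsChord.not_mem_frontier (hx : V.IsChord w x) {K : Set W}
    (hK : K ∈ ({V.M, V.Min} : Set (Set W))) {t : ℝ} (ht : t ∈ Icc (0 : ℝ) 1) :
    x t ∉ frontier K := by
  intro htf
  obtain ⟨f, hf⟩ := (V.isDomain hK).exists_defining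
  have hn := V.normalized hK
  set N₀ := interior {x | V.H x = 1 → x ∈ frontier K}
  have hKN₀ : frontier K ⊆ N₀ := fun y hy =>
    mem_interior_iff_mem_nhds.2 (hn.eventually_mem_frontier hf V.smooth_H hy)
  obtain ⟨N', -, hKN', htrap⟩ := hn.exists_trap hf V.smooth_H (V.isDomain hK).1 isOpen_interior hKN₀
  have hsub := htrap _ hx.isPreconnected_image hx.image_H_const ⟨x t, ⟨t, ht, rfl⟩, hKN' htf⟩
  have hall : ∀ s ∈ Icc (0 : ℝ) 1, x s ∈ frontier K := by
    intro s hs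
    have h1 := interior_subset (hsub ⟨s, hs, rfl⟩)
    simp only [mem_ofPred_eq] at h1
    exact h1 (by rw [hx.H_const hs, ← hx.H_const ht, (hn _ htf).1])
  refine V.no_reeb_chords K hK ⟨w, x, hx.pos, hx.start_mem, hx.end_mem, fun s hs =>
    ⟨hall s hs, Y.X V.H (x s), hn.isReeb hf V.smooth_H (hall s hs), hx.curve s hs⟩⟩

/-- Every integer chord lies either inside `Min` or outside `Min`. -/
lemma IsChord.in_or_out (hx : V.IsChord w x) : V.IsChordIn w x ∨ V.IsChordOut w x := by
  have hM : ∀ t ∈ Icc (0 : ℝ) 1, x t ∈ interior V.M := by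
    intro t ht
    have h1 := hx.not_mem_frontier (K := V.M) (by simp) ht
    by_contra h2
    refine h1 ?_
    rw [V.domain_M.1.isClosed.frontier_eq]
    exact ⟨hx.mem t ht, h2⟩
  have hMin : ∀ t ∈ Icc (0 : ℝ) 1, x t ∉ frontier V.Min := fun t ht =>
    hx.not_mem_frontier (by simp) ht
  by_cases h : ∀ t ∈ Icc (0 : ℝ) 1, x t ∈ interior V.Min
  · exact Or.inl ⟨hx, h⟩
  · right
    refine ⟨hx, fun t ht => ⟨hM t ht, fun htM => ?_⟩⟩
    push Not at h
    obtain ⟨s, hs, hsM⟩ := h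
    have hs' : x s ∉ V.Min := fun h1 => hMin s hs (by
      rw [V.domain_Min.1.isClosed.frontier_eq]; exact ⟨h1, hsM⟩)
    obtain ⟨_, ⟨r, hr, rfl⟩, hr'⟩ := exists_mem_frontier hx.isPreconnected_image
      (s := V.Min) ⟨x t, ⟨t, ht, rfl⟩, htM⟩ ⟨x s, ⟨s, hs, rfl⟩, hs'⟩
    exact hMin r hr hr'

variable (V) in
/-- The function `H - dH(Z)`, which is the action density of chords. -/
def actionDensity (x : W) : ℝ := V.H x - df V.H x (vv Y.Z x)

variable (V) in
lemma continuous_actionDensity : Continuous V.actionDensity :=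
  V.smooth_H.continuous.sub (Y.isFlow.contMDiff_df V.smooth_H).continuous

lemma IsChord.action_eq (hx : V.IsChord w x) :
    V.action w x = (∫ t in (0 : ℝ)..1, w * V.actionDensity (x t)) + V.h (x 1) - V.h (x 0) := by
  unfold action
  congr 2
  refine intervalIntegral.integral_congr fun t ht => ?_
  rw [uIcc_of_le zero_le_one] at ht
  have h1 : Y.θ (x t) (mfderivWithin 𝓘(ℝ, ℝ) 𝓘(ℝ, E) x (Icc 0 1) t (1 : ℝ)) =
      fm Y.θ (x t) (Viterbo.vel x (Icc 0 1) t 1) := rfl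
  simp only [h1]
  rw [hx.vel ht, map_smul, fm_X, actionDensity, smul_eq_mul]
  ring

end TargetData

end Chords

/-! ### The primitive `h` near the boundaries, and the action threshold -/

section Threshold

variable {E : Type*} [NormedAddCommGroup E] [NormedSpace ℝ E] [FiniteDimensional ℝ E]
variable {W : Type*} [TopologicalSpace W] [T2Space W] [ChartedSpace E W]
  [IsManifold 𝓘(ℝ, E) ∞ W]

open LiouvilleManifold

/-- Let `A` be a submanifold, and `G` a function vanishing at a point of `A` with nonzero differential
along `A`. If `h` is locally constant along `A` where `G ≥ 0`, and vanishes on `A` where `G = 0`,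
then it vanishes near that point on the part of `A` where `G ≥ 0`: points of that part can be
joined to `{G = 0}` by straight segments in a chart flattening `A`. -/
lemma eventually_eq_zero_of_transverse {A : Set W} (hA : IsClosedSubmanifold (E := E) A) {y : W}
    (hyA : y ∈ A) {G h : W → ℝ} (hG : ContMDiffAt 𝓘(ℝ, E) 𝓘(ℝ, ℝ) ∞ G y) (hGy : G y = 0)
    {v : E} (hv : v ∈ tangentTo (E := E) A y) (hdv : df G y v ≠ 0)
    (hh : ContMDiff 𝓘(ℝ, E) 𝓘(ℝ, ℝ) ∞ h) {U : Set W} (hU : IsOpen U) (hyU : y ∈ U)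
    (hdh : ∀ x ∈ A ∩ U, 0 ≤ G x → ∀ v : E, v ∈ tangentTo (E := E) A x → df h x v = 0)
    (hh0 : ∀ x ∈ A ∩ U, G x = 0 → h x = 0) :
    ∀ᶠ x in 𝓝 y, x ∈ A → 0 ≤ G x → h x = 0 := by
  obtain ⟨φ, hφ, hyφ, V, hV⟩ := hA.2 y hyA
  have hsymm : ContMDiffOn 𝓘(ℝ, E) 𝓘(ℝ, E) ∞ φ.symm φ.target := contMDiffOn_symm_of_mem_maximalAtlas hφ
  have hφs : ContMDiffOn 𝓘(ℝ, E) 𝓘(ℝ, E) ∞ φ φ.source := contMDiffOn_of_mem_maximalAtlas hφ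
  have hsymmAt : ∀ p ∈ φ.target, ContMDiffAt 𝓘(ℝ, E) 𝓘(ℝ, E) ∞ φ.symm p := fun p hp =>
    hsymm.contMDiffAt (φ.open_target.mem_nhds hp)
  set g : E → ℝ := fun p => G (φ.symm p) with hg
  have hpt : φ y ∈ φ.target := φ.map_source hyφ
  have hgs : ContDiffAt ℝ ∞ g (φ y) := by
    rw [← contMDiffAt_iff_contDiffAt]
    refine ContMDiffAt.comp (φ y) ?_ (hsymmAt _ hpt)
    rwa [φ.left_inv hyφ]
  -- a direction in `V` along which `g` increases
  obtain ⟨w, hwV, hw⟩ : ∃ w ∈ V, 0 < fderiv ℝ g (φ y) w := by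
    obtain ⟨c, hc, hcA, hc0, hcv⟩ := tangentTo_iff.1 hv
    have hce : ∀ᶠ t in 𝓝 (0 : ℝ), c t ∈ φ.source :=
      hc.continuous.continuousAt.eventually (φ.open_source.mem_nhds (by rwa [hc0]))
    have hφy : ContMDiffAt 𝓘(ℝ, E) 𝓘(ℝ, E) ∞ φ (c 0) := by
      rw [hc0]; exact hφs.contMDiffAt (φ.open_source.mem_nhds hyφ)
    have hcd : DifferentiableAt ℝ (fun t => φ (c t)) 0 := by
      have := (hφy.comp 0 hc.contMDiffAt).mdifferentiableAt (by simp)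
      exact this.differentiableAt
    set w := deriv (fun t => φ (c t)) 0 with hwdef
    have hwV : w ∈ V := by
      have hcl : IsClosed (V : Set E) := V.closed_of_finiteDimensional
      have h1 := hcd.hasDerivAt.tendsto_slope_zero_right
      refine hcl.mem_of_tendsto h1 ?_
      have h2 : ∀ᶠ t in 𝓝[>] (0 : ℝ), c t ∈ φ.source := hce.filter_mono nhdsWithin_le_nhds
      filter_upwards [h2] with t ht
      have e1 : φ (c t) ∈ V := (hV _ ht).1 (hcA t)
      have e2 : φ (c 0) ∈ V := (hV _ (by rwa [hc0])).1 (hcA 0)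
      rw [zero_add]
      exact V.smul_mem _ (V.sub_mem e1 e2)
    have hne : fderiv ℝ g (φ y) w ≠ 0 := by
      have hgd : HasFDerivAt g (fderiv ℝ g (φ y)) (φ (c 0)) := by
        rw [hc0]; exact (hgs.differentiableAt (by simp)).hasFDerivAt
      have h1 := hgd.comp_hasDerivAt 0 hcd.hasDerivAt
      have h2 : (g ∘ fun t => φ (c t)) =ᶠ[𝓝 0] fun t => G (c t) := by
        filter_upwards [hce] with t ht
        exact congrArg G (φ.left_inv ht)
      have h3 := fderivWithin_comp_vel (E := E) (f := G) (u := c) (s := univ) (z := 0)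
        (by rw [hc0]; exact hG.mdifferentiableAt (by simp)) uniqueDiffWithinAt_univ
        (vel_global_mdiff hc 0) 1
      rw [fderivWithin_univ, fderiv_apply_one_eq_deriv, hcv, hc0] at h3
      rw [← h1.deriv, h2.deriv_eq, h3]
      exact hdv
    rcases lt_or_gt_of_ne hne with h | h
    · exact ⟨-w, V.neg_mem hwV, by rw [map_neg]; linarith⟩
    · exact ⟨w, hwV, h⟩
  -- a ball on which the derivative in this direction is bounded below
  set a := fderiv ℝ g (φ y) w / 2 with ha
  have hapos : 0 < a := half_pos hw
  have hev : ∀ᶠ p in 𝓝 (φ y), p ∈ φ.target ∧ φ.symm p ∈ U ∧ DifferentiableAt ℝ g p ∧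
      a < fderiv ℝ g p w := by
    refine Filter.Eventually.and (φ.open_target.mem_nhds hpt) (Filter.Eventually.and
      ((φ.continuousAt_symm hpt).eventually (hU.mem_nhds (by rwa [φ.left_inv hyφ])))
      (Filter.Eventually.and ?_ ?_))
    · filter_upwards [(hgs.of_le (m := 1) (by simp)).eventually (by simp)] with p hp
      exact hp.differentiableAt one_ne_zero
    · have hcont : ContinuousAt (fun p => fderiv ℝ g p w) (φ y) :=
        ((hgs.fderiv_right (m := ∞) (by simp)).clm_apply contDiffAt_const).continuousAt
      exact hcont.eventually (lt_mem_nhds (by rw [ha]; linarith))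
  obtain ⟨ε, hε, hB⟩ := Metric.eventually_nhds_iff_ball.1 hev
  set T := ε / (2 * (‖w‖ + 1)) with hT
  have hTpos : 0 < T := by positivity
  have hTw : T * ‖w‖ < ε / 2 := by
    have : T * (‖w‖ + 1) = ε / 2 := by rw [hT]; field_simp
    nlinarith
  have hnear : ∀ᶠ x in 𝓝 y, x ∈ φ.source ∧ φ x ∈ Metric.ball (φ y) (ε / 2) ∧ g (φ x) < a * T := by
    have h1 := φ.continuousAt hyφ
    refine Filter.Eventually.and (φ.open_source.mem_nhds hyφ) (Filter.Eventually.and (h1.eventually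
      (Metric.ball_mem_nhds _ (half_pos hε))) (h1.eventually (p := fun q => g q < a * T) ?_))
    refine hgs.continuousAt.eventually (gt_mem_nhds ?_)
    simp only [hg, φ.left_inv hyφ, hGy]
    positivity
  filter_upwards [hnear] with x ⟨hxs, hxb, hxT⟩ hxA hxG
  set p := φ x with hp
  have hseg : ∀ τ ∈ Icc (0 : ℝ) T, p - τ • w ∈ Metric.ball (φ y) ε := by
    intro τ hτ
    rw [mem_ball_iff_norm] at hxb ⊢
    calc ‖p - τ • w - φ y‖ = ‖(p - φ y) - τ • w‖ := by congr 1; abel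
      _ ≤ ‖p - φ y‖ + ‖τ • w‖ := norm_sub_le _ _
      _ ≤ ‖p - φ y‖ + T * ‖w‖ := by
        rw [norm_smul, Real.norm_eq_abs, abs_of_nonneg hτ.1]; gcongr; exact hτ.2
      _ < ε := by linarith
  have hline : ∀ τ : ℝ, HasDerivAt (fun τ : ℝ => p - τ • w) (-w) τ := fun τ => by
    have := ((hasDerivAt_id τ).smul_const w).const_sub p
    simpa using this
  have hgd : ∀ τ ∈ Icc (0 : ℝ) T, HasDerivAt (fun τ : ℝ => g (p - τ • w))
      (-(fderiv ℝ g (p - τ • w) w)) τ := by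
    intro τ hτ
    have := (hB _ (hseg τ hτ)).2.2.1.hasFDerivAt.comp_hasDerivAt τ (hline τ)
    simpa [Function.comp_def] using this
  have hgc : ContinuousOn (fun τ : ℝ => g (p - τ • w)) (Icc 0 T) := fun τ hτ =>
    (hgd τ hτ).continuousAt.continuousWithinAt
  have hg0 : g (p - (0 : ℝ) • w) = G x := by simp [hg, hp, φ.left_inv hxs]
  -- Moving by `-T w` lowers `g` by at least `a T`, which is more than `g p`.
  have hgT : g (p - T • w) ≤ 0 := by
    have h1 := (convex_Icc (0 : ℝ) T).image_sub_le_mul_sub_of_deriv_le hgc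
      (fun τ hτ => (hgd τ (interior_subset hτ)).differentiableAt.differentiableWithinAt)
      (C := -a) (fun τ hτ => by
        rw [(hgd τ (interior_subset hτ)).deriv]
        have := (hB _ (hseg τ (interior_subset hτ))).2.2.2
        linarith) 0 ⟨le_rfl, hTpos.le⟩ T ⟨hTpos.le, le_rfl⟩ hTpos.le
    have h2 : g (p - (0 : ℝ) • w) = g p := by simp
    rw [h2] at h1
    linarith
  obtain ⟨τ₁, hτ₁, hτ₁0⟩ := intermediate_value_Icc' hTpos.le hgc
    (show (0 : ℝ) ∈ Icc _ _ from ⟨hgT, by rw [hg0]; exact hxG⟩)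
  have hanti : AntitoneOn (fun τ : ℝ => g (p - τ • w)) (Icc 0 T) := by
    refine antitoneOn_of_deriv_nonpos (convex_Icc 0 T) hgc
      (fun τ hτ => (hgd τ (interior_subset hτ)).differentiableAt.differentiableWithinAt)
      fun τ hτ => ?_
    rw [(hgd τ (interior_subset hτ)).deriv]
    have := (hB _ (hseg τ (interior_subset hτ))).2.2.2
    linarith
  have hmemA : ∀ τ : ℝ, p - τ • w ∈ φ.target → φ.symm (p - τ • w) ∈ A := by
    intro τ hτ
    rw [hV _ (φ.map_target hτ), φ.right_inv hτ]
    exact V.sub_mem ((hV x hxs).1 hxA) (V.smul_mem _ hwV)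
  -- `h` is constant along the segment until the latter reaches `{G = 0}`, at time `τ₁`
  have hsd : ∀ τ ∈ Icc (0 : ℝ) τ₁, HasDerivAt (fun τ : ℝ => h (φ.symm (p - τ • w))) 0 τ := by
    intro τ hτ
    have hτT : τ ∈ Icc (0 : ℝ) T := ⟨hτ.1, hτ.2.trans hτ₁.2⟩
    obtain ⟨hq1, hq2, -, -⟩ := hB _ (hseg τ hτT)
    set c : ℝ → W := fun t => φ.symm (p - (τ + t) • w) with hc
    have hl : Continuous fun t : ℝ => p - (τ + t) • w := by fun_prop
    have hls : ContDiff ℝ ∞ fun t : ℝ => p - (τ + t) • w := by fun_prop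
    obtain ⟨δ, hδ, hδB⟩ := Metric.eventually_nhds_iff.1 ((hl.continuousAt (x := 0)).eventually
      (φ.open_target.mem_nhds (by simpa using hq1)))
    have hcs : ContMDiffOn 𝓘(ℝ, ℝ) 𝓘(ℝ, E) ∞ c (Ioo (-δ) δ) :=
      hsymm.comp hls.contMDiff.contMDiffOn fun t ht => hδB (by
        rw [Real.dist_eq, sub_zero]; exact abs_lt.2 ht)
    have h0m : Ioo (-δ) δ ∈ 𝓝 (0 : ℝ) := Ioo_mem_nhds (by linarith) hδ
    have hvel := vel_mem_tangentTo (A := A) hδ hcs (fun t ht => hmemA _ (hδB (by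
        rw [Real.dist_eq, sub_zero]; exact abs_lt.2 ht))) (x := φ.symm (p - τ • w)) (by simp [hc]) rfl
    have hGτ : 0 ≤ G (φ.symm (p - τ • w)) := by
      have := hanti hτT hτ₁ hτ.2
      simp only [hτ₁0] at this
      exact this
    have h1 := hdh _ ⟨hmemA τ hq1, hq2⟩ hGτ _ hvel
    have hcm : MDifferentiableAt 𝓘(ℝ, ℝ) 𝓘(ℝ, E) c 0 :=
      (hcs.contMDiffAt h0m).mdifferentiableAt (by simp)
    have h2 := fderivWithin_comp_vel (E := E) (f := h) (u := c) (s := univ) (z := 0)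
      (hh.contMDiffAt.mdifferentiableAt (by simp)) uniqueDiffWithinAt_univ
      hcm.mdifferentiableWithinAt 1
    have hc0 : c 0 = φ.symm (p - τ • w) := by simp [hc]
    rw [hc0, h1, fderivWithin_univ, fderiv_apply_one_eq_deriv] at h2
    have h3 : DifferentiableAt ℝ (fun t => h (c t)) 0 :=
      ((hh.contMDiffAt.mdifferentiableAt (by simp)).comp 0 hcm).differentiableAt
    have h4 := h3.hasDerivAt
    rw [h2] at h4
    have h5 := (show HasDerivAt (fun t => h (c t)) 0 (τ - τ) by rwa [sub_self]).comp_sub_const τ τ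
    simpa [hc] using h5
  have hconst := constant_of_derivWithin_zero (f := fun τ : ℝ => h (φ.symm (p - τ • w)))
    (a := 0) (b := τ₁) (fun τ hτ => (hsd τ hτ).differentiableAt.differentiableWithinAt)
    (fun τ hτ => (hsd τ (Ico_subset_Icc_self hτ)).hasDerivWithinAt.derivWithin
      (uniqueDiffOn_Icc (lt_of_le_of_lt hτ.1 hτ.2) τ (Ico_subset_Icc_self hτ))) τ₁ ⟨hτ₁.1, le_rfl⟩
  have hend : h (φ.symm (p - τ₁ • w)) = 0 :=
    hh0 _ ⟨hmemA τ₁ (hB _ (hseg τ₁ hτ₁)).1, (hB _ (hseg τ₁ hτ₁)).2.1⟩ hτ₁0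
  rw [hend] at hconst
  simp only [zero_smul, sub_zero] at hconst
  rw [hconst, hp, φ.left_inv hxs]

namespace TargetData

variable {Y : LiouvilleManifold E W} (V : TargetData Y)

lemma frontier_Min_subset : frontier V.Min ⊆ interior V.M :=
  V.domain_Min.1.isClosed.frontier_subset.trans V.Min_subset

/-- Near a boundary point of `M` or `Min`, `h` vanishes on the part of `L` outside `Min`. The sign `σ` says on
which side of the boundary that part lies. -/
lemma eventually_h_eq_zero {K : Set W} (hK : K ∈ ({V.M, V.Min} : Set (Set W))) {y : W}
    (hy : y ∈ frontier K) {σ : ℝ} (hσ : σ ≠ 0) {U : Set W} (hU : IsOpen U) (hyU : y ∈ U)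
    (hUc : U ⊆ Y.collar K)
    (hM : ∀ x ∈ U, 0 ≤ σ * Y.logr K x ↔ x ∈ V.M ∧ x ∉ interior V.Min) :
    ∀ᶠ x in 𝓝 y, x ∈ V.L → x ∈ V.M → x ∉ interior V.Min → V.h x = 0 := by
  obtain ⟨f, hf⟩ := (V.isDomain hK).exists_defining
  by_cases hyL : y ∈ V.L
  · obtain ⟨(v : E), hvL, hvK⟩ := V.transverse K hK y ⟨hyL, hy⟩
    obtain ⟨U₁, hU₁, hU₁s, hθ⟩ := V.θ_vanishes
    have hKs : frontier K ⊆ frontier V.M ∪ frontier V.Min := by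
      rcases hK with rfl | rfl
      · exact subset_union_left
      · exact subset_union_right
    have hyc := hf.frontier_subset_collar hy
    -- the direction `v` along `L` provided by transversality leaves the boundary of `K`
    have hdG : df (E := E) (fun x => σ * Y.logr K x) y v ≠ 0 := by
      have h1 := const_smul_mfderiv (hf.mdiff_logr hyc) σ
      have h2 : df (E := E) (fun x => σ * Y.logr K x) y v = σ * df (Y.logr K) y v :=
        congrArg (fun L : E →L[ℝ] ℝ => L v) h1
      rw [h2]
      refine mul_ne_zero hσ fun h => hvK ?_
      exact (hf.mem_tangentTo_frontier_iff hy v).2 h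
    have h1 := eventually_eq_zero_of_transverse V.lagrangian.1 hyL (G := fun x => σ * Y.logr K x)
      (h := V.h) (contMDiffAt_const.mul (hf.contMDiffAt_logr hyc))
      (by simp [hf.logr_frontier hy]) hvL hdG V.smooth_h (hU.inter hU₁) ⟨hyU, hU₁s (hKs hy)⟩
      (by
        rintro x ⟨hxL, hxU, hxU₁⟩ hx v hv
        have h2 := (hM x hxU).1 hx
        exact (V.dh x hxL v hv).trans (hθ x ⟨hxL, hxU₁⟩ h2.1 h2.2 v hv))
      (by
        rintro x ⟨hxL, hxU, hxU₁⟩ hx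
        refine V.h_boundary x hxL (hKs ((hf.mem_frontier_iff (hUc hxU)).2 ?_))
        exact (mul_eq_zero.1 hx).resolve_left hσ)
    filter_upwards [h1, hU.mem_nhds hyU] with x hx hxU hxL hxM hxMin
    exact hx hxL ((hM x hxU).2 ⟨hxM, hxMin⟩)
  · filter_upwards [V.lagrangian.1.1.isOpen_compl.mem_nhds hyL] with x hx hxL
    exact absurd hxL hx

/-- The primitive `h` vanishes on the part of `L` outside `Min` near the boundaries. -/
lemma exists_h_eq_zero : ∃ N : Set W, IsOpen N ∧ frontier V.M ∪ frontier V.Min ⊆ N ∧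
    ∀ x ∈ V.L ∩ N, x ∈ V.M → x ∉ interior V.Min → V.h x = 0 := by
  refine ⟨interior {x | x ∈ V.L → x ∈ V.M → x ∉ interior V.Min → V.h x = 0}, isOpen_interior,
    ?_, fun x hx h1 h2 => interior_subset hx.2 hx.1 h1 h2⟩
  rintro y (hy | hy) <;> rw [mem_interior_iff_mem_nhds]
  · obtain ⟨f, hf⟩ := V.domain_M.exists_defining
    have hyMin : y ∉ V.Min := fun h => by
      rw [V.domain_M.1.isClosed.frontier_eq] at hy
      exact hy.2 (V.Min_subset h)
    refine V.eventually_h_eq_zero (K := V.M) (by simp) hy (σ := -1) (by norm_num)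
      (U := Y.collar V.M ∩ V.Minᶜ) (hf.isOpen_collar.inter V.domain_Min.1.isClosed.isOpen_compl)
      ⟨hf.frontier_subset_collar hy, hyMin⟩ inter_subset_left ?_
    rintro x ⟨hxc, hxM⟩
    have h1 : x ∈ V.M ↔ Y.logr V.M x ≤ 0 := by
      rw [← not_lt, ← hf.f_pos_iff hxc, not_lt, hf.eq]; rfl
    rw [h1]
    constructor
    · intro h; exact ⟨by linarith, fun h' => hxM (interior_subset h')⟩
    · rintro ⟨h, -⟩; linarith
  · obtain ⟨f, hf⟩ := V.domain_Min.exists_defining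
    refine V.eventually_h_eq_zero (K := V.Min) (by simp) hy (σ := 1) (by norm_num)
      (U := Y.collar V.Min ∩ interior V.M) (hf.isOpen_collar.inter isOpen_interior)
      ⟨hf.frontier_subset_collar hy, V.frontier_Min_subset hy⟩ inter_subset_left ?_
    rintro x ⟨hxc, hxM⟩
    have h1 : x ∈ interior V.Min ↔ Y.logr V.Min x < 0 := by
      rw [← hf.f_neg_iff hxc, hf.interior_eq]; rfl
    rw [h1]
    constructor
    · intro h; exact ⟨interior_subset hxM, by linarith⟩
    · rintro ⟨-, h⟩; linarith

lemma actionDensity_pos {x : W} (hx : x ∈ interior V.M \ V.Min) : 0 < V.actionDensity x :=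
  V.H_out x hx.1 hx.2

lemma IsChord.continuousOn_density {V : TargetData Y} {w : ℕ} {x : ℝ → W} (hx : V.IsChord w x) :
    ContinuousOn (fun t => w * V.actionDensity (x t)) (Icc 0 1) :=
  continuousOn_const.mul (V.continuous_actionDensity.comp_continuousOn hx.continuousOn)

/-- Long chords outside `Min` have positive action. Those which stay in a fixed compact subset of
the interior have large action since the action density is bounded below there. The remaining ones
stay close to the boundary, where `h` vanishes. -/
lemma exists_positiveAction : ∃ ν : ℕ, V.PositiveAction ν := by
  obtain ⟨N, hN, hNs, hh⟩ := V.exists_h_eq_zero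
  obtain ⟨f₁, hf₁⟩ := V.domain_M.exists_defining
  obtain ⟨f₂, hf₂⟩ := V.domain_Min.exists_defining
  obtain ⟨N₁, hN₁, hN₁s, htrap₁⟩ := V.normalized_M.exists_trap hf₁ V.smooth_H V.domain_M.1 hN
    (subset_union_left.trans hNs)
  obtain ⟨N₂, hN₂, hN₂s, htrap₂⟩ := V.normalized_Min.exists_trap hf₂ V.smooth_H V.domain_Min.1 hN
    (subset_union_right.trans hNs)
  -- `B` consists of the points outside `Min` that are not close to the boundaries.
  set B := (V.M \ interior V.Min) \ (N₁ ∪ N₂) with hB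
  have hBc : IsCompact B := (V.domain_M.1.diff isOpen_interior).diff (hN₁.union hN₂)
  have hBpos : ∀ x ∈ B, 0 < V.actionDensity x := by
    rintro x ⟨⟨hxM, hxMin⟩, hxN⟩
    refine V.actionDensity_pos ⟨?_, ?_⟩
    · by_contra h
      exact hxN (Or.inl (hN₁s (by rw [V.domain_M.1.isClosed.frontier_eq]; exact ⟨hxM, h⟩)))
    · intro h
      exact hxN (Or.inr (hN₂s (by rw [V.domain_Min.1.isClosed.frontier_eq]; exact ⟨h, hxMin⟩)))
  obtain ⟨c, hc, hcB⟩ : ∃ c > 0, ∀ x ∈ B, c ≤ V.actionDensity x := by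
    rcases B.eq_empty_or_nonempty with h | h
    · exact ⟨1, one_pos, by simp [h]⟩
    · obtain ⟨x, hx, hxm⟩ := hBc.exists_isMinOn h V.continuous_actionDensity.continuousOn
      exact ⟨_, hBpos x hx, fun z hz => hxm hz⟩
  obtain ⟨C, hC⟩ := V.domain_M.1.exists_bound_of_continuousOn V.smooth_h.continuous.continuousOn
  obtain ⟨ν, hν⟩ := exists_nat_gt (2 * C / c)
  refine ⟨ν, fun w hw x hx => ?_⟩
  have hwpos : (0 : ℝ) < w := by exact_mod_cast hx.1.pos
  rw [hx.1.action_eq]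
  have hint : IntervalIntegrable (fun t => w * V.actionDensity (x t)) MeasureTheory.volume 0 1 :=
    ContinuousOn.intervalIntegrable (by rw [uIcc_of_le zero_le_one]; exact hx.1.continuousOn_density)
  have h0 : (0 : ℝ) ∈ Icc (0 : ℝ) 1 := ⟨le_rfl, zero_le_one⟩
  have h1 : (1 : ℝ) ∈ Icc (0 : ℝ) 1 := ⟨zero_le_one, le_rfl⟩
  -- Either the chord lies in `N`, where `h` vanishes at its ends, or it lies in `B`, where the density is
  -- at least `c`.
  by_cases hmeet : x '' Icc 0 1 ⊆ N
  · have hz : ∀ t ∈ Icc (0 : ℝ) 1, x t ∈ V.L → V.h (x t) = 0 := fun t ht htL =>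
      hh _ ⟨htL, hmeet ⟨t, ht, rfl⟩⟩ (hx.1.mem t ht) fun h => (hx.2 t ht).2 (interior_subset h)
    rw [hz 0 h0 hx.1.start_mem, hz 1 h1 hx.1.end_mem, add_zero, sub_zero]
    refine intervalIntegral.intervalIntegral_pos_of_pos_on hint (fun t ht => ?_) one_pos
    exact mul_pos hwpos (V.actionDensity_pos (hx.2 t (Ioo_subset_Icc_self ht)))
  · have hxB : ∀ t ∈ Icc (0 : ℝ) 1, x t ∈ B := by
      intro t ht
      refine ⟨⟨hx.1.mem t ht, fun h => (hx.2 t ht).2 (interior_subset h)⟩, ?_⟩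
      rintro (h | h)
      · exact hmeet (htrap₁ _ hx.1.isPreconnected_image hx.1.image_H_const ⟨_, ⟨t, ht, rfl⟩, h⟩)
      · exact hmeet (htrap₂ _ hx.1.isPreconnected_image hx.1.image_H_const ⟨_, ⟨t, ht, rfl⟩, h⟩)
    have hlow : (w : ℝ) * c ≤ ∫ t in (0 : ℝ)..1, w * V.actionDensity (x t) := by
      have := intervalIntegral.integral_mono_on (f := fun _ => (w : ℝ) * c) zero_le_one
        intervalIntegrable_const hint fun t ht => mul_le_mul_of_nonneg_left (hcB _ (hxB t ht)) hwpos.le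
      simpa using this
    have hb0 := abs_le.1 (hC _ (hx.1.mem 0 h0))
    have hb1 := abs_le.1 (hC _ (hx.1.mem 1 h1))
    have hwc : 2 * C < w * c := by
      have : (2 * C / c) < w := hν.trans_le (by exact_mod_cast hw)
      rwa [div_lt_iff₀ hc] at this
    linarith [hb0.2, hb1.1]

end TargetData

end Threshold

/-! ### Gluing functions to first order -/

section Glue

variable {E : Type*} [NormedAddCommGroup E] [NormedSpace ℝ E]

/-- A function which is locally equal to `g` or to zero, except at points where `g` vanishes to
first order, is continuously differentiable. -/
lemma contDiffOn_one_of_glue {f g : E → ℝ} {U : Set E} (hU : IsOpen U) (hg : ContDiffOn ℝ 1 g U)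
    (hfg : ∀ p ∈ U, f p = g p ∨ f p = 0)
    (h : ∀ p ∈ U, f =ᶠ[𝓝 p] g ∨ f =ᶠ[𝓝 p] (fun _ => 0) ∨ (g p = 0 ∧ fderiv ℝ g p = 0)) :
    ContDiffOn ℝ 1 f U ∧ ∀ p ∈ U, g p = 0 → fderiv ℝ g p = 0 → HasFDerivAt f (0 : E →L[ℝ] ℝ) p := by
  have hgd : ∀ p ∈ U, DifferentiableAt ℝ g p := fun p hp =>
    (hg.differentiableOn one_ne_zero).differentiableAt (hU.mem_nhds hp)
  have h3 : ∀ p ∈ U, g p = 0 → fderiv ℝ g p = 0 → HasFDerivAt f (0 : E →L[ℝ] ℝ) p := by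
    intro p hp h0 h1
    have hd := (hgd p hp).hasFDerivAt
    rw [h1, hasFDerivAt_iff_isLittleO] at hd
    rw [hasFDerivAt_iff_isLittleO]
    have hf0 : f p = 0 := by
      rcases hfg p hp with e | e
      · rw [e, h0]
      · exact e
    refine Asymptotics.IsBigO.trans_isLittleO (Asymptotics.IsBigO.of_bound 1 ?_) hd
    filter_upwards [hU.mem_nhds hp] with q hq
    simp only [hf0, h0, sub_zero, zero_apply, one_mul]
    rcases hfg q hq with e | e <;> simp [e]
  have hd : ∀ p ∈ U, DifferentiableAt ℝ f p ∧ (fderiv ℝ f p = fderiv ℝ g p ∨ fderiv ℝ f p = 0) := by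
    intro p hp
    rcases h p hp with e | e | ⟨e1, e2⟩
    · exact ⟨(hgd p hp).congr_of_eventuallyEq e, Or.inl e.fderiv_eq⟩
    · exact ⟨(differentiableAt_const (0 : ℝ)).congr_of_eventuallyEq e, Or.inr (by
        rw [e.fderiv_eq]; simp)⟩
    · exact ⟨(h3 p hp e1 e2).differentiableAt, Or.inr (h3 p hp e1 e2).fderiv⟩
  refine ⟨?_, h3⟩
  have hgc : ContinuousOn (fderiv ℝ g) U := hg.continuousOn_fderiv_of_isOpen hU (by simp)
  refine (contDiffOn_succ_iff_fderiv_of_isOpen (n := 0) hU).2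
    ⟨fun p hp => (hd p hp).1.differentiableWithinAt, by simp, ?_⟩
  rw [contDiffOn_zero]
  intro p hp
  refine ContinuousAt.continuousWithinAt ?_
  have hgcp : ContinuousAt (fderiv ℝ g) p := hgc.continuousAt (hU.mem_nhds hp)
  rcases h p hp with e | e | ⟨e1, e2⟩
  · exact hgcp.congr e.fderiv.symm
  · have : (fderiv ℝ f) =ᶠ[𝓝 p] fun _ => 0 := e.fderiv.trans (by simp; rfl)
    exact continuousAt_const.congr this.symm
  · have h0 : fderiv ℝ f p = 0 := (h3 p hp e1 e2).fderiv
    rw [ContinuousAt, h0]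
    rw [ContinuousAt, e2] at hgcp
    refine squeeze_zero_norm' ?_ (tendsto_zero_iff_norm_tendsto_zero.1 hgcp)
    filter_upwards [hU.mem_nhds hp] with q hq
    rcases (hd q hq).2 with e | e <;> simp [e]

variable {W : Type*} [TopologicalSpace W] [ChartedSpace E W] [IsManifold 𝓘(ℝ, E) ∞ W]

/-- A function that locally is either `g` or zero, and may switch between the two only where `g` vanishes
to first order, is `C¹`; its differential is zero at the switching points. -/
lemma contMDiffAt_one_of_glue {f g : W → ℝ} {U : Set W} (hU : IsOpen U)
    (hg : ContMDiffOn 𝓘(ℝ, E) 𝓘(ℝ, ℝ) ∞ g U)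
    (hfg : ∀ x ∈ U, f x = g x ∨ f x = 0)
    (h : ∀ x ∈ U, f =ᶠ[𝓝 x] g ∨ f =ᶠ[𝓝 x] (fun _ => 0) ∨ (g x = 0 ∧ df (E := E) g x = 0))
    {y : W} (hy : y ∈ U) :
    ContMDiffAt 𝓘(ℝ, E) 𝓘(ℝ, ℝ) 1 f y ∧ (g y = 0 → df (E := E) g y = 0 → df (E := E) f y = 0) := by
  set φ := extChartAt 𝓘(ℝ, E) y with hφ
  set U' : Set E := φ.target ∩ φ.symm ⁻¹' U with hU'
  have hU'o : IsOpen U' := (continuousOn_extChartAt_symm y).isOpen_inter_preimage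
    (isOpen_extChartAt_target y) hU
  have hsymm : ∀ p ∈ φ.target, ContMDiffAt 𝓘(ℝ, E) 𝓘(ℝ, E) ∞ φ.symm p := fun p hp =>
    (contMDiffOn_extChartAt_symm y).contMDiffAt ((isOpen_extChartAt_target y).mem_nhds hp)
  have hgs : ContDiffOn ℝ 1 (fun p => g (φ.symm p)) U' := by
    intro p hp
    refine ContDiffAt.contDiffWithinAt ?_
    rw [← contMDiffAt_iff_contDiffAt]
    exact ((hg.contMDiffAt (hU.mem_nhds hp.2)).comp p (hsymm p hp.1)).of_le (by simp)
  have hgd : ∀ x ∈ U, MDifferentiableAt 𝓘(ℝ, E) 𝓘(ℝ, ℝ) g x := fun x hx =>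
    (hg.contMDiffAt (hU.mem_nhds hx)).mdifferentiableAt (by simp)
  -- the differential of `g` in the chart
  have hdg : ∀ p ∈ U', df (E := E) g (φ.symm p) = 0 → fderiv ℝ (fun p => g (φ.symm p)) p = 0 := by
    intro p hp h0
    have h1 := fderivWithin_comp_vel (E := E) (f := g) (u := (φ.symm : E → W)) (s := univ) (z := p)
      (hgd _ hp.2) uniqueDiffWithinAt_univ
      ((hsymm p hp.1).mdifferentiableAt (by simp)).mdifferentiableWithinAt
    refine ContinuousLinearMap.ext fun a => ?_
    have h2 := h1 a
    rw [fderivWithin_univ, h0] at h2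
    simpa using h2
  have key := contDiffOn_one_of_glue (f := fun p => f (φ.symm p)) hU'o hgs
    (fun p hp => hfg _ hp.2) (fun p hp => by
      have hc : Tendsto φ.symm (𝓝 p) (𝓝 (φ.symm p)) := (hsymm p hp.1).continuousAt
      rcases h _ hp.2 with e | e | ⟨e1, e2⟩
      · exact Or.inl (hc.eventually e)
      · exact Or.inr (Or.inl (hc.eventually e))
      · exact Or.inr (Or.inr ⟨e1, hdg p hp e2⟩))
  have hys : y ∈ φ.source := mem_extChartAt_source (I := 𝓘(ℝ, E)) y
  have hyU' : φ y ∈ U' := ⟨φ.map_source hys, by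
    show φ.symm (φ y) ∈ U
    rwa [φ.left_inv hys]⟩
  have hf : ContMDiffAt 𝓘(ℝ, E) 𝓘(ℝ, ℝ) 1 f y := by
    have h1 : ContMDiffAt 𝓘(ℝ, E) 𝓘(ℝ, ℝ) 1 ((fun p => f (φ.symm p)) ∘ φ) y :=
      ContMDiffAt.comp y (key.1.contDiffAt (hU'o.mem_nhds hyU')).contMDiffAt contMDiffAt_extChartAt
    refine h1.congr_of_eventuallyEq ?_
    filter_upwards [(isOpen_extChartAt_source (I := 𝓘(ℝ, E)) y).mem_nhds hys] with x hx
    exact congrArg f (φ.left_inv hx).symm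
  refine ⟨hf, fun h0 h1 => ?_⟩
  have h2 := key.2 _ hyU' (by simpa only [φ.left_inv hys] using h0)
    (hdg _ hyU' (by rwa [φ.left_inv hys]))
  refine ContinuousLinearMap.ext fun v => ?_
  rw [df_eq_fderiv_chart hys (hf.mdifferentiableAt (by simp)), h2.fderiv]
  simp

end Glue

/-! ### Radial cutoff functions -/

section Cutoff

variable {E : Type*} [NormedAddCommGroup E] [NormedSpace ℝ E] [FiniteDimensional ℝ E]
variable {W : Type*} [TopologicalSpace W] [T2Space W] [ChartedSpace E W]
  [IsManifold 𝓘(ℝ, E) ∞ W]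

lemma df_comp_real {f : W → ℝ} {g : ℝ → ℝ} {x : W}
    (hf : MDifferentiableAt 𝓘(ℝ, E) 𝓘(ℝ, ℝ) f x) (hg : DifferentiableAt ℝ g (f x)) (v : E) :
    df (fun x => g (f x)) x v = deriv g (f x) * df f x v := by
  have h := mfderiv_comp x hg.mdifferentiableAt hf
  have h1 := congrArg (fun L : E →L[ℝ] ℝ => L v) h
  refine h1.trans ?_
  have h2 : mfderiv 𝓘(ℝ, ℝ) 𝓘(ℝ, ℝ) g (f x) = fderiv ℝ g (f x) := mfderiv_eq_fderiv
  have h3 : (mfderiv 𝓘(ℝ, ℝ) 𝓘(ℝ, ℝ) g (f x) : ℝ →L[ℝ] ℝ) (df f x v) = fderiv ℝ g (f x) (df f x v) :=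
    congrArg (fun L : ℝ →L[ℝ] ℝ => L (df f x v)) h2
  refine h3.trans ?_
  rw [fderiv_eq_smul_deriv, smul_eq_mul, mul_comm]

lemma df_sub' {f g : W → ℝ} {x : W} (hf : MDifferentiableAt 𝓘(ℝ, E) 𝓘(ℝ, ℝ) f x)
    (hg : MDifferentiableAt 𝓘(ℝ, E) 𝓘(ℝ, ℝ) g x) (v : E) :
    df (fun x => f x - g x) x v = df f x v - df g x v :=
  congrArg (fun L : E →L[ℝ] ℝ => L v) (mfderiv_sub hf hg)

lemma df_add' {f g : W → ℝ} {x : W} (hf : MDifferentiableAt 𝓘(ℝ, E) 𝓘(ℝ, ℝ) f x)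
    (hg : MDifferentiableAt 𝓘(ℝ, E) 𝓘(ℝ, ℝ) g x) (v : E) :
    df (fun x => f x + g x) x v = df f x v + df g x v :=
  congrArg (fun L : E →L[ℝ] ℝ => L v) (mfderiv_add hf hg)

/-- A curve can be slowed down so as to stay where a condition holds which is true near the given
time, without changing its velocity at that time. -/
lemma exists_reparam {c : ℝ → W} (hc : ContMDiff 𝓘(ℝ, ℝ) 𝓘(ℝ, E) ∞ c) {t₀ : ℝ} {P : W → Prop}
    (hP : ∀ᶠ t in 𝓝 t₀, P (c t)) : ∃ c' : ℝ → W, ContMDiff 𝓘(ℝ, ℝ) 𝓘(ℝ, E) ∞ c' ∧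
      c' 0 = c t₀ ∧ vel (E := E) c' univ 0 1 = vel c univ t₀ 1 ∧ (∀ t, P (c' t)) ∧
      ∀ t, ∃ t', c' t = c t' := by
  obtain ⟨ε, hε, hB⟩ := Metric.eventually_nhds_iff.1 hP
  have hε2 : 0 < ε / 2 := half_pos hε
  set g : ℝ → ℝ := fun t => t₀ + ε / 2 * Real.sin (t / (ε / 2)) with hg
  have hgs : ContDiff ℝ ∞ g := contDiff_const.add (contDiff_sin_scale _)
  have hgd : HasDerivAt g 1 0 := (hasDerivAt_sin_scale hε2).const_add _
  have hg0 : g 0 = t₀ := by simp [hg]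
  refine ⟨fun t => c (g t), hc.comp hgs.contMDiff, by simp [hg0], ?_, fun t => hB ?_,
    fun t => ⟨_, rfl⟩⟩
  · have h := vel_comp (E := E) (u := c) (g := g) (s := univ) (t := univ) (q := 0)
      (vel_global_mdiff hc _) hgd.differentiableAt.differentiableWithinAt (mapsTo_univ _ _)
      uniqueDiffWithinAt_univ 1
    rw [fderivWithin_univ, fderiv_apply_one_eq_deriv, hgd.deriv, hg0] at h
    exact h
  · rw [Real.dist_eq]
    simp only [hg, add_sub_cancel_left]
    exact (abs_sin_scale_le hε2 t).trans_lt (by linarith)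

namespace LiouvilleManifold

variable {Y : LiouvilleManifold E W} {K : Set W}

variable (Y K) in
/-- A smooth function with values in `[0,1]`, depending only on the radial coordinate, which is zero
up to the level `e^a` and one above the level `e^b`. -/
def cut (a b : ℝ) (x : W) : ℝ :=
  open Classical in
  if Y.flow (-a) x ∈ K then 0 else if Y.flow (-b) x ∈ interior K then
    Real.smoothTransition ((Y.logr K x - a) / (b - a)) else 1

lemma cut_nonneg (a b : ℝ) (x : W) : 0 ≤ Y.cut K a b x := by
  unfold cut
  split_ifs
  exacts [le_rfl, Real.smoothTransition.nonneg _, zero_le_one]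

lemma cut_eq_zero {a b : ℝ} {x : W} (h : Y.flow (-a) x ∈ K) : Y.cut K a b x = 0 := if_pos h

namespace IsDefining

variable {f : W → ℝ} (hf : Y.IsDefining K f)
include hf

lemma mem_iff {x : W} (hx : x ∈ Y.collar K) : x ∈ K ↔ Y.logr K x ≤ 0 := by
  rw [← not_lt, ← hf.f_pos_iff hx, not_lt, hf.eq]; rfl

lemma mem_interior_iff {x : W} (hx : x ∈ Y.collar K) : x ∈ interior K ↔ Y.logr K x < 0 := by
  rw [← hf.f_neg_iff hx, hf.interior_eq]; rfl

lemma flow_mem_iff {x : W} (hx : x ∈ Y.collar K) (a : ℝ) :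
    Y.flow (-a) x ∈ K ↔ Y.logr K x ≤ a := by
  rw [hf.mem_iff (hf.flow_mem_collar hx _), hf.logr_flow_collar hx]
  constructor <;> intro h <;> linarith

lemma flow_mem_interior_iff {x : W} (hx : x ∈ Y.collar K) (a : ℝ) :
    Y.flow (-a) x ∈ interior K ↔ Y.logr K x < a := by
  rw [hf.mem_interior_iff (hf.flow_mem_collar hx _), hf.logr_flow_collar hx]
  constructor <;> intro h <;> linarith

lemma flow_mem_interior_of_nonpos {x : W} (hx : x ∈ interior K) {t : ℝ} (ht : t ≤ 0) :
    Y.flow t x ∈ interior K := by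
  by_contra h
  have h1 := hf.flow_mem_of_nonpos (interior_subset hx) ht
  have h2 : Y.flow t x ∈ frontier K := by rw [hf.isClosed.frontier_eq]; exact ⟨h1, h⟩
  have hc : x ∈ Y.collar K := ⟨t, h2⟩
  have h3 := hf.logr_eq (x := x) (t := -t) (by simpa using h2)
  have h4 := (hf.mem_interior_iff hc).1 hx
  linarith

lemma flow_mem_interior_of_neg {x : W} (hx : x ∈ K) {t : ℝ} (ht : t < 0) :
    Y.flow t x ∈ interior K := by
  by_cases h : x ∈ interior K
  · exact hf.flow_mem_interior_of_nonpos h ht.le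
  · exact hf.flow_mem_interior (by rw [hf.isClosed.frontier_eq]; exact ⟨hx, h⟩) ht

/-- A point whose flow line leaves `K` lies in the collar. -/
lemma mem_collar_of_exit {x : W} {s t : ℝ} (hs : Y.flow s x ∈ K) (ht : Y.flow t x ∉ interior K) :
    x ∈ Y.collar K := by
  have hc : Continuous fun s => f (Y.flow s x) :=
    hf.smooth.continuous.comp (Y.isFlow.contMDiff_time x).continuous
  rw [hf.eq] at hs
  rw [hf.interior_eq] at ht
  obtain ⟨r, -, hr⟩ := intermediate_value_uIcc (a := s) (b := t) hc.continuousOn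
    (show (0 : ℝ) ∈ uIcc _ _ from by
      rw [mem_uIcc]; exact Or.inl ⟨hs, not_lt.1 ht⟩)
  exact ⟨r, by rw [hf.frontier_eq]; exact hr⟩

lemma cut_eq_one {a b : ℝ} (hab : a < b) {x : W} (h : Y.flow (-b) x ∉ interior K) :
    Y.cut K a b x = 1 := by
  unfold cut
  rw [if_neg, if_neg h]
  intro h'
  refine h ?_
  have := hf.flow_mem_interior_of_neg h' (t := -b + a) (by linarith)
  rwa [← Y.isFlow.add, add_assoc, add_neg_cancel, add_zero] at this

lemma cut_eq_of_collar {a b : ℝ} (hab : a < b) {x : W} (hx : x ∈ Y.collar K) :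
    Y.cut K a b x = Real.smoothTransition ((Y.logr K x - a) / (b - a)) := by
  unfold cut
  have hba : 0 < b - a := sub_pos.2 hab
  rw [hf.flow_mem_iff hx, hf.flow_mem_interior_iff hx]
  split_ifs with h1 h2
  · rw [Real.smoothTransition.zero_of_nonpos]
    exact div_nonpos_of_nonpos_of_nonneg (by linarith) hba.le
  · rfl
  · rw [Real.smoothTransition.one_of_one_le]
    rw [le_div_iff₀ hba]; linarith

lemma eventually_cut_eq_zero {a b : ℝ} {x : W} (h : Y.flow (-a) x ∈ interior K) :
    Y.cut K a b =ᶠ[𝓝 x] fun _ => 0 := by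
  have hc := (Y.isFlow.contMDiff (-a)).continuous.continuousAt (x := x)
  filter_upwards [hc.eventually (isOpen_interior.mem_nhds h)] with y hy
  exact cut_eq_zero (interior_subset hy)

lemma eventually_cut_eq_one {a b : ℝ} (hab : a < b) {x : W} (h : Y.flow (-b) x ∉ K) :
    Y.cut K a b =ᶠ[𝓝 x] fun _ => 1 := by
  have hc := (Y.isFlow.contMDiff (-b)).continuous.continuousAt (x := x)
  filter_upwards [hc.eventually (hf.isClosed.isOpen_compl.mem_nhds h)] with y hy
  exact hf.cut_eq_one hab fun h' => hy (interior_subset h')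

lemma cases_cut (a b : ℝ) (x : W) :
    Y.flow (-a) x ∈ interior K ∨ x ∈ Y.collar K ∨ Y.flow (-b) x ∉ K := by
  by_cases h1 : Y.flow (-a) x ∈ interior K
  · exact Or.inl h1
  by_cases h2 : Y.flow (-b) x ∈ K
  · exact Or.inr (Or.inl (hf.mem_collar_of_exit h2 h1))
  · exact Or.inr (Or.inr h2)

lemma contMDiff_cut {a b : ℝ} (hab : a < b) : ContMDiff 𝓘(ℝ, E) 𝓘(ℝ, ℝ) ∞ (Y.cut K a b) := by
  intro x
  rcases hf.cases_cut a b x with h | h | h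
  · exact contMDiffAt_const.congr_of_eventuallyEq (hf.eventually_cut_eq_zero h)
  · have h1 : ContDiff ℝ ∞ fun t : ℝ => Real.smoothTransition ((t - a) / (b - a)) :=
      Real.smoothTransition.contDiff.comp (by fun_prop)
    refine (h1.contMDiff.contMDiffAt.comp x (hf.contMDiffAt_logr h)).congr_of_eventuallyEq ?_
    filter_upwards [hf.isOpen_collar.mem_nhds h] with y hy
    exact hf.cut_eq_of_collar hab hy
  · exact contMDiffAt_const.congr_of_eventuallyEq (hf.eventually_cut_eq_one hab h)

/-- The differential of a radial cutoff function is a nonnegative multiple of `d log r`, and it is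
zero below the level `a` and above the level `b`. -/
lemma exists_df_cut {a b : ℝ} (hab : a < b) (x : W) : ∃ c : ℝ, 0 ≤ c ∧
    (∀ v : E, df (Y.cut K a b) x v = c * df (Y.logr K) x v) ∧
    (c ≠ 0 → x ∈ Y.collar K ∧ a ≤ Y.logr K x ∧ Y.logr K x ≤ b) := by
  have hz : ∀ c : ℝ, Y.cut K a b =ᶠ[𝓝 x] (fun _ => c) → ∀ v : E, df (Y.cut K a b) x v = 0 := by
    intro c hc v
    rw [df_congr hc]
    exact congrArg (fun L : E →L[ℝ] ℝ => L v) (mfderiv_const (c := c) (x := x) (I := 𝓘(ℝ, E)) (I' := 𝓘(ℝ, ℝ)))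
  rcases hf.cases_cut a b x with h | h | h
  · exact ⟨0, le_rfl, fun v => by rw [hz 0 (hf.eventually_cut_eq_zero h) v, zero_mul],
      fun h => absurd rfl h⟩
  · set χ : ℝ → ℝ := fun t => Real.smoothTransition ((t - a) / (b - a)) with hχ
    have hba : 0 < b - a := sub_pos.2 hab
    have h1 : ContDiff ℝ ∞ χ := Real.smoothTransition.contDiff.comp (by fun_prop)
    have hev : Y.cut K a b =ᶠ[𝓝 x] fun y => χ (Y.logr K y) := by
      filter_upwards [hf.isOpen_collar.mem_nhds h] with y hy
      exact hf.cut_eq_of_collar hab hy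
    have hmono : Monotone χ := fun s t hst =>
      Real.smoothTransition.monotone (by gcongr)
    refine ⟨deriv χ (Y.logr K x), hmono.deriv_nonneg, fun v => ?_, fun hne => ⟨h, ?_, ?_⟩⟩
    · rw [df_congr hev]
      exact df_comp_real (hf.mdiff_logr h) ((h1.differentiable (by simp)).differentiableAt) v
    · by_contra hlt
      refine hne ?_
      have : χ =ᶠ[𝓝 (Y.logr K x)] fun _ => 0 := by
        filter_upwards [gt_mem_nhds (not_le.1 hlt)] with t ht
        exact Real.smoothTransition.zero_of_nonpos
          (div_nonpos_of_nonpos_of_nonneg (by linarith) hba.le)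
      rw [this.deriv_eq]; simp
    · by_contra hlt
      refine hne ?_
      have : χ =ᶠ[𝓝 (Y.logr K x)] fun _ => 1 := by
        filter_upwards [lt_mem_nhds (not_le.1 hlt)] with t ht
        refine Real.smoothTransition.one_of_one_le ?_
        rw [le_div_iff₀ hba]; linarith
      rw [this.deriv_eq]; simp
  · exact ⟨0, le_rfl, fun v => by rw [hz 1 (hf.eventually_cut_eq_one hab h) v, zero_mul],
      fun h => absurd rfl h⟩

lemma cut_pos_iff {a b : ℝ} (hab : a < b) (x : W) : 0 < Y.cut K a b x ↔ Y.flow (-a) x ∉ K := by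
  constructor
  · intro h h'
    rw [cut_eq_zero h'] at h
    exact lt_irrefl _ h
  · intro h
    by_cases h2 : Y.flow (-b) x ∈ interior K
    · have hc : x ∈ Y.collar K :=
        hf.mem_collar_of_exit (interior_subset h2) fun h' => h (interior_subset h')
      rw [hf.cut_eq_of_collar hab hc]
      rw [hf.flow_mem_iff hc] at h
      exact Real.smoothTransition.pos_of_pos (div_pos (by linarith) (by linarith))
    · rw [hf.cut_eq_one hab h2]; exact one_pos

end IsDefining

end LiouvilleManifold

end Cutoff

/-! ### The rescaled Hamiltonian -/

section Rescaled

variable {E : Type*} [NormedAddCommGroup E] [NormedSpace ℝ E] [FiniteDimensional ℝ E]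
variable {W : Type*} [TopologicalSpace W] [T2Space W] [ChartedSpace E W]
  [IsManifold 𝓘(ℝ, E) ∞ W]

open LiouvilleManifold

namespace TargetData

variable {Y : LiouvilleManifold E W} (V : TargetData Y)

lemma mem_MinR_iff (ρ : ℝ) (x : W) : x ∈ V.MinR ρ ↔ Y.flow (-Real.log ρ) x ∈ V.Min := by
  constructor
  · rintro ⟨m, hm, rfl⟩
    rwa [LiouvilleManifold.ψ, Y.isFlow.neg_cancel]
  · intro h
    exact ⟨_, h, Y.isFlow.cancel_neg _ _⟩

lemma HR_of_mem {ρ : ℝ} {x : W} (h : Y.flow (-Real.log ρ) x ∈ V.Min) :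
    V.HR ρ x = ρ * V.H (Y.flow (-Real.log ρ) x) := by
  rw [HR, if_pos ((V.mem_MinR_iff ρ x).2 h), LiouvilleManifold.ψ, Real.log_inv]

variable {f : W → ℝ} (hf : Y.IsDefining V.Min f)
include hf

lemma radius_eq {x : W} (hx : x ∈ Y.collar V.Min) : V.radius x = Real.exp (Y.logr V.Min x) := by
  have hex : ∃ r : ℝ, 0 < r ∧ ∃ y ∈ frontier V.Min, Y.ψ r y = x :=
    ⟨Real.exp (Y.logr V.Min x), Real.exp_pos _, _, hf.flow_neg_logr hx, by
      rw [LiouvilleManifold.ψ, Real.log_exp, Y.isFlow.cancel_neg]⟩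
  rw [radius, dif_pos hex]
  obtain ⟨h1, y, hy, hxy⟩ := hex.choose_spec
  have h2 : Y.logr V.Min x = Real.log hex.choose := by
    conv_lhs => rw [← hxy]
    exact hf.logr_flow hy _
  rw [h2, Real.exp_log h1]

lemma HR_eq_exp {ρ : ℝ} {x : W} (hx : x ∈ Y.collar V.Min) (h1 : Real.log ρ < Y.logr V.Min x)
    (h2 : Y.logr V.Min x ≤ 0) : V.HR ρ x = Real.exp (Y.logr V.Min x) := by
  rw [HR, if_neg, if_pos ((hf.mem_iff hx).2 h2), V.radius_eq hf hx]
  rw [mem_MinR_iff, hf.flow_mem_iff hx]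
  exact not_le.2 h1

lemma HR_eq_H {ρ : ℝ} (hρ : ρ ∈ Ioo (0 : ℝ) 1) {x : W} (hx : x ∉ V.Min) : V.HR ρ x = V.H x := by
  rw [HR, if_neg, if_neg hx]
  rw [mem_MinR_iff]
  intro h
  refine hx ?_
  have := hf.flow_mem_of_nonpos h (t := Real.log ρ) (Real.log_neg hρ.1 hρ.2).le
  rwa [Y.isFlow.cancel_neg] at this

lemma contMDiffAt_exp_logr {x : W} (hx : x ∈ Y.collar V.Min) :
    ContMDiffAt 𝓘(ℝ, E) 𝓘(ℝ, ℝ) ∞ (fun x => Real.exp (Y.logr V.Min x)) x :=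
  Real.contDiff_exp.contMDiff.contMDiffAt.comp x (hf.contMDiffAt_logr hx)

lemma df_exp_logr {x : W} (hx : x ∈ Y.collar V.Min) (v : E) :
    df (fun x => Real.exp (Y.logr V.Min x)) x v =
      Real.exp (Y.logr V.Min x) * df (Y.logr V.Min) x v := by
  rw [df_comp_real (hf.mdiff_logr hx) Real.differentiableAt_exp, Real.deriv_exp]

/-- The Hamiltonian and the radial coordinate agree to first order along the boundary. -/
lemma H_first_order {y : W} (hy : y ∈ frontier V.Min) : V.H y = Real.exp (Y.logr V.Min y) ∧
    ∀ v : E, df V.H y v = df (fun x => Real.exp (Y.logr V.Min x)) y v := by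
  rw [hf.logr_frontier hy, Real.exp_zero]
  constructor
  · have := V.H_dividing y hy 0
    simp only [iteratedDeriv_zero, ψ_one] at this
    linarith
  · intro v
    rw [V.df_exp_logr hf (hf.frontier_subset_collar hy), hf.logr_frontier hy, Real.exp_zero, one_mul]
    exact V.normalized_Min.df_eq hf V.smooth_H hy v

/-- The rescaled Hamiltonian is `C¹` on the outer part of the collar, since `H` and the radial coordinate
`r` agree to first order along `r = 1`: the difference `HR ρ - r` is glued from `H - r` and zero. -/
lemma contMDiffAt_HR_collar {ρ : ℝ} (hρ : ρ ∈ Ioo (0 : ℝ) 1) {x : W} (hx : x ∈ Y.collar V.Min)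
    (h1 : Real.log ρ < Y.logr V.Min x) :
    ContMDiffAt 𝓘(ℝ, E) 𝓘(ℝ, ℝ) 1 (V.HR ρ) x ∧ (Y.logr V.Min x ≤ 0 → ∀ v : E,
      df (V.HR ρ) x v = Real.exp (Y.logr V.Min x) * df (Y.logr V.Min) x v) := by
  have hlc : ∀ x ∈ Y.collar V.Min, ContinuousAt (Y.logr V.Min) x := fun x hx =>
    (hf.contMDiffAt_logr hx).continuousAt
  set e : W → ℝ := fun x => Real.exp (Y.logr V.Min x) with he
  set U : Set W := Y.collar V.Min ∩ {x | x ∈ Y.collar V.Min → Real.log ρ < Y.logr V.Min x} with hU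
  have hUo : IsOpen U := by
    rw [isOpen_iff_mem_nhds]
    rintro x ⟨hx, hx'⟩
    filter_upwards [hf.isOpen_collar.mem_nhds hx, (hlc x hx).eventually (lt_mem_nhds (hx' hx))]
      with y hy hy'
    exact ⟨hy, fun _ => hy'⟩
  have hxU : x ∈ U := ⟨hx, fun _ => h1⟩
  have hes : ∀ x ∈ Y.collar V.Min, MDifferentiableAt 𝓘(ℝ, E) 𝓘(ℝ, ℝ) e x := fun x hx =>
    (V.contMDiffAt_exp_logr hf hx).mdifferentiableAt (by simp)
  have hHs : ∀ x, MDifferentiableAt 𝓘(ℝ, E) 𝓘(ℝ, ℝ) V.H x := fun x =>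
    V.smooth_H.contMDiffAt.mdifferentiableAt (by simp)
  have hout : ∀ y ∈ Y.collar V.Min, 0 < Y.logr V.Min y → V.HR ρ y = V.H y := fun y hy hy' =>
    V.HR_eq_H hf hρ fun h => not_lt.2 ((hf.mem_iff hy).1 h) hy'
  -- inside the shell `HR ρ` is the radial coordinate `e`, outside `Min` it is `H`
  have key := contMDiffAt_one_of_glue (f := fun x => V.HR ρ x - e x) (g := fun x => V.H x - e x) hUo
    (fun y hy => (V.smooth_H.contMDiffAt.sub (V.contMDiffAt_exp_logr hf hy.1)).contMDiffWithinAt)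
    (fun y hy => by
      rcases le_or_gt (Y.logr V.Min y) 0 with h | h
      · right; simp only [he, V.HR_eq_exp hf hy.1 (hy.2 hy.1) h, sub_self]
      · left; rw [hout y hy.1 h])
    (fun y hy => by
      rcases lt_trichotomy (Y.logr V.Min y) 0 with h | h | h
      · right; left
        filter_upwards [hUo.mem_nhds hy, (hlc y hy.1).eventually (gt_mem_nhds h)] with z hz hz'
        simp only [he, V.HR_eq_exp hf hz.1 (hz.2 hz.1) hz'.le, sub_self]
      · right; right
        have hyf := (hf.mem_frontier_iff hy.1).2 h
        refine ⟨sub_eq_zero.2 (V.H_first_order hf hyf).1, ContinuousLinearMap.ext fun v => ?_⟩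
        rw [df_sub' (hHs y) (hes y hy.1), (V.H_first_order hf hyf).2 v]
        exact sub_self _
      · left
        filter_upwards [hUo.mem_nhds hy, (hlc y hy.1).eventually (lt_mem_nhds h)] with z hz hz'
        rw [hout z hz.1 hz']) hxU
  have hsum : V.HR ρ = fun x => (V.HR ρ x - e x) + e x := by funext x; ring
  refine ⟨?_, fun h v => ?_⟩
  · rw [hsum]
    exact key.1.add ((V.contMDiffAt_exp_logr hf hx).of_le (by simp))
  · rw [← V.df_exp_logr hf hx]
    rcases h.lt_or_eq with h | h
    · have : V.HR ρ =ᶠ[𝓝 x] e := by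
        filter_upwards [hUo.mem_nhds hxU, (hlc x hx).eventually (gt_mem_nhds h)] with z hz hz'
        exact V.HR_eq_exp hf hz.1 (hz.2 hz.1) hz'.le
      rw [df_congr this]
    · have hyf := (hf.mem_frontier_iff hx).2 h
      have h0 := key.2 (sub_eq_zero.2 (V.H_first_order hf hyf).1) (ContinuousLinearMap.ext fun v => by
        rw [df_sub' (hHs x) (hes x hx), (V.H_first_order hf hyf).2 v]
        exact sub_self _)
      rw [hsum, df_add' (key.1.mdifferentiableAt (by simp)) (hes x hx), h0]
      exact zero_add _

lemma HR_eventually_eq_H {ρ : ℝ} (hρ : ρ ∈ Ioo (0 : ℝ) 1) {x : W} (hx : x ∉ V.Min) :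
    V.HR ρ =ᶠ[𝓝 x] V.H := by
  filter_upwards [hf.isClosed.isOpen_compl.mem_nhds hx] with y hy
  exact V.HR_eq_H hf hρ hy

/-- The rescaled Hamiltonian is continuously differentiable outside the shrunk subdomain. -/
lemma contMDiffAt_HR {ρ : ℝ} (hρ : ρ ∈ Ioo (0 : ℝ) 1) {x : W} (hx : x ∉ V.MinR ρ) :
    ContMDiffAt 𝓘(ℝ, E) 𝓘(ℝ, ℝ) 1 (V.HR ρ) x := by
  by_cases h : x ∈ V.Min
  · rw [mem_MinR_iff] at hx
    have hc : x ∈ Y.collar V.Min := hf.mem_collar_of_exit (s := 0) (by rwa [Y.isFlow.zero])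
      fun h' => hx (interior_subset h')
    refine (V.contMDiffAt_HR_collar hf hρ hc ?_).1
    rw [hf.flow_mem_iff hc] at hx
    exact not_le.1 hx
  · exact (V.smooth_H.contMDiffAt.of_le (by simp)).congr_of_eventuallyEq (V.HR_eventually_eq_H hf hρ h)

lemma HR_pos {ρ : ℝ} (hρ : ρ ∈ Ioo (0 : ℝ) 1) {x : W} (hx : x ∈ V.M) (hx' : x ∉ V.MinR ρ) :
    0 < V.HR ρ x := by
  by_cases h : x ∈ V.Min
  · rw [mem_MinR_iff] at hx'
    have hc : x ∈ Y.collar V.Min := hf.mem_collar_of_exit (s := 0) (by rwa [Y.isFlow.zero])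
      fun h' => hx' (interior_subset h')
    rw [hf.flow_mem_iff hc] at hx'
    rw [V.HR_eq_exp hf hc (not_le.1 hx') ((hf.mem_iff hc).1 h)]
    exact Real.exp_pos _
  · rw [V.HR_eq_H hf hρ h]
    exact V.H_pos x hx

/-- The differential of the rescaled Hamiltonian on the shrunk subdomain. Points of the boundary
are included since `H` continues there to first order by the radial coordinate. -/
lemma df_HR_flow {ρ : ℝ} (hρ : ρ ∈ Ioo (0 : ℝ) 1) {x : W} (hx : x ∈ V.Min) (v : E) :
    df (V.HR ρ) (Y.flow (Real.log ρ) x) (dd (Y.flow (Real.log ρ)) x v) = ρ * df V.H x v := by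
  set l := Real.log ρ with hl
  have hl0 : l < 0 := Real.log_neg hρ.1 hρ.2
  have hlc : ∀ x ∈ Y.collar V.Min, ContinuousAt (Y.logr V.Min) x := fun x hx =>
    (hf.contMDiffAt_logr hx).continuousAt
  set e : W → ℝ := fun x => Real.exp (Y.logr V.Min x) with he
  have hHs : ∀ x, MDifferentiableAt 𝓘(ℝ, E) 𝓘(ℝ, ℝ) V.H x := fun x =>
    V.smooth_H.contMDiffAt.mdifferentiableAt (by simp)
  -- the function which is `H` on `Min`, and the radial coordinate outside
  classical
  set G : W → ℝ := fun x => if x ∈ V.Min then V.H x else e x with hG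
  have hGd : MDifferentiableAt 𝓘(ℝ, E) 𝓘(ℝ, ℝ) G x ∧ ∀ v : E, df G x v = df V.H x v := by
    by_cases hxi : x ∈ interior V.Min
    · have : G =ᶠ[𝓝 x] V.H := by
        filter_upwards [isOpen_interior.mem_nhds hxi] with y hy
        exact if_pos (interior_subset hy)
      exact ⟨(hHs x).congr_of_eventuallyEq this, fun v => by rw [df_congr this]⟩
    · have hxf : x ∈ frontier V.Min := by rw [hf.isClosed.frontier_eq]; exact ⟨hx, hxi⟩
      have hxc := hf.frontier_subset_collar hxf
      have hes : ∀ x ∈ Y.collar V.Min, MDifferentiableAt 𝓘(ℝ, E) 𝓘(ℝ, ℝ) e x := fun x hx =>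
        (V.contMDiffAt_exp_logr hf hx).mdifferentiableAt (by simp)
      have hz : ∀ y ∈ frontier V.Min, df (E := E) (fun x => e x - V.H x) y = 0 := fun y hy =>
        ContinuousLinearMap.ext fun v => by
          rw [df_sub' (hes y (hf.frontier_subset_collar hy)) (hHs y), (V.H_first_order hf hy).2 v]
          exact sub_self _
      have key := contMDiffAt_one_of_glue (f := fun x => G x - V.H x) (g := fun x => e x - V.H x)
        hf.isOpen_collar
        (fun y hy => ((V.contMDiffAt_exp_logr hf hy).sub V.smooth_H.contMDiffAt).contMDiffWithinAt)
        (fun y hy => by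
          by_cases h : y ∈ V.Min
          · right; simp [hG, h]
          · left; simp [hG, h])
        (fun y hy => by
          rcases lt_trichotomy (Y.logr V.Min y) 0 with h | h | h
          · right; left
            filter_upwards [hf.isOpen_collar.mem_nhds hy, (hlc y hy).eventually (gt_mem_nhds h)]
              with z hz hz'
            simp [hG, (hf.mem_iff hz).2 hz'.le]
          · right; right
            have hyf := (hf.mem_frontier_iff hy).2 h
            exact ⟨sub_eq_zero.2 (V.H_first_order hf hyf).1.symm, hz y hyf⟩
          · left
            filter_upwards [hf.isOpen_collar.mem_nhds hy, (hlc y hy).eventually (lt_mem_nhds h)]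
              with z hz hz'
            have : z ∉ V.Min := fun h => not_lt.2 ((hf.mem_iff hz).1 h) hz'
            simp [hG, this]) hxc
      have hsum : G = fun x => (G x - V.H x) + V.H x := by funext x; ring
      have hd := key.1.mdifferentiableAt (n := 1) (by simp)
      constructor
      · rw [hsum]; exact hd.add (hHs x)
      · intro v
        have h0 := key.2 (sub_eq_zero.2 (V.H_first_order hf hxf).1.symm) (hz x hxf)
        rw [hsum, df_add' hd (hHs x), h0]
        simp
  -- `HR ρ ∘ flow l` equals `ρ • G` also on the shell, as the radial coordinate scales by `ρ` under the flow
  have hev : (fun y => V.HR ρ (Y.flow l y)) =ᶠ[𝓝 x] fun y => ρ * G y := by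
    have hc := (Y.isFlow.contMDiff l).continuous.continuousAt (x := x)
    by_cases hxi : x ∈ interior V.Min
    · filter_upwards [isOpen_interior.mem_nhds hxi] with y hy
      have hy' := interior_subset hy
      rw [HR_of_mem _ (by rwa [← hl, Y.isFlow.neg_cancel]), ← hl, Y.isFlow.neg_cancel]
      simp [hG, hy']
    · have hxf : x ∈ frontier V.Min := by rw [hf.isClosed.frontier_eq]; exact ⟨hx, hxi⟩
      have hxc := hf.frontier_subset_collar hxf
      have h0 := hf.logr_frontier hxf
      filter_upwards [hf.isOpen_collar.mem_nhds hxc, (hlc x hxc).eventually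
        (gt_mem_nhds (show Y.logr V.Min x < -l by rw [h0]; linarith))] with y hy hy'
      by_cases hyM : y ∈ V.Min
      · rw [HR_of_mem _ (by rwa [← hl, Y.isFlow.neg_cancel]), ← hl, Y.isFlow.neg_cancel]
        simp [hG, hyM]
      · have h1 : 0 < Y.logr V.Min y := by rw [hf.mem_iff hy] at hyM; exact not_le.1 hyM
        have h2 := hf.logr_flow_collar hy l
        rw [V.HR_eq_exp hf (hf.flow_mem_collar hy l) (by rw [h2]; linarith) (by rw [h2]; linarith), h2,
          Real.exp_add, hl, Real.exp_log hρ.1]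
        simp [hG, hyM, he, mul_comm]
  have hflow : V.HR ρ =ᶠ[𝓝 (Y.flow l x)] fun y => ρ * G (Y.flow (-l) y) := by
    have hc := (Y.isFlow.contMDiff (-l)).continuous.tendsto (Y.flow l x)
    rw [Y.isFlow.neg_cancel] at hc
    filter_upwards [hc.eventually hev] with y hy
    rwa [Y.isFlow.cancel_neg] at hy
  have hmd : MDifferentiableAt 𝓘(ℝ, E) 𝓘(ℝ, ℝ) (fun y => G (Y.flow (-l) y)) (Y.flow l x) :=
    MDifferentiableAt.comp (Y.flow l x) (g := G) (by rw [Y.isFlow.neg_cancel]; exact hGd.1)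
      (Y.mdiff_flow (-l) _)
  have hsm : ∀ w : E, df (fun y => ρ * G (Y.flow (-l) y)) (Y.flow l x) w =
      ρ * df (fun y => G (Y.flow (-l) y)) (Y.flow l x) w := fun w =>
    congrArg (fun L : E →L[ℝ] ℝ => L w) (const_smul_mfderiv hmd ρ)
  rw [df_congr hflow, hsm, df_comp (Y.mdiff_flow (-l) _) (by rw [Y.isFlow.neg_cancel]; exact hGd.1),
    Y.isFlow.neg_cancel, Y.dd_neg_cancel, hGd.2]

/-- The rescaled Hamiltonian vector field on the shrunk subdomain. -/
lemma X_HR_flow {ρ : ℝ} (hρ : ρ ∈ Ioo (0 : ℝ) 1) {x : W} (hx : x ∈ V.Min) :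
    vv (Y.X (V.HR ρ)) (Y.flow (Real.log ρ) x) =
      dd (Y.flow (Real.log ρ)) x (vv (Y.X V.H) x) := by
  refine Y.eq_of_om (x := Y.flow (Real.log ρ) x) fun w => ?_
  obtain ⟨w', rfl⟩ : ∃ w' : E, dd (Y.flow (Real.log ρ)) x w' = w := ⟨_, Y.dd_cancel_neg _ _ _⟩
  rw [Y.om_X, V.df_HR_flow hf hρ hx, Y.om_flow, Real.exp_log hρ.1, Y.om_X]
  ring

end TargetData

end Rescaled

/-! ### The rescaled Lagrangian as a boundary condition -/

section Boundary

variable {E : Type*} [NormedAddCommGroup E] [NormedSpace ℝ E] [FiniteDimensional ℝ E]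
variable {W : Type*} [TopologicalSpace W] [T2Space W] [ChartedSpace E W]
  [IsManifold 𝓘(ℝ, E) ∞ W]

open LiouvilleManifold

/-- Moving a curve by a time-dependent amount along the Liouville flow. -/
lemma LiouvilleManifold.vel_flow_graph (Y : LiouvilleManifold E W) {c : ℝ → W}
    (hc : ContMDiff 𝓘(ℝ, ℝ) 𝓘(ℝ, E) ∞ c) {τ : ℝ → ℝ} (hτ : ContDiff ℝ ∞ τ) (t : ℝ) :
    vel (E := E) (fun t => Y.flow (τ t) (c t)) univ t 1 =
      deriv τ t • vv Y.Z (Y.flow (τ t) (c t)) + dd (Y.flow (τ t)) (c t) (vel (E := E) c univ t 1) := by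
  set u : ℝ × ℝ → W := fun p => Y.flow p.1 (c p.2) with hu
  have hus : ContMDiff 𝓘(ℝ, ℝ × ℝ) 𝓘(ℝ, E) ∞ u :=
    Y.isFlow.smooth.comp (contDiff_fst.contMDiff.prodMk (hc.comp contDiff_snd.contMDiff))
  have hτd : HasDerivAt τ (deriv τ t) t := (hτ.differentiable (by simp) t).hasDerivAt
  have hg := hτd.prodMk (hasDerivAt_id t)
  have h := vel_comp (E := E) (u := u) (g := fun t : ℝ => (τ t, id t)) (s := univ) (t := univ)
    (q := t) (vel_global_mdiff hus _) hg.differentiableAt.differentiableWithinAt (mapsTo_univ _ _)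
    uniqueDiffWithinAt_univ 1
  rw [fderivWithin_univ, fderiv_apply_one_eq_deriv, hg.deriv] at h
  refine h.trans ?_
  have hsplit : ((deriv τ t, 1) : ℝ × ℝ) = (deriv τ t, 0) + (0, 1) := by simp
  rw [hsplit, map_add]
  congr 1
  · rw [LiouvilleManifold.vel_prod hus]
    congr 1
    exact Y.isFlow.vel_time (c (id t)) (τ t)
  · have hi : HasDerivAt (fun s : ℝ => (τ t, s)) ((0 : ℝ), (1 : ℝ)) t :=
      (hasDerivAt_const t (τ t)).prodMk (hasDerivAt_id t)
    have h := vel_comp (E := E) (u := u) (g := fun s : ℝ => (τ t, s)) (s := univ) (t := univ)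
      (q := t) (vel_global_mdiff hus _) hi.differentiableAt.differentiableWithinAt (mapsTo_univ _ _)
      uniqueDiffWithinAt_univ 1
    rw [fderivWithin_univ, fderiv_apply_one_eq_deriv, hi.deriv] at h
    refine h.symm.trans ?_
    exact vel_map (E := E) (u := c) (s := univ) (z := t) (Ψ := Y.flow (τ t))
      (Y.mdiff_flow _ _) uniqueDiffWithinAt_univ (vel_global_mdiff hc _) 1

lemma deriv_comp_vel {g : W → ℝ} {c : ℝ → W} (hc : ContMDiff 𝓘(ℝ, ℝ) 𝓘(ℝ, E) ∞ c) {t : ℝ}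
    (hg : MDifferentiableAt 𝓘(ℝ, E) 𝓘(ℝ, ℝ) g (c t)) :
    deriv (fun t => g (c t)) t = df g (c t) (vel (E := E) c univ t 1) := by
  have h := fderivWithin_comp_vel (E := E) (f := g) (u := c) (s := univ) (z := t) hg
    uniqueDiffWithinAt_univ (vel_global_mdiff hc t) 1
  rwa [fderivWithin_univ, fderiv_apply_one_eq_deriv] at h

namespace TargetData

variable {Y : LiouvilleManifold E W} (V : TargetData Y)

lemma fm_vel_of_mem_L {c : ℝ → W} (hc : ContMDiff 𝓘(ℝ, ℝ) 𝓘(ℝ, E) ∞ c) (h : ∀ t, c t ∈ V.L) :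
    fm Y.θ (c 0) (vel (E := E) c univ 0 1) = df V.h (c 0) (vel (E := E) c univ 0 1) := by
  have hv : (vel c univ 0 1 : E) ∈ tangentTo (E := E) V.L (c 0) :=
    tangentTo_iff.2 ⟨c, hc, h, rfl, rfl⟩
  exact (V.dh (c 0) (h 0) _ hv).symm

variable {f : W → ℝ} (hf : Y.IsDefining V.Min f)
include hf

/-- Along the cone over the Legendrian submanifold `∂Lin` the Liouville form vanishes. -/
lemma fm_vel_of_mem_cone {c : ℝ → W} (hc : ContMDiff 𝓘(ℝ, ℝ) 𝓘(ℝ, E) ∞ c)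
    (hcol : ∀ t, c t ∈ Y.collar V.Min) (h : ∀ t, Y.flow (-Y.logr V.Min (c t)) (c t) ∈ V.L) :
    fm Y.θ (c 0) (vel (E := E) c univ 0 1) = 0 := by
  have hτ : ContDiff ℝ ∞ fun t => -Y.logr V.Min (c t) := by
    refine ContDiff.neg (contDiff_iff_contDiffAt.2 fun t => ?_)
    rw [← contMDiffAt_iff_contDiffAt]
    exact (hf.contMDiffAt_logr (hcol t)).comp t hc.contMDiffAt
  set p : ℝ → W := fun t => Y.flow (-Y.logr V.Min (c t)) (c t) with hp
  have hps : ContMDiff 𝓘(ℝ, ℝ) 𝓘(ℝ, E) ∞ p := by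
    rw [← contMDiffOn_univ]
    exact contMDiff_prodSpace Y.isFlow hτ.contDiffOn hc.contMDiffOn
  have h1 := V.fm_vel_of_mem_L hps h
  have h2 : df V.h (p 0) (vel (E := E) p univ 0 1) = 0 := by
    rw [← deriv_comp_vel hps (V.smooth_h.contMDiffAt.mdifferentiableAt (by simp))]
    have : (fun t => V.h (p t)) = fun _ => 0 := funext fun t =>
      V.h_boundary _ (h t) (Or.inr (hf.flow_neg_logr (hcol t)))
    rw [this]; simp
  rw [h2, hp, Y.vel_flow_graph hc hτ 0, map_add, map_smul, Y.fm_Z, smul_zero, zero_add,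
    Y.fm_flow] at h1
  exact (mul_eq_zero.1 h1).resolve_left (Real.exp_ne_zero _)

lemma MinR_subset_interior {ρ : ℝ} (hρ : ρ ∈ Ioo (0 : ℝ) 1) : V.MinR ρ ⊆ interior V.Min := by
  rintro _ ⟨m, hm, rfl⟩
  exact hf.flow_mem_interior_of_neg hm (Real.log_neg hρ.1 hρ.2)

/-- A point of the rescaled Lagrangian lies in the shrunk copy of `Lin`, on the cone, or outside `Min`. -/
lemma LR_cases {ρ : ℝ} (hρ : ρ ∈ Ioo (0 : ℝ) 1) {x : W} (hx : x ∈ V.LR ρ) :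
    x ∈ Y.ψ ρ '' V.Lin ∨ (x ∈ Y.collar V.Min ∧ Real.log ρ < Y.logr V.Min x ∧
      Y.logr V.Min x ≤ 0 ∧ Y.flow (-Y.logr V.Min x) x ∈ V.L) ∨ (x ∈ V.L ∧ x ∉ V.Min) := by
  rcases hx with (hx | ⟨r, hr, y, hy, rfl⟩) | hx
  · exact Or.inl hx
  · right; left
    have hyc := hf.frontier_subset_collar hy.2
    have hr0 : 0 < r := hρ.1.trans hr.1
    have h1 : Y.logr V.Min (Y.ψ r y) = Real.log r := hf.logr_flow hy.2 _
    refine ⟨hf.flow_mem_collar hyc _, ?_, ?_, ?_⟩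
    · rw [h1]; exact Real.log_lt_log hρ.1 hr.1
    · rw [h1]; exact (Real.log_neg hr0 hr.2).le
    · rw [h1, LiouvilleManifold.ψ, Y.isFlow.neg_cancel]; exact hy.1
  · by_cases h : x ∈ V.Min
    · right; left
      have hxf : x ∈ frontier V.Min := by rw [hf.isClosed.frontier_eq]; exact ⟨h, hx.2⟩
      refine ⟨hf.frontier_subset_collar hxf, ?_, ?_, ?_⟩
      · rw [hf.logr_frontier hxf]; exact Real.log_neg hρ.1 hρ.2
      · rw [hf.logr_frontier hxf]
      · rw [hf.logr_frontier hxf, neg_zero, Y.isFlow.zero]; exact hx.1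
    · exact Or.inr (Or.inr ⟨hx.1, h⟩)

/-- The primitive `h` vanishes on the part of `L` in an outer collar of `Min`, whose width is uniform because
the boundary of `Min` is compact. -/
lemma exists_collar_h_eq_zero : ∃ b : ℝ, 0 < b ∧ ∀ x ∈ V.L, x ∈ V.M → x ∉ V.Min →
    Y.flow (-b) x ∈ V.Min → V.h x = 0 := by
  obtain ⟨N, hN, hNs, hh⟩ := V.exists_h_eq_zero
  have hcF : IsCompact (frontier V.Min) := V.domain_Min.1.of_isClosed_subset isClosed_frontier
    hf.isClosed.frontier_subset
  obtain ⟨u, v, hu, -, h0u, hv, huv⟩ := generalized_tube_lemma (isCompact_singleton (x := (0 : ℝ)))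
    hcF (n := (fun p : ℝ × W => Y.flow p.1 p.2) ⁻¹' N) (hN.preimage Y.isFlow.continuous) (by
      rintro ⟨t, y⟩ ⟨ht, hy⟩
      rw [mem_singleton_iff] at ht
      simp only at ht hy
      subst ht
      simpa [Y.isFlow.zero] using hNs (Or.inr hy))
  obtain ⟨ε, hε, hB⟩ := Metric.isOpen_iff.1 hu 0 (h0u rfl)
  refine ⟨ε / 2, half_pos hε, fun x hxL hxM hxMin hxb => ?_⟩
  have hc : x ∈ Y.collar V.Min := hf.mem_collar_of_exit hxb (t := 0) (by
    rw [Y.isFlow.zero]; exact fun h => hxMin (interior_subset h))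
  rw [hf.flow_mem_iff hc] at hxb
  have h0 : 0 < Y.logr V.Min x := by rw [hf.mem_iff hc] at hxMin; exact not_le.1 hxMin
  have hm : (Y.logr V.Min x, Y.flow (-Y.logr V.Min x) x) ∈ u ×ˢ v := ⟨hB (by
    rw [mem_ball_zero_iff, Real.norm_eq_abs, abs_of_pos h0]; linarith), hv (hf.flow_neg_logr hc)⟩
  have hxN : x ∈ N := by simpa [Y.isFlow.cancel_neg] using huv hm
  exact hh x ⟨hxL, hxN⟩ hxM fun h => hxMin (interior_subset h)

end TargetData

variable {Y : LiouvilleManifold E W}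

/-- The primitive `h`, cut off so as to vanish near `Min`. -/
def TargetData.hcut (V : TargetData Y) (b : ℝ) (x : W) : ℝ := Y.cut V.Min (b / 2) b x * V.h x

namespace TargetData

variable (V : TargetData Y) {f : W → ℝ} (hf : Y.IsDefining V.Min f)
include hf

lemma contMDiff_hcut {b : ℝ} (hb : 0 < b) : ContMDiff 𝓘(ℝ, E) 𝓘(ℝ, ℝ) ∞ (V.hcut b) :=
  (hf.contMDiff_cut (half_lt_self hb)).mul V.smooth_h

lemma hcut_eventually_eq_zero {b : ℝ} (hb : 0 < b) {x : W} (hx : x ∈ V.Min) :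
    V.hcut b =ᶠ[𝓝 x] fun _ => 0 := by
  filter_upwards [hf.eventually_cut_eq_zero (a := b / 2) (b := b)
    (hf.flow_mem_interior_of_neg hx (t := -(b / 2)) (by linarith))] with y hy
  rw [hcut, hy, zero_mul]

lemma df_hcut_of_mem {b : ℝ} (hb : 0 < b) {x : W} (hx : x ∈ V.Min) : df (E := E) (V.hcut b) x = 0 := by
  rw [df_congr (V.hcut_eventually_eq_zero hf hb hx)]
  exact mfderiv_const (c := (0 : ℝ)) (x := x) (I := 𝓘(ℝ, E)) (I' := 𝓘(ℝ, ℝ))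

lemma hcut_eq {b : ℝ} (hb : 0 < b) (hbh : ∀ x ∈ V.L, x ∈ V.M → x ∉ V.Min →
    Y.flow (-b) x ∈ V.Min → V.h x = 0) {x : W} (hxL : x ∈ V.L) (hxM : x ∈ V.M) (hx : x ∉ V.Min) :
    V.hcut b x = V.h x := by
  by_cases h : Y.flow (-b) x ∈ V.Min
  · rw [hcut, hbh x hxL hxM hx h, mul_zero]
  · rw [hcut, hf.cut_eq_one (half_lt_self hb) fun h' => h (interior_subset h'), one_mul]

/-- On curves in the rescaled Lagrangian, the cut off form `χ θ` agrees with the differential of the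
cut off primitive. -/
lemma cut_mul_fm_vel {ρ : ℝ} (hρ : ρ ∈ Ioo (0 : ℝ) 1) {a a' : ℝ} (ha : Real.log ρ ≤ a) (haa : a < a')
    (ha' : a' < 0) {b : ℝ} (hb : 0 < b) (hbh : ∀ x ∈ V.L, x ∈ V.M → x ∉ V.Min →
    Y.flow (-b) x ∈ V.Min → V.h x = 0) {c : ℝ → W} (hc : ContMDiff 𝓘(ℝ, ℝ) 𝓘(ℝ, E) ∞ c)
    (hcL : ∀ t, c t ∈ V.LR ρ) (hcM : ∀ t, c t ∈ V.M) :
    Y.cut V.Min a a' (c 0) * fm Y.θ (c 0) (vel (E := E) c univ 0 1) =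
      df (V.hcut b) (c 0) (vel (E := E) c univ 0 1) := by
  have hcc : Continuous c := hc.continuous
  -- the part of the curve outside `Min` lies in `L`
  have hout : ∀ t, c t ∉ V.Min → c t ∈ V.L := by
    intro t ht
    rcases V.LR_cases hf hρ (hcL t) with h | h | h
    · refine absurd (V.MinR_subset_interior hf hρ ?_) fun h' => ht (interior_subset h')
      exact image_mono inter_subset_right h
    · exact absurd ((hf.mem_iff h.1).2 h.2.2.1) ht
    · exact h.1
  have hhd : ∀ x, MDifferentiableAt 𝓘(ℝ, E) 𝓘(ℝ, ℝ) V.h x := fun x =>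
    V.smooth_h.contMDiffAt.mdifferentiableAt (by simp)
  have htd : ∀ x, MDifferentiableAt 𝓘(ℝ, E) 𝓘(ℝ, ℝ) (V.hcut b) x := fun x =>
    (V.contMDiff_hcut hf hb).contMDiffAt.mdifferentiableAt (by simp)
  -- outside `Min` the form `θ` and the differential of the cut off primitive agree along the curve
  have hthe : ∀ t, c t ∉ V.Min →
      fm Y.θ (c t) (vel (E := E) c univ t 1) = df (V.hcut b) (c t) (vel (E := E) c univ t 1) := by
    intro t ht
    have hev : ∀ᶠ s in 𝓝 t, c s ∉ V.Min :=
      hcc.continuousAt.eventually (hf.isClosed.isOpen_compl.mem_nhds ht)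
    obtain ⟨c', hc', h0, hv, hP, -⟩ := exists_reparam hc (P := fun x => x ∉ V.Min ∧ x ∈ V.L ∧ x ∈ V.M)
      (hev.mono fun s hs => ⟨hs, hout s hs, hcM s⟩)
    have h1 := V.fm_vel_of_mem_L hc' fun t => (hP t).2.1
    have h2 := deriv_comp_vel hc' (t := 0) (hhd _)
    have h3 := deriv_comp_vel hc' (t := 0) (htd _)
    have h4 : (fun t => V.hcut b (c' t)) = fun t => V.h (c' t) := funext fun t =>
      V.hcut_eq hf hb hbh (hP t).2.1 (hP t).2.2 (hP t).1
    rw [h4, h2] at h3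
    rw [h0, hv] at h1 h3
    rw [h1, h3]
  -- along a piece of curve inside the cone over the Legendrian, `θ` vanishes
  have hcone : ∀ t, (∀ᶠ s in 𝓝 t, c s ∈ Y.collar V.Min ∧
      Y.flow (-Y.logr V.Min (c s)) (c s) ∈ V.L) → fm Y.θ (c t) (vel (E := E) c univ t 1) = 0 := by
    intro t hev
    obtain ⟨c', hc', h0, hv, hP, -⟩ := exists_reparam hc (P := fun x => x ∈ Y.collar V.Min ∧
      Y.flow (-Y.logr V.Min x) x ∈ V.L) hev
    have h1 := V.fm_vel_of_mem_cone hf hc' (fun t => (hP t).1) fun t => (hP t).2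
    rwa [h0, hv] at h1
  by_cases hMin : c 0 ∈ V.Min
  · rw [V.df_hcut_of_mem hf hb hMin, zero_apply]
    by_cases hlow : Y.flow (-a) (c 0) ∈ V.Min
    · rw [cut_eq_zero hlow, zero_mul]
    -- now `c 0` lies in the shell, where the Liouville form vanishes along the curve
    refine mul_eq_zero_of_right _ ?_
    have hcol : c 0 ∈ Y.collar V.Min := hf.mem_collar_of_exit (s := 0)
      (by rwa [Y.isFlow.zero]) fun h' => hlow (interior_subset h')
    have ha0 : a < Y.logr V.Min (c 0) := by rw [hf.flow_mem_iff hcol] at hlow; exact not_le.1 hlow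
    have hlc : ContinuousAt (fun t => Y.logr V.Min (c t)) 0 :=
      ContinuousAt.comp (f := c) (g := Y.logr V.Min) (hf.contMDiffAt_logr hcol).continuousAt hcc.continuousAt
    have hev : ∀ᶠ t in 𝓝 (0 : ℝ), c t ∈ Y.collar V.Min ∧ a < Y.logr V.Min (c t) ∧
        Y.logr V.Min (c t) < b / 2 :=
      Filter.Eventually.and (hcc.continuousAt.eventually (hf.isOpen_collar.mem_nhds hcol))
        (Filter.Eventually.and (hlc.eventually (lt_mem_nhds ha0)) (hlc.eventually (gt_mem_nhds (by
          have := (hf.mem_iff hcol).1 hMin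
          linarith))))
    have hin : ∀ t, c t ∈ Y.collar V.Min → a < Y.logr V.Min (c t) → Y.logr V.Min (c t) ≤ 0 →
        Y.flow (-Y.logr V.Min (c t)) (c t) ∈ V.L := by
      intro t h1 h2 h3
      rcases V.LR_cases hf hρ (hcL t) with h | h | h
      · have : c t ∈ V.MinR ρ := image_mono inter_subset_right h
        rw [mem_MinR_iff, hf.flow_mem_iff h1] at this
        linarith
      · exact h.2.2.2
      · exact absurd ((hf.mem_iff h1).2 h3) h.2
    have hgc : Continuous fun t => fm Y.θ (c t) (vel (E := E) c univ t 1) := by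
      have h1 := contDiffOn_pullForm Y.smooth_θ uniqueDiffOn_univ hc.contMDiffOn
      rw [contDiffOn_univ] at h1
      exact (h1.continuous).clm_apply continuous_const
    -- if `θ` does not vanish on the velocity at time `0`, neither does it at nearby times; as it does
    -- vanish just outside `Min`, the curve then stays inside the cone, where it vanishes as well
    by_contra hne
    have hev2 : ∀ᶠ t in 𝓝 (0 : ℝ), fm Y.θ (c t) (vel (E := E) c univ t 1) ≠ 0 :=
      hgc.continuousAt.eventually_ne hne
    refine hne (hcone 0 ?_)
    filter_upwards [hev, hev2] with t ht ht2
    refine ⟨ht.1, hin t ht.1 ht.2.1 ?_⟩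
    by_contra hpos
    have hpos' := not_le.1 hpos
    have hnm : c t ∉ V.Min := fun h => hpos ((hf.mem_iff ht.1).1 h)
    -- outside `Min`, near its boundary, the cut off primitive is zero
    refine ht2 ?_
    have hz := hf.eventually_cut_eq_zero (a := b / 2) (b := b)
      ((hf.flow_mem_interior_iff ht.1 (b / 2)).2 ht.2.2)
    have hz' : V.hcut b =ᶠ[𝓝 (c t)] fun _ => 0 := by
      filter_upwards [hz] with y hy
      rw [hcut, hy, zero_mul]
    rw [hthe t hnm, df_congr hz']
    exact congrArg (fun L : E →L[ℝ] ℝ => L (vel (E := E) c univ t 1))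
      (mfderiv_const (c := (0 : ℝ)) (x := c t) (I := 𝓘(ℝ, E)) (I' := 𝓘(ℝ, ℝ)))
  · rw [hf.cut_eq_one haa, one_mul, hthe 0 hMin]
    intro h
    have := hf.flow_mem_of_nonpos (interior_subset h) ha'.le
    rw [Y.isFlow.cancel_neg] at this
    exact hMin this

end TargetData

end Boundary

/-! ### Stokes' theorem for boxes and for the disc -/

section Stokes

open MeasureTheory

/-- The exterior derivative of a one-form on `ℂ`, evaluated on `(1, i)`. -/
def curl (b : ℂ → ℂ →L[ℝ] ℝ) (z : ℂ) : ℝ := fderiv ℝ b z 1 Complex.I - fderiv ℝ b z Complex.I 1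

lemma clm_complex_apply {G : Type*} [NormedAddCommGroup G] [NormedSpace ℝ G] (l : ℂ →L[ℝ] G) (v : ℂ) :
    l v = v.re • l 1 + v.im • l Complex.I := by
  conv_lhs => rw [show v = v.re • (1 : ℂ) + v.im • Complex.I from by
    simp]
  rw [map_add, map_smul, map_smul]

/-- The alternation of a bilinear form transforms under complex multiplication by the square of the
absolute value. -/
lemma alternate_mul (B : ℂ →L[ℝ] ℂ →L[ℝ] ℝ) (v : ℂ) :
    B v (v * Complex.I) - B (v * Complex.I) v =
      Complex.normSq v * (B 1 Complex.I - B Complex.I 1) := by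
  rw [clm_complex_apply B v, clm_complex_apply B (v * Complex.I)]
  simp only [add_apply, smul_apply, clm_complex_apply (B 1) v,
    clm_complex_apply (B Complex.I) v, clm_complex_apply (B 1) (v * Complex.I),
    clm_complex_apply (B Complex.I) (v * Complex.I), Complex.mul_re, Complex.mul_im, Complex.I_re,
    Complex.I_im, Complex.normSq_apply, smul_eq_mul]
  ring

lemma alternate_mul_prod (l m : ℂ →L[ℝ] ℝ) (v : ℂ) :
    l v * m (v * Complex.I) - l (v * Complex.I) * m v =
      Complex.normSq v * (l 1 * m Complex.I - l Complex.I * m 1) :=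
  alternate_mul (l.smulRight m) v

lemma hasFDerivAt_exp_mul_I (p : ℝ × ℝ) :
    HasFDerivAt (fun p : ℝ × ℝ => Complex.exp (p.2 * Complex.I))
      ((ContinuousLinearMap.snd ℝ ℝ ℝ).smulRight (Complex.exp (p.2 * Complex.I) * Complex.I)) p := by
  have h1 : HasDerivAt (fun t : ℝ => Complex.exp (t * Complex.I))
      (Complex.exp (p.2 * Complex.I) * Complex.I) p.2 := by
    have := ((hasDerivAt_id p.2).ofReal_comp.mul_const Complex.I).cexp
    simpa using this
  exact (h1.hasFDerivAt.comp p (hasFDerivAt_snd (𝕜 := ℝ) (E := ℝ) (F := ℝ) (p := p))).congr_fderiv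
    (ContinuousLinearMap.ext fun v => by simp)

lemma hasFDerivAt_polar (p : ℝ × ℝ) :
    HasFDerivAt (fun p : ℝ × ℝ => (p.1 : ℂ) * Complex.exp (p.2 * Complex.I))
      ((ContinuousLinearMap.fst ℝ ℝ ℝ).smulRight (Complex.exp (p.2 * Complex.I)) +
        (ContinuousLinearMap.snd ℝ ℝ ℝ).smulRight (p.1 * Complex.exp (p.2 * Complex.I) * Complex.I))
      p := by
  have h3 : HasFDerivAt (fun p : ℝ × ℝ => p.1) (ContinuousLinearMap.fst ℝ ℝ ℝ) p := hasFDerivAt_fst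
  have h4 := h3.smul (hasFDerivAt_exp_mul_I p)
  have e : (fun p : ℝ × ℝ => (p.1 : ℂ) * Complex.exp (p.2 * Complex.I)) =
      fun p : ℝ × ℝ => p.1 • Complex.exp (p.2 * Complex.I) := by
    funext p; simp
  rw [e]
  refine h4.congr_fderiv (ContinuousLinearMap.ext fun v => ?_)
  simp
  ring

/-- Stokes' theorem on the disc, for one-forms whose restriction to the boundary is zero. -/
theorem integral_curl_ball_eq_zero {b : ℂ → ℂ →L[ℝ] ℝ}
    (hb : ContDiffOn ℝ 1 b (Metric.closedBall 0 1))
    (hbd : ∀ z ∈ Metric.sphere (0 : ℂ) 1, b z (Complex.I * z) = 0) :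
    ∫ z in Metric.ball (0 : ℂ) 1, curl b z = 0 := by
  set B : Set ℂ := Metric.closedBall 0 1 with hB
  set D : ℂ → ℂ →L[ℝ] ℂ →L[ℝ] ℝ := fderivWithin ℝ b B with hD
  have hBu : UniqueDiffOn ℝ B := uniqueDiffOn_convex (convex_closedBall 0 1) (by
    rw [hB, interior_closedBall _ one_ne_zero]; exact Metric.nonempty_ball.2 one_pos)
  have hDc : ContinuousOn D B := hb.continuousOn_fderivWithin hBu (by simp)
  have hnhds : ∀ z ∈ Metric.ball (0 : ℂ) 1, B ∈ 𝓝 z := fun z hz =>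
    mem_of_superset (Metric.isOpen_ball.mem_nhds hz) Metric.ball_subset_closedBall
  have hDd : ∀ z ∈ Metric.ball (0 : ℂ) 1, HasFDerivAt b (D z) z := by
    intro z hz
    have h1 := ((hb.differentiableOn one_ne_zero) z (Metric.ball_subset_closedBall hz)).hasFDerivWithinAt
    exact h1.hasFDerivAt (hnhds z hz)
  set φ : ℝ × ℝ → ℂ := fun p => (p.1 : ℂ) * Complex.exp (p.2 * Complex.I) with hφ
  set e : ℝ × ℝ → ℂ := fun p => Complex.exp (p.2 * Complex.I) with he
  have hec : Continuous e := by fun_prop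
  have hφc : Continuous φ := by fun_prop
  have hnorm : ∀ p, ‖φ p‖ = |p.1| := fun p => by
    simp only [hφ, norm_mul, Complex.norm_exp_ofReal_mul_I, mul_one, Complex.norm_real, Real.norm_eq_abs]
  set R : Set (ℝ × ℝ) := uIcc 0 1 ×ˢ uIcc (-Real.pi) Real.pi with hR
  have hmaps : MapsTo φ R B := by
    rintro p ⟨hp, -⟩
    rw [uIcc_of_le zero_le_one] at hp
    rw [hB, mem_closedBall_zero_iff, hnorm, abs_of_nonneg hp.1]; exact hp.2
  have hDe : ∀ p : ℝ × ℝ,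
      HasFDerivAt e ((ContinuousLinearMap.snd ℝ ℝ ℝ).smulRight (e p * Complex.I)) p :=
    fun p => hasFDerivAt_exp_mul_I p
  -- the components of the form in polar coordinates
  set F : ℝ × ℝ → ℝ := fun p => b (φ p) (φ p * Complex.I) with hF
  set G : ℝ × ℝ → ℝ := fun p => -b (φ p) (e p) with hG
  set φ' : ℝ × ℝ → ℝ × ℝ →L[ℝ] ℂ := fun p => (ContinuousLinearMap.fst ℝ ℝ ℝ).smulRight (e p) +
      (ContinuousLinearMap.snd ℝ ℝ ℝ).smulRight (φ p * Complex.I) with hφ'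
  have hφd : ∀ p, HasFDerivAt φ (φ' p) p := fun p => hasFDerivAt_polar p
  set F' : ℝ × ℝ → ℝ × ℝ →L[ℝ] ℝ := fun p =>
    (b (φ p)).comp (((ContinuousLinearMap.mul ℝ ℂ).flip Complex.I).comp (φ' p)) +
      ((D (φ p)).comp (φ' p)).flip (φ p * Complex.I) with hF'
  set G' : ℝ × ℝ → ℝ × ℝ →L[ℝ] ℝ := fun p =>
    -((b (φ p)).comp ((ContinuousLinearMap.snd ℝ ℝ ℝ).smulRight (e p * Complex.I)) +
      ((D (φ p)).comp (φ' p)).flip (e p)) with hG'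
  have hbc : ContinuousOn (fun p => b (φ p)) R := hb.continuousOn.comp hφc.continuousOn hmaps
  have hDφ : ContinuousOn (fun p => D (φ p)) R := hDc.comp hφc.continuousOn hmaps
  have hsum : ∀ p : ℝ × ℝ, F' p (1, 0) + G' p (0, 1) =
      p.1 * (D (φ p) 1 Complex.I - D (φ p) Complex.I 1) := by
    intro p
    have h1 : φ p = p.1 • e p := by simp [hφ, he]
    have h2 := alternate_mul (D (φ p)) (e p)
    have h3 : Complex.normSq (e p) = 1 := by
      rw [Complex.normSq_eq_norm_sq, he]; simp [Complex.norm_exp_ofReal_mul_I]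
    rw [h3, one_mul] at h2
    rw [← h2]
    simp only [hF', hG', hφ', ContinuousLinearMap.comp_apply, ContinuousLinearMap.flip_apply,
      add_apply, neg_apply, ContinuousLinearMap.smulRight_apply, ContinuousLinearMap.coe_fst', ContinuousLinearMap.coe_snd',
      one_smul, zero_smul, add_zero, zero_add, ContinuousLinearMap.mul_apply']
    have h4 : D (φ p) (e p) (φ p * Complex.I) = p.1 * D (φ p) (e p) (e p * Complex.I) := by
      rw [show φ p * Complex.I = p.1 • (e p * Complex.I) by rw [h1]; simp [mul_assoc], map_smul, smul_eq_mul]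
    have h5 : D (φ p) (φ p * Complex.I) (e p) = p.1 * D (φ p) (e p * Complex.I) (e p) := by
      rw [show φ p * Complex.I = p.1 • (e p * Complex.I) by rw [h1]; simp [mul_assoc], map_smul, smul_apply, smul_eq_mul]
    rw [h4, h5]
    ring
  -- the divergence theorem in polar coordinates, on the rectangle `[0, 1] × [-π, π]`
  have hbox := integral2_divergence_prod_of_hasFDerivAt_off_countable F G F' G' 0 (-Real.pi) 1 Real.pi ∅
    countable_empty (hbc.clm_apply (by fun_prop)) (hbc.clm_apply hec.continuousOn).neg
    (by
      rintro p ⟨⟨hp, -⟩, -⟩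
      rw [min_eq_left zero_le_one, max_eq_right zero_le_one] at hp
      have hpb : φ p ∈ Metric.ball (0 : ℂ) 1 := by
        rw [mem_ball_zero_iff, hnorm, abs_of_pos hp.1]; exact hp.2
      have h1 := ((hDd _ hpb).comp p (hφd p)).clm_apply ((hφd p).mul_const Complex.I)
      refine h1.congr_fderiv (ContinuousLinearMap.ext fun v => ?_)
      simp [hF', mul_comm])
    (by
      rintro p ⟨⟨hp, -⟩, -⟩
      rw [min_eq_left zero_le_one, max_eq_right zero_le_one] at hp
      have hpb : φ p ∈ Metric.ball (0 : ℂ) 1 := by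
        rw [mem_ball_zero_iff, hnorm, abs_of_pos hp.1]; exact hp.2
      exact (((hDd _ hpb).comp p (hφd p)).clm_apply (hDe p)).neg)
    (by
      have : ContinuousOn (fun p : ℝ × ℝ => F' p (1, 0) + G' p (0, 1)) R := by
        refine ContinuousOn.congr (f := fun p : ℝ × ℝ =>
          p.1 * (D (φ p) 1 Complex.I - D (φ p) Complex.I 1)) ?_ fun p _ => hsum p
        exact continuousOn_fst.mul (((hDφ.clm_apply continuousOn_const).clm_apply continuousOn_const).sub
          ((hDφ.clm_apply continuousOn_const).clm_apply continuousOn_const))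
      exact this.integrableOn_compact (isCompact_uIcc.prod isCompact_uIcc))
  have hG1 : ∀ x : ℝ, G (x, Real.pi) = G (x, -Real.pi) := by
    intro x
    have : Complex.exp ((Real.pi : ℝ) * Complex.I) = Complex.exp (((-Real.pi : ℝ)) * Complex.I) := by
      rw [Complex.exp_eq_exp_iff_exists_int]
      exact ⟨1, by push_cast; ring⟩
    simp only [hG, hφ, he, this]
  have hF1 : ∀ y : ℝ, F (1, y) = 0 := by
    intro y
    simp only [hF]
    rw [mul_comm]
    exact hbd _ (by rw [mem_sphere_zero_iff_norm, hnorm]; simp)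
  have hF0 : ∀ y : ℝ, F (0, y) = 0 := by
    intro y
    simp [hF, hφ]
  simp only [hG1, hF1, hF0, sub_self, intervalIntegral.integral_zero, add_zero, hsum] at hbox
  -- the integral in polar coordinates
  rw [← integral_indicator measurableSet_ball, ← Complex.integral_comp_polarCoord_symm]
  have hset : ∫ p in polarCoord.target, p.1 • (Metric.ball (0 : ℂ) 1).indicator (curl b)
      (Complex.polarCoord.symm p) =
      ∫ p in Ioc (0 : ℝ) 1 ×ˢ Ioc (-Real.pi) Real.pi, p.1 * (D (φ p) 1 Complex.I - D (φ p) Complex.I 1) := by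
    have hsub : Ioo (0 : ℝ) 1 ×ˢ Ioo (-Real.pi) Real.pi ⊆ polarCoord.target := by
      rw [polarCoord_target]; exact prod_mono Ioo_subset_Ioi_self le_rfl
    have hsymm : ∀ p, Complex.polarCoord.symm p = φ p := fun p => by
      simp only [Complex.polarCoord_symm_apply, hφ, Complex.exp_mul_I, Complex.ofReal_cos, Complex.ofReal_sin]
    have h1 : ∫ p in polarCoord.target, p.1 • (Metric.ball (0 : ℂ) 1).indicator (curl b)
        (Complex.polarCoord.symm p) = ∫ p in Ioo (0 : ℝ) 1 ×ˢ Ioo (-Real.pi) Real.pi,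
        p.1 • (Metric.ball (0 : ℂ) 1).indicator (curl b) (Complex.polarCoord.symm p) := by
      refine setIntegral_eq_of_subset_of_forall_sdiff_eq_zero
        polarCoord.open_target.measurableSet hsub ?_
      rintro p ⟨hp, hp'⟩
      rw [polarCoord_target] at hp
      have : 1 ≤ p.1 := by
        by_contra h
        exact hp' ⟨⟨hp.1, not_le.1 h⟩, hp.2⟩
      rw [indicator_of_notMem, smul_zero]
      rw [hsymm, mem_ball_zero_iff, hnorm, abs_of_pos hp.1]
      exact not_lt.2 this
    rw [h1]
    have h2 : (Ioo (0 : ℝ) 1 ×ˢ Ioo (-Real.pi) Real.pi : Set (ℝ × ℝ)) =ᵐ[volume]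
        (Ioc (0 : ℝ) 1 ×ˢ Ioc (-Real.pi) Real.pi : Set (ℝ × ℝ)) := by
      rw [Measure.volume_eq_prod]
      exact Measure.set_prod_ae_eq Ioo_ae_eq_Ioc Ioo_ae_eq_Ioc
    rw [← setIntegral_congr_set h2]
    refine setIntegral_congr_fun (measurableSet_Ioo.prod measurableSet_Ioo) fun p hp => ?_
    have hpb : φ p ∈ Metric.ball (0 : ℂ) 1 := by
      rw [mem_ball_zero_iff, hnorm, abs_of_pos hp.1.1]; exact hp.1.2
    simp only [hsymm, indicator_of_mem hpb, smul_eq_mul, curl, (hDd _ hpb).fderiv]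
  rw [hset]
  have hint : IntegrableOn (fun p : ℝ × ℝ => p.1 * (D (φ p) 1 Complex.I - D (φ p) Complex.I 1))
      (Ioc (0 : ℝ) 1 ×ˢ Ioc (-Real.pi) Real.pi) := by
    have : ContinuousOn (fun p : ℝ × ℝ => p.1 * (D (φ p) 1 Complex.I - D (φ p) Complex.I 1)) R :=
      continuousOn_fst.mul (((hDφ.clm_apply continuousOn_const).clm_apply continuousOn_const).sub
        ((hDφ.clm_apply continuousOn_const).clm_apply continuousOn_const))
    refine (this.integrableOn_compact (isCompact_uIcc.prod isCompact_uIcc)).mono_set ?_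
    exact prod_mono (by rw [uIcc_of_le zero_le_one]; exact Ioc_subset_Icc_self)
      (by rw [uIcc_of_le (by linarith [Real.pi_pos])]; exact Ioc_subset_Icc_self)
  rw [Measure.volume_eq_prod] at hint ⊢
  rw [setIntegral_prod _ hint]
  rw [intervalIntegral.integral_of_le zero_le_one] at hbox
  simp only [intervalIntegral.integral_of_le (show -Real.pi ≤ Real.pi by linarith [Real.pi_pos])] at hbox
  exact hbox

end Stokes

section StripEnds

open MeasureTheory

/-- The closed half-strip `[a,∞) × [0,1]`. -/
def strip (a : ℝ) : Set ℂ := {z | a ≤ z.re ∧ z.im ∈ Icc (0 : ℝ) 1}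

/-- The closed rectangle `[a,b] × [0,1]`. -/
def rect (a b : ℝ) : Set ℂ := {z | z.re ∈ Icc a b ∧ z.im ∈ Icc (0 : ℝ) 1}

/-- The open rectangle `(a,b) × (0,1)`. -/
def openRect (a b : ℝ) : Set ℂ := {z | z.re ∈ Ioo a b ∧ z.im ∈ Ioo (0 : ℝ) 1}

lemma convex_strip (a : ℝ) : Convex ℝ (strip a) := by
  have h1 : Convex ℝ {z : ℂ | a ≤ z.re} := (convex_Ici a).linear_preimage Complex.reLm
  have h2 : Convex ℝ {z : ℂ | z.im ∈ Icc (0 : ℝ) 1} := (convex_Icc 0 1).linear_preimage Complex.imLm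
  exact h1.inter h2

lemma isOpen_openRect (a b : ℝ) : IsOpen (openRect a b) :=
  (isOpen_Ioo.preimage Complex.continuous_re).inter (isOpen_Ioo.preimage Complex.continuous_im)

lemma isCompact_rect (a b : ℝ) : IsCompact (rect a b) :=
  (isCompact_Icc (a := a) (b := b)).reProdIm (isCompact_Icc (a := (0 : ℝ)) (b := 1))

lemma openRect_subset_rect (a b : ℝ) : openRect a b ⊆ rect a b := fun _ hz =>
  ⟨Ioo_subset_Icc_self hz.1, Ioo_subset_Icc_self hz.2⟩

lemma rect_subset_strip {c a b : ℝ} (h : c ≤ a) : rect a b ⊆ strip c := fun _ hz =>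
  ⟨h.trans hz.1.1, hz.2⟩

lemma strip_mem_nhds {a : ℝ} {z : ℂ} (h1 : a < z.re) (h2 : z.im ∈ Ioo (0 : ℝ) 1) : strip a ∈ 𝓝 z := by
  have : IsOpen (openRect a (z.re + 1)) := isOpen_openRect _ _
  refine mem_of_superset (this.mem_nhds ⟨⟨h1, by linarith⟩, h2⟩) fun w hw => ⟨hw.1.1.le, Ioo_subset_Icc_self hw.2⟩

lemma uniqueDiffOn_strip (a : ℝ) : UniqueDiffOn ℝ (strip a) :=
  uniqueDiffOn_convex (convex_strip a) ⟨⟨a + 1, 1 / 2⟩, mem_interior_iff_mem_nhds.2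
    (strip_mem_nhds (by simp) (by constructor <;> norm_num))⟩

/-- Stokes' theorem on a rectangle, for one-forms which vanish along the horizontal sides. -/
lemma integral_curl_rect {α : ℂ → ℂ →L[ℝ] ℝ} {D : ℂ → ℂ →L[ℝ] ℂ →L[ℝ] ℝ} {a b : ℝ} (hab : a ≤ b)
    (hα : ContinuousOn α (rect a b)) (hD : ContinuousOn D (rect a b))
    (hd : ∀ z ∈ openRect a b, HasFDerivAt α (D z) z)
    (h01 : ∀ z ∈ rect a b, z.im = 0 ∨ z.im = 1 → α z 1 = 0) :
    ∫ x in a..b, ∫ y in (0 : ℝ)..1, (D ⟨x, y⟩ 1 Complex.I - D ⟨x, y⟩ Complex.I 1) =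
      (∫ y in (0 : ℝ)..1, α ⟨b, y⟩ Complex.I) - ∫ y in (0 : ℝ)..1, α ⟨a, y⟩ Complex.I := by
  set L : ℝ × ℝ →L[ℝ] ℂ := (Complex.equivRealProdCLM.symm : ℝ × ℝ →L[ℝ] ℂ) with hL
  have hLv : ∀ p : ℝ × ℝ, L p = ⟨p.1, p.2⟩ := fun p => by
    apply Complex.ext <;> simp [hL]
  have hmaps : MapsTo L (uIcc a b ×ˢ uIcc (0 : ℝ) 1) (rect a b) := by
    rintro p ⟨h1, h2⟩
    rw [uIcc_of_le hab] at h1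
    rw [uIcc_of_le zero_le_one] at h2
    rw [hLv]; exact ⟨h1, h2⟩
  have hαL : ContinuousOn (fun p => α (L p)) (uIcc a b ×ˢ uIcc (0 : ℝ) 1) :=
    hα.comp L.continuous.continuousOn hmaps
  have hDL : ContinuousOn (fun p => D (L p)) (uIcc a b ×ˢ uIcc (0 : ℝ) 1) :=
    hD.comp L.continuous.continuousOn hmaps
  have hL1 : L (1, 0) = 1 := by rw [hLv]; rfl
  have hL2 : L (0, 1) = Complex.I := by rw [hLv]; rfl
  have hder : ∀ p ∈ Ioo (min a b) (max a b) ×ˢ Ioo (min 0 1) (max 0 1) \ (∅ : Set (ℝ × ℝ)), ∀ v : ℂ,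
      HasFDerivAt (fun p => α (L p) v) (((D (L p)).comp L).flip v) p := by
    rintro p ⟨⟨h1, h2⟩, -⟩ v
    rw [min_eq_left hab, max_eq_right hab] at h1
    rw [min_eq_left zero_le_one, max_eq_right zero_le_one] at h2
    have h3 := ((hd (L p) (by rw [hLv]; exact ⟨h1, h2⟩)).comp p L.hasFDerivAt).clm_apply
      (hasFDerivAt_const v p)
    exact h3.congr_fderiv (ContinuousLinearMap.ext fun w => by simp)
  -- the divergence theorem in real coordinates; the horizontal sides do not contribute
  have hbox := integral2_divergence_prod_of_hasFDerivAt_off_countable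
    (fun p => α (L p) Complex.I) (fun p => -α (L p) 1) (fun p => ((D (L p)).comp L).flip Complex.I)
    (fun p => -(((D (L p)).comp L).flip 1)) a 0 b 1 ∅ countable_empty
    (hαL.clm_apply continuousOn_const) (hαL.clm_apply continuousOn_const).neg
    (fun p hp => hder p hp _) (fun p hp => (hder p hp _).neg)
    (by
      refine ContinuousOn.integrableOn_compact (isCompact_uIcc.prod isCompact_uIcc) ?_
      simp only [ContinuousLinearMap.flip_apply, ContinuousLinearMap.comp_apply, neg_apply, hL1, hL2]
      exact ((hDL.clm_apply continuousOn_const).clm_apply continuousOn_const).add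
          ((hDL.clm_apply continuousOn_const).clm_apply continuousOn_const).neg)
  simp only [ContinuousLinearMap.flip_apply, ContinuousLinearMap.comp_apply, neg_apply, hL1, hL2,
    ← sub_eq_add_neg] at hbox
  simp only [hLv] at hbox
  have hz : ∀ t : ℝ, (t = 0 ∨ t = 1) → ∫ x in a..b, -α ⟨x, t⟩ 1 = 0 := by
    intro t ht
    rw [intervalIntegral.integral_congr (g := fun _ => (0 : ℝ))]
    · simp
    · intro x hx
      rw [uIcc_of_le hab] at hx
      have ht' : t ∈ Icc (0 : ℝ) 1 := by rcases ht with rfl | rfl <;> simp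
      simp only [h01 ⟨x, t⟩ ⟨hx, ht'⟩ ht, neg_zero]
  rw [hz 0 (Or.inl rfl), hz 1 (Or.inr rfl), sub_zero, zero_add] at hbox
  exact hbox

lemma setIntegral_openRect {g : ℂ → ℝ} {a b : ℝ} (hab : a ≤ b) (hg : ContinuousOn g (rect a b)) :
    ∫ z in openRect a b, g z = ∫ x in a..b, ∫ y in (0 : ℝ)..1, g ⟨x, y⟩ := by
  have h1 := (Complex.volume_preserving_equiv_real_prod.symm).setIntegral_preimage_emb
    Complex.measurableEquivRealProd.symm.measurableEmbedding g (openRect a b)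
  rw [← h1]
  have hpre : (Complex.measurableEquivRealProd.symm ⁻¹' openRect a b) = Ioo a b ×ˢ Ioo (0 : ℝ) 1 := by
    ext p; simp [openRect, Complex.measurableEquivRealProd]
  have hv : ∀ p : ℝ × ℝ, Complex.measurableEquivRealProd.symm p = ⟨p.1, p.2⟩ := fun p => rfl
  rw [hpre]
  simp only [hv]
  have h2 : (Ioo a b ×ˢ Ioo (0 : ℝ) 1 : Set (ℝ × ℝ)) =ᵐ[volume] (Ioc a b ×ˢ Ioc (0 : ℝ) 1 : Set (ℝ × ℝ)) := by
    rw [Measure.volume_eq_prod]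
    exact Measure.set_prod_ae_eq Ioo_ae_eq_Ioc Ioo_ae_eq_Ioc
  rw [setIntegral_congr_set h2]
  have hc : ContinuousOn (fun p : ℝ × ℝ => g ⟨p.1, p.2⟩) (Icc a b ×ˢ Icc (0 : ℝ) 1) := by
    have hL : Continuous fun p : ℝ × ℝ => (⟨p.1, p.2⟩ : ℂ) := Complex.equivRealProdCLM.symm.continuous
    exact hg.comp hL.continuousOn fun p hp => hp
  have hint : IntegrableOn (fun p : ℝ × ℝ => g ⟨p.1, p.2⟩) (Ioc a b ×ˢ Ioc (0 : ℝ) 1) :=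
    (hc.integrableOn_compact (isCompact_Icc.prod isCompact_Icc)).mono_set
      (prod_mono Ioc_subset_Icc_self Ioc_subset_Icc_self)
  rw [Measure.volume_eq_prod] at hint ⊢
  rw [setIntegral_prod _ hint, intervalIntegral.integral_of_le hab]
  simp only [intervalIntegral.integral_of_le (zero_le_one (α := ℝ))]

/-- A strip-like end of `S` at the boundary point `ζ` of the disc, parametrized by the positive
half-strip. -/
structure StripEnd (S : Set ℂ) (ε : ℂ → ℂ) (ζ : ℂ) : Prop where
  norm_point : ‖ζ‖ = 1
  subset : S ⊆ Metric.closedBall 0 1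
  not_mem : ζ ∉ S
  smooth : ContDiffOn ℝ ∞ ε (strip 0)
  holo : ∀ z ∈ strip 0, ∃ c : ℂ, c ≠ 0 ∧ ∀ v, fderivWithin ℝ ε (strip 0) z v = c * v
  inj : InjOn ε (strip 0)
  mem : MapsTo ε (strip 0) S
  bdry : ∀ z ∈ strip 0, ‖ε z‖ = 1 ↔ z.im = 0 ∨ z.im = 1
  lim : Tendsto (fun p : ℝ × ℝ => ε ⟨p.1, p.2⟩) (atTop ×ˢ 𝓟 (Icc 0 1)) (𝓝 ζ)

namespace StripEnd

variable {S : Set ℂ} {ε : ℂ → ℂ} {ζ : ℂ} (h : StripEnd S ε ζ)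
include h

lemma exists_forall {P : ℂ → Prop} (hP : ∀ᶠ z in 𝓝 ζ, P z) :
    ∃ T : ℝ, ∀ p : ℂ, T ≤ p.re → p.im ∈ Icc (0 : ℝ) 1 → P (ε p) := by
  have h1 := h.lim.eventually hP
  rw [eventually_prod_principal_iff] at h1
  obtain ⟨T, hT⟩ := eventually_atTop.1 h1
  exact ⟨T, fun p h1 h2 => hT p.re h1 p.im h2⟩

lemma mem_ball {p : ℂ} (hp : p ∈ strip 0) (hi : p.im ∈ Ioo (0 : ℝ) 1) : ε p ∈ Metric.ball (0 : ℂ) 1 := by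
  have h1 : ‖ε p‖ ≤ 1 := by simpa using h.subset (h.mem hp)
  rw [mem_ball_zero_iff]
  refine lt_of_le_of_ne h1 fun h2 => ?_
  rcases (h.bdry p hp).1 h2 with h3 | h3
  · exact hi.1.ne' h3
  · exact hi.2.ne h3

lemma hasFDerivAt {p : ℂ} (h1 : 0 < p.re) (h2 : p.im ∈ Ioo (0 : ℝ) 1) :
    HasFDerivAt ε (fderivWithin ℝ ε (strip 0) p) p :=
  ((h.smooth.differentiableOn (by simp)) p ⟨h1.le, Ioo_subset_Icc_self h2⟩).hasFDerivWithinAt.hasFDerivAt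
    (strip_mem_nhds h1 h2)

lemma isOpen_image {T : ℝ} (hT : 0 ≤ T) : IsOpen (ε '' {p | T < p.re ∧ p.im ∈ Ioo (0 : ℝ) 1}) := by
  rw [isOpen_iff_mem_nhds]
  rintro _ ⟨p, ⟨hp1, hp2⟩, rfl⟩
  have hp0 : 0 < p.re := hT.trans_lt hp1
  have hcd : ContDiffAt ℝ ∞ ε p := h.smooth.contDiffAt (strip_mem_nhds hp0 hp2)
  have hs := hcd.hasStrictFDerivAt (by simp)
  have hsurj : (fderiv ℝ ε p).range = ⊤ := by
    obtain ⟨c, hc, hcv⟩ := h.holo p ⟨hp0.le, Ioo_subset_Icc_self hp2⟩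
    rw [(h.hasFDerivAt hp0 hp2).fderiv, LinearMap.range_eq_top]
    intro w
    exact ⟨c⁻¹ * w, (hcv _).trans (by field_simp)⟩
  rw [← hs.map_nhds_eq_of_surj hsurj]
  refine image_mem_map ?_
  have : IsOpen {p : ℂ | T < p.re ∧ p.im ∈ Ioo (0 : ℝ) 1} :=
    (isOpen_Ioi.preimage Complex.continuous_re).inter (isOpen_Ioo.preimage Complex.continuous_im)
  exact this.mem_nhds ⟨hp1, hp2⟩

/-- The image of a strip-like end contains all points of the open disc close to the point at infinity:
the part of the disc in a small ball is connected, and the end is open and closed in it. -/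
lemma exists_near {T : ℝ} (hT : 0 ≤ T) : ∃ r > 0, (∀ y ∈ Icc (0 : ℝ) 1, r ≤ dist (ε ⟨T, y⟩) ζ) ∧
    ∀ z ∈ Metric.ball (0 : ℂ) 1, dist z ζ < r →
      ∃ p : ℂ, T < p.re ∧ p.im ∈ Ioo (0 : ℝ) 1 ∧ ε p = z := by
  -- `r` is the distance from `ζ` to the image of the segment `re = T`
  have hcK : IsCompact (ε '' rect T T) := (isCompact_rect T T).image_of_continuousOn
    (h.smooth.continuousOn.mono (rect_subset_strip hT))
  have hζK : ζ ∉ ε '' rect T T := by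
    rintro ⟨p, hp, hpζ⟩
    exact h.not_mem (hpζ ▸ h.mem (rect_subset_strip hT hp))
  obtain ⟨r, hr, hrK⟩ := Metric.isOpen_iff.1 hcK.isClosed.isOpen_compl ζ hζK
  refine ⟨r, hr, fun y hy => ?_, ?_⟩
  · by_contra hlt
    exact hrK (Metric.mem_ball.2 (not_le.1 hlt)) ⟨⟨T, y⟩, ⟨⟨le_rfl, le_rfl⟩, hy⟩, rfl⟩
  set A := ε '' {p | T < p.re ∧ p.im ∈ Ioo (0 : ℝ) 1} with hA
  set U := Metric.ball (0 : ℂ) 1 ∩ Metric.ball ζ r with hU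
  have hconn : IsPreconnected U := ((convex_ball 0 1).inter (convex_ball ζ r)).isPreconnected
  have hne : (U ∩ A).Nonempty := by
    obtain ⟨T', hT'⟩ := h.exists_forall (Metric.ball_mem_nhds ζ hr)
    set p : ℂ := ⟨max T T' + 1, 1 / 2⟩ with hp
    have hp1 : T < p.re := by simp only [hp]; linarith [le_max_left T T']
    have hp2 : p.im ∈ Ioo (0 : ℝ) 1 := by simp only [hp]; constructor <;> norm_num
    refine ⟨ε p, ⟨h.mem_ball ⟨hT.trans hp1.le, Ioo_subset_Icc_self hp2⟩ hp2, hT' p ?_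
      (Ioo_subset_Icc_self hp2)⟩, p, ⟨hp1, hp2⟩, rfl⟩
    simp only [hp]; linarith [le_max_right T T']
  -- the image of the half-strip is open and relatively closed in the connected set near `ζ`
  have hsub := hconn.subset_of_closure_inter_subset (h.isOpen_image hT) hne (by
    rintro z ⟨hzA, hzU⟩
    have hzζ : z ≠ ζ := by
      rintro rfl
      have := hzU.1
      rw [mem_ball_zero_iff, h.norm_point] at this
      exact lt_irrefl _ this
    set δ := dist z ζ / 2 with hδ
    have hδ0 : 0 < δ := half_pos (dist_pos.2 hzζ)
    obtain ⟨T', hT'⟩ := h.exists_forall (Metric.closedBall_mem_nhds ζ hδ0)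
    have hAsub : A ⊆ ε '' rect T T' ∪ Metric.closedBall ζ δ := by
      rintro _ ⟨p, ⟨hp1, hp2⟩, rfl⟩
      rcases le_total T' p.re with h1 | h1
      · exact Or.inr (hT' p h1 (Ioo_subset_Icc_self hp2))
      · exact Or.inl ⟨p, ⟨⟨hp1.le, h1⟩, Ioo_subset_Icc_self hp2⟩, rfl⟩
    have hcl : IsClosed (ε '' rect T T' ∪ Metric.closedBall ζ δ) :=
      ((isCompact_rect T T').image_of_continuousOn
        (h.smooth.continuousOn.mono (rect_subset_strip hT))).isClosed.union Metric.isClosed_closedBall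
    rcases closure_minimal hAsub hcl hzA with ⟨p, hp, rfl⟩ | h1
    · have hps := rect_subset_strip hT hp
      have hn : ¬ ‖ε p‖ = 1 := fun h1 => by
        have := hzU.1
        rw [mem_ball_zero_iff, h1] at this
        exact lt_irrefl _ this
      rw [h.bdry p hps, not_or] at hn
      refine ⟨p, ⟨lt_of_le_of_ne hp.1.1 fun h1 => ?_, lt_of_le_of_ne hp.2.1 (Ne.symm hn.1),
        lt_of_le_of_ne hp.2.2 hn.2⟩, rfl⟩
      exact hrK hzU.2 ⟨p, ⟨⟨h1.le, h1.ge⟩, hp.2⟩, rfl⟩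
    · rw [Metric.mem_closedBall] at h1
      exfalso
      have : 0 < dist (z) ζ := dist_pos.2 hzζ
      linarith)
  intro z hz hzr
  obtain ⟨p, hp, rfl⟩ := hsub ⟨hz, hzr⟩
  exact ⟨p, hp.1, hp.2, rfl⟩

end StripEnd

end StripEnds

section StokesEnds

open MeasureTheory

/-- The pullback of a one-form under a strip-like end. -/
def endForm (β : ℂ → ℂ →L[ℝ] ℝ) (ε : ℂ → ℂ) (p : ℂ) : ℂ →L[ℝ] ℝ :=
  (β (ε p)).comp (fderivWithin ℝ ε (strip 0) p)

lemma det_mul (c : ℂ) (l : ℂ →L[ℝ] ℂ) (hl : ∀ v, l v = c * v) : l.det = Complex.normSq c := by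
  rw [← Algebra.norm_complex_apply, Algebra.norm_apply]
  change LinearMap.det (l : ℂ →ₗ[ℝ] ℂ) = _
  congr 1
  ext
  all_goals simp [hl]

namespace StripEnd

variable {S : Set ℂ} {ε : ℂ → ℂ} {ζ : ℂ} (h : StripEnd S ε ζ)
include h

lemma contDiffOn_endForm {β : ℂ → ℂ →L[ℝ] ℝ} (hβ : ContDiffOn ℝ 1 β S) :
    ContDiffOn ℝ 1 (endForm β ε) (strip 0) :=
  (hβ.comp (h.smooth.of_le (by simp)) h.mem).clm_comp
    (h.smooth.fderivWithin (uniqueDiffOn_strip 0) (by rw [one_add_one_eq_two]; exact two_le_infty))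

/-- The sides of the strip are mapped to the unit circle, so that the derivative of the end in the real
direction is tangent to the circle there. -/
lemma endForm_bdry {β : ℂ → ℂ →L[ℝ] ℝ}
    (hbd : ∀ z ∈ S, ‖z‖ = 1 → β z (Complex.I * z) = 0) {p : ℂ} (hp : p ∈ strip 0)
    (hi : p.im = 0 ∨ p.im = 1) : endForm β ε p 1 = 0 := by
  obtain ⟨c, -, hc⟩ := h.holo p hp
  have hpath : HasDerivWithinAt (fun x : ℝ => ε ⟨x, p.im⟩) c (Ici 0) p.re := by
    have h1 : HasDerivAt (fun x : ℝ => (⟨x, p.im⟩ : ℂ)) 1 p.re := by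
      have h2 : (fun x : ℝ => (⟨x, p.im⟩ : ℂ)) = fun x : ℝ => (x : ℂ) + p.im * Complex.I := by
        funext x; apply Complex.ext <;> simp
      rw [h2]
      simpa using ((hasDerivAt_id p.re).ofReal_comp).add_const (p.im * Complex.I)
    have h2 : HasFDerivWithinAt ε (fderivWithin ℝ ε (strip 0) p) (strip 0)
        ((fun x : ℝ => (⟨x, p.im⟩ : ℂ)) p.re) :=
      ((h.smooth.differentiableOn (by simp)) p hp).hasFDerivWithinAt
    have h3 := h2.comp_hasDerivWithinAt (s := Ici (0 : ℝ)) p.re h1.hasDerivWithinAt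
      (show MapsTo (fun x : ℝ => (⟨x, p.im⟩ : ℂ)) (Ici 0) (strip 0) from fun x hx => ⟨hx, hp.2⟩)
    rw [hc, mul_one] at h3
    exact h3
  -- the norm is constant along the side
  have horth : inner ℝ (ε p) c = 0 := by
    have h1 := hpath.norm_sq
    have h2 : HasDerivWithinAt (fun x : ℝ => ‖ε ⟨x, p.im⟩‖ ^ 2) 0 (Ici 0) p.re := by
      refine (hasDerivWithinAt_const p.re (Ici 0) (1 : ℝ)).congr (fun x hx => ?_) ?_
      · rw [(h.bdry ⟨x, p.im⟩ ⟨hx, hp.2⟩).2 hi, one_pow]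
      · rw [(h.bdry ⟨p.re, p.im⟩ hp).2 hi, one_pow]
    have h3 := (uniqueDiffOn_Ici (0 : ℝ) p.re hp.1).eq_deriv _ h1 h2
    simpa using h3
  have hn : ‖ε p‖ = 1 := (h.bdry p hp).2 hi
  have hcκ : c = (inner ℝ (Complex.I * ε p) c) • (Complex.I * ε p) := by
    have h1 : (ε p).re ^ 2 + (ε p).im ^ 2 = 1 := by
      have := Complex.sq_norm (ε p)
      rw [hn, Complex.normSq_apply] at this
      linarith
    rw [Complex.inner] at horth ⊢
    simp at horth ⊢
    apply Complex.ext
    · simp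
      linear_combination c.re * (-h1) + (ε p).re * horth
    · simp
      linear_combination c.im * (-h1) + (ε p).im * horth
  rw [endForm, ContinuousLinearMap.comp_apply, hc, mul_one, hcκ, map_smul,
    hbd _ (h.mem hp) hn, smul_zero]

/-- The contribution of a strip-like end to Stokes' theorem, if a cutoff function at `ζ` is used. -/
lemma exists_integral_le {β : ℂ → ℂ →L[ℝ] ℝ} (hβ : ContDiffOn ℝ 1 β S)
    (hbd : ∀ z ∈ S, ‖z‖ = 1 → β z (Complex.I * z) = 0) {T : ℝ} (hT : 0 ≤ T)
    (hcurl : ∀ p : ℂ, T < p.re → p.im ∈ Ioo (0 : ℝ) 1 → 0 ≤ curl (endForm β ε) p)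
    {r : ℝ} (hr1 : ∀ y ∈ Icc (0 : ℝ) 1, r ≤ dist (ε ⟨T, y⟩) ζ)
    (hr2 : ∀ z ∈ Metric.ball (0 : ℂ) 1, dist z ζ < r →
      ∃ p : ℂ, T < p.re ∧ p.im ∈ Ioo (0 : ℝ) 1 ∧ ε p = z)
    (χ : ContDiffBump ζ) (hχ : χ.rOut < r) :
    ∃ T' : ℝ, T ≤ T' ∧ ∫ z in Metric.ball (0 : ℂ) 1,
      (fderiv ℝ χ z 1 * β z Complex.I - fderiv ℝ χ z Complex.I * β z 1) ≤
        ∫ y in (0 : ℝ)..1, endForm β ε ⟨T', y⟩ Complex.I := by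
  set α := endForm β ε with hα
  set w : ℂ → ℝ := fun z => fderiv ℝ χ z 1 * β z Complex.I - fderiv ℝ χ z Complex.I * β z 1 with hw
  obtain ⟨T₁, hT₁⟩ := h.exists_forall (Metric.ball_mem_nhds ζ χ.rIn_pos)
  set T' := max T T₁ + 1 with hT'
  have hTT : T < T' := by rw [hT']; linarith [le_max_left T T₁]
  have hT'1 : T₁ ≤ T' := by rw [hT']; linarith [le_max_right T T₁]
  refine ⟨T', hTT.le, ?_⟩
  set Q := openRect T T' with hQ
  have hQs : ∀ p ∈ Q, p ∈ strip 0 := fun p hp => rect_subset_strip hT (openRect_subset_rect _ _ hp)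
  have hχs : ContDiff ℝ ∞ χ := χ.contDiff
  have hχd : ∀ z, HasFDerivAt χ (fderiv ℝ χ z) z := fun z =>
    ((hχs.differentiable (by simp)) z).hasFDerivAt
  -- the integrand is supported in the image of the rectangle
  have hsupp : ∀ z ∈ Metric.ball (0 : ℂ) 1 \ ε '' Q, w z = 0 := by
    rintro z ⟨hz, hzQ⟩
    have hz0 : fderiv ℝ χ z = 0 := by
      by_cases hzr : dist z ζ < r
      · obtain ⟨p, hp1, hp2, rfl⟩ := hr2 z hz hzr
        have hp3 : T' ≤ p.re := by
          by_contra hlt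
          exact hzQ ⟨p, ⟨⟨hp1, not_le.1 hlt⟩, hp2⟩, rfl⟩
        have hb := hT₁ p (hT'1.trans hp3) (Ioo_subset_Icc_self hp2)
        have hev : (χ : ℂ → ℝ) =ᶠ[𝓝 (ε p)] fun _ => 1 := by
          filter_upwards [Metric.isOpen_ball.mem_nhds hb] with z hz
          exact χ.one_of_mem_closedBall (Metric.ball_subset_closedBall hz)
        rw [hev.fderiv_eq]; simp
      · have hev : (χ : ℂ → ℝ) =ᶠ[𝓝 z] fun _ => 0 := by
          filter_upwards [Metric.isClosed_closedBall.isOpen_compl.mem_nhds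
            (show z ∈ (Metric.closedBall ζ χ.rOut)ᶜ from fun h' => by
              rw [Metric.mem_closedBall] at h'; linarith [not_lt.1 hzr])] with y hy
          refine χ.zero_of_le_dist ?_
          rw [mem_compl_iff, Metric.mem_closedBall, not_le] at hy
          exact hy.le
        rw [hev.fderiv_eq]; simp
    simp only [hw, hz0, zero_apply, zero_mul, sub_zero]
  have hsub : ε '' Q ⊆ Metric.ball 0 1 := by
    rintro _ ⟨p, hp, rfl⟩
    exact h.mem_ball (hQs p hp) hp.2
  change ∫ z in Metric.ball (0 : ℂ) 1, w z ≤ _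
  rw [setIntegral_eq_of_subset_of_forall_sdiff_eq_zero measurableSet_ball hsub hsupp]
  have hQ0 : ∀ p ∈ Q, 0 < p.re := fun p hp => hT.trans_lt hp.1.1
  rw [integral_image_eq_integral_abs_det_fderiv_smul volume (isOpen_openRect T T').measurableSet
    (fun p hp => (h.hasFDerivAt (hQ0 p hp) hp.2).hasFDerivWithinAt) (h.inj.mono hQs)]
  -- the cutoff function and the form in the coordinates of the strip
  set ψ : ℂ → ℝ := fun p => χ (ε p) with hψ
  have hψs : ContDiffOn ℝ ∞ ψ (strip 0) := hχs.comp_contDiffOn h.smooth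
  set dψ : ℂ → ℂ →L[ℝ] ℝ := fderivWithin ℝ ψ (strip 0) with hdψ
  set Dα : ℂ → ℂ →L[ℝ] ℂ →L[ℝ] ℝ := fderivWithin ℝ α (strip 0) with hDα
  have hαs : ContDiffOn ℝ 1 α (strip 0) := h.contDiffOn_endForm hβ
  have hrs : rect T T' ⊆ strip 0 := rect_subset_strip hT
  have hαc : ContinuousOn α (rect T T') := hαs.continuousOn.mono hrs
  have hψc : ContinuousOn ψ (rect T T') := hψs.continuousOn.mono hrs
  have hdψc : ContinuousOn dψ (rect T T') :=
    (hψs.continuousOn_fderivWithin (uniqueDiffOn_strip 0) (by simp)).mono hrs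
  have hstr : ∀ p ∈ Q, strip 0 ∈ 𝓝 p := fun p hp => strip_mem_nhds (hQ0 p hp) hp.2
  have hψd : ∀ p ∈ Q, HasFDerivAt ψ (dψ p) p := fun p hp =>
    ((hψs.differentiableOn (by simp)) p (hQs p hp)).hasFDerivWithinAt.hasFDerivAt (hstr p hp)
  have hαd : ∀ p ∈ Q, HasFDerivAt α (Dα p) p := fun p hp =>
    ((hαs.differentiableOn (by simp)) p (hQs p hp)).hasFDerivWithinAt.hasFDerivAt (hstr p hp)
  set k₁ : ℂ → ℝ := fun p => dψ p 1 * α p Complex.I - dψ p Complex.I * α p 1 with hk₁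
  have hdet : ∀ p ∈ Q, |(fderivWithin ℝ ε (strip 0) p).det| • w (ε p) = k₁ p := by
    intro p hp
    obtain ⟨c, -, hc⟩ := h.holo p (hQs p hp)
    have h1 : dψ p = (fderiv ℝ χ (ε p)).comp (fderivWithin ℝ ε (strip 0) p) :=
      (hψd p hp).unique ((hχd (ε p)).comp p (h.hasFDerivAt (hQ0 p hp) hp.2))
    rw [det_mul c _ hc, abs_of_nonneg (Complex.normSq_nonneg c), smul_eq_mul]
    simp only [hw, hk₁, h1, hα, endForm, ContinuousLinearMap.comp_apply, hc, mul_one]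
    rw [alternate_mul_prod]
  rw [setIntegral_congr_fun (isOpen_openRect T T').measurableSet hdet]
  have hψα : ContDiffOn ℝ 1 (ψ • α) (strip 0) := (hψs.of_le (by simp)).smul hαs
  set D : ℂ → ℂ →L[ℝ] ℂ →L[ℝ] ℝ := fderivWithin ℝ (ψ • α) (strip 0) with hD
  have hDc : ContinuousOn D (rect T T') :=
    (hψα.continuousOn_fderivWithin (uniqueDiffOn_strip 0) (by simp)).mono hrs
  have hDd : ∀ p ∈ Q, HasFDerivAt (ψ • α) (D p) p := fun p hp =>
    ((hψα.differentiableOn (by simp)) p (hQs p hp)).hasFDerivWithinAt.hasFDerivAt (hstr p hp)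
  have hk : ∀ p ∈ Q, D p 1 Complex.I - D p Complex.I 1 =
      k₁ p + ψ p * (Dα p 1 Complex.I - Dα p Complex.I 1) := by
    intro p hp
    rw [(hDd p hp).unique ((hψd p hp).smul (hαd p hp))]
    simp only [hk₁, add_apply, smul_apply, ContinuousLinearMap.smulRight_apply, smul_eq_mul]
    ring
  -- Stokes' theorem for `ψ • α` on the rectangle between `T`, where `ψ = 0`, and `T'`, where `ψ = 1`
  have hbox := integral_curl_rect hTT.le (hψc.smul hαc) hDc
    hDd
    (fun p hp hi => by
      simp only [Pi.smul_apply', smul_apply, hα, h.endForm_bdry hbd (hrs hp) hi, smul_zero])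
  have hDk : ContinuousOn (fun p => D p 1 Complex.I - D p Complex.I 1) (rect T T') :=
    ((hDc.clm_apply continuousOn_const).clm_apply continuousOn_const).sub
      ((hDc.clm_apply continuousOn_const).clm_apply continuousOn_const)
  have hk₁c : ContinuousOn k₁ (rect T T') :=
    ((hdψc.clm_apply continuousOn_const).mul (hαc.clm_apply continuousOn_const)).sub
      ((hdψc.clm_apply continuousOn_const).mul (hαc.clm_apply continuousOn_const))
  rw [← setIntegral_openRect hTT.le hDk] at hbox
  have e1 : ∫ y in (0 : ℝ)..1, (ψ • α) ⟨T', y⟩ Complex.I = ∫ y in (0 : ℝ)..1, α ⟨T', y⟩ Complex.I := by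
    refine intervalIntegral.integral_congr fun y hy => ?_
    rw [uIcc_of_le zero_le_one] at hy
    have h1 : ψ ⟨T', y⟩ = 1 := χ.one_of_mem_closedBall
      (Metric.ball_subset_closedBall (hT₁ ⟨T', y⟩ hT'1 hy))
    simp [h1]
  have e2 : ∫ y in (0 : ℝ)..1, (ψ • α) ⟨T, y⟩ Complex.I = 0 := by
    rw [intervalIntegral.integral_congr (g := fun _ => (0 : ℝ))]
    · simp
    · intro y hy
      rw [uIcc_of_le zero_le_one] at hy
      have h1 : ψ ⟨T, y⟩ = 0 := χ.zero_of_le_dist (hχ.le.trans (hr1 y hy))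
      simp [h1]
  have hbox2 : ∫ z in Q, (D z 1 Complex.I - D z Complex.I 1) =
      ∫ y in (0 : ℝ)..1, α ⟨T', y⟩ Complex.I := by
    rw [e1, e2, sub_zero] at hbox
    exact hbox
  -- the two integrands differ by `ψ * curl α`, which is nonnegative
  rw [← hbox2]
  have hint : ∀ g : ℂ → ℝ, ContinuousOn g (rect T T') → IntegrableOn g Q := fun g hg =>
    (hg.integrableOn_compact (isCompact_rect T T')).mono_set (openRect_subset_rect T T')
  refine setIntegral_mono_on (hint _ hk₁c) (hint _ hDk) (isOpen_openRect T T').measurableSet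
    fun p hp => ?_
  rw [hk p hp]
  have h1 := hcurl p hp.1.1 hp.2
  rw [curl, (hαd p hp).fderiv] at h1
  have h2 : 0 ≤ ψ p := χ.nonneg
  nlinarith [mul_nonneg h2 h1]

end StripEnd

end StokesEnds

section StokesSurface

open MeasureTheory

lemma continuousOn_curl {b : ℂ → ℂ →L[ℝ] ℝ} {U : Set ℂ} (hU : IsOpen U) (hb : ContDiffOn ℝ 1 b U) :
    ContinuousOn (curl b) U := by
  have h1 := hb.continuousOn_fderiv_of_isOpen hU (by simp)
  exact ((h1.clm_apply continuousOn_const).clm_apply continuousOn_const).sub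
    ((h1.clm_apply continuousOn_const).clm_apply continuousOn_const)

lemma integrableOn_curl {b : ℂ → ℂ →L[ℝ] ℝ} (hb : ContDiffOn ℝ 1 b (Metric.closedBall 0 1)) :
    IntegrableOn (curl b) (Metric.ball 0 1) := by
  have hBu : UniqueDiffOn ℝ (Metric.closedBall (0 : ℂ) 1) :=
    uniqueDiffOn_convex (convex_closedBall 0 1) (by
      rw [interior_closedBall _ one_ne_zero]; exact Metric.nonempty_ball.2 one_pos)
  have hc := hb.continuousOn_fderivWithin hBu (by simp)
  have h1 : IntegrableOn (fun z => fderivWithin ℝ b (Metric.closedBall 0 1) z 1 Complex.I -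
      fderivWithin ℝ b (Metric.closedBall 0 1) z Complex.I 1) (Metric.closedBall 0 1) :=
    ContinuousOn.integrableOn_compact (isCompact_closedBall 0 1)
      (((hc.clm_apply continuousOn_const).clm_apply continuousOn_const).sub
        ((hc.clm_apply continuousOn_const).clm_apply continuousOn_const))
  refine (h1.mono_set Metric.ball_subset_closedBall).congr_fun (fun z hz => ?_) measurableSet_ball
  simp only [curl, fderivWithin_of_mem_nhds (mem_of_superset (Metric.isOpen_ball.mem_nhds hz)
    Metric.ball_subset_closedBall)]

/-- Stokes' theorem on a disc with strip-like ends, in the form of a maximum principle: a one-form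
which vanishes along the boundary, has nonnegative exterior derivative, and has nonpositive integrals
over the paths `{s} × [0,1]` far out on the ends, is closed, and none of those integrals can be
negative. -/
theorem curl_eq_zero_of_ends {n : ℕ} {S : Set ℂ} {ζ : Fin n → ℂ} (hζ : Function.Injective ζ)
    (hS : S = Metric.closedBall 0 1 \ range ζ) {β : ℂ → ℂ →L[ℝ] ℝ} (hβ : ContDiffOn ℝ 1 β S)
    (hbd : ∀ z ∈ S, ‖z‖ = 1 → β z (Complex.I * z) = 0)
    (hpos : ∀ z ∈ Metric.ball (0 : ℂ) 1, 0 ≤ curl β z) {ε : Fin n → ℂ → ℂ}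
    (hε : ∀ k, StripEnd S (ε k) (ζ k)) {N : Set (Fin n)}
    (hend : ∀ k, ∃ T : ℝ, 0 ≤ T ∧
      (∀ p : ℂ, T < p.re → p.im ∈ Ioo (0 : ℝ) 1 → 0 ≤ curl (endForm β (ε k)) p) ∧
      ∀ s : ℝ, T ≤ s → ∫ y in (0 : ℝ)..1, endForm β (ε k) ⟨s, y⟩ Complex.I ≤ 0 ∧
        (k ∈ N → ∫ y in (0 : ℝ)..1, endForm β (ε k) ⟨s, y⟩ Complex.I < 0)) :
    N = ∅ ∧ ∀ z ∈ Metric.ball (0 : ℂ) 1, curl β z = 0 := by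
  -- the cutoff functions at the punctures are chosen such that they vanish at a given point `z₀`
  suffices H : ∀ z₀ ∈ Metric.ball (0 : ℂ) 1, N = ∅ ∧ curl β z₀ = 0 from
    ⟨(H 0 (Metric.mem_ball_self one_pos)).1, fun z hz => (H z hz).2⟩
  intro z₀ hz₀
  choose T hT hcurl hneg using hend
  choose r hr hr1 hr2 using fun k => (hε k).exists_near (hT k)
  have hballS : Metric.ball (0 : ℂ) 1 ⊆ S := by
    intro z hz
    rw [hS]
    refine ⟨Metric.ball_subset_closedBall hz, ?_⟩
    rintro ⟨k, rfl⟩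
    rw [mem_ball_zero_iff, (hε k).norm_point] at hz
    exact lt_irrefl _ hz
  -- a common radius for the cutoff functions
  obtain ⟨R, hR0, hR⟩ : ∃ R : ℝ, 0 < R ∧ ∀ k, R < r k ∧ R < dist z₀ (ζ k) ∧
      ∀ j, j ≠ k → 2 * R < dist (ζ j) (ζ k) := by
    have h1 : ∀ᶠ R in 𝓝[>] (0 : ℝ), ∀ k, R < r k ∧ R < dist z₀ (ζ k) ∧
        ∀ j, j ≠ k → 2 * R < dist (ζ j) (ζ k) := by
      refine eventually_all.2 fun k => ?_
      have hz : 0 < dist z₀ (ζ k) := dist_pos.2 fun h => (hε k).not_mem (h ▸ hballS hz₀)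
      refine Filter.Eventually.and (mem_nhdsWithin_of_mem_nhds (gt_mem_nhds (hr k)))
        (Filter.Eventually.and (mem_nhdsWithin_of_mem_nhds (gt_mem_nhds hz)) ?_)
      refine eventually_all.2 fun j => ?_
      by_cases hj : j = k
      · exact Eventually.of_forall fun _ h => absurd hj h
      · have hd : 0 < dist (ζ j) (ζ k) / 2 := half_pos (dist_pos.2 fun h => hj (hζ h))
        filter_upwards [mem_nhdsWithin_of_mem_nhds (gt_mem_nhds hd)] with R hR _
        linarith
    obtain ⟨R, hR, hR0⟩ := (h1.and self_mem_nhdsWithin).exists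
    exact ⟨R, hR0, hR⟩
  set χ : ∀ k, ContDiffBump (ζ k) := fun k => ⟨R / 2, R, half_pos hR0, half_lt_self hR0⟩ with hχ
  have hχs : ∀ k, ContDiff ℝ ∞ (χ k) := fun k => (χ k).contDiff
  set c : ℂ → ℝ := fun z => ∑ k, χ k z with hc
  have hcs : ContDiff ℝ ∞ c := ContDiff.sum fun k _ => hχs k
  have hone : ∀ k z, dist z (ζ k) < R → c z = χ k z := by
    intro k z hz
    refine Finset.sum_eq_single k (fun j _ hj => (χ j).zero_of_le_dist ?_) (by simp)
    have h1 := (hR k).2.2 j hj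
    have h2 := dist_triangle_left (ζ j) (ζ k) z
    change R ≤ _
    linarith
  have hc0 : ∀ z, (∀ k, R ≤ dist z (ζ k)) → c z = 0 := fun z hz =>
    Finset.sum_eq_zero fun k _ => (χ k).zero_of_le_dist (hz k)
  have hc1 : ∀ z, c z ≤ 1 := by
    intro z
    by_cases h : ∃ k, dist z (ζ k) < R
    · obtain ⟨k, hk⟩ := h
      rw [hone k z hk]; exact (χ k).le_one
    · push Not at h
      rw [hc0 z h]; exact zero_le_one
  have hcζ : ∀ k, ∀ᶠ z in 𝓝 (ζ k), c z = 1 := by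
    intro k
    filter_upwards [Metric.ball_mem_nhds (ζ k) (half_pos hR0)] with z hz
    rw [Metric.mem_ball] at hz
    rw [hone k z (by linarith)]
    exact (χ k).one_of_mem_closedBall (Metric.ball_subset_closedBall hz)
  -- the cut off form
  set b : ℂ → ℂ →L[ℝ] ℝ := fun z => (1 - c z) • β z with hb
  have hcl : IsOpen (range ζ)ᶜ := (finite_range ζ).isClosed.isOpen_compl
  have hSnhds : ∀ z ∉ range ζ, 𝓝[Metric.closedBall 0 1] z ≤ 𝓝[S] z := by
    intro z hz
    refine nhdsWithin_le_iff.2 ?_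
    rw [hS]
    exact inter_mem self_mem_nhdsWithin (mem_nhdsWithin_of_mem_nhds (hcl.mem_nhds hz))
  have hbs : ContDiffOn ℝ 1 b (Metric.closedBall 0 1) := by
    intro z hz
    by_cases hzr : z ∈ range ζ
    · obtain ⟨k, rfl⟩ := hzr
      refine (contDiffAt_const (c := (0 : ℂ →L[ℝ] ℝ))).congr_of_eventuallyEq ?_ |>.contDiffWithinAt
      filter_upwards [hcζ k] with w hw
      simp [hb, hw]
    · have h1 : ContDiffWithinAt ℝ 1 b S z :=
        (contDiff_const.sub (hcs.of_le (by simp))).contDiffAt.contDiffWithinAt.smul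
          (hβ z (by rw [hS]; exact ⟨hz, hzr⟩))
      exact h1.mono_of_mem_nhdsWithin (hSnhds z hzr self_mem_nhdsWithin)
  have hbbd : ∀ z ∈ Metric.sphere (0 : ℂ) 1, b z (Complex.I * z) = 0 := by
    intro z hz
    have hzn : ‖z‖ = 1 := by simpa using hz
    by_cases hzr : z ∈ range ζ
    · obtain ⟨k, rfl⟩ := hzr
      simp [hb, (hcζ k).self_of_nhds]
    · simp only [hb, smul_apply]
      rw [hbd z (by rw [hS]; exact ⟨by simp [hzn], hzr⟩) hzn, smul_zero]
  have hstokes := integral_curl_ball_eq_zero hbs hbbd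
  set w : Fin n → ℂ → ℝ := fun k z =>
    fderiv ℝ (χ k) z 1 * β z Complex.I - fderiv ℝ (χ k) z Complex.I * β z 1 with hw
  -- the curl of the truncated form, up to the terms `w k` from the derivatives of the cutoff functions
  have hcurlb : ∀ z ∈ Metric.ball (0 : ℂ) 1, (1 - c z) * curl β z = curl b z + ∑ k, w k z := by
    intro z hz
    have h1 : HasFDerivAt (fun z => 1 - c z) (-∑ k, fderiv ℝ (χ k) z) z := by
      have : HasFDerivAt c (∑ k, fderiv ℝ (χ k) z) z :=
        HasFDerivAt.fun_sum fun k _ => (((hχs k).differentiable (by simp)) z).hasFDerivAt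
      exact this.const_sub 1
    have h2 : HasFDerivAt β (fderiv ℝ β z) z := by
      refine DifferentiableAt.hasFDerivAt ?_
      exact (hβ.differentiableOn (by simp)).differentiableAt
        (mem_of_superset (Metric.isOpen_ball.mem_nhds hz) hballS)
    have h3 := (h1.smul h2).fderiv
    have h4 : fderiv ℝ b z = _ := h3
    simp only [curl, h4, hw, add_apply, smul_apply, ContinuousLinearMap.smulRight_apply, neg_apply,
      sum_apply, smul_eq_mul, Finset.sum_sub_distrib, ← Finset.sum_mul]
    ring
  have hwc : ∀ k, ContinuousOn (w k) (Metric.closedBall 0 1) := by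
    intro k z hz
    by_cases hzr : z ∈ range ζ
    · obtain ⟨j, rfl⟩ := hzr
      have h0 : ∀ᶠ z in 𝓝 (ζ j), fderiv ℝ (χ k) z = 0 := by
        by_cases hjk : j = k
        · subst hjk
          have : (χ j : ℂ → ℝ) =ᶠ[𝓝 (ζ j)] fun _ => 1 := (χ j).eventuallyEq_one
          filter_upwards [this.fderiv (𝕜 := ℝ)] with y hy
          rw [hy]; simp
        · have : (χ k : ℂ → ℝ) =ᶠ[𝓝 (ζ j)] fun _ => 0 := by
            filter_upwards [Metric.ball_mem_nhds (ζ j) hR0] with y hy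
            rw [Metric.mem_ball] at hy
            refine (χ k).zero_of_le_dist ?_
            have h1 := (hR k).2.2 j hjk
            have h2 := dist_triangle_left (ζ j) (ζ k) y
            change R ≤ _
            linarith
          filter_upwards [this.fderiv (𝕜 := ℝ)] with y hy
          rw [hy]; simp
      refine (continuousAt_const (y := (0 : ℝ))).congr ?_ |>.continuousWithinAt
      filter_upwards [h0] with y hy
      simp [hw, hy]
    · have h1 : ContinuousWithinAt β S z := hβ.continuousOn z (by rw [hS]; exact ⟨hz, hzr⟩)
      have h2 : Continuous (fderiv ℝ (χ k)) := (hχs k).continuous_fderiv (by simp)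
      have h3 : ContinuousWithinAt (w k) S z :=
        ((h2.continuousAt.continuousWithinAt.clm_apply continuousWithinAt_const).mul
          (h1.clm_apply continuousWithinAt_const)).sub
        ((h2.continuousAt.continuousWithinAt.clm_apply continuousWithinAt_const).mul
          (h1.clm_apply continuousWithinAt_const))
      exact Tendsto.mono_left h3 (hSnhds z hzr)
  have hwint : ∀ k, IntegrableOn (w k) (Metric.ball 0 1) := fun k =>
    ((hwc k).integrableOn_compact (isCompact_closedBall 0 1)).mono_set Metric.ball_subset_closedBall
  set g : ℂ → ℝ := fun z => (1 - c z) * curl β z with hg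
  have hgint : IntegrableOn g (Metric.ball 0 1) := by
    have h1 : IntegrableOn (fun z => curl b z + ∑ k, w k z) (Metric.ball 0 1) :=
      (integrableOn_curl hbs).add (integrable_finsetSum _ fun k _ => hwint k)
    exact h1.congr_fun (fun z hz => (hcurlb z hz).symm) measurableSet_ball
  have hgsum : ∫ z in Metric.ball (0 : ℂ) 1, g z = ∑ k, ∫ z in Metric.ball (0 : ℂ) 1, w k z := by
    rw [setIntegral_congr_fun measurableSet_ball hcurlb,
      integral_add (integrableOn_curl hbs) (integrable_finsetSum _ fun k _ => hwint k), hstokes, zero_add,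
      integral_finsetSum _ fun k _ => hwint k]
  have hg0 : ∀ z ∈ Metric.ball (0 : ℂ) 1, 0 ≤ g z := fun z hz =>
    mul_nonneg (sub_nonneg.2 (hc1 z)) (hpos z hz)
  have hgpos : 0 ≤ ∫ z in Metric.ball (0 : ℂ) 1, g z := setIntegral_nonneg measurableSet_ball hg0
  choose T' hT' hle using fun k => (hε k).exists_integral_le hβ hbd (hT k) (hcurl k) (hr1 k) (hr2 k)
    (χ k) (hR k).1
  have hwle : ∀ k, ∫ z in Metric.ball (0 : ℂ) 1, w k z ≤ 0 := fun k =>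
    (hle k).trans (hneg k _ (hT' k)).1
  -- the integral of `g` is nonnegative, and equal to a sum of nonpositive contributions of the ends
  have hN : N = ∅ := by
    by_contra hne
    obtain ⟨k, hk⟩ := nonempty_iff_ne_empty.2 hne
    have : ∑ k, ∫ z in Metric.ball (0 : ℂ) 1, w k z < 0 :=
      Finset.sum_neg' (fun k _ => hwle k) ⟨k, Finset.mem_univ k,
        (hle k).trans_lt ((hneg k _ (hT' k)).2 hk)⟩
    linarith
  refine ⟨hN, ?_⟩
  have hgzero : ∫ z in Metric.ball (0 : ℂ) 1, g z = 0 :=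
    le_antisymm (hgsum.le.trans (Finset.sum_nonpos fun k _ => hwle k)) hgpos
  have hae := (setIntegral_eq_zero_iff_of_nonneg_ae
    ((ae_restrict_iff' measurableSet_ball).2 (Eventually.of_forall hg0)) hgint).1 hgzero
  have hgc : ContinuousOn g (Metric.ball 0 1) :=
    (continuous_const.sub hcs.continuous).continuousOn.mul
      (continuousOn_curl Metric.isOpen_ball (hβ.mono hballS))
  -- `g` is continuous and has integral zero, so it vanishes; at `z₀` it is the curl of `β`
  have heq := Measure.eqOn_open_of_ae_eq hae Metric.isOpen_ball hgc continuousOn_const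
  have h1 : g z₀ = 0 := heq hz₀
  rw [hg] at h1
  simp only [hc0 z₀ fun k => (hR k).2.1.le, sub_zero, one_mul] at h1
  exact h1

end StokesSurface

/-! ### Differential inequalities along the ends -/

section Riccati

open MeasureTheory

/-- A function which satisfies the Riccati type inequality `(a + A)² ≤ B a'` wherever it is
nonnegative would blow up in finite time if it ever became nonnegative. The inequality is stated in
linearized form, with a parameter `l`. -/
lemma neg_of_riccati {a k : ℝ → ℝ} {T A B : ℝ} (hA : 0 < A) (hB : 0 < B)
    (ha : ∀ s, T < s → HasDerivAt a (k s) s) (hk : ∀ s, T < s → 0 ≤ k s)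
    (hest : ∀ s, T < s → ∀ l : ℝ, 0 < l → a s ≤ -A + l * B + k s / (4 * l)) {s : ℝ} (hs : T < s) :
    a s < 0 := by
  by_contra hneg
  have h0 : 0 ≤ a s := not_lt.1 hneg
  have hmono : MonotoneOn a (Ici s) := by
    refine monotoneOn_of_deriv_nonneg (convex_Ici s)
      (fun t ht => (ha t (hs.trans_le ht)).continuousAt.continuousWithinAt)
      (fun t ht => (ha t (hs.trans_le (interior_subset ht))).differentiableAt.differentiableWithinAt)
      fun t ht => ?_
    have ht' := hs.trans_le (interior_subset ht)
    rw [(ha t ht').deriv]; exact hk t ht'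
  have hpos : ∀ t, s ≤ t → 0 < a t + A := fun t ht => by
    have := hmono self_mem_Ici ht ht
    linarith
  -- the choice of `l` that minimizes the right hand side of the estimate
  have hric : ∀ t, s ≤ t → 1 / B ≤ k t / (a t + A) ^ 2 := by
    intro t ht
    have h1 := hpos t ht
    have h2 := hest t (hs.trans_le ht) ((a t + A) / (2 * B)) (by positivity)
    have h3 : (a t + A) / (2 * B) * B = (a t + A) / 2 := by field_simp
    have h4 : k t / (4 * ((a t + A) / (2 * B))) = k t * B / (2 * (a t + A)) := by field_simp; norm_num
    rw [h3, h4] at h2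
    have h5 : (a t + A) / 2 ≤ k t * B / (2 * (a t + A)) := by linarith
    rw [div_le_div_iff₀ two_pos (by positivity)] at h5
    rw [div_le_div_iff₀ hB (by positivity)]
    nlinarith
  have hgd : ∀ t, s ≤ t → HasDerivAt (fun t => -(a t + A)⁻¹) (k t / (a t + A) ^ 2) t := by
    intro t ht
    have h1 := (((ha t (hs.trans_le ht)).add_const A).inv (hpos t ht).ne').neg
    refine h1.congr_deriv ?_
    ring
  -- the function `-(a + A)⁻¹` grows at rate at least `1 / B`, hence would be nonnegative at this time
  set t := s + B / (a s + A) with ht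
  have hst : s ≤ t := by
    have := hpos s le_rfl
    have : 0 < B / (a s + A) := by positivity
    linarith
  have hmv := (convex_Ici s).mul_sub_le_image_sub_of_le_deriv (f := fun t => -(a t + A)⁻¹) (C := 1 / B)
    (fun t ht => (hgd t ht).continuousAt.continuousWithinAt)
    (fun t ht => (hgd t (interior_subset ht)).differentiableAt.differentiableWithinAt)
    (fun t ht => by rw [(hgd t (interior_subset ht)).deriv]; exact hric t (interior_subset ht))
    s self_mem_Ici t hst hst
  have h1 : 0 < (a t + A)⁻¹ := inv_pos.2 (hpos t hst)
  have h2 : 1 / B * (t - s) = (a s + A)⁻¹ := by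
    have := hpos s le_rfl
    rw [ht]; field_simp; ring
  rw [h2] at hmv
  linarith

lemma exists_forall_of_eventually {P : ℝ → ℝ → Prop}
    (h : ∀ t ∈ Icc (0 : ℝ) 1, ∀ᶠ p : ℝ × ℝ in atTop ×ˢ 𝓝[Icc 0 1] t, P p.1 p.2) :
    ∃ T : ℝ, ∀ s, T ≤ s → ∀ t ∈ Icc (0 : ℝ) 1, P s t := by
  have := isCompact_Icc.induction_on (s := Icc (0 : ℝ) 1)
    (p := fun A => ∃ T : ℝ, ∀ s, T ≤ s → ∀ t ∈ A, P s t) ⟨0, by simp⟩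
    (fun A B hAB ⟨T, hT⟩ => ⟨T, fun s hs t ht => hT s hs t (hAB ht)⟩)
    (fun A B ⟨T, hT⟩ ⟨T', hT'⟩ => ⟨max T T', fun s hs t ht => by
      rcases ht with ht | ht
      · exact hT s ((le_max_left _ _).trans hs) t ht
      · exact hT' s ((le_max_right _ _).trans hs) t ht⟩)
    (fun t ht => by
      obtain ⟨u, hu, v, hv, huv⟩ := mem_prod_iff.1 (h t ht)
      obtain ⟨T, hT⟩ := mem_atTop_sets.1 hu
      exact ⟨v, hv, T, fun s hs t ht => huv (show (s, t) ∈ u ×ˢ v from ⟨hT s hs, ht⟩)⟩)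
  exact this

/-- The integrals of a one-form over the paths `{s} × [0,1]` in a half-strip vary according to Stokes'
theorem. -/
lemma hasDerivAt_integral_end {α : ℂ → ℂ →L[ℝ] ℝ} (hα : ContDiffOn ℝ 1 α (strip 0))
    (h01 : ∀ p ∈ strip 0, p.im = 0 ∨ p.im = 1 → α p 1 = 0) {s : ℝ} (hs : 0 < s) :
    HasDerivAt (fun s => ∫ y in (0 : ℝ)..1, α ⟨s, y⟩ Complex.I)
      (∫ y in (0 : ℝ)..1, (fderivWithin ℝ α (strip 0) ⟨s, y⟩ 1 Complex.I -
        fderivWithin ℝ α (strip 0) ⟨s, y⟩ Complex.I 1)) s := by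
  set D := fderivWithin ℝ α (strip 0) with hD
  have hDc : ContinuousOn D (strip 0) := hα.continuousOn_fderivWithin (uniqueDiffOn_strip 0) (by simp)
  set κ : ℂ → ℝ := fun p => D p 1 Complex.I - D p Complex.I 1 with hκ
  have hκc : ContinuousOn κ (strip 0) := ((hDc.clm_apply continuousOn_const).clm_apply
    continuousOn_const).sub ((hDc.clm_apply continuousOn_const).clm_apply continuousOn_const)
  -- extend the integrand continuously to the plane
  set pr : ℝ × ℝ → ℂ := fun p => ((max 0 p.1 : ℝ) : ℂ) + ((max 0 (min 1 p.2) : ℝ) : ℂ) * Complex.I with hpr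
  have hprc : Continuous pr := by fun_prop
  have hpre : ∀ p, pr p = ⟨max 0 p.1, max 0 (min 1 p.2)⟩ := fun p => by
    apply Complex.ext <;> simp [hpr]
  have hprs : ∀ p, pr p ∈ strip 0 := fun p => by
    rw [hpre]
    exact ⟨le_max_left _ _, le_max_left _ _, max_le zero_le_one (min_le_left _ _)⟩
  have hfc : Continuous fun p : ℝ × ℝ => κ (pr p) := hκc.comp_continuous hprc hprs
  set K : ℝ → ℝ := fun x => ∫ y in (0 : ℝ)..1, κ (pr (x, y)) with hK
  have hKc : Continuous K := intervalIntegral.continuous_parametric_intervalIntegral_of_continuous'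
    (f := fun x y => κ (pr (x, y))) hfc 0 1
  have hKeq : ∀ x, 0 ≤ x → K x = ∫ y in (0 : ℝ)..1, κ ⟨x, y⟩ := by
    intro x hx
    refine intervalIntegral.integral_congr fun y hy => ?_
    rw [uIcc_of_le zero_le_one] at hy
    simp only [hpre, max_eq_right hx, min_eq_right hy.2, max_eq_right hy.1]
  have hs2 : 0 < s / 2 := half_pos hs
  have hint : ∀ x, s / 2 ≤ x → (∫ y in (0 : ℝ)..1, α ⟨x, y⟩ Complex.I) =
      (∫ y in (0 : ℝ)..1, α ⟨s / 2, y⟩ Complex.I) + ∫ x' in (s / 2)..x, K x' := by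
    intro x hx
    have hrs : rect (s / 2) x ⊆ strip 0 := rect_subset_strip hs2.le
    have hbox := integral_curl_rect hx (hα.continuousOn.mono hrs) (hDc.mono hrs)
      (fun z hz => ((hα.differentiableOn one_ne_zero) z
        (hrs (openRect_subset_rect _ _ hz))).hasFDerivWithinAt.hasFDerivAt
          (strip_mem_nhds (hs2.trans hz.1.1) hz.2))
      (fun z hz hi => h01 z (hrs hz) hi)
    have h1 : ∫ x' in (s / 2)..x, K x' =
        ∫ x' in (s / 2)..x, ∫ y in (0 : ℝ)..1, (D ⟨x', y⟩ 1 Complex.I - D ⟨x', y⟩ Complex.I 1) := by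
      refine intervalIntegral.integral_congr fun x' hx' => ?_
      rw [uIcc_of_le hx] at hx'
      exact hKeq x' (hs2.le.trans hx'.1)
    rw [h1, hbox]; ring
  have hd := (hKc.integral_hasStrictDerivAt (s / 2) s).hasDerivAt.const_add
    (∫ y in (0 : ℝ)..1, α ⟨s / 2, y⟩ Complex.I)
  rw [hKeq s hs.le] at hd
  refine hd.congr_of_eventuallyEq ?_
  filter_upwards [lt_mem_nhds (half_lt_self hs)] with x hx
  exact hint x hx.le

end Riccati

/-! ### The exterior derivative of the action form -/

section CurlFormula

variable {E : Type*} [NormedAddCommGroup E] [NormedSpace ℝ E]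
variable {W : Type*} [TopologicalSpace W] [ChartedSpace E W] [IsManifold 𝓘(ℝ, E) ∞ W]

lemma curl_congr {b b' : ℂ → ℂ →L[ℝ] ℝ} {z : ℂ} (h : b =ᶠ[𝓝 z] b') : curl b z = curl b' z := by
  rw [curl, curl, h.fderiv_eq]

/-- The exterior derivative of `F u^*θ - G γ - dg`. Second derivatives of `g` drop out, and those of `u`
combine to `u^*ω`. -/
lemma curl_formula {θ : OneForm E W} (hθ : SmoothForm θ) {u : ℂ → W} {S : Set ℂ} (hS : UniqueDiffOn ℝ S)
    (hu : ContMDiffOn 𝓘(ℝ, ℂ) 𝓘(ℝ, E) ∞ u S) {z : ℂ} (hz : S ∈ 𝓝 z) {F G g : ℂ → ℝ}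
    {γ : ℂ → ℂ →L[ℝ] ℝ} {F' G' : ℂ →L[ℝ] ℝ} (hF : HasFDerivAt F F' z) (hG : HasFDerivAt G G' z)
    (hγ : DifferentiableAt ℝ γ z) (hg : ContDiffOn ℝ ∞ g S) :
    curl (fun z => F z • pullForm θ u S z - G z • γ z - fderivWithin ℝ g S z) z =
      F' 1 * fm θ (u z) (vel (E := E) u S z Complex.I) - F' Complex.I * fm θ (u z) (vel (E := E) u S z 1) +
      F z * om θ (u z) (vel u S z 1) (vel u S z Complex.I) -
      (G' 1 * γ z Complex.I - G' Complex.I * γ z 1) - G z * curl γ z := by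
  have hzS : z ∈ S := mem_of_mem_nhds hz
  have hzi : z ∈ closure (interior S) := subset_closure (mem_interior_iff_mem_nhds.2 hz)
  have hp : ContDiffOn ℝ ∞ (pullForm θ u S) S := contDiffOn_pullForm hθ hS hu
  have hpd : HasFDerivAt (pullForm θ u S) (fderivWithin ℝ (pullForm θ u S) S z) z :=
    ((hp.differentiableOn (by simp)) z hzS).hasFDerivWithinAt.hasFDerivAt hz
  have hgd : ContDiffAt ℝ ∞ g z := hg.contDiffAt hz
  have hg2 : fderivWithin ℝ g S =ᶠ[𝓝 z] fderiv ℝ g := by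
    filter_upwards [eventually_mem_nhds_iff.2 hz] with y hy
    exact fderivWithin_of_mem_nhds hy
  have hg3 : HasFDerivAt (fderivWithin ℝ g S) (fderiv ℝ (fderiv ℝ g) z) z := by
    have : DifferentiableAt ℝ (fderiv ℝ g) z :=
      (hgd.fderiv_right (m := ∞) (by simp)).differentiableAt (by simp)
    exact this.hasFDerivAt.congr_of_eventuallyEq hg2
  have hsym : fderiv ℝ (fderiv ℝ g) z 1 Complex.I = fderiv ℝ (fderiv ℝ g) z Complex.I 1 :=
    (hgd.isSymmSndFDerivAt (by simpa using two_le_infty)).eq 1 Complex.I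
  have hcp := curl_pullForm hθ hS hu hzS hzi 1 Complex.I
  have hd := (((hF.smul hpd).sub (hG.smul hγ.hasFDerivAt)).sub hg3).fderiv
  have hd' : fderiv ℝ (fun z => F z • pullForm θ u S z - G z • γ z - fderivWithin ℝ g S z) z = _ := hd
  rw [curl, hd']
  simp only [_root_.sub_apply, add_apply, smul_apply, ContinuousLinearMap.smulRight_apply, smul_eq_mul,
    hsym, pullForm_apply, curl]
  rw [← hcp]
  ring

end CurlFormula

/-! ### Negativity of the action form along ends outside the subdomain -/

section EndEstimate

variable {E : Type*} [NormedAddCommGroup E] [NormedSpace ℝ E] [FiniteDimensional ℝ E]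
variable {W : Type*} [TopologicalSpace W] [T2Space W] [ChartedSpace E W]
  [IsManifold 𝓘(ℝ, E) ∞ W]

/-- The inequality `θ(Jξ) ≤ l ω(Z, JZ) + ω(ξ, Jξ) / 4l`, a form of the Cauchy-Schwarz inequality for the
metric `ω(·, J·)`. -/
lemma LiouvilleManifold.fm_le (Y : LiouvilleManifold E W) {x : W} {J : E →L[ℝ] E}
    (hsym : ∀ u u' : E, om Y.θ x u (J u') = om Y.θ x u' (J u)) (hpos : ∀ u : E, 0 ≤ om Y.θ x u (J u))
    (ξ : E) {l : ℝ} (hl : 0 < l) :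
    fm Y.θ x (J ξ) ≤ l * fm Y.θ x (J (vv Y.Z x)) + om Y.θ x ξ (J ξ) / (4 * l) := by
  have h := hpos ((2 * l) • vv Y.Z x - ξ)
  rw [map_sub, map_smul, om_sub_left, om_sub_right, om_sub_right, om_smul_left, om_smul_left,
    om_smul_right, om_smul_right, hsym ξ (vv Y.Z x), Y.om_Z, Y.om_Z] at h
  have h4 : (0 : ℝ) < 4 * l := by positivity
  rw [← sub_nonneg]
  have : 0 ≤ (4 * l * (l * fm Y.θ x (J (vv Y.Z x))) + om Y.θ x ξ (J ξ) -
      4 * l * fm Y.θ x (J ξ)) / (4 * l) := div_nonneg (by linarith) h4.le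
  convert this using 1
  field_simp

namespace TargetData

variable {Y : LiouvilleManifold E W} (V : TargetData Y)

/-- On an end where the solution satisfies Floer's equation and stays outside the subdomain, the
integral `a(s)` of the action form over the segments is nondecreasing and satisfies the differential
inequality that forces it to be negative. The constant `A` bounds from below the part of the
action that survives in the limit. -/
lemma integral_end_neg {v : ℂ → W} (hv : ContMDiffOn 𝓘(ℝ, ℂ) 𝓘(ℝ, E) ∞ v (strip 0)) {T w A B : ℝ}
    (hT : 0 ≤ T) (hA : 0 < A) (hB : 0 < B) {J : ℂ → E →L[ℝ] E}
    (hsym : ∀ p ∈ strip T, ∀ u u' : E, om Y.θ (v p) u (J p u') = om Y.θ (v p) u' (J p u))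
    (hpos : ∀ p ∈ strip T, ∀ u : E, 0 ≤ om Y.θ (v p) u (J p u))
    (hJB : ∀ p ∈ strip T, fm Y.θ (v p) (J p (vv Y.Z (v p))) ≤ B)
    (heq : ∀ p ∈ strip T, vel v (strip 0) p Complex.I - w • vv (Y.X V.H) (v p) =
      J p (vel v (strip 0) p 1))
    {g : W → ℝ} (hg : ContMDiff 𝓘(ℝ, E) 𝓘(ℝ, ℝ) ∞ g) {α : ℂ → ℂ →L[ℝ] ℝ}
    (hα : ContDiffOn ℝ 1 α (strip 0))
    (h01 : ∀ p ∈ strip 0, p.im = 0 ∨ p.im = 1 → α p 1 = 0)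
    (hαeq : ∀ p ∈ strip T, α p = pullForm Y.θ v (strip 0) p - (w * V.H (v p)) • Complex.imCLM -
      fderivWithin ℝ (fun q => g (v q)) (strip 0) p)
    (hlow : ∀ s, T ≤ s → A ≤ (∫ t in (0 : ℝ)..1, w * V.actionDensity (v ⟨s, t⟩)) +
      (g (v ⟨s, 1⟩) - g (v ⟨s, 0⟩))) :
    (∀ p : ℂ, T < p.re → p.im ∈ Ioo (0 : ℝ) 1 → 0 ≤ curl α p) ∧
      ∀ s, T < s → ∫ y in (0 : ℝ)..1, α ⟨s, y⟩ Complex.I < 0 := by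
  have hgv : ContDiffOn ℝ ∞ (fun q => g (v q)) (strip 0) := contDiffOn_comp hg hv
  have hHv : ContDiffOn ℝ ∞ (fun q => V.H (v q)) (strip 0) := contDiffOn_comp V.smooth_H hv
  have hTs : ∀ p : ℂ, T ≤ p.re → p.im ∈ Icc (0 : ℝ) 1 → p ∈ strip T := fun p h1 h2 => ⟨h1, h2⟩
  have hT0 : ∀ p ∈ strip T, p ∈ strip 0 := fun p hp => ⟨hT.trans hp.1, hp.2⟩
  -- the curl of the action form is the energy density
  have hcurl : ∀ p : ℂ, T < p.re → p.im ∈ Ioo (0 : ℝ) 1 →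
      curl α p = om Y.θ (v p) (vel v (strip 0) p 1) (J p (vel v (strip 0) p 1)) := by
    intro p h1 h2
    have hpT : p ∈ strip T := hTs p h1.le (Ioo_subset_Icc_self h2)
    have hn : strip T ∈ 𝓝 p := strip_mem_nhds h1 h2
    have hn0 : strip 0 ∈ 𝓝 p := mem_of_superset hn hT0
    have hGd : HasFDerivAt (fun q => w * V.H (v q))
        (w • fderivWithin ℝ (fun q => V.H (v q)) (strip 0) p) p :=
      (((hHv.differentiableOn (by simp)) p (hT0 p hpT)).hasFDerivWithinAt.hasFDerivAt hn0).const_mul w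
    have hev : α =ᶠ[𝓝 p] fun z => (1 : ℝ) • pullForm Y.θ v (strip 0) z -
        (w * V.H (v z)) • (fun _ => Complex.imCLM) z - fderivWithin ℝ (fun q => g (v q)) (strip 0) z := by
      filter_upwards [hn] with z hz
      rw [hαeq z hz, one_smul]
    rw [curl_congr hev, curl_formula Y.smooth_θ (uniqueDiffOn_strip 0) hv hn0
      (hasFDerivAt_const (1 : ℝ) p) hGd (differentiableAt_const _) hgv]
    have hcc : curl (fun _ : ℂ => Complex.imCLM) p = 0 := by simp [curl]
    have hdH : fderivWithin ℝ (fun q => V.H (v q)) (strip 0) p 1 =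
        df V.H (v p) (vel (E := E) v (strip 0) p 1) :=
      fderivWithin_comp_vel ((V.smooth_H.contMDiffAt).mdifferentiableAt (by simp))
        (uniqueDiffOn_strip 0 p (hT0 p hpT)) ((hv p (hT0 p hpT)).mdifferentiableWithinAt (by simp)) 1
    rw [hcc]
    have hI : vel v (strip 0) p Complex.I = J p (vel v (strip 0) p 1) + w • vv (Y.X V.H) (v p) := by
      rw [← heq p hpT, sub_add_cancel]
    rw [hI, om_add_right, om_smul_right, om_swap _ _ _ (vv (Y.X V.H) (v p)), Y.om_X]
    simp [hdH]
  refine ⟨fun p h1 h2 => ?_, fun s hs => ?_⟩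
  · rw [hcurl p h1 h2]
    exact hpos p (hTs p h1.le (Ioo_subset_Icc_self h2)) _
  have hline : ∀ s, T < s → ContinuousOn (fun y : ℝ => (⟨s, y⟩ : ℂ)) (Icc 0 1) ∧
      MapsTo (fun y : ℝ => (⟨s, y⟩ : ℂ)) (Icc 0 1) (strip 0) := fun s hs =>
    ⟨((Complex.equivRealProdCLM.symm.continuous.comp (by fun_prop : Continuous fun y : ℝ => (s, y))) :
      Continuous fun y : ℝ => (⟨s, y⟩ : ℂ)).continuousOn, fun y hy => ⟨(hT.trans hs.le), hy⟩⟩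
  have hD1 : ContinuousOn (fderivWithin ℝ α (strip 0)) (strip 0) :=
    hα.continuousOn_fderivWithin (uniqueDiffOn_strip 0) le_rfl
  have hκ : ContinuousOn (fun p => fderivWithin ℝ α (strip 0) p 1 Complex.I -
      fderivWithin ℝ α (strip 0) p Complex.I 1) (strip 0) :=
    ((hD1.clm_apply continuousOn_const).clm_apply continuousOn_const).sub
      ((hD1.clm_apply continuousOn_const).clm_apply continuousOn_const)
  have hκc : ∀ p : ℂ, T < p.re → p.im ∈ Ioo (0 : ℝ) 1 → fderivWithin ℝ α (strip 0) p 1 Complex.I -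
      fderivWithin ℝ α (strip 0) p Complex.I 1 = curl α p := by
    intro p h1 h2
    have hn0 : strip 0 ∈ 𝓝 p := mem_of_superset (strip_mem_nhds h1 h2) hT0
    rw [curl, fderivWithin_of_mem_nhds hn0]
  have hint : ∀ {q : ℂ → ℝ}, ContinuousOn q (strip 0) → ∀ s, T < s →
      IntervalIntegrable (fun y : ℝ => q ⟨s, y⟩) MeasureTheory.volume 0 1 := fun hq s hs =>
    ContinuousOn.intervalIntegrable (by
      rw [uIcc_of_le zero_le_one]
      exact hq.comp (hline s hs).1 (hline s hs).2)
  have hαI : ContinuousOn (fun p => α p Complex.I) (strip 0) := hα.continuousOn.clm_apply continuousOn_const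
  have hDv : ContinuousOn (fun p => w * V.actionDensity (v p)) (strip 0) :=
    continuousOn_const.mul (V.continuous_actionDensity.comp_continuousOn hv.continuousOn)
  have hgI : ContinuousOn (fun p => fderivWithin ℝ (fun q => g (v q)) (strip 0) p Complex.I) (strip 0) :=
    (hgv.continuousOn_fderivWithin (uniqueDiffOn_strip 0) (by simp)).clm_apply continuousOn_const
  have hftc : ∀ s, T < s → ∫ y in (0 : ℝ)..1,
      fderivWithin ℝ (fun q => g (v q)) (strip 0) ⟨s, y⟩ Complex.I = g (v ⟨s, 1⟩) - g (v ⟨s, 0⟩) := by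
    intro s hs
    refine intervalIntegral.integral_eq_sub_of_hasDerivAt_of_le (f := fun y : ℝ => g (v ⟨s, y⟩))
      zero_le_one (hgv.continuousOn.comp (hline s hs).1 (hline s hs).2) (fun y hy => ?_) (hint hgI s hs)
    have hn0 : strip 0 ∈ 𝓝 (⟨s, y⟩ : ℂ) := strip_mem_nhds (hT.trans_lt hs) hy
    have h1 : HasFDerivAt (fun q => g (v q)) (fderivWithin ℝ (fun q => g (v q)) (strip 0) ⟨s, y⟩)
        (⟨s, y⟩ : ℂ) :=
      ((hgv.differentiableOn (by simp)) _ (mem_of_mem_nhds hn0)).hasFDerivWithinAt.hasFDerivAt hn0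
    have h2 : HasDerivAt (fun y : ℝ => (⟨s, y⟩ : ℂ)) Complex.I y := by
      have : HasDerivAt (fun y : ℝ => (s : ℂ) + y * Complex.I) (1 * Complex.I) y :=
        ((Complex.ofRealCLM.hasDerivAt (x := y)).mul_const Complex.I).const_add _
      rw [one_mul] at this
      refine this.congr_of_eventuallyEq (Eventually.of_forall fun y => ?_)
      exact Complex.mk_eq_add_mul_I s y
    exact h1.comp_hasDerivAt y h2
  -- the derivative of `a(s)` is the energy `κ(s)` of the segment
  refine neg_of_riccati (k := fun s => ∫ y in (0 : ℝ)..1, (fderivWithin ℝ α (strip 0) ⟨s, y⟩ 1 Complex.I -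
        fderivWithin ℝ α (strip 0) ⟨s, y⟩ Complex.I 1)) hA hB
    (fun s hs => hasDerivAt_integral_end hα h01 (hT.trans_lt hs)) (fun s hs => ?_)
    (fun s hs l hl => ?_) hs
  · refine intervalIntegral.integral_nonneg_of_ae_restrict zero_le_one ?_
    rw [← MeasureTheory.restrict_Ioo_eq_restrict_Icc]
    refine MeasureTheory.ae_restrict_of_forall_mem measurableSet_Ioo fun y hy => ?_
    simp only [Pi.zero_apply]
    rw [hκc ⟨s, y⟩ hs hy, hcurl ⟨s, y⟩ hs hy]
    exact hpos _ (hTs _ hs.le (Ioo_subset_Icc_self hy)) _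
  -- completing the square in `θ(Jξ)` gives `a(s) ≤ l * B + κ(s) / (4 * l) - A` for all `l > 0`
  · have hpt : ∀ y ∈ Ioo (0 : ℝ) 1, α ⟨s, y⟩ Complex.I ≤
        (l * B + (fderivWithin ℝ α (strip 0) ⟨s, y⟩ 1 Complex.I -
          fderivWithin ℝ α (strip 0) ⟨s, y⟩ Complex.I 1) / (4 * l)) -
        (w * V.actionDensity (v ⟨s, y⟩) +
          fderivWithin ℝ (fun q => g (v q)) (strip 0) ⟨s, y⟩ Complex.I) := by
      intro y hy
      have hp : (⟨s, y⟩ : ℂ) ∈ strip T := hTs _ hs.le (Ioo_subset_Icc_self hy)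
      have hI : vel v (strip 0) ⟨s, y⟩ Complex.I =
          J ⟨s, y⟩ (vel v (strip 0) ⟨s, y⟩ 1) + w • vv (Y.X V.H) (v ⟨s, y⟩) := by
        rw [← heq _ hp, sub_add_cancel]
      have h1 := Y.fm_le (hsym _ hp) (hpos _ hp) (vel v (strip 0) ⟨s, y⟩ 1) hl
      have h2 := mul_le_mul_of_nonneg_left (hJB _ hp) hl.le
      rw [hκc ⟨s, y⟩ hs hy, hcurl ⟨s, y⟩ hs hy, hαeq _ hp]
      simp only [_root_.sub_apply, smul_apply, pullForm_apply, hI, map_add, map_smul,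
        Y.fm_X, actionDensity, smul_eq_mul, Complex.imCLM_apply, Complex.I_im]
      linarith
    have hsum := intervalIntegral.integral_mono_on_of_le_Ioo zero_le_one (hint hαI s hs)
      (((intervalIntegrable_const (c := l * B)).add ((hint hκ s hs).div_const (4 * l))).sub
        ((hint hDv s hs).add (hint hgI s hs))) hpt
    rw [intervalIntegral.integral_sub
      ((intervalIntegrable_const (c := l * B)).add ((hint hκ s hs).div_const (4 * l)))
        ((hint hDv s hs).add (hint hgI s hs)),
      intervalIntegral.integral_add (intervalIntegrable_const (c := l * B))
        ((hint hκ s hs).div_const (4 * l)),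
      intervalIntegral.integral_add (hint hDv s hs) (hint hgI s hs), hftc s hs,
      intervalIntegral.integral_div, intervalIntegral.integral_const] at hsum
    have := hlow s hs.le
    simp only [sub_zero, one_smul] at hsum
    linarith

end TargetData

end EndEstimate

section EndBounds

/-- Local bounds near infinity over each point of `[0, 1]` give a bound on a half-strip, by compactness. -/
lemma exists_bound_of_eventually {f : ℂ → ℝ}
    (h : ∀ t ∈ Icc (0 : ℝ) 1, ∃ B : ℝ, ∀ᶠ p : ℝ × ℝ in atTop ×ˢ 𝓝[Icc 0 1] t, f ⟨p.1, p.2⟩ ≤ B) :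
    ∃ B : ℝ, 0 < B ∧ ∃ T : ℝ, 0 ≤ T ∧ ∀ p ∈ strip T, f p ≤ B := by
  have key : ∃ B : ℝ, ∃ T : ℝ, ∀ s, T ≤ s → ∀ t ∈ Icc (0 : ℝ) 1, f ⟨s, t⟩ ≤ B := by
    refine isCompact_Icc.induction_on
      (p := fun A : Set ℝ => ∃ B : ℝ, ∃ T : ℝ, ∀ s, T ≤ s → ∀ t ∈ A, f ⟨s, t⟩ ≤ B)
      ⟨0, 0, fun s _ t ht => absurd ht (notMem_empty t)⟩
      (fun A A' hA ⟨B, T, hT⟩ => ⟨B, T, fun s hs t ht => hT s hs t (hA ht)⟩)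
      (fun A A' ⟨B, T, hT⟩ ⟨B', T', hT'⟩ => ⟨max B B', max T T', fun s hs t ht =>
        ht.elim (fun ht => (hT s (le_of_max_le_left hs) t ht).trans (le_max_left _ _))
          (fun ht => (hT' s (le_of_max_le_right hs) t ht).trans (le_max_right _ _))⟩)
      (fun t ht => ?_)
    obtain ⟨B, hB⟩ := h t ht
    obtain ⟨u, hu, v, hv, huv⟩ := mem_prod_iff.1 hB
    obtain ⟨T, hT⟩ := mem_atTop_sets.1 hu
    exact ⟨v, hv, B, T, fun s hs t ht => huv (show (s, t) ∈ u ×ˢ v from ⟨hT s hs, ht⟩)⟩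
  obtain ⟨B, T, hT⟩ := key
  exact ⟨max B 1, lt_max_of_lt_right one_pos, max T 0, le_max_right _ _, fun p hp =>
    (hT p.re (le_of_max_le_left hp.1) p.im hp.2).trans (le_max_left _ _)⟩

variable {E : Type*} [NormedAddCommGroup E] [NormedSpace ℝ E] [FiniteDimensional ℝ E]
variable {W : Type*} [TopologicalSpace W] [T2Space W] [ChartedSpace E W]
  [IsManifold 𝓘(ℝ, E) ∞ W]

/-- The function `θ(J ξ)` in terms of the coordinate expressions of `θ`, `J` and `ξ`. -/
lemma fm_en_eq_chart (θ : OneForm E W) (J : EndField E W) {x₀ : W} {y : E}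
    (hy : y ∈ (extChartAt 𝓘(ℝ, E) x₀).target) (ξ : E) :
    fm θ ((extChartAt 𝓘(ℝ, E) x₀).symm y) (en J ((extChartAt 𝓘(ℝ, E) x₀).symm y) ξ) =
      coordForm θ x₀ y (coordEnd J x₀ y (cv x₀ ((extChartAt 𝓘(ℝ, E) x₀).symm y) ξ)) := by
  let A : E →L[ℝ] E := mfderiv 𝓘(ℝ, E) 𝓘(ℝ, E) ((extChartAt 𝓘(ℝ, E) x₀).symm : E → W) y
  have hinv : ∀ ξ : E, A (cv x₀ ((extChartAt 𝓘(ℝ, E) x₀).symm y) ξ) = ξ := by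
    intro ξ
    have h := mfderivWithin_extChartAt_symm_comp_mfderiv_extChartAt (I := 𝓘(ℝ, E)) hy
    have hr : range (𝓘(ℝ, E) : E → E) = univ := by simp
    rw [hr, mfderivWithin_univ] at h
    exact congrArg (fun l : E →L[ℝ] E => l ξ) h
  have h1 : coordForm θ x₀ y (coordEnd J x₀ y (cv x₀ ((extChartAt 𝓘(ℝ, E) x₀).symm y) ξ)) =
      fm θ ((extChartAt 𝓘(ℝ, E) x₀).symm y) (A (cv x₀ ((extChartAt 𝓘(ℝ, E) x₀).symm y)
        (en J ((extChartAt 𝓘(ℝ, E) x₀).symm y) (A (cv x₀ ((extChartAt 𝓘(ℝ, E) x₀).symm y) ξ))))) := rfl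
  rw [h1, hinv, hinv]

lemma eventually_norm_le {X F : Type*} [SeminormedAddCommGroup F] {f : X → F} {l : Filter X} {a : F}
    (h : Tendsto f l (𝓝 a)) : ∀ᶠ x in l, ‖f x‖ ≤ ‖a‖ + 1 :=
  (h.norm.eventually (ge_mem_nhds (lt_add_one ‖a‖)))

/-- Along an end, `ω(Z, JZ) = θ(JZ)` stays bounded. -/
lemma LiouvilleManifold.exists_fm_end_le (Y : LiouvilleManifold E W) {K : Set W}
    (hK : Y.completion K = univ) {J : ℂ → EndField E W} {Jlim : ℝ → EndField E W}
    (hlim : Y.SmoothFamily K (Icc (0 : ℝ) 1) Jlim)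
    (hJ : ∀ x₀ : W, ∃ U : Set E, IsOpen U ∧ extChartAt 𝓘(ℝ, E) x₀ x₀ ∈ U ∧ ∃ B : ℝ,
      ∀ q ∈ strip 0 ×ˢ U, ‖coordEnd (J q.1) x₀ q.2 - coordEnd (Jlim q.1.im) x₀ q.2‖ ≤ B)
    {v : ℂ → W} {x : ℝ → W} (hv : ∀ t ∈ Icc (0 : ℝ) 1,
      Tendsto (fun p : ℝ × ℝ => v ⟨p.1, p.2⟩) (atTop ×ˢ 𝓝[Icc 0 1] t) (𝓝 (x t))) :
    ∃ B : ℝ, 0 < B ∧ ∃ T : ℝ, 0 ≤ T ∧ ∀ p ∈ strip T,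
      fm Y.θ (v p) (en (J p) (v p) (vv Y.Z (v p))) ≤ B := by
  refine exists_bound_of_eventually (f := fun p => fm Y.θ (v p) (en (J p) (v p) (vv Y.Z (v p))))
    fun t ht => ?_
  set φ := extChartAt 𝓘(ℝ, E) (x t) with hφ
  obtain ⟨U, hU, hxU, B, hB⟩ := hJ (x t)
  have hsrc : ∀ᶠ p : ℝ × ℝ in atTop ×ˢ 𝓝[Icc 0 1] t, v ⟨p.1, p.2⟩ ∈ φ.source :=
    (hv t ht).eventually (extChartAt_source_mem_nhds (I := 𝓘(ℝ, E)) (x t))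
  have hφv : Tendsto (fun p : ℝ × ℝ => φ (v ⟨p.1, p.2⟩)) (atTop ×ˢ 𝓝[Icc 0 1] t) (𝓝 (φ (x t))) :=
    (continuousAt_extChartAt (I := 𝓘(ℝ, E)) (x t)).tendsto.comp (hv t ht)
  have htgt : φ.target ∈ 𝓝 (φ (x t)) := extChartAt_target_mem_nhds (I := 𝓘(ℝ, E)) (x t)
  -- in a chart at `x t`, the form, the almost complex structure and the Liouville field are all bounded
  have h1 := eventually_norm_le ((((Y.smooth_θ (x t)).continuousOn.continuousAt htgt).tendsto).comp hφv)
  have h2 := eventually_norm_le (((Y.isFlow.contMDiffAt_cv (x t) (x t)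
    (mem_extChartAt_source (I := 𝓘(ℝ, E)) (x t))).continuousAt.tendsto).comp (hv t ht))
  have hpair : Tendsto (fun p : ℝ × ℝ => (p.2, φ (v ⟨p.1, p.2⟩))) (atTop ×ˢ 𝓝[Icc 0 1] t)
      (𝓝[Icc 0 1 ×ˢ φ.target] (t, φ (x t))) := by
    rw [nhdsWithin_prod_eq]
    refine tendsto_snd.prodMk (tendsto_nhdsWithin_of_tendsto_nhds_of_eventually_within _ hφv ?_)
    filter_upwards [hφv.eventually htgt] with p hp using hp
  have hJc : ContinuousWithinAt (fun p : ℝ × E => coordEnd (Jlim p.1) (x t) p.2)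
      (Icc 0 1 ×ˢ φ.target) (t, φ (x t)) := by
    have := (hlim (x t)).continuousOn
    rw [hK, preimage_univ, inter_univ] at this
    exact this _ ⟨ht, mem_of_mem_nhds htgt⟩
  have h3 := eventually_norm_le (hJc.tendsto.comp hpair)
  have h4 : ∀ᶠ p : ℝ × ℝ in atTop ×ˢ 𝓝[Icc 0 1] t, 0 ≤ p.1 ∧ p.2 ∈ Icc (0 : ℝ) 1 :=
    (tendsto_fst.eventually (eventually_ge_atTop 0)).and (tendsto_snd.eventually self_mem_nhdsWithin)
  refine ⟨(‖coordForm Y.θ (x t) (φ (x t))‖ + 1) * ((B + (‖coordEnd (Jlim t) (x t) (φ (x t))‖ + 1)) *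
    (‖cv (x t) (x t) (vv Y.Z (x t))‖ + 1)), ?_⟩
  filter_upwards [hsrc, h1, h2, h3, h4, hφv.eventually (hU.mem_nhds hxU)] with p hp h1 h2 h3 h4 h5
  have hxy : φ.symm (φ (v ⟨p.1, p.2⟩)) = v ⟨p.1, p.2⟩ := φ.left_inv hp
  have hform := fm_en_eq_chart Y.θ (J ⟨p.1, p.2⟩) (φ.map_source hp) (vv Y.Z (v ⟨p.1, p.2⟩))
  rw [← hφ, hxy] at hform
  rw [hform]
  have hJB := hB (⟨p.1, p.2⟩, φ (v ⟨p.1, p.2⟩)) ⟨⟨h4.1, h4.2⟩, h5⟩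
  have hJn : ‖coordEnd (J ⟨p.1, p.2⟩) (x t) (φ (v ⟨p.1, p.2⟩))‖ ≤
      B + (‖coordEnd (Jlim t) (x t) (φ (x t))‖ + 1) := by
    refine le_trans ?_ (add_le_add hJB h3)
    refine le_trans (le_of_eq ?_) (norm_add_le _ _)
    simp
  refine (le_abs_self _).trans (((coordForm Y.θ (x t) (φ (v ⟨p.1, p.2⟩))).le_opNorm_of_le
    ((ContinuousLinearMap.le_of_opNorm_le_of_le _ hJn h2))).trans
      (mul_le_mul_of_nonneg_right h1 ?_))
  exact mul_nonneg ((norm_nonneg _).trans hJn) ((norm_nonneg _).trans h2)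

namespace TargetData

variable {Y : LiouvilleManifold E W} {V : TargetData Y}

/-- Far along an end which converges to a chord `x` of positive action, the terms of the action that do
not involve the Cauchy-Riemann operator are bounded below by half of that action. -/
lemma IsChord.exists_le_integral {w : ℕ} {x : ℝ → W} (hx : V.IsChord w x) (hpos : 0 < V.action w x)
    {v : ℂ → W} (hvc : ContinuousOn v (strip 0)) (hv : ∀ t ∈ Icc (0 : ℝ) 1,
      Tendsto (fun p : ℝ × ℝ => v ⟨p.1, p.2⟩) (atTop ×ˢ 𝓝[Icc 0 1] t) (𝓝 (x t)))
    {g : W → ℝ} (hg : Continuous g) (h0 : g (x 0) = V.h (x 0)) (h1 : g (x 1) = V.h (x 1)) :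
    ∃ T : ℝ, 0 ≤ T ∧ ∀ s, T ≤ s → V.action w x / 2 ≤
      (∫ t in (0 : ℝ)..1, w * V.actionDensity (v ⟨s, t⟩)) + (g (v ⟨s, 1⟩) - g (v ⟨s, 0⟩)) := by
  -- a sixth of the action is lost in each of the integral, the start point and the end point
  set e := V.action w x / 6 with he
  have hepos : 0 < e := by positivity
  have hDx : ContinuousOn (fun t => w * V.actionDensity (x t)) (Icc 0 1) :=
    continuousOn_const.mul (V.continuous_actionDensity.comp_continuousOn hx.continuousOn)
  obtain ⟨T₁, hT₁⟩ := exists_forall_of_eventually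
    (P := fun s t => w * V.actionDensity (x t) - e < w * V.actionDensity (v ⟨s, t⟩)) fun t ht => by
      have hl : Tendsto (fun p : ℝ × ℝ => w * V.actionDensity (v ⟨p.1, p.2⟩) -
          w * V.actionDensity (x p.2)) (atTop ×ˢ 𝓝[Icc 0 1] t) (𝓝 0) := by
        have := (((V.continuous_actionDensity.tendsto (x t)).comp (hv t ht)).const_mul (w : ℝ)).sub
          ((hDx t ht).tendsto.comp (tendsto_snd (f := atTop (α := ℝ))))
        rwa [sub_self] at this
      filter_upwards [hl.eventually (lt_mem_nhds (neg_lt_zero.2 hepos))] with p hp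
      linarith
  have hend : ∀ t ∈ Icc (0 : ℝ) 1, Tendsto (fun s : ℝ => g (v ⟨s, t⟩)) atTop (𝓝 (g (x t))) := fun t ht =>
    (hg.tendsto (x t)).comp ((hv t ht).comp (tendsto_id.prodMk
      (tendsto_const_pure.mono_right (pure_le_nhdsWithin ht))))
  obtain ⟨T₂, hT₂⟩ := eventually_atTop.1 (((hend 1 (by simp)).eventually
    (lt_mem_nhds (sub_lt_self (g (x 1)) hepos))).and ((hend 0 (by simp)).eventually
    (gt_mem_nhds (lt_add_of_pos_right (g (x 0)) hepos))))
  refine ⟨max 0 (max T₁ T₂), le_max_left _ _, fun s hs => ?_⟩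
  have hs0 : 0 ≤ s := le_of_max_le_left hs
  have hs1 : T₁ ≤ s := (le_max_left _ _).trans (le_of_max_le_right hs)
  have hs2 := hT₂ s ((le_max_right _ _).trans (le_of_max_le_right hs))
  have hvs : ContinuousOn (fun t : ℝ => w * V.actionDensity (v ⟨s, t⟩)) (Icc 0 1) :=
    continuousOn_const.mul (V.continuous_actionDensity.comp_continuousOn (hvc.comp
      ((Complex.equivRealProdCLM.symm.continuous.comp (by fun_prop : Continuous fun y : ℝ => (s, y))) :
        Continuous fun y : ℝ => (⟨s, y⟩ : ℂ)).continuousOn (fun y hy => ⟨hs0, hy⟩)))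
  have hi : IntervalIntegrable (fun t => w * V.actionDensity (x t)) MeasureTheory.volume 0 1 :=
    ContinuousOn.intervalIntegrable (by rwa [uIcc_of_le zero_le_one])
  have hmono := intervalIntegral.integral_mono_on zero_le_one (hi.sub intervalIntegrable_const)
    (ContinuousOn.intervalIntegrable (by rwa [uIcc_of_le zero_le_one]))
    (fun t ht => (hT₁ s hs1 t ht).le)
  rw [intervalIntegral.integral_sub hi intervalIntegrable_const, intervalIntegral.integral_const] at hmono
  have ha := hx.action_eq
  simp only [sub_zero, one_smul] at hmono
  have h6 : V.action w x = 6 * e := by rw [he]; ring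
  rw [h0, h1] at hs2
  linarith [hs2.1, hs2.2]

end TargetData

end EndBounds

/-! ### Almost complex structures of contact type -/

section Contact

variable {E : Type*} [NormedAddCommGroup E] [NormedSpace ℝ E] [FiniteDimensional ℝ E]
variable {W : Type*} [TopologicalSpace W] [T2Space W] [ChartedSpace E W]
  [IsManifold 𝓘(ℝ, E) ∞ W]

namespace LiouvilleManifold

variable {Y : LiouvilleManifold E W} {K : Set W} {I : EndField E W}

lemma IsACS.en_en (h : Y.IsACS K I) (hK : Y.completion K = univ) (x : W) (v : E) :
    en I x (en I x v) = -v := h.sq x (hK ▸ mem_univ x) v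

lemma IsACS.om_symm (h : Y.IsACS K I) (hK : Y.completion K = univ) (x : W) (u v : E) :
    om Y.θ x u (en I x v) = om Y.θ x v (en I x u) := by
  have h1 : om Y.θ x (en I x u) (en I x (en I x v)) = om Y.θ x u (en I x v) :=
    h.invariant x (hK ▸ mem_univ x) u (en I x v)
  rw [← h1, h.en_en hK, om_neg_right, om_swap, neg_neg]

lemma IsACS.om_pos (h : Y.IsACS K I) (hK : Y.completion K = univ) {x : W} {v : E} (hv : v ≠ 0) :
    0 < om Y.θ x v (en I x v) := h.tame x (hK ▸ mem_univ x) v hv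

lemma IsACS.om_nonneg (h : Y.IsACS K I) (hK : Y.completion K = univ) (x : W) (v : E) :
    0 ≤ om Y.θ x v (en I x v) := by
  rcases eq_or_ne v 0 with rfl | hv
  · rw [map_zero, om_self]
  · exact (h.om_pos hK hv).le

/-- The contact type condition in the form `θ ∘ J = dr`, where `r = exp (logr)` is the radial
coordinate. -/
lemma ContactTypeOn.fm_en {f : W → ℝ} (hf : Y.IsDefining K f) {A : Set ℝ}
    (h : Y.ContactTypeOn K A I) (hsq : ∀ (x : W) (v : E), en I x (en I x v) = -v) {x : W}
    (hx : x ∈ Y.collar K) (hA : Real.exp (Y.logr K x) ∈ A) (v : E) :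
    fm Y.θ x (en I x v) = Real.exp (Y.logr K x) * df (Y.logr K) x v := by
  obtain ⟨I₀, hI₀⟩ := h
  set t := Y.logr K x with ht
  have hy : Y.flow (-t) x ∈ frontier K := hf.flow_neg_logr hx
  set y := Y.flow (-t) x with hyd
  have hxy : x = Y.flow t y := (Y.isFlow.cancel_neg t x).symm
  obtain ⟨hR, hξ, hI⟩ := hI₀ (Real.exp t) hA (Real.exp_pos t) y hy
  have hI' : ∀ v : E, en I x (dd (Y.flow t) y v) = dd (Y.flow t) y (en I₀ y v) := by
    intro v
    have := hI v
    unfold ψ dψ ψ at this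
    rw [Real.log_exp, ← hxy] at this
    exact this
  have hycol := hf.frontier_subset_collar hy
  set R : E := en I₀ y (vv Y.Z y) with hRd
  have hRt : df (Y.logr K) y R = 0 := (hf.mem_tangentTo_frontier_iff hy R).1 hR.1
  have hRθ : fm Y.θ y R = 1 := hR.2.1
  -- the structure at the boundary also has square `-1` on the Liouville field
  have hIR : en I₀ y R = -vv Y.Z y := by
    have h1 := hsq x (dd (Y.flow t) y (vv Y.Z y))
    rw [hI', hI'] at h1
    have h2 := congrArg (dd (Y.flow (-t)) (Y.flow t y)) h1
    rwa [map_neg, Y.dd_neg_cancel, Y.dd_neg_cancel] at h2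
  have key : ∀ v : E, fm Y.θ y (en I₀ y v) = df (Y.logr K) y v := by
    intro v
    set ξ : E := v - df (Y.logr K) y v • vv Y.Z y - fm Y.θ y v • R with hξd
    have hξ1 : ξ ∈ tangentTo (E := E) (frontier K) y := by
      refine (hf.mem_tangentTo_frontier_iff hy ξ).2 ?_
      rw [hξd, map_sub, map_sub, map_smul, map_smul, hRt, hf.df_logr_Z hycol]
      simp
    have hξ2 : fm Y.θ y ξ = 0 := by
      rw [hξd, map_sub, map_sub, map_smul, map_smul, hRθ, Y.fm_Z]
      simp
    have hξ3 : fm Y.θ y (en I₀ y ξ) = 0 := (hξ ξ ⟨hξ1, hξ2⟩).2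
    have hv : v = ξ + df (Y.logr K) y v • vv Y.Z y + fm Y.θ y v • R := by rw [hξd]; abel
    calc fm Y.θ y (en I₀ y v)
        = fm Y.θ y (en I₀ y (ξ + df (Y.logr K) y v • vv Y.Z y + fm Y.θ y v • R)) := by rw [← hv]
      _ = df (Y.logr K) y v := by
        simp only [map_add, map_smul, hIR, ← hRd, map_neg, hξ3, hRθ, Y.fm_Z]
        simp
  have hv : dd (Y.flow t) y (dd (Y.flow (-t)) x v) = v := by
    have := Y.dd_cancel_neg t y v
    rwa [← hxy] at this
  rw [← hv, hI']
  have h1 := Y.fm_flow t y (en I₀ y (dd (Y.flow (-t)) x v))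
  have h2 := hf.df_logr_flow hycol t (dd (Y.flow (-t)) x v)
  rw [← hxy] at h1 h2
  rw [h1, h2, key]

end LiouvilleManifold

end Contact

/-! ### The truncated action form of a solution -/

namespace WeightedDisc

variable {d : ℕ} {w : Fin (d + 1) → ℕ} (D : WeightedDisc d w)

lemma norm_point (k : Fin (d + 1)) : ‖D.point k‖ = 1 := Complex.norm_exp_ofReal_mul_I _

lemma isOpen_compl_range_point : IsOpen (range D.point)ᶜ := (finite_range D.point).isClosed.isOpen_compl

lemma ball_subset_S : Metric.ball (0 : ℂ) 1 ⊆ D.S := by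
  rintro z hz
  refine ⟨Metric.ball_subset_closedBall hz, ?_⟩
  rintro ⟨k, rfl⟩
  rw [mem_ball_zero_iff, D.norm_point] at hz
  exact lt_irrefl _ hz

lemma S_mem_nhds {z : ℂ} (hz : z ∈ Metric.ball (0 : ℂ) 1) : D.S ∈ 𝓝 z :=
  mem_of_superset (Metric.isOpen_ball.mem_nhds hz) D.ball_subset_S

lemma uniqueDiffOn_S : UniqueDiffOn ℝ D.S :=
  (uniqueDiffOn_convex (convex_closedBall (0 : ℂ) 1)
    ⟨0, interior_mono Metric.ball_subset_closedBall (by simp [Metric.isOpen_ball.interior_eq])⟩).inter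
      D.isOpen_compl_range_point

lemma mem_bdry {z : ℂ} (hz : z ∈ D.S) (h : ‖z‖ = 1) : z ∈ D.bdry := ⟨by simpa using h, hz.2⟩

lemma mem_S_of_bdry {z : ℂ} (hz : z ∈ D.bdry) : z ∈ D.S := ⟨Metric.sphere_subset_closedBall hz.1, hz.2⟩

/-- Through every boundary point there is a smooth boundary curve with tangent vector `iz`. -/
lemma exists_bdry_curve {z : ℂ} (hz : z ∈ D.bdry) : ∃ e : ℝ → ℂ, ContDiff ℝ ∞ e ∧ e 0 = z ∧
    (∀ t, e t ∈ D.bdry) ∧ fderivWithin ℝ e univ 0 1 = Complex.I * z := by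
  have hc : Continuous fun t : ℝ => z * Complex.exp (t * Complex.I) := by fun_prop
  have hev : ∀ᶠ t : ℝ in 𝓝 0, z * Complex.exp (t * Complex.I) ∈ (range D.point)ᶜ :=
    hc.continuousAt.eventually (D.isOpen_compl_range_point.mem_nhds (by simpa using hz.2))
  obtain ⟨δ, hδ, h⟩ := Metric.eventually_nhds_iff.1 hev
  have hδ2 : 0 < δ / 2 := half_pos hδ
  have hex : HasDerivAt (fun t : ℝ => z * Complex.exp (t * Complex.I)) (Complex.I * z) 0 := by
    have h1 : HasDerivAt (fun t : ℝ => (t : ℂ) * Complex.I) (1 * Complex.I) 0 :=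
      (Complex.ofRealCLM.hasDerivAt (x := (0 : ℝ))).mul_const Complex.I
    refine (h1.cexp.const_mul z).congr_deriv ?_
    simp [mul_comm]
  have hsm : ContDiff ℝ ∞ fun t : ℝ => z * Complex.exp (t * Complex.I) :=
    contDiff_const.mul (Complex.ofRealCLM.contDiff.mul contDiff_const).cexp
  -- the sine keeps the angle smaller than `δ`, so that the arc avoids the punctures for all times
  refine ⟨fun t => z * Complex.exp ((δ / 2 * Real.sin (t / (δ / 2)) : ℝ) * Complex.I),
    hsm.comp (contDiff_sin_scale _), by simp, fun t => ⟨?_, h ?_⟩, ?_⟩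
  · have : ‖z‖ = 1 := by simpa using hz.1
    rw [mem_sphere_zero_iff_norm, norm_mul, Complex.norm_exp_ofReal_mul_I, this, one_mul]
  · rw [Real.dist_eq, sub_zero]
    exact (abs_sin_scale_le hδ2 t).trans_lt (half_lt_self hδ)
  · have h0 : δ / 2 * Real.sin (0 / (δ / 2)) = 0 := by simp
    have h1 : HasDerivAt (fun t : ℝ => z * Complex.exp (t * Complex.I)) (Complex.I * z)
        (δ / 2 * Real.sin (0 / (δ / 2))) := by rw [h0]; exact hex
    have h2 := h1.scomp (0 : ℝ) (hasDerivAt_sin_scale hδ2)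
    rw [one_smul] at h2
    rw [fderivWithin_univ, fderiv_apply_one_eq_deriv]
    exact h2.deriv

end WeightedDisc

section CutForm

variable {E : Type*} [NormedAddCommGroup E] [NormedSpace ℝ E] [FiniteDimensional ℝ E]
variable {W : Type*} [TopologicalSpace W] [T2Space W] [ChartedSpace E W]
  [IsManifold 𝓘(ℝ, E) ∞ W]

namespace TargetData

variable {Y : LiouvilleManifold E W} (V : TargetData Y)

/-- The action form `u^*θ - H(u) γ` of a map `u`, multiplied by a cutoff function that vanishes near
`MinR ρ`, and made to vanish along the boundary of `S` by subtracting an exact form. -/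
def cutForm {d : ℕ} {w : Fin (d + 1) → ℕ} (D : WeightedDisc d w) (ρ a a' b : ℝ) (u : ℂ → W) (z : ℂ) :
    ℂ →L[ℝ] ℝ :=
  Y.cut V.Min a a' (u z) • pullForm Y.θ u D.S z -
    (Y.cut V.Min a a' (u z) * V.HR ρ (u z)) • D.γ z -
    fderivWithin ℝ (fun z => V.hcut b (u z)) D.S z

variable {f : W → ℝ} (hf : Y.IsDefining V.Min f)
include hf

lemma not_mem_MinR {ρ a : ℝ} (ha : Real.log ρ < a) {x : W} (hx : Y.flow (-a) x ∉ interior V.Min) :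
    x ∉ V.MinR ρ := by
  rw [mem_MinR_iff]
  intro h
  apply hx
  have := hf.flow_mem_interior_of_neg h (t := Real.log ρ - a) (by linarith)
  rwa [← Y.isFlow.add, show Real.log ρ - a + -Real.log ρ = -a by ring] at this

lemma contMDiff_cut_mul_HR {ρ a a' : ℝ} (hρ : ρ ∈ Ioo (0 : ℝ) 1) (ha : Real.log ρ < a) (haa : a < a') :
    ContMDiff 𝓘(ℝ, E) 𝓘(ℝ, ℝ) 1 (fun x => Y.cut V.Min a a' x * V.HR ρ x) := by
  intro x
  by_cases hx : Y.flow (-a) x ∈ interior V.Min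
  · refine (contMDiffAt_const (c := (0 : ℝ))).congr_of_eventuallyEq ?_
    filter_upwards [hf.eventually_cut_eq_zero (b := a') hx] with y hy
    rw [hy, zero_mul]
  · exact (((hf.contMDiff_cut haa).of_le (by simp)) x).mul
      (V.contMDiffAt_HR hf hρ (V.not_mem_MinR hf ha hx))

variable {d : ℕ} {w : Fin (d + 1) → ℕ} {D : WeightedDisc d w} (hD : D.IsAdmissible) {ρ : ℝ}
  (hρ : ρ ∈ Ioo (0 : ℝ) 1) {J : ℂ → EndField E W} {xs : Fin (d + 1) → ℝ → W} {u : ℂ → W}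
  (hu : D.IsSolution V.M (V.LR ρ) (Y.X (V.HR ρ)) J xs u)
include hD hρ hu

lemma contDiffOn_cutForm {a a' b : ℝ} (ha : Real.log ρ < a) (haa : a < a') (hb : 0 < b) :
    ContDiffOn ℝ 1 (V.cutForm D ρ a a' b u) D.S := by
  have h1 : ContDiffOn ℝ 1 (fun z => Y.cut V.Min a a' (u z)) D.S :=
    contDiffOn_comp ((hf.contMDiff_cut haa).of_le (by simp)) (hu.smooth.of_le (by simp))
  have h2 : ContDiffOn ℝ 1 (fun z => Y.cut V.Min a a' (u z) * V.HR ρ (u z)) D.S :=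
    contDiffOn_comp (V.contMDiff_cut_mul_HR hf hρ ha haa) (hu.smooth.of_le (by simp))
  have h3 : ContDiffOn ℝ ∞ (fun z => V.hcut b (u z)) D.S :=
    contDiffOn_comp (V.contMDiff_hcut hf hb) hu.smooth
  have h4 : ContDiffOn ℝ 1 (fderivWithin ℝ (fun z => V.hcut b (u z)) D.S) D.S :=
    h3.fderivWithin D.uniqueDiffOn_S (by rw [one_add_one_eq_two]; exact two_le_infty)
  exact ((h1.smul ((contDiffOn_pullForm Y.smooth_θ D.uniqueDiffOn_S hu.smooth).of_le (by simp))).sub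
    (h2.smul (hD.γ_smooth.of_le (by simp)))).sub h4

/-- The truncated action form vanishes along the boundary. -/
lemma cutForm_bdry {a a' b : ℝ} (ha : Real.log ρ < a) (haa : a < a') (ha' : a' < 0) (hb : 0 < b)
    (hbh : ∀ x ∈ V.L, x ∈ V.M → x ∉ V.Min → Y.flow (-b) x ∈ V.Min → V.h x = 0) {z : ℂ} (hz : z ∈ D.S)
    (hz1 : ‖z‖ = 1) : V.cutForm D ρ a a' b u z (Complex.I * z) = 0 := by
  have hzb := D.mem_bdry hz hz1
  obtain ⟨e, he, he0, heb, hed⟩ := D.exists_bdry_curve hzb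
  have hc : ContMDiff 𝓘(ℝ, ℝ) 𝓘(ℝ, E) ∞ (fun t => u (e t)) := by
    rw [← contMDiffOn_univ]
    exact hu.smooth.comp he.contMDiff.contMDiffOn fun t _ => D.mem_S_of_bdry (heb t)
  have hud : MDifferentiableWithinAt 𝓘(ℝ, ℂ) 𝓘(ℝ, E) u D.S z :=
    (hu.smooth z hz).mdifferentiableWithinAt (by simp)
  have hvel : (vel (fun t => u (e t)) univ 0 : ℝ →L[ℝ] E) 1 = vel u D.S z (Complex.I * z) := by
    have hd : DifferentiableWithinAt ℝ e univ 0 :=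
      ((he.differentiable (by simp)) 0).differentiableWithinAt
    have := vel_comp (u := u) (g := e) (t := univ) (q := 0) (s := D.S) (by rw [he0]; exact hud) hd
      (fun t _ => D.mem_S_of_bdry (heb t)) uniqueDiffWithinAt_univ 1
    rw [this, hed, he0]
  have hkey := V.cut_mul_fm_vel hf hρ ha.le haa ha' hb hbh hc (fun t => hu.bdry (heb t))
    (fun t => hu.mem (D.mem_S_of_bdry (heb t)))
  simp only [he0] at hkey
  rw [hvel] at hkey
  have hh : fderivWithin ℝ (fun z => V.hcut b (u z)) D.S z (Complex.I * z) =
      df (V.hcut b) (u z) (vel (E := E) u D.S z (Complex.I * z)) :=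
    fderivWithin_comp_vel ((V.contMDiff_hcut hf hb).contMDiffAt.mdifferentiableAt (by simp))
      (D.uniqueDiffOn_S z hz) hud _
  simp only [cutForm, _root_.sub_apply, smul_apply, pullForm_apply, smul_eq_mul, hD.γ_bdry z hzb, hh]
  linarith

lemma curl_γ_nonpos {z : ℂ} (hz : z ∈ Metric.ball (0 : ℂ) 1) : curl D.γ z ≤ 0 := by
  have := hD.dγ_nonpos z (D.ball_subset_S hz)
  rwa [WeightedDisc.dγ, fderivWithin_of_mem_nhds (D.S_mem_nhds hz)] at this

/-- The exterior derivative of the truncated action form is bounded below by the energy density of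
`u`, weighted by the cutoff function. The derivative of the cutoff function contributes with
a positive sign because `J` is of contact type where that derivative is nonzero. -/
lemma le_curl_cutForm (hJ : ∀ z ∈ D.S, Y.IsACS V.M (J z)) {a a' b η : ℝ} (ha : Real.log ρ < a)
    (haa : a < a') (ha' : a' < 0) (hη : Real.exp a' < ρ + η) (hb : 0 < b)
    (hcon : ∀ z ∈ D.S, Y.ContactTypeOn V.Min (Ico ρ (ρ + η) ∩ Iic 1) (J z)) {z : ℂ}
    (hz : z ∈ Metric.ball (0 : ℂ) 1) {ζ : E}
    (hζ : ζ = vel u D.S z 1 - D.γ z 1 • vv (Y.X (V.HR ρ)) (u z)) :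
    Y.cut V.Min a a' (u z) * om Y.θ (u z) ζ (en (J z) (u z) ζ) ≤ curl (V.cutForm D ρ a a' b u) z := by
  have hzS := D.ball_subset_S hz
  have hn := D.S_mem_nhds hz
  have hud : MDifferentiableWithinAt 𝓘(ℝ, ℂ) 𝓘(ℝ, E) u D.S z :=
    (hu.smooth z hzS).mdifferentiableWithinAt (by simp)
  have hU := D.uniqueDiffOn_S z hzS
  have hF1 : ContDiffOn ℝ 1 (fun z => Y.cut V.Min a a' (u z)) D.S :=
    contDiffOn_comp ((hf.contMDiff_cut haa).of_le (by simp)) (hu.smooth.of_le (by simp))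
  have hG1 : ContDiffOn ℝ 1 (fun z => Y.cut V.Min a a' (u z) * V.HR ρ (u z)) D.S :=
    contDiffOn_comp (V.contMDiff_cut_mul_HR hf hρ ha haa) (hu.smooth.of_le (by simp))
  have hF := ((hF1.differentiableOn one_ne_zero) z hzS).hasFDerivWithinAt.hasFDerivAt hn
  have hG := ((hG1.differentiableOn one_ne_zero) z hzS).hasFDerivWithinAt.hasFDerivAt hn
  have hγ : DifferentiableAt ℝ D.γ z := (hD.γ_smooth.differentiableOn (by simp)).differentiableAt hn
  have hform : curl (V.cutForm D ρ a a' b u) z = _ := curl_formula Y.smooth_θ D.uniqueDiffOn_S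
    hu.smooth hn hF hG hγ (contDiffOn_comp (V.contMDiff_hcut hf hb) hu.smooth)
  have hFd : ∀ v : ℂ, fderivWithin ℝ (fun z => Y.cut V.Min a a' (u z)) D.S z v =
      df (Y.cut V.Min a a') (u z) (vel (E := E) u D.S z v) := fun v =>
    fderivWithin_comp_vel ((hf.contMDiff_cut haa).contMDiffAt.mdifferentiableAt (by simp)) hU hud v
  have hGd : ∀ v : ℂ, fderivWithin ℝ (fun z => Y.cut V.Min a a' (u z) * V.HR ρ (u z)) D.S z v =
      df (fun x => Y.cut V.Min a a' x * V.HR ρ x) (u z) (vel (E := E) u D.S z v) := fun v =>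
    fderivWithin_comp_vel ((V.contMDiff_cut_mul_HR hf hρ ha haa).contMDiffAt.mdifferentiableAt (by simp))
      hU hud v
  rw [hFd, hFd, hGd, hGd] at hform
  by_cases hin : Y.flow (-a) (u z) ∈ interior V.Min
  · -- near such points the cutoff function vanishes
    have h0 := hf.eventually_cut_eq_zero (b := a') hin
    have hc0 : Y.cut V.Min a a' (u z) = 0 := h0.eq_of_nhds
    have h1 : df (E := E) (Y.cut V.Min a a') (u z) = 0 := by
      rw [df_congr h0]; exact mfderiv_const
    have h2 : df (E := E) (fun x => Y.cut V.Min a a' x * V.HR ρ x) (u z) = 0 := by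
      have : (fun x => Y.cut V.Min a a' x * V.HR ρ x) =ᶠ[𝓝 (u z)] fun _ => (0 : ℝ) := by
        filter_upwards [h0] with y hy
        rw [hy, zero_mul]
      rw [df_congr this]; exact mfderiv_const
    rw [hform, h1, h2, hc0]
    simp
  have hnM := V.not_mem_MinR hf ha hin
  have hHd : MDifferentiableAt 𝓘(ℝ, E) 𝓘(ℝ, ℝ) (V.HR ρ) (u z) :=
    (V.contMDiffAt_HR hf hρ hnM).mdifferentiableAt (by simp)
  have hprod : ∀ v : E, df (fun x => Y.cut V.Min a a' x * V.HR ρ x) (u z) v =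
      Y.cut V.Min a a' (u z) * df (V.HR ρ) (u z) v + V.HR ρ (u z) * df (Y.cut V.Min a a') (u z) v := by
    intro v
    have h := ((hf.contMDiff_cut haa).contMDiffAt.mdifferentiableAt (x := u z) (by simp)).hasMFDerivAt.mul
      hHd.hasMFDerivAt
    have h' := h.mfderiv
    have h'' : df (fun x => Y.cut V.Min a a' x * V.HR ρ x) (u z) = _ := h'
    rw [h'']
    rfl
  obtain ⟨c, hc, hdc, hc1⟩ := hf.exists_df_cut haa (u z)
  set X : E := vv (Y.X (V.HR ρ)) (u z) with hX
  set ζ' : E := en (J z) (u z) ζ with hζ'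
  -- Floer's equation gives the second partial derivative of `u` in terms of the first
  have heqI : vel u D.S z Complex.I = ζ' + D.γ z Complex.I • X := by
    have h : vel u D.S z (Complex.I * 1) - D.γ z (Complex.I * 1) • X =
        en (J z) (u z) (vel u D.S z 1 - D.γ z 1 • X) := hu.eqn z hzS 1
    rw [mul_one, ← hζ] at h
    rw [hζ', ← h, sub_add_cancel]
  have heq1 : vel u D.S z 1 = ζ + D.γ z 1 • X := by rw [hζ, sub_add_cancel]
  have hXH : ∀ v : E, om Y.θ (u z) v X = df (V.HR ρ) (u z) v := fun v => by
    rw [om_swap, Y.om_X, neg_neg]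
  have hpos : 0 ≤ Y.cut V.Min a a' (u z) * (V.HR ρ (u z) * -curl D.γ z) :=
    mul_nonneg (LiouvilleManifold.cut_nonneg _ _ _) (mul_nonneg (V.HR_pos hf hρ (hu.mem hzS) hnM).le
      (neg_nonneg.2 (V.curl_γ_nonpos hf hD hρ hu hz)))
  -- the terms with the derivative `c` of the cutoff function: by the contact type condition the first
  -- is a sum of two squares, the others express that `HR ρ` is the radial coordinate where `c ≠ 0`
  have hcc : 0 ≤ c * ((df (Y.logr V.Min) (u z) ζ * fm Y.θ (u z) ζ' -
      df (Y.logr V.Min) (u z) ζ' * fm Y.θ (u z) ζ)) ∧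
      c * df (Y.logr V.Min) (u z) X = 0 ∧ c * fm Y.θ (u z) X = c * V.HR ρ (u z) := by
    rcases eq_or_ne c 0 with rfl | hc0
    · simp
    obtain ⟨hcol, h1, h2⟩ := hc1 hc0
    have hlog : Real.log ρ < Y.logr V.Min (u z) := ha.trans_le h1
    have hle : Y.logr V.Min (u z) ≤ 0 := h2.trans ha'.le
    have hdH := (V.contMDiffAt_HR_collar hf hρ hcol hlog).2 hle
    have hrad : Real.exp (Y.logr V.Min (u z)) ∈ Ico ρ (ρ + η) ∩ Iic 1 := by
      refine ⟨⟨?_, (Real.exp_le_exp.2 h2).trans_lt hη⟩, ?_⟩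
      · rw [← Real.exp_log hρ.1]; exact Real.exp_le_exp.2 hlog.le
      · rw [mem_Iic, ← Real.exp_zero]; exact Real.exp_le_exp.2 hle
    have hsq := (hJ z hzS).en_en V.completion_M
    have hfm := LiouvilleManifold.ContactTypeOn.fm_en hf (hcon z hzS) hsq hcol hrad
    have hexp := Real.exp_pos (Y.logr V.Min (u z))
    have h3 := hfm ζ
    have h4 := hfm ζ'
    rw [hζ', hsq, map_neg, ← hζ'] at h4
    refine ⟨mul_nonneg hc ?_, ?_, ?_⟩
    · rw [hζ', h3, ← hζ']
      have h5 : fm Y.θ (u z) ζ = -(Real.exp (Y.logr V.Min (u z)) * df (Y.logr V.Min) (u z) ζ') := by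
        linarith
      rw [h5]
      have h6 := mul_nonneg hexp.le (sq_nonneg (df (Y.logr V.Min) (u z) ζ))
      have h7 := mul_nonneg hexp.le (sq_nonneg (df (Y.logr V.Min) (u z) ζ'))
      linarith
    · have := Y.df_X (V.HR ρ) (u z)
      rw [hdH] at this
      rw [hX, (mul_eq_zero.1 this).resolve_left hexp.ne', mul_zero]
    · rw [hX, Y.fm_X, hdH, hf.df_logr_Z hcol, V.HR_eq_exp hf hcol hlog hle, mul_one]
  obtain ⟨hc2, hc3, hc4⟩ := hcc
  have hXX : df (V.HR ρ) (u z) X = 0 := Y.df_X _ _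
  rw [hform, hprod, hprod]
  simp only [hdc, heqI, heq1, map_add, map_smul, smul_eq_mul, om_add_left, om_add_right, om_smul_left,
    om_smul_right, hXH, om_swap Y.θ (u z) X ζ', hXX]
  -- `hpos` uses `dγ ≤ 0`; the terms with `γ` but not `curl γ` cancel by `hc3` and `hc4`
  linear_combination hpos + hc2 + hc4 * (df (Y.logr V.Min) (u z) ζ' * D.γ z 1 -
    df (Y.logr V.Min) (u z) ζ * D.γ z Complex.I) + hc3 * (fm Y.θ (u z) ζ * D.γ z Complex.I -
    fm Y.θ (u z) ζ' * D.γ z 1)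

end TargetData

end CutForm

/-! ### The ends of a solution -/

namespace WeightedDisc

variable {d : ℕ} {w : Fin (d + 1) → ℕ} (D : WeightedDisc d w)

/-- The affine identification of the positive half-strip with the domain of `ε^k`. -/
def flip (k : Fin (d + 1)) (p : ℂ) : ℂ := if k = 0 then Complex.I - p else p

/-- The strip-like ends, all parametrized by the positive half-strip. -/
def endMap (k : Fin (d + 1)) (p : ℂ) : ℂ := D.ends k (flip k p)

lemma endMap_of_ne {k : Fin (d + 1)} (hk : k ≠ 0) : D.endMap k = D.ends k := by
  funext p; rw [endMap, flip, if_neg hk]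

lemma halfStrip_of_ne {k : Fin (d + 1)} (hk : k ≠ 0) : halfStrip k = strip 0 := by
  ext z; simp [halfStrip, strip, hk]

lemma flip_im (k : Fin (d + 1)) (p : ℂ) : (flip k p).im = if k = 0 then 1 - p.im else p.im := by
  unfold flip; split_ifs <;> simp

lemma flip_mapsTo (k : Fin (d + 1)) : MapsTo (flip k) (strip 0) (halfStrip k) := by
  rintro p ⟨h1, h2, h3⟩
  unfold flip halfStrip
  split_ifs with hk
  · refine ⟨?_, ?_, ?_⟩ <;> simp <;> linarith
  · exact ⟨by simpa [hk] using h1, h2, h3⟩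

lemma hasDerivAt_flip (k : Fin (d + 1)) (p : ℂ) : HasDerivAt (flip k) (if k = 0 then -1 else 1) p := by
  unfold flip
  split_ifs with hk
  · exact (hasDerivAt_id p).const_sub _
  · exact hasDerivAt_id p

lemma flip_injective (k : Fin (d + 1)) : Function.Injective (flip k) := by
  intro p q h
  unfold flip at h
  split_ifs at h
  · exact sub_right_injective h
  · exact h

/-- Reversing both coordinates turns the negative end into a positive one. -/
lemma tendsto_flip (k : Fin (d + 1)) {l l' : Filter ℝ} (h0 : k = 0 → Tendsto (fun t => 1 - t) l l')
    (h1 : k ≠ 0 → l ≤ l') :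
    Tendsto (fun p : ℝ × ℝ => ((flip k ⟨p.1, p.2⟩).re, (flip k ⟨p.1, p.2⟩).im)) (atTop ×ˢ l)
      (endDir k ×ˢ l') := by
  unfold flip endDir
  split_ifs with hk
  · have : (fun p : ℝ × ℝ => ((Complex.I - ⟨p.1, p.2⟩).re, (Complex.I - ⟨p.1, p.2⟩).im)) =
        Prod.map (fun s : ℝ => -s) (fun t : ℝ => 1 - t) := by
      funext p; simp [Prod.map]
    rw [this]
    exact tendsto_neg_atTop_atBot.prodMap (h0 hk)
  · exact Filter.prod_mono le_rfl (h1 hk)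

variable {D} (hD : D.IsAdmissible)
include hD

/-- The angles of the marked points increase within one period of the exponential. -/
lemma point_injective : Function.Injective D.point := by
  intro j k h
  obtain ⟨n, hn⟩ := Complex.exp_eq_exp_iff_exists_int.1 h
  have h1 : D.angle j = D.angle k + n * (2 * Real.pi) := by
    have h2 : ((D.angle j : ℝ) : ℂ) * Complex.I = ((D.angle k + n * (2 * Real.pi) : ℝ) : ℂ) * Complex.I := by
      rw [hn]; push_cast; ring
    exact_mod_cast mul_right_cancel₀ Complex.I_ne_zero h2
  have hpi : 0 < 2 * Real.pi := by positivity
  have hj := D.angle_lt j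
  have hk := D.angle_lt k
  have hj0 := D.angle_mono.monotone (Fin.zero_le j)
  have hk0 := D.angle_mono.monotone (Fin.zero_le k)
  have hn1 : n < 1 := by
    by_contra! hn1
    have : (1 : ℝ) ≤ n := by exact_mod_cast hn1
    nlinarith
  have hn2 : -1 < n := by
    by_contra! hn2
    have : (n : ℝ) ≤ -1 := by exact_mod_cast hn2
    nlinarith
  have hn0 : n = 0 := by omega
  rw [hn0] at h1
  exact D.angle_mono.injective (by simpa using h1)

lemma hasDerivWithinAt_endMap (k : Fin (d + 1)) {p : ℂ} (hp : p ∈ strip 0) :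
    HasDerivWithinAt (D.endMap k)
      (derivWithin (D.ends k) (halfStrip k) (flip k p) * (if k = 0 then -1 else 1)) (strip 0) p :=
  (((hD.ends_holo k) _ (flip_mapsTo k hp)).hasDerivWithinAt).comp p
    (hasDerivAt_flip k p).hasDerivWithinAt (flip_mapsTo k)

lemma fderivWithin_endMap (k : Fin (d + 1)) {p : ℂ} (hp : p ∈ strip 0) (v : ℂ) :
    fderivWithin ℝ (D.endMap k) (strip 0) p v =
      derivWithin (D.ends k) (halfStrip k) (flip k p) * (if k = 0 then -1 else 1) * v := by
  rw [((hasDerivWithinAt_endMap hD k hp).hasFDerivWithinAt.restrictScalars ℝ).fderivWithin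
    (uniqueDiffOn_strip 0 p hp)]
  simp [mul_comm]

lemma stripEnd (k : Fin (d + 1)) : StripEnd D.S (D.endMap k) (D.point k) where
  norm_point := D.norm_point k
  subset := sdiff_subset
  not_mem := fun h => h.2 ⟨k, rfl⟩
  smooth := by
    refine (hD.ends_smooth k).comp ?_ (flip_mapsTo k)
    unfold flip
    split_ifs
    · exact contDiffOn_const.sub contDiffOn_id
    · exact contDiffOn_id
  holo := fun p hp => ⟨_, mul_ne_zero (hD.ends_deriv k _ (flip_mapsTo k hp)) (by split_ifs <;> simp),
    fderivWithin_endMap hD k hp⟩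
  inj := fun p hp q hq h =>
    flip_injective k (hD.ends_inj k (flip_mapsTo k hp) (flip_mapsTo k hq) h)
  mem := fun p hp => hD.ends_mem k (flip_mapsTo k hp)
  bdry := by
    intro p hp
    have h1 := hD.ends_bdry k _ (flip_mapsTo k hp)
    have h2 : D.endMap k p ∈ D.bdry ↔ ‖D.endMap k p‖ = 1 :=
      ⟨fun h => by simpa using h.1, D.mem_bdry (hD.ends_mem k (flip_mapsTo k hp))⟩
    rw [← h2]
    refine h1.trans ?_
    rw [flip_im]
    split_ifs
    · rw [or_comm, sub_eq_zero, eq_comm (a := (1 : ℝ)), sub_eq_self, or_comm]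
    · rfl
  lim := by
    refine (hD.ends_lim k).comp (tendsto_flip k (fun _ => ?_) fun _ => le_rfl)
    refine tendsto_principal_principal.2 fun t ht => ⟨?_, ?_⟩ <;> linarith [ht.1, ht.2]

end WeightedDisc

section SolutionEnds

variable {E : Type*} [NormedAddCommGroup E] [NormedSpace ℝ E] [FiniteDimensional ℝ E]
variable {W : Type*} [TopologicalSpace W] [T2Space W] [ChartedSpace E W]
  [IsManifold 𝓘(ℝ, E) ∞ W]
variable {d : ℕ} {w : Fin (d + 1) → ℕ} {D : WeightedDisc d w}

lemma WeightedDisc.IsSolution.tendsto_endMap {K Λ : Set W} {X : VField E W} {J : ℂ → EndField E W}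
    {x : Fin (d + 1) → ℝ → W} {u : ℂ → W} (hu : D.IsSolution K Λ X J x u) (k : Fin (d + 1)) {t : ℝ}
    (ht : t ∈ Icc (0 : ℝ) 1) :
    Tendsto (fun p : ℝ × ℝ => u (D.endMap k ⟨p.1, p.2⟩)) (atTop ×ˢ 𝓝[Icc 0 1] t)
      (𝓝 (x k (if k = 0 then 1 - t else t))) := by
  have ht' : (if k = 0 then 1 - t else t) ∈ Icc (0 : ℝ) 1 := by
    split_ifs
    · constructor <;> linarith [ht.1, ht.2]
    · exact ht
  refine (hu.lim k _ ht').comp (WeightedDisc.tendsto_flip k (fun hk => ?_) fun hk => ?_)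
  · rw [if_pos hk]
    refine tendsto_nhdsWithin_of_tendsto_nhds_of_eventually_within _
      (((continuous_const.sub continuous_id).tendsto t).mono_left nhdsWithin_le_nhds) ?_
    filter_upwards [self_mem_nhdsWithin] with s hs
    constructor <;> linarith [hs.1, hs.2]
  · rw [if_neg hk]

namespace TargetData

variable {Y : LiouvilleManifold E W} (V : TargetData Y) {f : W → ℝ} (hf : Y.IsDefining V.Min f)
include hf

lemma mem_Min_of_flow {a : ℝ} (ha : a ≤ 0) {x : W} (hx : Y.flow (-a) x ∈ interior V.Min) : x ∈ V.Min := by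
  have := hf.flow_mem_of_nonpos (interior_subset hx) ha
  rwa [Y.isFlow.cancel_neg] at this

variable (hD : D.IsAdmissible) {ρ : ℝ} (hρ : ρ ∈ Ioo (0 : ℝ) 1) {J : ℂ → EndField E W}
  {xs : Fin (d + 1) → ℝ → W} {u : ℂ → W} (hu : D.IsSolution V.M (V.LR ρ) (Y.X (V.HR ρ)) J xs u)
include hD hρ hu

lemma cutForm_eq_zero {a a' b : ℝ} (ha : a ≤ 0) (hb : 0 < b) {z : ℂ} (hz : z ∈ D.S)
    (h : Y.flow (-a) (u z) ∈ interior V.Min) : V.cutForm D ρ a a' b u z = 0 := by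
  have hh : fderivWithin ℝ (fun z => V.hcut b (u z)) D.S z = 0 := by
    ext v
    rw [fderivWithin_comp_vel ((V.contMDiff_hcut hf hb).contMDiffAt.mdifferentiableAt (by simp))
      (D.uniqueDiffOn_S z hz) ((hu.smooth z hz).mdifferentiableWithinAt (by simp)),
      V.df_hcut_of_mem hf hb (V.mem_Min_of_flow hf ha h)]
    rfl
  rw [cutForm, hh, LiouvilleManifold.cut_eq_zero (interior_subset h)]
  simp

/-- The truncated action form vanishes far along the ends that converge to chords in the interior of
`MinR ρ`. -/
lemma cutForm_end_in {a a' b : ℝ} (ha : a ≤ 0) (hb : 0 < b) {k : Fin (d + 1)}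
    (hx : ∀ t ∈ Icc (0 : ℝ) 1, Y.flow (-a) (xs k t) ∈ interior V.Min) :
    ∃ T : ℝ, 0 ≤ T ∧ ∀ p ∈ strip T, Y.flow (-a) (u (D.endMap k p)) ∈ interior V.Min ∧
      endForm (V.cutForm D ρ a a' b u) (D.endMap k) p = 0 := by
  obtain ⟨T, hT⟩ := exists_forall_of_eventually
    (P := fun s t => Y.flow (-a) (u (D.endMap k ⟨s, t⟩)) ∈ interior V.Min) fun t ht => by
      have ht' : (if k = 0 then 1 - t else t) ∈ Icc (0 : ℝ) 1 := by
        split_ifs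
        · constructor <;> linarith [ht.1, ht.2]
        · exact ht
      exact ((((Y.isFlow.contMDiff (-a)).continuous.tendsto _).comp (hu.tendsto_endMap k ht))).eventually
        (isOpen_interior.mem_nhds (hx _ ht'))
  refine ⟨max T 0, le_max_right _ _, fun p hp => ?_⟩
  have h1 := hT p.re (le_of_max_le_left hp.1) p.im hp.2
  refine ⟨h1, ?_⟩
  have h2 := V.cutForm_eq_zero hf hD hρ hu (a' := a') ha hb
    ((WeightedDisc.stripEnd hD k).mem ⟨le_of_max_le_right hp.1, hp.2⟩) h1
  ext v
  rw [endForm, h2]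
  rfl

/-- The truncated action form has negative integral over segments far along the ends that converge to
chords of positive action outside `Min`. -/
lemma cutForm_end_out (hJ : D.IsACSFamily Y V.M J) {a a' b : ℝ} (ha : Real.log ρ < a)
    (haa : a < a') (ha' : a' < 0) (hb : 0 < b)
    (hbh : ∀ x ∈ V.L, x ∈ V.M → x ∉ V.Min → Y.flow (-b) x ∈ V.Min → V.h x = 0) {k : Fin (d + 1)}
    (hk : k ≠ 0) (hx : V.IsChordOut (w k) (xs k)) (hpos : 0 < V.action (w k) (xs k)) :
    ∃ T : ℝ, 0 ≤ T ∧
      (∀ p : ℂ, T < p.re → p.im ∈ Ioo (0 : ℝ) 1 →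
        0 ≤ curl (endForm (V.cutForm D ρ a a' b u) (D.endMap k)) p) ∧
      ∀ s : ℝ, T ≤ s →
        ∫ y in (0 : ℝ)..1, endForm (V.cutForm D ρ a a' b u) (D.endMap k) ⟨s, y⟩ Complex.I < 0 := by
  have hE := WeightedDisc.stripEnd hD k
  have hlim : ∀ t ∈ Icc (0 : ℝ) 1, Tendsto (fun p : ℝ × ℝ => u (D.endMap k ⟨p.1, p.2⟩))
      (atTop ×ˢ 𝓝[Icc 0 1] t) (𝓝 (xs k t)) := fun t ht => by
    simpa [hk] using hu.tendsto_endMap k ht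
  have hvs : ContMDiffOn 𝓘(ℝ, ℂ) 𝓘(ℝ, E) ∞ (fun p => u (D.endMap k p)) (strip 0) :=
    hu.smooth.comp hE.smooth.contMDiffOn hE.mem
  have hmin : IsClosed V.Min := hf.isClosed
  obtain ⟨T₁, hT₁⟩ := exists_forall_of_eventually
    (P := fun s t => u (D.endMap k ⟨s, t⟩) ∉ V.Min) fun t ht =>
      (hlim t ht).eventually (hmin.isOpen_compl.mem_nhds (hx.2 t ht).2)
  obtain ⟨Jlim, -, hJs, hJa⟩ := hJ.asymptotic k
  obtain ⟨B, hB, T₂, -, hT₂⟩ := Y.exists_fm_end_le V.completion_M (J := fun p => J (D.endMap k p))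
    (v := fun p => u (D.endMap k p)) hJs
    (fun x₀ => by
      obtain ⟨U, hU, hxU, h⟩ := hJa x₀ (V.completion_M ▸ mem_univ x₀)
      obtain ⟨B, hB⟩ := h 0 0
      refine ⟨U, hU, hxU, B, fun q hq => ?_⟩
      have := hB q (by rwa [WeightedDisc.halfStrip_of_ne hk])
      rw [norm_iteratedFDerivWithin_zero] at this
      rw [D.endMap_of_ne hk]
      simpa using this) hlim
  -- the limit chord starts and ends outside `Min`, where the cut off primitive agrees with `h`
  have h0 : V.hcut b (xs k 0) = V.h (xs k 0) :=
    V.hcut_eq hf hb hbh hx.1.start_mem (hx.1.mem 0 (by simp)) (hx.2 0 (by simp)).2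
  have h1 : V.hcut b (xs k 1) = V.h (xs k 1) :=
    V.hcut_eq hf hb hbh hx.1.end_mem (hx.1.mem 1 (by simp)) (hx.2 1 (by simp)).2
  obtain ⟨T₃, -, hT₃⟩ := hx.1.exists_le_integral hpos hvs.continuousOn hlim
    (V.contMDiff_hcut hf hb).continuous h0 h1
  obtain ⟨T₄, hT₄⟩ := hD.γ_ends k
  set T := max (max T₁ T₂) (max (max T₃ T₄) 0) with hTd
  have hTT : T₁ ≤ T ∧ T₂ ≤ T ∧ T₃ ≤ T ∧ T₄ ≤ T ∧ 0 ≤ T := by simp [hTd]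
  have hT0 : ∀ p ∈ strip T, p ∈ strip 0 := fun p hp => ⟨hTT.2.2.2.2.trans hp.1, hp.2⟩
  have hout : ∀ p ∈ strip T, u (D.endMap k p) ∉ V.Min := fun p hp =>
    hT₁ p.re (hTT.1.trans hp.1) p.im hp.2
  -- the pullback of `γ` far along the end
  have hγ : ∀ p ∈ strip T, ∀ v : ℂ,
      D.γ (D.endMap k p) (fderivWithin ℝ (D.endMap k) (strip 0) p v) = w k * v.im := by
    intro p hp v
    rw [WeightedDisc.fderivWithin_endMap hD k (hT0 p hp), if_neg hk, mul_one, WeightedDisc.flip, if_neg hk,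
      D.endMap_of_ne hk]
    exact hT₄ p (by rw [WeightedDisc.halfStrip_of_ne hk]; exact hT0 p hp)
      ((hTT.2.2.2.1.trans hp.1).trans (le_abs_self _)) v
  have hvel : ∀ p ∈ strip T, ∀ v : ℂ, (vel (fun p => u (D.endMap k p)) (strip 0) p : ℂ →L[ℝ] E) v =
      vel u D.S (D.endMap k p) (fderivWithin ℝ (D.endMap k) (strip 0) p v) := fun p hp v =>
    vel_comp ((hu.smooth _ (hE.mem (hT0 p hp))).mdifferentiableWithinAt (by simp))
      ((hE.smooth.differentiableOn (by simp)) p (hT0 p hp)) hE.mem (uniqueDiffOn_strip 0 p (hT0 p hp)) v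
  have hXeq : ∀ p ∈ strip T, vv (Y.X (V.HR ρ)) (u (D.endMap k p)) = vv (Y.X V.H) (u (D.endMap k p)) := by
    intro p hp
    have : df (E := E) (V.HR ρ) (u (D.endMap k p)) = df V.H (u (D.endMap k p)) :=
      df_congr (V.HR_eventually_eq_H hf hρ (hout p hp))
    refine Y.eq_of_om (x := u (D.endMap k p)) fun v => ?_
    rw [Y.om_X, Y.om_X, this]
  have hacs : ∀ p ∈ strip T, Y.IsACS V.M (J (D.endMap k p)) := fun p hp => hJ.mem _ (hE.mem (hT0 p hp))
  have hgd : ∀ x, MDifferentiableAt 𝓘(ℝ, E) 𝓘(ℝ, ℝ) (V.hcut b) x := fun x =>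
    (V.contMDiff_hcut hf hb).contMDiffAt.mdifferentiableAt (by simp)
  have hβ := V.contDiffOn_cutForm hf hD hρ hu ha haa hb
  -- outside `Min` the truncated action form is the untruncated one, and the equation is that for `H`
  have key := V.integral_end_neg hvs (T := T) (w := w k) hTT.2.2.2.2 (half_pos hpos) hB
    (J := fun p => en (J (D.endMap k p)) (u (D.endMap k p)))
    (fun p hp => (hacs p hp).om_symm V.completion_M _)
    (fun p hp => (hacs p hp).om_nonneg V.completion_M _)
    (fun p hp => hT₂ p ⟨hTT.2.1.trans hp.1, hp.2⟩)
    (fun p hp => by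
      obtain ⟨c, -, hc⟩ := hE.holo p (hT0 p hp)
      have h := hu.eqn (D.endMap k p) (hE.mem (hT0 p hp)) c
      have h2 : vel u D.S (D.endMap k p) (Complex.I * c) -
          D.γ (D.endMap k p) (Complex.I * c) • vv (Y.X (V.HR ρ)) (u (D.endMap k p)) =
          en (J (D.endMap k p)) (u (D.endMap k p)) (vel u D.S (D.endMap k p) c -
            D.γ (D.endMap k p) c • vv (Y.X (V.HR ρ)) (u (D.endMap k p))) := h
      have h3 := hγ p hp 1
      have h4 := hγ p hp Complex.I
      rw [hc, mul_one] at h3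
      rw [hc, mul_comm] at h4
      rw [h3, h4, hXeq p hp] at h2
      rw [hvel p hp, hvel p hp, hc, hc, mul_one, mul_comm c]
      simpa using h2)
    (V.contMDiff_hcut hf hb) (hE.contDiffOn_endForm hβ)
    (fun p hp hi => hE.endForm_bdry (fun z hz hz1 => V.cutForm_bdry hf hD hρ hu ha haa ha' hb hbh hz hz1) hp hi)
    (fun p hp => by
      have hcut : Y.cut V.Min a a' (u (D.endMap k p)) = 1 :=
        hf.cut_eq_one haa fun h => hout p hp (V.mem_Min_of_flow hf ha'.le h)
      ext v
      have hh : fderivWithin ℝ (fun z => V.hcut b (u z)) D.S (D.endMap k p)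
          (fderivWithin ℝ (D.endMap k) (strip 0) p v) =
          fderivWithin ℝ (fun p => V.hcut b (u (D.endMap k p))) (strip 0) p v := by
        rw [fderivWithin_comp_vel (hgd _) (D.uniqueDiffOn_S _ (hE.mem (hT0 p hp)))
          ((hu.smooth _ (hE.mem (hT0 p hp))).mdifferentiableWithinAt (by simp)),
          fderivWithin_comp_vel (hgd _) (uniqueDiffOn_strip 0 p (hT0 p hp))
            ((hvs p (hT0 p hp)).mdifferentiableWithinAt (by simp)), hvel p hp]
      simp only [endForm, cutForm, ContinuousLinearMap.comp_apply, _root_.sub_apply, smul_apply,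
        pullForm_apply, hcut, hγ p hp, hh, hvel p hp, V.HR_eq_H hf hρ (hout p hp), smul_eq_mul,
        Complex.imCLM_apply]
      ring)
    (fun s hs => hT₃ s (hTT.2.2.1.trans hs))
  exact ⟨T + 1, by linarith [hTT.2.2.2.2], fun p h1 h2 => key.1 p (by linarith) h2,
    fun s hs => key.2 s (by linarith)⟩

end TargetData

end SolutionEnds

/-! ### Solutions are confined to the shrunk subdomain -/

section Confinement

variable {E : Type*} [NormedAddCommGroup E] [NormedSpace ℝ E] [FiniteDimensional ℝ E]
variable {W : Type*} [TopologicalSpace W] [T2Space W] [ChartedSpace E W]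
  [IsManifold 𝓘(ℝ, E) ∞ W]
variable {d : ℕ} {w : Fin (d + 1) → ℕ} {D : WeightedDisc d w}

namespace TargetData

variable {Y : LiouvilleManifold E W} {V : TargetData Y}

lemma IsChordIn.chordR_eq {l : ℕ} {x : ℝ → W} (hx : V.IsChordIn l x) (ρ : ℝ) :
    V.chordR ρ x = fun t => Y.flow (Real.log ρ) (x t) := if_pos hx.2

lemma IsChordOut.chordR_eq {l : ℕ} {x : ℝ → W} (hx : V.IsChordOut l x) (ρ : ℝ) : V.chordR ρ x = x :=
  if_neg fun h => (hx.2 0 (by simp)).2 (interior_subset (h 0 (by simp)))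

variable (V) {f : W → ℝ} (hf : Y.IsDefining V.Min f)
include hf

/-- On the collar the rescaled Hamiltonian is a function of the radial coordinate, so its vector field is
tangent to the level sets of the cutoff function. -/
lemma df_cut_X {ρ a a' : ℝ} (hρ : ρ ∈ Ioo (0 : ℝ) 1) (ha : Real.log ρ < a) (haa : a < a') (ha' : a' < 0)
    (x : W) : df (Y.cut V.Min a a') x (vv (Y.X (V.HR ρ)) x) = 0 := by
  obtain ⟨c, -, hdc, hc1⟩ := hf.exists_df_cut haa x
  rw [hdc]
  rcases eq_or_ne c 0 with rfl | hc0
  · rw [zero_mul]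
  obtain ⟨hcol, h1, h2⟩ := hc1 hc0
  have := Y.df_X (V.HR ρ) x
  rw [(V.contMDiffAt_HR_collar hf hρ hcol (ha.trans_le h1)).2 (h2.trans ha'.le)] at this
  rw [(mul_eq_zero.1 this).resolve_left (Real.exp_pos _).ne', mul_zero]

variable (hD : D.IsAdmissible) {ρ : ℝ} (hρ : ρ ∈ Ioo (0 : ℝ) 1) {J : ℂ → EndField E W}
  {x : Fin (d + 1) → ℝ → W} {u : ℂ → W}
  (hu : D.IsSolution V.M (V.LR ρ) (Y.X (V.HR ρ)) J (fun k => V.chordR ρ (x k)) u)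
include hD hρ hu

/-- A solution inside the shrunk subdomain is the image of a solution in the original one. -/
lemma isSolution_rescale {F : InterpolatingFamily V D} (hJF : J = F.J ρ) (hδ : ρ ≤ F.δ)
    (hall : ∀ k, V.IsChordIn (w k) (x k)) (hmem : MapsTo u D.S (V.MinR ρ)) :
    D.IsSolution V.Min V.Lin (Y.X V.H) F.Jin x (fun z => Y.flow (-Real.log ρ) (u z)) where
  smooth := (Y.isFlow.contMDiff _).comp_contMDiffOn hu.smooth
  mem := fun z hz => (V.mem_MinR_iff ρ _).1 (hmem hz)
  bdry := by
    intro z hz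
    have hzM := (V.mem_MinR_iff ρ _).1 (hmem (D.mem_S_of_bdry hz))
    rcases V.LR_cases hf hρ (hu.bdry hz) with ⟨y, hy, hyz⟩ | ⟨h1, h2, -, -⟩ | ⟨-, h⟩
    · have : Y.flow (-Real.log ρ) (u z) = y := by
        rw [← hyz]; exact Y.isFlow.neg_cancel _ _
      simp only [this]
      exact hy
    · exact absurd ((hf.flow_mem_iff h1 _).1 hzM) (not_le.2 h2)
    · exact absurd (interior_subset (V.MinR_subset_interior hf hρ (hmem (D.mem_S_of_bdry hz)))) h
  lim := by
    intro k t ht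
    have h := (((Y.isFlow.contMDiff (-Real.log ρ)).continuous.tendsto _).comp (hu.lim k t ht))
    simp only [(hall k).chordR_eq, Y.isFlow.neg_cancel] at h
    exact h
  eqn := by
    intro z hz v
    set t := Real.log ρ with ht
    set uin : ℂ → W := fun z => Y.flow (-t) (u z) with huin
    have huu : u = fun z => Y.flow t (uin z) := by
      funext z; exact (Y.isFlow.cancel_neg t (u z)).symm
    have hind : MDifferentiableWithinAt 𝓘(ℝ, ℂ) 𝓘(ℝ, E) uin D.S z :=
      (((Y.isFlow.contMDiff (-t)).comp_contMDiffOn hu.smooth) z hz).mdifferentiableWithinAt (by simp)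
    have hvel : ∀ v : ℂ, (vel u D.S z : ℂ →L[ℝ] E) v = dd (Y.flow t) (uin z) (vel uin D.S z v) := by
      intro v
      have := vel_map (Ψ := Y.flow t) (Y.mdiff_flow t (uin z)) (D.uniqueDiffOn_S z hz) hind v
      rwa [← huu] at this
    have huz : u z = Y.flow t (uin z) := congrFun huu z
    have hyM : uin z ∈ V.Min := (V.mem_MinR_iff ρ _).1 (hmem hz)
    have hX : vv (Y.X (V.HR ρ)) (u z) = dd (Y.flow t) (uin z) (vv (Y.X V.H) (uin z)) := by
      rw [huz]; exact V.X_HR_flow hf hρ hyM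
    -- the interpolation condition intertwines the almost complex structures by the flow
    have hJ : ∀ ξ : E, en (J z) (u z) (dd (Y.flow t) (uin z) ξ) =
        dd (Y.flow t) (uin z) (en (F.Jin z) (uin z) ξ) := by
      intro ξ
      rw [huz, hJF]
      exact F.inner ρ ⟨hρ.1, hρ.2.le⟩ hδ z hz (uin z) hyM ξ
    have heq : vel u D.S z (Complex.I * v) - D.γ z (Complex.I * v) • vv (Y.X (V.HR ρ)) (u z) =
        en (J z) (u z) (vel u D.S z v - D.γ z v • vv (Y.X (V.HR ρ)) (u z)) := hu.eqn z hz v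
    rw [hvel, hvel, hX, ← map_smul, ← map_smul, ← map_sub, ← map_sub, hJ] at heq
    have h := congrArg (dd (Y.flow (-t)) (Y.flow t (uin z))) heq
    rw [Y.dd_neg_cancel, Y.dd_neg_cancel] at h
    exact h

variable (hx : ∀ k, V.IsChord (w k) (x k)) (hx0 : V.IsChordIn (w 0) (x 0))
include hx hx0

/-- Stokes' theorem for the truncated action form: there are no chords outside `Min`, and the solution
does not enter the region where the cutoff function is positive. -/
lemma flow_mem_of_isSolution (hpos : ∀ k, V.IsChordOut (w k) (x k) → 0 < V.action (w k) (x k))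
    (hJ : D.IsACSFamily Y V.M J) {a a' η : ℝ} (ha : Real.log ρ < a) (haa : a < a') (ha' : a' < 0)
    (hη : Real.exp a' < ρ + η)
    (hcon : ∀ z ∈ D.S, Y.ContactTypeOn V.Min (Ico ρ (ρ + η) ∩ Iic 1) (J z)) :
    (∀ k, V.IsChordIn (w k) (x k)) ∧ ∀ z ∈ Metric.ball (0 : ℂ) 1, Y.flow (-a) (u z) ∈ V.Min := by
  obtain ⟨b, hb, hbh⟩ := V.exists_collar_h_eq_zero hf
  have hin : ∀ k, V.IsChordIn (w k) (x k) → ∃ T : ℝ, 0 ≤ T ∧ ∀ p ∈ strip T,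
      Y.flow (-a) (u (D.endMap k p)) ∈ interior V.Min ∧
      endForm (V.cutForm D ρ a a' b u) (D.endMap k) p = 0 := fun k hk =>
    V.cutForm_end_in hf hD hρ hu (haa.trans ha').le hb fun t ht => by
      rw [hk.chordR_eq]
      simp only
      rw [← Y.isFlow.add]
      exact hf.flow_mem_interior_of_nonpos (hk.2 t ht) (by linarith)
  have hge : ∀ z ∈ Metric.ball (0 : ℂ) 1, Y.cut V.Min a a' (u z) *
      om Y.θ (u z) (vel u D.S z 1 - D.γ z 1 • vv (Y.X (V.HR ρ)) (u z))
        (en (J z) (u z) (vel u D.S z 1 - D.γ z 1 • vv (Y.X (V.HR ρ)) (u z))) ≤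
      curl (V.cutForm D ρ a a' b u) z := fun z hz =>
    V.le_curl_cutForm hf hD hρ hu hJ.mem ha haa ha' hη hb hcon hz rfl
  have hom : ∀ z ∈ Metric.ball (0 : ℂ) 1, ∀ ξ : E, 0 ≤ om Y.θ (u z) ξ (en (J z) (u z) ξ) :=
    fun z hz => (hJ.mem z (D.ball_subset_S hz)).om_nonneg V.completion_M _
  -- the truncated form is zero along the ends with limits in `Min`, among them the one with `k = 0`
  obtain ⟨hN, hcurl⟩ := curl_eq_zero_of_ends (WeightedDisc.point_injective hD) rfl
    (V.contDiffOn_cutForm hf hD hρ hu ha haa hb)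
    (fun z hz hz1 => V.cutForm_bdry hf hD hρ hu ha haa ha' hb hbh hz hz1)
    (fun z hz => (mul_nonneg (LiouvilleManifold.cut_nonneg _ _ _) (hom z hz _)).trans (hge z hz))
    (WeightedDisc.stripEnd hD) (N := {k | ¬ V.IsChordIn (w k) (x k)}) (fun k => by
      by_cases hk : V.IsChordIn (w k) (x k)
      · obtain ⟨T, hT0, hT⟩ := hin k hk
        refine ⟨T, hT0, fun p h1 h2 => ?_, fun s hs => ?_⟩
        · have : endForm (V.cutForm D ρ a a' b u) (D.endMap k) =ᶠ[𝓝 p] fun _ => 0 := by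
            filter_upwards [strip_mem_nhds h1 h2] with q hq using (hT q hq).2
          rw [curl_congr this]
          simp [curl]
        · have : ∫ y in (0 : ℝ)..1, endForm (V.cutForm D ρ a a' b u) (D.endMap k) ⟨s, y⟩ Complex.I =
              ∫ y in (0 : ℝ)..1, (0 : ℝ) := by
            refine intervalIntegral.integral_congr fun y hy => ?_
            rw [uIcc_of_le zero_le_one] at hy
            rw [(hT ⟨s, y⟩ ⟨hs, hy⟩).2]
            rfl
          rw [this, intervalIntegral.integral_zero]
          exact ⟨le_rfl, fun h => absurd hk h⟩
      · have hk0 : k ≠ 0 := by rintro rfl; exact hk hx0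
        have hout := (hx k).in_or_out.resolve_left hk
        have heq := hout.chordR_eq ρ
        obtain ⟨T, hT0, h1, h2⟩ := V.cutForm_end_out hf hD hρ hu hJ ha haa ha' hb hbh hk0
          (by simpa only [heq] using hout) (by simpa only [heq] using hpos k hout)
        exact ⟨T, hT0, h1, fun s hs => ⟨(h2 s hs).le, fun _ => h2 s hs⟩⟩)
  have hall : ∀ k, V.IsChordIn (w k) (x k) := fun k => by
    by_contra hk
    have : k ∈ (∅ : Set (Fin (d + 1))) := hN ▸ hk
    exact this
  refine ⟨hall, ?_⟩
  have hud : ∀ z ∈ D.S, MDifferentiableWithinAt 𝓘(ℝ, ℂ) 𝓘(ℝ, E) u D.S z := fun z hz =>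
    (hu.smooth z hz).mdifferentiableWithinAt (by simp)
  have hcs : ContDiffOn ℝ ∞ (fun z => Y.cut V.Min a a' (u z)) D.S :=
    contDiffOn_comp (hf.contMDiff_cut haa) hu.smooth
  -- the composition of the cutoff function with `u` is constant: on `{cut > 0}` the map `u` satisfies
  -- `du = X ⊗ γ`, and `X` is tangent to the level sets of the cutoff function
  have hzero : EqOn (fderiv ℝ fun z => Y.cut V.Min a a' (u z)) 0 (Metric.ball 0 1) := by
    intro z hz
    have hzS := D.ball_subset_S hz
    rcases eq_or_lt_of_le (LiouvilleManifold.cut_nonneg (Y := Y) (K := V.Min) a a' (u z)) with h0 | h0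
    · refine IsLocalMin.fderiv_eq_zero (Eventually.of_forall fun y => ?_)
      simp only [← h0]
      exact LiouvilleManifold.cut_nonneg _ _ _
    -- where the cutoff function is positive, the energy density vanishes
    have hζ : vel u D.S z 1 - D.γ z 1 • vv (Y.X (V.HR ρ)) (u z) = 0 := by
      by_contra hne
      have h1 := (hJ.mem z hzS).om_pos V.completion_M (x := u z) hne
      have h2 := hge z hz
      rw [hcurl z hz] at h2
      exact absurd (mul_pos h0 h1) (not_lt.2 h2)
    have hI : vel u D.S z (Complex.I * 1) - D.γ z (Complex.I * 1) • vv (Y.X (V.HR ρ)) (u z) =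
        en (J z) (u z) (vel u D.S z 1 - D.γ z 1 • vv (Y.X (V.HR ρ)) (u z)) := hu.eqn z hzS 1
    rw [hζ, map_zero, mul_one, sub_eq_zero] at hI
    rw [sub_eq_zero] at hζ
    have hd : ∀ v : ℂ, fderiv ℝ (fun z => Y.cut V.Min a a' (u z)) z v =
        df (Y.cut V.Min a a') (u z) (vel (E := E) u D.S z v) := fun v => by
      rw [← fderivWithin_of_mem_nhds (D.S_mem_nhds hz)]
      exact fderivWithin_comp_vel ((hf.contMDiff_cut haa).contMDiffAt.mdifferentiableAt (by simp))
        (D.uniqueDiffOn_S z hzS) (hud z hzS) v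
    ext v
    rw [clm_complex_apply, hd, hd, hI, hζ, map_smul, map_smul, V.df_cut_X hf hρ ha haa ha']
    simp
  have hconst : ∀ z ∈ Metric.ball (0 : ℂ) 1, ∀ z' ∈ Metric.ball (0 : ℂ) 1,
      Y.cut V.Min a a' (u z) = Y.cut V.Min a a' (u z') := fun z hz z' hz' =>
    Metric.isOpen_ball.is_const_of_fderiv_eq_zero (convex_ball (0 : ℂ) 1).isPreconnected
      ((hcs.differentiableOn (by simp)).mono D.ball_subset_S) hzero hz hz'
  obtain ⟨T, hT0, hT⟩ := hin 0 hx0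
  have hp : (⟨T, 1 / 2⟩ : ℂ) ∈ strip T := ⟨le_rfl, by norm_num, by norm_num⟩
  have hpb : D.endMap 0 ⟨T, 1 / 2⟩ ∈ Metric.ball (0 : ℂ) 1 :=
    (WeightedDisc.stripEnd hD 0).mem_ball ⟨hT0, hp.2⟩ (by norm_num)
  intro z hz
  by_contra hz'
  have h1 := (hf.cut_pos_iff haa (u z)).2 hz'
  rw [hconst z hz _ hpb, LiouvilleManifold.cut_eq_zero (interior_subset (hT _ hp).1)] at h1
  exact lt_irrefl _ h1

/-- A solution with `x⁰` inside `Min` stays inside the shrunk subdomain: let the level from which the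
cutoff function is positive decrease to that of its boundary. -/
lemma mem_MinR_of_isSolution (hpos : ∀ k, V.IsChordOut (w k) (x k) → 0 < V.action (w k) (x k))
    (hJ : D.IsACSFamily Y V.M J) {η : ℝ} (hη : 0 < η)
    (hcon : ∀ z ∈ D.S, Y.ContactTypeOn V.Min (Ico ρ (ρ + η) ∩ Iic 1) (J z)) :
    (∀ k, V.IsChordIn (w k) (x k)) ∧ MapsTo u D.S (V.MinR ρ) := by
  set m := min (Real.log (ρ + η)) 0 with hm
  have hlm : Real.log ρ < m := lt_min (Real.log_lt_log hρ.1 (by linarith)) (Real.log_neg hρ.1 hρ.2)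
  have key : ∀ a ∈ Ioo (Real.log ρ) m, (∀ k, V.IsChordIn (w k) (x k)) ∧
      ∀ z ∈ Metric.ball (0 : ℂ) 1, Y.flow (-a) (u z) ∈ V.Min := by
    intro a ha
    have h2 : (a + m) / 2 < m := by linarith [ha.2]
    refine V.flow_mem_of_isSolution hf hD hρ hu hx hx0 hpos hJ ha.1 (a' := (a + m) / 2)
      (by linarith [ha.2]) (h2.trans_le (min_le_right _ _)) ?_ hcon
    rw [← Real.lt_log_iff_exp_lt (by linarith [hρ.1])]
    exact h2.trans_le (min_le_left _ _)
  have hev : ∀ᶠ a in 𝓝[>] Real.log ρ, a ∈ Ioo (Real.log ρ) m := Ioo_mem_nhdsGT hlm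
  refine ⟨(key ((Real.log ρ + m) / 2) ⟨by linarith, by linarith⟩).1, ?_⟩
  have hball : MapsTo u (Metric.ball (0 : ℂ) 1) (V.MinR ρ) := by
    intro z hz
    rw [mem_MinR_iff]
    have hc : Continuous fun a : ℝ => Y.flow (-a) (u z) :=
      Y.isFlow.continuous.comp (continuous_neg.prodMk continuous_const)
    refine hf.isClosed.mem_of_tendsto (b := 𝓝[>] Real.log ρ) ((hc.tendsto (Real.log ρ)).mono_left nhdsWithin_le_nhds) ?_
    filter_upwards [hev] with a ha using (key a ha).2 z hz
  have hcl : IsClosed (V.MinR ρ) := by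
    have : V.MinR ρ = Y.flow (-Real.log ρ) ⁻¹' V.Min := by
      ext y; exact V.mem_MinR_iff ρ y
    rw [this]
    exact hf.isClosed.preimage (Y.isFlow.contMDiff _).continuous
  intro z hz
  have hzc : z ∈ closure (Metric.ball (0 : ℂ) 1) := by
    rw [closure_ball _ one_ne_zero]; exact hz.1
  have := ((hu.smooth.continuousOn z hz).mono D.ball_subset_S).mem_closure hzc hball
  rwa [hcl.closure_eq] at this

end TargetData

end Confinement

end Viterbo

end

theorem mainTheorem10
    {E : Type*} [NormedAddCommGroup E] [NormedSpace ℝ E] [FiniteDimensional ℝ E]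
    {W : Type*} [TopologicalSpace W] [T2Space W] [SecondCountableTopology W]
    [ChartedSpace E W] [IsManifold 𝓘(ℝ, E) ∞ W]
    (Y : Viterbo.LiouvilleManifold E W) (V : Viterbo.TargetData Y) :
    (∃ ν : ℕ, V.PositiveAction ν) ∧
    ∀ ν : ℕ, V.PositiveAction ν →
    ∀ (d : ℕ) (w : Fin (d + 1) → ℕ), (∀ k, 0 < w k) → (∀ k, ν ≤ w k) →
    ∃ δ₀ : ℝ, 0 < δ₀ ∧
      ∀ D : Viterbo.WeightedDisc d w, D.IsAdmissible →
      ∀ F : Viterbo.InterpolatingFamily V D,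
      ∀ ρ ∈ Ioc (0 : ℝ) 1, ρ ≤ δ₀ → ρ ≤ F.δ →
      ∀ x : Fin (d + 1) → ℝ → W, (∀ k, V.IsChord (w k) (x k)) → V.IsChordIn (w 0) (x 0) →
      ∀ u : ℂ → W,
        D.IsSolution V.M (V.LR ρ) (Y.X (V.HR ρ)) (F.J ρ) (fun k => V.chordR ρ (x k)) u →
        (∀ k, V.IsChordIn (w k) (x k)) ∧
        MapsTo u D.S (V.MinR ρ) ∧
        ∃ uin : ℂ → W, D.IsSolution V.Min V.Lin (Y.X V.H) F.Jin x uin ∧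
          ∀ z ∈ D.S, u z = Y.ψ ρ (uin z) := by
  refine ⟨V.exists_positiveAction, fun ν hν d w _ hw => ⟨1 / 2, by norm_num, ?_⟩⟩
  intro D hD F ρ hρ hρ₀ hρδ x hx hx0 u hu
  obtain ⟨f, hf⟩ := Viterbo.LiouvilleManifold.IsDomain.exists_defining V.domain_Min
  obtain ⟨η, hη, hcon⟩ := F.collar ρ hρ hρδ
  have hρ' : ρ ∈ Ioo (0 : ℝ) 1 := ⟨hρ.1, by linarith⟩
  obtain ⟨hall, hmem⟩ := V.mem_MinR_of_isSolution hf hD hρ' hu hx hx0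
    (fun k hk => hν (w k) (hw k) (x k) hk) (F.family ρ hρ) hη hcon
  exact ⟨hall, hmem, _, V.isSolution_rescale hf hD hρ' hu rfl hρδ hall hmem, fun z _ =>
    (Y.isFlow.cancel_neg _ _).symm⟩
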